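/- **Setting.** There are $N$ independent jobs of $n$ types to be scheduled non-preemptively on $m\ge 1$ identical machines. The types have rational sizes $p_1>\dots>p_n>0$; type $j$ has $N_j\ge1$ jobs, $N=\sum_jN_j$. A job $J$ of type $j$ has processing time $p_j$ ("long") with rational probability $q_J\in(0,1]$ and $0$ ("short") otherwise, and this becomes known as soon as $J$ is started. Jobs of the same type are indexed by nondecreasing $q_J$. Let $\varepsilon\le 1/3$ with $1/\varepsilon$ an integer. A (non-anticipatory) policy decides, from the jobs started so far with their machines, start times and realizations, which job to start next, on which idle machine, and at which time (not before the previous start). Its cost is the expected sum of the completion times $C_J$. **Groups.** $G_1,\dots,G_\gamma$ partition the types into consecutive blocks; a new block starts at type $j\ge2$ exactly if $p_j\le\varepsilon^2p_{j-1}$. $G(j)$ is the group of type $j$; $p_{G_h}$ and $p^{\max}_{G_h}$ are the smallest and largest size in $G_h$; $z=\max_h|G_h|$. **Time points.** Let $$p^*_{G_h}=p_{G_h}+(1+\varepsilon)\varepsilon\sum_{k=h}^{\gamma-1}\Bigl(\sum_{i=k+1}^{\gamma}|G_i|+3\Bigr)p_{G_k}.$$ Let $l_0<l_1<\dots$ be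 the increasing enumeration of: $0$; for $2\le h\le\gamma-1$, the points $p^*_{G_h}+i\varepsilon p_{G_h}$ ($i\in\mathbb N_0$) that are smaller than $p^*_{G_{h-1}}-\varepsilon p_{G_h}$, and the midpoint between the last of these and $p^*_{G_{h-1}}$; and the points $p^*_{G_1}+i\varepsilon p_{G_1}$, $i\in\mathbb N_0$. Let $l'_k=(1+5\varepsilon)l_k$, and $p^\circ_{G_h}=l'_k+(p^*_{G_h}-l_k)$, where $k$ is maximal with $l_k\le p^*_{G_h}$; put $p^\circ_{G_0}=\infty$. For $1\le h\le\gamma$ let $$Q'_{G_h}=\{l'_k\in[p^\circ_{G_h},p^\circ_{G_{h-1}})\}\cup\{l'_k+i\varepsilon p_{G_h}: k,i\in\mathbb N_0,\ l'_k\ge p^\circ_{G_{h-1}},\ l'_k+i\varepsilon p_{G_h}<l'_{k+1}-p^{\max}_{G_h}\},$$ with the point $0$ added if $h=\gamma$. Finally $Q_{G_\gamma}=Q'_{G_\gamma}$ and $Q_{G_h}=Q'_{G_h}\cup(Q_{G_{h+1}}\cap[0,p^\circ_{G_h}))$ for $h<\gamma$. **Stratified policies.** A policy is stratified if, in all realizations,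 (i) jobs of type $j$ are started only at times in $Q_{G(j)}$; (ii) after a long job $J$ of type $j$, no job is started on the same machine in $[C_J,t')$, where $t'=\min\{t\in Q_{G(j)}: t\ge\max\{p^\circ_{G(j)},C_J\}\}$; (iii) jobs of the same type are started in order of index. **Dynamic program.** A cell $(\mathbf m,\boldsymbol\nu)$ consists of the sorted vector $\mathbf m$ of the times from which the machines are available and of the numbers $\nu_j$ of leftover jobs per type. In a cell one chooses a type $j$ with $\nu_j>0$, waits until $s=\min\{t\in Q_{G(j)}:t\ge m_1\}$ (all loads below $s$ are raised to $s$, giving a profile $\mathbf m^{0}$), and starts the next job of type $j$ at time $s$ on a machine of smallest load. If it is short, the next cell is $(\mathbf m^{0},\boldsymbol\nu-\mathbf e_j)$; if it is long, the load of its machine is in addition replaced by $\min\{t\in Q_{G(j)}:t\ge\max\{p^\circ_{G(j)},s+p_j\}\}$ and the profile is sorted. The value $\mathrm{Cost}(\mathbf m,\boldsymbol\nu)$ is $0$ if $\boldsymbol\nu=\mathbf 0$, and otherwise the minimum over these $j$ of the expected completion time of the started job plus the expected value of the next cell. The relevant cells are those reachable from $(\mathbf 0,(N_1,\dots,N_n))$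 and the waiting cells $(\mathbf m^{0},\boldsymbol\nu)$ passed on the way. **Theorem.** There is an algorithm that, given $1/\varepsilon$, $m$, the sizes and the probabilities (numbers in binary), computes a table with the value and a minimizing decision (type and start time) for each reachable cell with leftover jobs, such that following the table is an optimal policy among all stratified policies, of expected cost $\mathrm{Cost}(\mathbf 0,(N_1,\dots,N_n))$. For every fixed $n$ and $\varepsilon$ its running time is polynomial in $N$, $m$ and the bit length of the input. The number of relevant cells is at most $C\cdot N^{2n}\varepsilon^{-2n}m^{n\varepsilon^{-2z}}$, where $C$ depends only on $n$ and $\varepsilon$. -/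

import Mathlib

namespace BernoulliSched

/-! ### A model of computation

A small first-order programming language over rationals, pairs and lists, with a step count.
The count is logarithmic: executing any node of a program is charged the bit lengths of its input
and of its output, so that no data is moved for free, and bodies of loops are charged once per
iteration.  All primitives are computable on a Turing machine in time polynomial in the charge. -/

/-- Data types of the language. -/
inductive Ty : Type
  | rat : Ty
  | prod : Ty → Ty → Ty
  | list : Ty → Ty

/-- The values of a data type. -/
@[reducible] def Ty.den : Ty → Type
  | .rat => ℚ
  | .prod a b => a.den × b.den
  | .list a => List a.den

/-- Bit length of a value; numbers are written in binary. -/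
def Ty.size : (a : Ty) → a.den → ℕ
  | .rat, x => Nat.size (Int.natAbs (Rat.num x)) + Nat.size (Rat.den x) + 1
  | .prod a b, x => a.size x.1 + b.size x.2 + 1
  | .list a, l => (List.map (fun x => a.size x + 1) l).sum + 1

/-- Programs with input type `a` and output type `b`. -/
inductive Prog : Ty → Ty → Type
  | ident (a : Ty) : Prog a a
  | comp {a b c : Ty} (g : Prog b c) (f : Prog a b) : Prog a c
  | pair {a b c : Ty} (f : Prog a b) (g : Prog a c) : Prog a (.prod b c)
  | fst (a b : Ty) : Prog (.prod a b) a
  | snd (a b : Ty) : Prog (.prod a b) b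
  | const (a : Ty) (x : ℚ) : Prog a .rat
  | add : Prog (.prod .rat .rat) .rat
  | sub : Prog (.prod .rat .rat) .rat
  | mul : Prog (.prod .rat .rat) .rat
  | div : Prog (.prod .rat .rat) .rat
  | floor : Prog .rat .rat
  /-- if the value of `c` is positive then `f` else `g` -/
  | ite {a b : Ty} (c : Prog a .rat) (f g : Prog a b) : Prog a b
  | nil (a b : Ty) : Prog a (.list b)
  | cons (b : Ty) : Prog (.prod b (.list b)) (.list b)
  /-- case distinction on a list, in a context -/
  | caseList {a b c : Ty} (f : Prog a c) (g : Prog (.prod a (.prod b (.list b))) c) :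
      Prog (.prod a (.list b)) c
  /-- run through a list from left to right, updating a state -/
  | fold {s b : Ty} (f : Prog (.prod s b) s) : Prog (.prod s (.list b)) s
  /-- repeat an update of a state a given number of times -/
  | loop {s : Ty} (f : Prog s s) : Prog (.prod s .rat) s

/-- The function that a program computes. -/
def Prog.eval : {a b : Ty} → Prog a b → a.den → b.den
  | _, _, .ident _, x => x
  | _, _, .comp g f, x => g.eval (f.eval x)
  | _, _, .pair f g, x => (f.eval x, g.eval x)
  | _, _, .fst _ _, x => x.1
  | _, _, .snd _ _, x => x.2
  | _, _, .const _ r, _ => r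
  | _, _, .add, x => (x.1 + x.2 : ℚ)
  | _, _, .sub, x => (x.1 - x.2 : ℚ)
  | _, _, .mul, x => (x.1 * x.2 : ℚ)
  | _, _, .div, x => (x.1 / x.2 : ℚ)
  | _, _, .floor, x => ((⌊(x : ℚ)⌋ : ℤ) : ℚ)
  | _, _, .ite c f g, x => if (0 : ℚ) < c.eval x then f.eval x else g.eval x
  | _, _, .nil _ _, _ => []
  | _, _, .cons _, x => x.1 :: x.2
  | _, _, .caseList f g, x =>
      match x.2 with
      | [] => f.eval x.1
      | y :: l => g.eval (x.1, y, l)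
  | _, _, .fold f, x => List.foldl (fun s y => f.eval (s, y)) x.1 x.2
  | _, _, .loop f, x => (fun s => f.eval s)^[⌊(x.2 : ℚ)⌋₊] x.1

/-- The charge for executing a single node. -/
def Prog.charge {a b : Ty} (f : Prog a b) (x : a.den) : ℕ := a.size x + b.size (f.eval x) + 1

/-- The number of steps that a program takes on an input. -/
def Prog.cost : {a b : Ty} → Prog a b → a.den → ℕ
  | _, _, .ident a, x => (Prog.ident a).charge x
  | _, _, .comp g f, x => (Prog.comp g f).charge x + (f.cost x + g.cost (f.eval x))
  | _, _, .pair f g, x => (Prog.pair f g).charge x + (f.cost x + g.cost x)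
  | _, _, .fst a b, x => (Prog.fst a b).charge x
  | _, _, .snd a b, x => (Prog.snd a b).charge x
  | _, _, .const a r, x => (Prog.const a r).charge x
  | _, _, .add, x => Prog.add.charge x
  | _, _, .sub, x => Prog.sub.charge x
  | _, _, .mul, x => Prog.mul.charge x
  | _, _, .div, x => Prog.div.charge x
  | _, _, .floor, x => Prog.floor.charge x
  | _, _, .ite c f g, x =>
      (Prog.ite c f g).charge x +
        (c.cost x + if (0 : ℚ) < c.eval x then f.cost x else g.cost x)
  | _, _, .nil a b, x => (Prog.nil a b).charge x
  | _, _, .cons b, x => (Prog.cons b).charge x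
  | _, _, .caseList f g, x =>
      (Prog.caseList f g).charge x +
        match x.2 with
        | [] => f.cost x.1
        | y :: l => g.cost (x.1, y, l)
  | _, _, .fold f, x =>
      (Prog.fold f).charge x +
        (List.foldl (fun s y => (f.eval (s.1, y), s.2 + f.cost (s.1, y))) (x.1, 0) x.2).2
  | _, _, .loop f, x =>
      (Prog.loop f).charge x +
        ((fun s => (f.eval s.1, s.2 + f.cost s.1))^[⌊(x.2 : ℚ)⌋₊] (x.1, 0)).2

/-! ### Instances -/

/-- The least element of a set of rationals (`0` if there is none). -/
noncomputable def leastOf (S : Set ℚ) : ℚ :=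
  open Classical in if h : ∃ x, IsLeast S x then h.choose else 0

/-- The greatest element of a set of rationals (`0` if there is none). -/
noncomputable def greatestOf (S : Set ℚ) : ℚ :=
  open Classical in if h : ∃ x, IsGreatest S x then h.choose else 0

/-- The first point of `S` at or after time `t`. -/
noncomputable def nextPt (S : Set ℚ) (t : ℚ) : ℚ := leastOf {s ∈ S | t ≤ s}

/-- An instance with `n` job types of sizes `p 0 > ... > p (n - 1)`, to be treated with accuracy
`ε = 1 / E`.  The list `probs j` holds the probabilities of being long of the jobs of type `j`,
which are indexed in nondecreasing order of probability. -/
structure Instance (n E : ℕ) where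
  m : ℕ
  m_pos : 0 < m
  p : Fin n → ℚ
  p_pos : ∀ j, 0 < p j
  p_anti : StrictAnti p
  probs : Fin n → List ℚ
  probs_ne : ∀ j, probs j ≠ []
  probs_mem : ∀ j, ∀ q ∈ probs j, 0 < q ∧ q ≤ 1
  probs_sorted : ∀ j, (probs j).Pairwise (· ≤ ·)

namespace Instance

variable {n E : ℕ} (I : Instance n E)

/-- The number of jobs of a type. -/
def Nj (j : Fin n) : ℕ := (I.probs j).length

/-- The number of jobs. -/
def N : ℕ := ∑ j, I.Nj j

/-- Jobs: a type together with an index within the type. -/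
abbrev Job : Type := (j : Fin n) × Fin (I.probs j).length

/-- The probability that a job is long. -/
def q (J : I.Job) : ℚ := (I.probs J.1).get J.2

/-- The accuracy. -/
def eps (_ : Instance n E) : ℚ := 1 / (E : ℚ)

/-- The input of the algorithm: `E`, the number of machines, and the list of the types, each with
its size and its list of probabilities. -/
def encode : (Ty.prod (.prod .rat .rat) (.list (.prod .rat (.list .rat)))).den :=
  (((E : ℚ), (I.m : ℚ)), List.ofFn fun j => (I.p j, I.probs j))

/-! ### Size groups -/

/-- The number `h` of the group `G_h` of type `j`, counted from `1`: a new group starts at each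
type whose size is at most `ε ^ 2` times the size of its predecessor. -/
def grp (j : Fin n) : ℕ :=
  (Finset.univ.filter fun i : Fin n =>
    i ≤ j ∧ ∃ i₀ : Fin n, (i₀ : ℕ) + 1 = i ∧ I.p i ≤ I.eps ^ 2 * I.p i₀).card + 1

/-- The number `γ` of groups. -/
def γ : ℕ := Finset.univ.sup I.grp

/-- The number of types in group `h`. -/
def gsize (h : ℕ) : ℕ := (Finset.univ.filter fun j => I.grp j = h).card

/-- The largest number of types in a group. -/
def z : ℕ := Finset.univ.sup fun j => I.gsize (I.grp j)

/-- The smallest size `p_{G_h}` in group `h`. -/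
noncomputable def pG (h : ℕ) : ℚ := leastOf {x | ∃ j, I.grp j = h ∧ x = I.p j}

/-- The largest size in group `h`. -/
noncomputable def pmax (h : ℕ) : ℚ := greatestOf {x | ∃ j, I.grp j = h ∧ x = I.p j}

/-- The shifted sizes `p*_{G_h}`. -/
noncomputable def pstar (h : ℕ) : ℚ :=
  I.pG h + (1 + I.eps) * I.eps *
    ∑ k ∈ Finset.Ico h I.γ, ((∑ i ∈ Finset.Ioc k I.γ, (I.gsize i : ℚ)) + 3) * I.pG k

/-! ### Time points -/

/-- The points `p*_{G_h} + i ε p_{G_h}` below `p*_{G_{h-1}} - ε p_{G_h}`. -/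
def innerEnds (h : ℕ) : Set ℚ :=
  {x | (∃ i : ℕ, x = I.pstar h + i * (I.eps * I.pG h)) ∧
    x < I.pstar (h - 1) - I.eps * I.pG h}

/-- The left endpoints of the intervals that partition the time axis. -/
def leftEnds : Set ℚ :=
  {0} ∪
  {x | ∃ h, 2 ≤ h ∧ h < I.γ ∧ (x ∈ I.innerEnds h ∨
    x = greatestOf (I.innerEnds h) + (I.pstar (h - 1) - greatestOf (I.innerEnds h)) / 2)} ∪
  {x | ∃ i : ℕ, x = I.pstar 1 + i * (I.eps * I.pG 1)}

/-- The left endpoints `l_0 < l_1 < ...` in increasing order. -/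
noncomputable def l : ℕ → ℚ
  | 0 => 0
  | k + 1 => leastOf {x ∈ I.leftEnds | l k < x}

/-- The left endpoints of the stretched intervals. -/
noncomputable def lStr (k : ℕ) : ℚ := (1 + 5 * I.eps) * I.l k

/-- The map of times to the stretched time axis; it keeps the distance from the left endpoint of
the ambient interval. -/
noncomputable def stretch (t : ℚ) : ℚ :=
  I.lStr (sSup {k | I.l k ≤ t}) + (t - I.l (sSup {k | I.l k ≤ t}))

/-- The thresholds `p°_{G_h}`. -/
noncomputable def pcirc (h : ℕ) : ℚ := I.stretch (I.pstar h)

/-- The sets `Q'_{G_h}`, for `1 ≤ h ≤ γ` (for `h = 1`, `p°_{G_{h-1}}` is infinite). -/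
def Qprime (h : ℕ) : Set ℚ :=
  {t | h = I.γ ∧ t = 0} ∪
  {t | ∃ k, t = I.lStr k ∧ I.pcirc h ≤ t ∧ (2 ≤ h → t < I.pcirc (h - 1))} ∪
  {t | 2 ≤ h ∧ ∃ k i : ℕ, t = I.lStr k + i * (I.eps * I.pG h) ∧
    I.pcirc (h - 1) ≤ I.lStr k ∧ t < I.lStr (k + 1) - I.pmax h}

/-- The set `Q_{G_h}` for `h = γ - d`. -/
def Qdown : ℕ → Set ℚ
  | 0 => I.Qprime I.γ
  | d + 1 => I.Qprime (I.γ - (d + 1)) ∪ (Qdown d ∩ Set.Ico 0 (I.pcirc (I.γ - (d + 1))))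

/-- The time points `Q_{G_h}` at which jobs with types in group `h` may be started. -/
def Q (h : ℕ) : Set ℚ := I.Qdown (I.γ - h)

/-- The time from which a machine may be used again on which a long job of type `j` was started at
time `s`: the first point of `Q_{G(j)}` that is neither before the threshold nor before the
completion of the job. -/
noncomputable def release (j : Fin n) (s : ℚ) : ℚ :=
  nextPt (I.Q (I.grp j)) (max (I.pcirc (I.grp j)) (s + I.p j))

/-! ### Policies -/

/-- The start of a job: the job, its machine, its start time, and whether it turned out long. -/
structure Event where
  job : I.Job
  mach : Fin I.m
  start : ℚ
  long : Bool

/-- The completion time of a started job. -/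
def Event.compl {I : Instance n E} (e : I.Event) : ℚ :=
  e.start + if e.long then I.p e.job.1 else 0

/-- A non-anticipatory policy: from the jobs started so far (latest first), with their machines,
start times and realizations, it determines which job to start next, on which machine and when.
Since a realization is known as soon as the job is started, nothing is learned between two
consecutive starts. -/
abbrev Policy : Type := List I.Event → Option (I.Job × Fin I.m × ℚ)

/-- A realization of the processing times tells which jobs are long. -/
abbrev Realization : Type := I.Job → Bool

/-- The probability of a realization; jobs are independent. -/
def prob (ω : I.Realization) : ℚ := ∏ J, if ω J then I.q J else 1 - I.q J

/-- The first `k` starts under a policy, latest first. -/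
def run (pol : I.Policy) (ω : I.Realization) : ℕ → List I.Event
  | 0 => []
  | k + 1 =>
    match pol (run pol ω k) with
    | none => run pol ω k
    | some (J, i, s) => ⟨J, i, s, ω J⟩ :: run pol ω k

/-- In every realization the policy starts all the jobs, in order of time, and a machine that is
still busy with a job is never given another one. -/
def Feasible (pol : I.Policy) : Prop :=
  ∀ ω, ∀ k < I.N, ∃ J i s, pol (I.run pol ω k) = some (J, i, s) ∧ 0 ≤ s ∧
    ∀ e ∈ I.run pol ω k, e.job ≠ J ∧ e.start ≤ s ∧ (e.mach = i → e.compl ≤ s)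

/-- The expected sum of the completion times. -/
def expCost (pol : I.Policy) : ℚ :=
  ∑ ω : I.Realization, I.prob ω * ((I.run pol ω I.N).map Event.compl).sum

/-- Stratified policies with respect to the sets `Q_{G_h}` and the thresholds `p°_{G_h}`. -/
def Stratified (pol : I.Policy) : Prop :=
  ∀ ω,
    (∀ e ∈ I.run pol ω I.N, e.start ∈ I.Q (I.grp e.job.1)) ∧
    (∀ e ∈ I.run pol ω I.N, e.long = true → ∀ e' ∈ I.run pol ω I.N, e'.mach = e.mach →
      e.compl ≤ e'.start → I.release e.job.1 e.start ≤ e'.start) ∧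
    (I.run pol ω I.N).Pairwise fun later earlier =>
      later.job.1 = earlier.job.1 → (earlier.job.2 : ℕ) < later.job.2

/-- Optimal stratified policies. -/
def IsOptimalStratified (pol : I.Policy) : Prop :=
  I.Feasible pol ∧ I.Stratified pol ∧
    ∀ pol₂ : I.Policy, I.Feasible pol₂ → I.Stratified pol₂ → I.expCost pol ≤ I.expCost pol₂

/-! ### The dynamic program

A cell consists of a machine load profile (the sorted list of the times from which the machines
are available) and the numbers of leftover jobs per type. -/

/-- Cells of the dynamic program. -/
abbrev Cell (n : ℕ) : Type := List ℚ × (Fin n → ℕ)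

/-- The earliest time at which a job of type `j` can be started, given a profile. -/
noncomputable def startTime (j : Fin n) (ms : List ℚ) : ℚ :=
  nextPt (I.Q (I.grp j)) (ms.headD 0)

/-- The profile after waiting, if necessary, until a job of type `j` can be started.  It is also
the profile after a short job of type `j` has been started. -/
noncomputable def waitProfile (j : Fin n) (ms : List ℚ) : List ℚ :=
  ms.map (max (I.startTime j ms))

/-- The profile after a long job of type `j` has been started on a machine of smallest load. -/
noncomputable def longProfile (j : Fin n) (ms : List ℚ) : List ℚ :=
  (I.waitProfile j ms).tail.orderedInsert (· ≤ ·) (I.release j (I.startTime j ms))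

/-- The numbers of leftover jobs after one more job of type `j` has been started. -/
def dec (ν : Fin n → ℕ) (j : Fin n) : Fin n → ℕ := Function.update ν j (ν j - 1)

/-- The probability of the next job of type `j` if `v` jobs of this type are left over. -/
def nextProb (j : Fin n) (v : ℕ) : ℚ := (I.probs j).getD (I.Nj j - v) 0

/-- The expected cost of the leftover jobs if a job of type `j` is started next and the cost of the
resulting cells is given by `V`. -/
noncomputable def startCost (V : List ℚ → (Fin n → ℕ) → ℚ) (ms : List ℚ) (ν : Fin n → ℕ)
    (j : Fin n) : ℚ :=
  I.nextProb j (ν j) * (V (I.longProfile j ms) (dec ν j) + (I.startTime j ms + I.p j)) +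
    (1 - I.nextProb j (ν j)) * (V (I.waitProfile j ms) (dec ν j) + I.startTime j ms)

/-- The value of a cell with `k` leftover jobs. -/
noncomputable def ecostAux : ℕ → List ℚ → (Fin n → ℕ) → ℚ
  | 0, _, _ => 0
  | k + 1, ms, ν => leastOf {c | ∃ j, 0 < ν j ∧ c = I.startCost (ecostAux k) ms ν j}

/-- The value of a cell: the minimum, over the types with leftover jobs, of the expected cost of
starting a job of this type next. -/
noncomputable def ecost (ms : List ℚ) (ν : Fin n → ℕ) : ℚ := I.ecostAux (∑ j, ν j) ms ν

/-- The initial profile. -/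
def profileInit : List ℚ := List.replicate I.m 0

/-- The cells that can be reached from the initial one. -/
inductive Reach : Cell n → Prop
  | init : Reach (I.profileInit, I.Nj)
  | long (ms : List ℚ) (ν : Fin n → ℕ) (j : Fin n) :
      Reach (ms, ν) → 0 < ν j → Reach (I.longProfile j ms, dec ν j)
  | short (ms : List ℚ) (ν : Fin n → ℕ) (j : Fin n) :
      Reach (ms, ν) → 0 < ν j → Reach (I.waitProfile j ms, dec ν j)

/-- The relevant cells: those that can be reached, and those that are passed through while waiting
for the next start. -/
def relevantCells : Set (Cell n) :=
  {c | I.Reach c} ∪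
    {c | ∃ ms ν j, I.Reach (ms, ν) ∧ 0 < ν j ∧ c = (I.waitProfile j ms, ν)}

/-! ### Tables and the policies that they describe -/

/-- The rows of a table: profile and leftover jobs of a cell; type and start time of the job to be
started next; value of the cell. -/
abbrev Row : Type := (List ℚ × List ℚ) × (ℚ × (ℚ × ℚ))

/-- Numbers of leftover jobs as a list. -/
def key (ν : Fin n → ℕ) : List ℚ := List.ofFn fun j => (ν j : ℚ)

/-- The table holds, for every cell that can be reached and that has leftover jobs, the value of
the cell and a decision that attains it, and it has no other rows. -/
def IsTable (T : List Row) : Prop :=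
  (∀ r ∈ T, ∃ ms ν j, I.Reach (ms, ν) ∧ 0 < ν j ∧ I.startCost I.ecost ms ν j = I.ecost ms ν ∧
    r = ((ms, key ν), (((j : ℕ) : ℚ), I.startTime j ms, I.ecost ms ν))) ∧
  ∀ ms ν, I.Reach (ms, ν) → ν ≠ 0 → ∃ r ∈ T, r.1 = (ms, key ν)

/-- The time from which machine `i` is available after the given starts (latest first). -/
noncomputable def load : List I.Event → Fin I.m → ℚ
  | [], _ => 0
  | e :: es, i =>
    max (load es i)
      (if e.mach = i ∧ e.long = true then I.release e.job.1 e.start else e.start)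

/-- The profile after the given starts. -/
noncomputable def profile (es : List I.Event) : List ℚ :=
  ((List.finRange I.m).map (I.load es)).insertionSort (· ≤ ·)

/-- The number of jobs of type `j` that have been started. -/
def started (es : List I.Event) (j : Fin n) : ℕ :=
  es.countP fun e => decide (e.job.1 = j)

/-- The policy that a table describes: look up the cell, and start the next job of the type found
there at the time found there, on a machine of smallest load. -/
noncomputable def tablePolicy (T : List Row) : I.Policy := fun es => do
  let r ← T.find? fun r =>
    decide (r.1 = (I.profile es, key fun j : Fin n => I.Nj j - I.started es j))
  let j ← (List.finRange n).find? fun j : Fin n => decide (((j : ℕ) : ℚ) = r.2.1)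
  let i ← (List.finRange I.m).argmin (I.load es)
  if h : I.started es j < (I.probs j).length then
    some (⟨j, ⟨I.started es j, h⟩⟩, i, r.2.2.1)
  else none

end Instance

/-- The type of inputs. -/
abbrev inputTy : Ty := .prod (.prod .rat .rat) (.list (.prod .rat (.list .rat)))

/-- The type of outputs: tables. -/
abbrev tableTy : Ty :=
  .list (.prod (.prod (.list .rat) (.list .rat)) (.prod .rat (.prod .rat .rat)))

end BernoulliSched

namespace BernoulliSched

/-! ### Polynomial bounds -/

/-! Optimality is a potential argument. The `potential` of a history is the cost incurred so far
plus the value `ecost` of the cell that the history has led to. A stratified policy must start the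
next job of some type, at a start point, on a machine that is available; so its start is never
earlier than the start that the dynamic program would make for this type. Values are monotone in the
profile (`ecost_mono`), hence the expected potential cannot decrease with a start
(`potential_step`). Averaging over the outcome of the started job pairs each realization with the
one in which this outcome is flipped; the history so far does not see the difference
(`sum_prob_step`). Initially the potential is the value of the initial cell, and after all starts it
is the realized cost. This gives the lower bound `ecost_le_expCost`; for decisions read off from the
table every inequality is an equality (`optimal_tablePolicy`).

The number of cells is the number of profiles times the number of vectors of leftover jobs. A
profile consists of its smallest load `t` and of loads that are release times of jobs started no
later than `t`. Such a release time lies in a window whose length is the largest size of its group,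
or is the first start point behind it. Since start points of a group keep a distance of `ε` times
its smallest size, and sizes within a group differ by a bounded factor, only a constant number of
values is possible (`ncard_window`). A profile with given `t` is then determined by multiplicities
below `m` (`ncard_sorted_le`).

It remains to bound the number of values of `t`. Every started job moves a time by boundedly many
start points, but different groups use different sets of start points. What saves the count is that
smaller groups have finer sets (`exists_mem_Q_between`, `cnt_le_cnt`): if start points of a coarse
group are needed after those of a fine one, the fine steps can be recounted as no more coarse ones
(`Rep.truncate`). So each time is reached from a threshold by steps that are sorted by group, and it
is determined by one step count per group (`ncard_rep_le`). This gives a polynomial of degree `n` in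
the number of jobs. Thresholds are start points of all groups, so the count can be restarted at each
of them (`Good.next`, `Good.release`).

The algorithm is one program for all `n` and `E`. It lists the reachable cells by rounds of
exploration, so that cells with fewer leftover jobs come first, and fills in the rows in this order
(`Explored.step`, `partialTable_foldl`). Start points are found by closed formulas (`nextPt_eq`,
`raw_bracket`). Its cost is polynomial because each round is, and because all intermediate states
stay small: the number of cells is bounded as above, all times are bounded multiples of one unit,
and values have a denominator of polynomial length (`Reach.time`, `Reach.ecost_isFrac`). -/

/-- `f` is bounded by a polynomial in `μ`. -/
def PolyBdd {X : Type*} (μ f : X → ℕ) : Prop := ∃ d : ℕ, ∀ x, f x ≤ (μ x + 2) ^ d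

namespace PolyBdd

variable {X : Type*} {μ ν f g : X → ℕ}

theorem mono (h : PolyBdd μ g) (hfg : ∀ x, f x ≤ g x) : PolyBdd μ f := by
  obtain ⟨d, hd⟩ := h
  exact ⟨d, fun x => (hfg x).trans (hd x)⟩

theorem self (μ : X → ℕ) : PolyBdd μ μ := ⟨1, fun x => by simp⟩

theorem of_le (h : ∀ x, f x ≤ μ x) : PolyBdd μ f := (self μ).mono h

/-- The base `μ x + 2` is at least two, so the constant can be absorbed into the exponent. This is
why a single exponent suffices in `PolyBdd`, without coefficients. -/
theorem const (μ : X → ℕ) (c : ℕ) : PolyBdd μ fun _ => c :=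
  ⟨c, fun x => (Nat.lt_two_pow_self).le.trans (Nat.pow_le_pow_left (by omega) c)⟩

theorem add (hf : PolyBdd μ f) (hg : PolyBdd μ g) : PolyBdd μ fun x => f x + g x := by
  obtain ⟨a, ha⟩ := hf
  obtain ⟨b, hb⟩ := hg
  refine ⟨max a b + 1, fun x => ?_⟩
  have h1 : (μ x + 2) ^ a ≤ (μ x + 2) ^ max a b := Nat.pow_le_pow_right (by omega) (le_max_left _ _)
  have h2 : (μ x + 2) ^ b ≤ (μ x + 2) ^ max a b := Nat.pow_le_pow_right (by omega) (le_max_right _ _)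
  have := ha x
  have := hb x
  rw [pow_succ]
  nlinarith [Nat.zero_le (μ x), Nat.zero_le ((μ x + 2) ^ max a b)]

theorem mul (hf : PolyBdd μ f) (hg : PolyBdd μ g) : PolyBdd μ fun x => f x * g x := by
  obtain ⟨a, ha⟩ := hf
  obtain ⟨b, hb⟩ := hg
  exact ⟨a + b, fun x => by rw [pow_add]; exact Nat.mul_le_mul (ha x) (hb x)⟩

theorem pow (hf : PolyBdd μ f) (k : ℕ) : PolyBdd μ fun x => f x ^ k := by
  obtain ⟨a, ha⟩ := hf
  exact ⟨a * k, fun x => by rw [pow_mul]; exact Nat.pow_le_pow_left (ha x) k⟩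

theorem trans (hf : PolyBdd ν f) (hν : PolyBdd μ ν) : PolyBdd μ f := by
  obtain ⟨d, hd⟩ := hf
  exact ((hν.add (const μ 2)).pow d).mono hd

theorem comp (hf : PolyBdd μ f) {Y : Type*} (φ : Y → X) :
    PolyBdd (fun y => μ (φ y)) fun y => f (φ y) := by
  obtain ⟨d, hd⟩ := hf
  exact ⟨d, fun y => hd _⟩

end PolyBdd

/-! ### Programs of polynomial cost -/

/-- Programs whose number of steps is polynomially bounded in the size of the input. -/
structure PT (a b : Ty) where
  prog : Prog a b
  poly : PolyBdd a.size prog.cost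

theorem Prog.charge_le_cost {a b : Ty} (f : Prog a b) (x : a.den) : f.charge x ≤ f.cost x := by
  cases f <;> simp [Prog.cost]

/-- The output is part of the charge, so step bounds are also size bounds. Closure under composition
rests on this. -/
theorem Prog.size_eval_le {a b : Ty} (f : Prog a b) (x : a.den) : b.size (f.eval x) ≤ f.cost x := by
  refine le_trans ?_ (f.charge_le_cost x)
  unfold Prog.charge
  omega

namespace Ty

@[simp] theorem size_prod {a b : Ty} (x : (Ty.prod a b).den) :
    (Ty.prod a b).size x = a.size x.1 + b.size x.2 + 1 := by rw [Ty.size]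

@[simp] theorem size_nil {a : Ty} : (Ty.list a).size ([] : List a.den) = 1 := by rw [Ty.size]; rfl

@[simp] theorem size_cons {a : Ty} (x : a.den) (l : List a.den) :
    (Ty.list a).size (x :: l) = a.size x + 1 + (Ty.list a).size l := by
  simp only [Ty.size, List.map_cons, List.sum_cons]; omega

theorem size_append {a : Ty} (l₁ l₂ : List a.den) :
    (Ty.list a).size (l₁ ++ l₂) + 1 = (Ty.list a).size l₁ + (Ty.list a).size l₂ := by
  simp only [Ty.size, List.map_append, List.sum_append]; omega

theorem size_mem {a : Ty} {x : a.den} {l : List a.den} (h : x ∈ l) :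
    a.size x < (Ty.list a).size l := by
  induction l with
  | nil => simp at h
  | cons y l ih =>
    rw [size_cons]
    rcases List.mem_cons.1 h with rfl | h
    · omega
    · have := ih h; omega

theorem length_lt_size {a : Ty} (l : List a.den) : l.length < (Ty.list a).size l := by
  induction l with
  | nil => simp
  | cons y l ih => rw [size_cons, List.length_cons]; omega

theorem size_list_le {a : Ty} (l : List a.den) (B : ℕ) (h : ∀ x ∈ l, a.size x ≤ B) :
    (Ty.list a).size l ≤ l.length * (B + 1) + 1 := by
  induction l with
  | nil => simp
  | cons y l ih =>
    rw [size_cons, List.length_cons]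
    have h1 := h y (by simp)
    have h2 := ih fun x hx => h x (by simp [hx])
    nlinarith

end Ty

/-- The number of steps of the iterations of a fold. -/
theorem foldl_cost {s b : Ty} (f : Prog (.prod s b) s) (s₀ : s.den) (l : List b.den) (c : ℕ) :
    List.foldl (fun s y => (f.eval (s.1, y), s.2 + f.cost (s.1, y))) (s₀, c) l =
      (List.foldl (fun s y => f.eval (s, y)) s₀ l,
        c + (List.foldl (fun s y => (f.eval (s.1, y), s.2 + f.cost (s.1, y))) (s₀, 0) l).2) := by
  induction l generalizing s₀ c with
  | nil => simp
  | cons y l ih =>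
    simp only [List.foldl_cons]
    rw [ih, ih _ (0 + f.cost (s₀, y))]
    simp [add_assoc]

/-- Only states after proper prefixes of the list are fed to the body, so only these need a bound.
-/
theorem foldl_cost_le {s b : Ty} (f : Prog (.prod s b) s) (s₀ : s.den) (l : List b.den) (B : ℕ)
    (h : ∀ l₁ y l₂, l = l₁ ++ y :: l₂ →
      f.cost (List.foldl (fun s y => f.eval (s, y)) s₀ l₁, y) ≤ B) :
    (List.foldl (fun s y => (f.eval (s.1, y), s.2 + f.cost (s.1, y))) (s₀, 0) l).2 ≤
      l.length * B := by
  induction l generalizing s₀ with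
  | nil => simp
  | cons y l ih =>
    simp only [List.foldl_cons]
    rw [foldl_cost]
    have h1 := h [] y l rfl
    have h2 := ih (f.eval (s₀, y)) fun l₁ z l₂ e => by
      have := h (y :: l₁) z l₂ (by rw [e]; rfl)
      simpa using this
    simp only [List.foldl_nil] at h1
    simp only [List.length_cons]
    have : (l.length + 1) * B = l.length * B + B := by ring
    simp only [zero_add]
    omega

theorem loop_cost {s : Ty} (f : Prog s s) (s₀ : s.den) (k c : ℕ) :
    (fun s : s.den × ℕ => (f.eval s.1, s.2 + f.cost s.1))^[k] (s₀, c) =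
      ((fun s => f.eval s)^[k] s₀, c + ∑ i ∈ Finset.range k, f.cost ((fun s => f.eval s)^[i] s₀)) := by
  induction k with
  | zero => simp
  | succ k ih =>
    rw [Function.iterate_succ_apply', ih, Finset.sum_range_succ, Function.iterate_succ_apply']
    simp [add_assoc]

theorem loop_cost_le {s : Ty} (f : Prog s s) (s₀ : s.den) (k B : ℕ)
    (h : ∀ i < k, f.cost ((fun s => f.eval s)^[i] s₀) ≤ B) :
    ((fun s : s.den × ℕ => (f.eval s.1, s.2 + f.cost s.1))^[k] (s₀, 0)).2 ≤ k * B := by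
  rw [loop_cost]
  simp only [zero_add]
  calc _ ≤ ∑ i ∈ Finset.range k, B := Finset.sum_le_sum fun i hi => h i (Finset.mem_range.1 hi)
    _ = k * B := by simp

namespace PT

variable {a b c s Γ : Ty}

/-- The function that is computed. -/
def ev (f : PT a b) (x : a.den) : b.den := f.prog.eval x

theorem size_ev (f : PT a b) : PolyBdd a.size fun x => b.size (f.ev x) :=
  f.poly.mono fun x => f.prog.size_eval_le x

theorem charge_poly {f : Prog a b} (h : PolyBdd a.size fun x => b.size (f.eval x)) :
    PolyBdd a.size f.charge :=
  ((PolyBdd.self _).add h).add (PolyBdd.const _ 1)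

/-- The identity. -/
def ident (a : Ty) : PT a a := ⟨.ident a, (charge_poly (PolyBdd.self _)).mono fun _ => le_rfl⟩

/-- Composition. -/
def comp (g : PT b c) (f : PT a b) : PT a c :=
  ⟨.comp g.prog f.prog, by
    -- The intermediate result has polynomial size, so the cost of `g` is polynomial in the original
    -- input.
    have hg : PolyBdd a.size fun x => g.prog.cost (f.ev x) := (g.poly.comp f.ev).trans f.size_ev
    exact (charge_poly (f := .comp g.prog f.prog) (hg.mono fun x => g.prog.size_eval_le _)).add
      (f.poly.add hg)⟩

/-- Pairing. -/
def pair (f : PT a b) (g : PT a c) : PT a (.prod b c) :=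
  ⟨.pair f.prog g.prog, by
    refine (charge_poly (f := .pair f.prog g.prog) ?_).add (f.poly.add g.poly)
    exact ((f.size_ev.add g.size_ev).add (PolyBdd.const _ 1)).mono fun x => by
      rw [Ty.size_prod]; exact le_rfl⟩

/-- First projection. -/
def fst (f : PT a (.prod b c)) : PT a b :=
  comp ⟨.fst b c, (charge_poly (f := .fst b c)
    (PolyBdd.of_le fun x => by rw [Ty.size_prod]; simp only [Prog.eval]; omega)).mono
    fun _ => le_rfl⟩ f

/-- Second projection. -/
def snd (f : PT a (.prod b c)) : PT a c :=
  comp ⟨.snd b c, (charge_poly (f := .snd b c)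
    (PolyBdd.of_le fun x => by rw [Ty.size_prod]; simp only [Prog.eval]; omega)).mono
    fun _ => le_rfl⟩ f

/-- Constants. -/
def const (a : Ty) (r : ℚ) : PT a .rat :=
  ⟨.const a r, (charge_poly (f := .const a r) (PolyBdd.const _ (Ty.rat.size r))).mono
    fun _ => le_rfl⟩

/-- Case distinction on the sign of a number. -/
def ite (c : PT a .rat) (f g : PT a b) : PT a b :=
  ⟨.ite c.prog f.prog g.prog, by
    have h1 : PolyBdd a.size fun x => b.size ((Prog.ite c.prog f.prog g.prog).eval x) :=
      (f.size_ev.add g.size_ev).mono fun x => by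
        simp only [Prog.eval, ev]
        split_ifs <;> omega
    refine ((charge_poly h1).add (c.poly.add (f.poly.add g.poly))).mono fun x => ?_
    simp only [Prog.cost]
    split_ifs <;> omega⟩

/-- The empty list. -/
def nil (a b : Ty) : PT a (.list b) :=
  ⟨.nil a b, (charge_poly (f := .nil a b) ((PolyBdd.const _ 1).mono fun x => by
    simp only [Prog.eval]; rw [Ty.size_nil])).mono fun _ => le_rfl⟩

/-- Attaching an element to a list. -/
def cons (f : PT a b) (g : PT a (.list b)) : PT a (.list b) :=
  comp ⟨.cons b, (charge_poly (f := .cons b)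
    (PolyBdd.of_le fun x => by
      rw [Ty.size_prod]; simp only [Prog.eval]; rw [Ty.size_cons]; omega)).mono
    fun _ => le_rfl⟩ (pair f g)

/-- Case distinction on a list. -/
def caseList (l : PT a (.list b)) (f : PT a c) (g : PT (.prod a (.prod b (.list b))) c) :
    PT a c :=
  comp ⟨.caseList f.prog g.prog, by
    have hf : PolyBdd (Ty.prod a (.list b)).size fun x => f.prog.cost x.1 :=
      (f.poly.comp Prod.fst).trans (PolyBdd.of_le fun x => by rw [Ty.size_prod]; omega)
    obtain ⟨d, hd⟩ := g.poly
    have hg : PolyBdd (Ty.prod a (.list b)).size fun x =>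
        match x.2 with
        | [] => 0
        | y :: l => g.prog.cost (x.1, y, l) := by
      refine ⟨d, fun x => ?_⟩
      obtain ⟨x, _ | ⟨y, l⟩⟩ := x
      · simp
      · refine (hd _).trans (Nat.pow_le_pow_left ?_ d)
        simp only [Ty.size_prod, Ty.size_cons]
        omega
    have h1 : PolyBdd (Ty.prod a (.list b)).size fun x =>
        c.size ((Prog.caseList f.prog g.prog).eval x) := by
      refine (hf.add hg).mono fun x => ?_
      obtain ⟨x, _ | ⟨y, l⟩⟩ := x
      · simp only [Prog.eval]
        exact (f.prog.size_eval_le x).trans (Nat.le_add_right _ _)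
      · simp only [Prog.eval]
        exact (g.prog.size_eval_le (x, y, l)).trans (Nat.le_add_left _ _)
    refine ((charge_poly h1).add (hf.add hg)).mono fun x => ?_
    obtain ⟨x, _ | ⟨y, l⟩⟩ := x
    · simp [Prog.cost]
    · simp [Prog.cost]⟩ (pair (ident a) l)

/-- Folding a list in a context. -/
def fold (l : PT Γ (.list b)) (s₀ : PT Γ s) (f : PT (.prod Γ (.prod s b)) s)
    (h : PolyBdd (fun x : Γ.den × s.den × List b.den => Γ.size x.1 + s.size x.2.1 +
        (Ty.list b).size x.2.2)
      fun x => s.size (x.2.2.foldl (fun s y => f.ev (x.1, s, y)) x.2.1)) : PT Γ s :=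
  -- The primitive fold has no context. The context therefore travels in the state, and each step
  -- hands it on unchanged.
  let A : Ty := .prod Γ s
  let ctx : PT (.prod A b) Γ := (ident (.prod A b)).fst.fst
  let step : PT (.prod A b) A :=
    ctx.pair (comp f (ctx.pair ((ident (.prod A b)).fst.snd.pair (ident (.prod A b)).snd)))
  snd (comp ⟨.fold step.prog, by
    have hst : ∀ (x : Γ.den) (s₀ : s.den) (l : List b.den),
        l.foldl (fun (s : A.den) (y : b.den) => step.prog.eval (s, y)) (x, s₀) =
          (x, l.foldl (fun s y => f.ev (x, s, y)) s₀) := by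
      intro x s₀ l
      induction l generalizing s₀ with
      | nil => rfl
      | cons y l ih => exact ih _
    obtain ⟨d, hd⟩ := h
    obtain ⟨e, he⟩ := step.poly
    have h0 : ∀ (x : Γ.den) (s₀ : s.den) (l : List b.den),
        s.size (l.foldl (fun s y => f.ev (x, s, y)) s₀) ≤
          (Γ.size x + s.size s₀ + (Ty.list b).size l + 2) ^ d := fun x s₀ l => hd (x, s₀, l)
    have h1 : PolyBdd (Ty.prod A (.list b)).size fun x => A.size ((Prog.fold step.prog).eval x) := by
      have : PolyBdd (Ty.prod A (.list b)).size fun x =>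
          (Ty.prod A (.list b)).size x + ((Ty.prod A (.list b)).size x + 2) ^ d + 1 :=
        ((PolyBdd.self _).add (((PolyBdd.self _).add (PolyBdd.const _ 2)).pow d)).add
          (PolyBdd.const _ 1)
      refine this.mono fun x => ?_
      obtain ⟨⟨x, s₀⟩, l⟩ := x
      simp only [Prog.eval]
      rw [hst, Ty.size_prod]
      have := h0 x s₀ l
      have h2 : (Γ.size x + s.size s₀ + (Ty.list b).size l + 2) ^ d ≤
          ((Ty.prod A (.list b)).size ((x, s₀), l) + 2) ^ d := by
        refine Nat.pow_le_pow_left ?_ d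
        simp only [A, Ty.size_prod]
        omega
      have h3 : Γ.size x ≤ (Ty.prod A (.list b)).size ((x, s₀), l) := by
        simp only [A, Ty.size_prod]
        omega
      simp only at this h2 h3 ⊢
      omega
    have h2 : PolyBdd (Ty.prod A (.list b)).size fun x =>
        (Ty.prod A (.list b)).size x *
          (2 * (Ty.prod A (.list b)).size x + ((Ty.prod A (.list b)).size x + 2) ^ d + 4) ^ e :=
      (PolyBdd.self _).mul (((((PolyBdd.const _ 2).mul (PolyBdd.self _)).add
        (((PolyBdd.self _).add (PolyBdd.const _ 2)).pow d)).add (PolyBdd.const _ 4)).pow e)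
    refine ((charge_poly h1).add h2).mono fun x => ?_
    obtain ⟨⟨x, s₀⟩, l⟩ := x
    simp only [Prog.cost]
    refine Nat.add_le_add_left ?_ _
    set S := (Ty.prod A (.list b)).size ((x, s₀), l) with hS
    have hS' : S = Γ.size x + s.size s₀ + 1 + (Ty.list b).size l + 1 := by
      simp only [hS, A, Ty.size_prod]
    refine (foldl_cost_le step.prog (x, s₀) l ((2 * S + (S + 2) ^ d + 4) ^ e) ?_).trans
      (Nat.mul_le_mul_right _ ?_)
    · rintro l₁ y l₂ rfl
      rw [hst]
      refine (he _).trans (Nat.pow_le_pow_left ?_ e)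
      -- The growth hypothesis covers all lists, hence also the prefix processed so far.
      have h3 := h0 x s₀ l₁
      have h4 := Ty.size_append l₁ (y :: l₂)
      have h5 := Ty.size_cons y l₂
      have h6 : (Γ.size x + s.size s₀ + (Ty.list b).size l₁ + 2) ^ d ≤ (S + 2) ^ d :=
        Nat.pow_le_pow_left (by omega) d
      simp only [A, Ty.size_prod]
      omega
    · have := Ty.length_lt_size l
      omega⟩ (pair (pair (ident Γ) s₀) l))

section eval

variable (x : a.den)

@[simp] theorem ev_comp (g : PT b c) (f : PT a b) : (comp g f).ev x = g.ev (f.ev x) := rfl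
@[simp] theorem ev_pair (f : PT a b) (g : PT a c) : (pair f g).ev x = (f.ev x, g.ev x) := rfl
@[simp] theorem ev_fst (f : PT a (.prod b c)) : (fst f).ev x = (f.ev x).1 := rfl
@[simp] theorem ev_snd (f : PT a (.prod b c)) : (snd f).ev x = (f.ev x).2 := rfl
@[simp] theorem ev_ite (c : PT a .rat) (f g : PT a b) :
    (ite c f g).ev x = if (0 : ℚ) < c.ev x then f.ev x else g.ev x := rfl
@[simp] theorem ev_cons (f : PT a b) (g : PT a (.list b)) :
    (cons f g).ev x = f.ev x :: g.ev x := rfl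
@[simp] theorem ev_fold (x : Γ.den) (l : PT Γ (.list b)) (s₀ : PT Γ s)
    (f : PT (.prod Γ (.prod s b)) s) (h) :
    (fold l s₀ f h).ev x = (l.ev x).foldl (fun s y => f.ev (x, s, y)) (s₀.ev x) := by
  have hst : ∀ (step : Prog (.prod (.prod Γ s) b) (.prod Γ s)),
      (∀ x s y, step.eval ((x, s), y) = (x, f.ev (x, s, y))) →
      ∀ (x : Γ.den) (s₀ : s.den) (l : List b.den),
        l.foldl (fun (s : (Ty.prod Γ s).den) (y : b.den) => step.eval (s, y)) (x, s₀) =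
          (x, l.foldl (fun s y => f.ev (x, s, y)) s₀) := by
    intro step hs x s₀ l
    induction l generalizing s₀ with
    | nil => rfl
    | cons y l ih => rw [List.foldl_cons, List.foldl_cons, hs]; exact ih _
  have := hst (((ident (.prod (.prod Γ s) b)).fst.fst.pair (comp f
    ((ident (.prod (.prod Γ s) b)).fst.fst.pair ((ident (.prod (.prod Γ s) b)).fst.snd.pair
      (ident (.prod (.prod Γ s) b)).snd))))).prog (fun _ _ _ => rfl) x (s₀.ev x) (l.ev x)
  exact congrArg Prod.snd this

theorem ev_caseList (l : PT a (.list b)) (f : PT a c) (g : PT (.prod a (.prod b (.list b))) c) :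
    (caseList l f g).ev x = match l.ev x with
      | [] => f.ev x
      | y :: l => g.ev (x, y, l) := rfl

end eval

end PT

end BernoulliSched

namespace BernoulliSched

/-! ### Heights of rational numbers -/

/-- The larger one of the bit lengths of numerator and denominator. -/
def ht (x : ℚ) : ℕ := max (Nat.size x.num.natAbs) (Nat.size x.den)

theorem ht_le_size (x : ℚ) : ht x ≤ Ty.rat.size x := by
  simp only [ht, Ty.size]; omega

theorem size_le_ht (x : ℚ) : Ty.rat.size x ≤ 2 * ht x + 1 := by
  simp only [ht, Ty.size]; omega

/-- Reduction to lowest terms divides numerator and denominator by a common factor, so heights can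
be read off from any representing fraction. -/
theorem num_den_le {x : ℚ} {p : ℤ} {q : ℕ} (hq : q ≠ 0) (h : x = p / q) :
    x.num.natAbs ≤ p.natAbs ∧ x.den ≤ q := by
  have hq' : (q : ℤ) ≠ 0 := by exact_mod_cast hq
  have h1 : x.num ∣ p := by
    have := Rat.num_dvd p hq'
    rwa [show Rat.divInt p q = x by rw [h, Rat.divInt_eq_div]; simp] at this
  have h2 : (x.den : ℤ) ∣ q := by
    have := Rat.den_dvd p (q : ℤ)
    rwa [show Rat.divInt p q = x by rw [h, Rat.divInt_eq_div]; simp] at this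
  constructor
  · by_cases hp : p = 0
    · subst hp
      have : x = 0 := by rw [h]; simp
      simp [this]
    · exact Nat.le_of_dvd (Int.natAbs_pos.2 hp) (Int.natAbs_dvd_natAbs.2 h1)
  · exact Nat.le_of_dvd (Nat.pos_of_ne_zero hq) (by exact_mod_cast h2)

theorem ht_le_of_eq_div {x : ℚ} {p : ℤ} {q : ℕ} (hq : q ≠ 0) (h : x = p / q) {k : ℕ}
    (hp : p.natAbs < 2 ^ k) (hk : q < 2 ^ k) : ht x ≤ k := by
  obtain ⟨h1, h2⟩ := num_den_le hq h
  exact max_le (Nat.size_le.2 (h1.trans_lt hp)) (Nat.size_le.2 (h2.trans_lt hk))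

theorem natAbs_num_lt (x : ℚ) : x.num.natAbs < 2 ^ ht x :=
  (Nat.lt_size_self _).trans_le (Nat.pow_le_pow_right (by norm_num) (le_max_left _ _))

theorem den_lt (x : ℚ) : x.den < 2 ^ ht x :=
  (Nat.lt_size_self _).trans_le (Nat.pow_le_pow_right (by norm_num) (le_max_right _ _))

/-- After cross-multiplication the numerator is a sum of two products, each below `2 ^ (ht x + ht
y)`; the sum costs one more bit. The coefficients `1` matter: they keep the height of an iterated
sum linear. -/
theorem ht_add (x y : ℚ) : ht (x + y) ≤ ht x + ht y + 1 := by
  have hx := natAbs_num_lt x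
  have hy := natAbs_num_lt y
  have hx' := den_lt x
  have hy' := den_lt y
  refine ht_le_of_eq_div (p := x.num * y.den + y.num * x.den) (q := x.den * y.den)
    (Nat.mul_ne_zero x.den_nz y.den_nz) ?_ ?_ ?_
  · conv_lhs => rw [← Rat.num_div_den x, ← Rat.num_div_den y]
    have h1 : (x.den : ℚ) ≠ 0 := by exact_mod_cast x.den_nz
    have h2 : (y.den : ℚ) ≠ 0 := by exact_mod_cast y.den_nz
    push_cast
    field_simp
  · refine (Int.natAbs_add_le _ _).trans_lt ?_
    rw [Int.natAbs_mul, Int.natAbs_mul, Int.natAbs_natCast, Int.natAbs_natCast, pow_succ, pow_add]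
    have h1 : x.num.natAbs * y.den < 2 ^ ht x * 2 ^ ht y := Nat.mul_lt_mul'' hx hy'
    have h2 : y.num.natAbs * x.den < 2 ^ ht y * 2 ^ ht x := Nat.mul_lt_mul'' hy hx'
    rw [mul_comm (2 ^ ht y)] at h2
    omega
  · rw [pow_succ, pow_add]
    have h1 : x.den * y.den < 2 ^ ht x * 2 ^ ht y := Nat.mul_lt_mul'' hx' hy'
    omega

theorem ht_neg (x : ℚ) : ht (-x) = ht x := by simp [ht]

theorem ht_sub (x y : ℚ) : ht (x - y) ≤ ht x + ht y + 1 := by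
  rw [sub_eq_add_neg, ← ht_neg y]; exact ht_add _ _

theorem ht_mul (x y : ℚ) : ht (x * y) ≤ ht x + ht y := by
  have hx := natAbs_num_lt x
  have hy := natAbs_num_lt y
  have hx' := den_lt x
  have hy' := den_lt y
  refine ht_le_of_eq_div (p := x.num * y.num) (q := x.den * y.den)
    (Nat.mul_ne_zero x.den_nz y.den_nz) ?_ ?_ ?_
  · conv_lhs => rw [← Rat.num_div_den x, ← Rat.num_div_den y]
    push_cast
    field_simp
  · rw [Int.natAbs_mul, pow_add]
    exact Nat.mul_lt_mul'' hx hy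
  · rw [pow_add]
    exact Nat.mul_lt_mul'' hx' hy'

theorem ht_inv (x : ℚ) : ht x⁻¹ ≤ ht x := by
  by_cases h0 : x = 0
  · simp [h0]
  have hn : x.num.natAbs ≠ 0 := by simpa using h0
  refine ht_le_of_eq_div (p := x.num.sign * x.den) (q := x.num.natAbs) hn ?_ ?_ (natAbs_num_lt x)
  · have h1 : (x.num.natAbs : ℚ) ≠ 0 := by exact_mod_cast hn
    have h2 : (x.num : ℚ) ≠ 0 := by exact_mod_cast (Rat.num_ne_zero.2 h0)
    have h3 : ((x.num.sign : ℤ) : ℚ) * x.num = x.num.natAbs := by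
      have h4 : x.num.sign * x.num = (x.num.natAbs : ℤ) := by
        rw [Int.natCast_natAbs]; exact Int.sign_mul_self_eq_abs _
      rw [← Int.cast_mul, h4, Int.cast_natCast]
    conv_lhs => rw [← Rat.num_div_den x, inv_div]
    push_cast
    rw [div_eq_div_iff h2 h1, ← h3]
    ring
  · rw [Int.natAbs_mul, Int.natAbs_sign_of_ne_zero (Rat.num_ne_zero.2 h0), one_mul, Int.natAbs_natCast]
    exact den_lt x

theorem ht_div (x y : ℚ) : ht (x / y) ≤ ht x + ht y := by
  rw [div_eq_mul_inv]
  exact (ht_mul _ _).trans (Nat.add_le_add_left (ht_inv y) _)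

theorem ht_floor (x : ℚ) : ht ((⌊x⌋ : ℤ) : ℚ) ≤ ht x := by
  refine ht_le_of_eq_div (p := ⌊x⌋) (q := 1) one_ne_zero (by simp) ?_ ?_
  · refine lt_of_le_of_lt ?_ (natAbs_num_lt x)
    rw [Rat.floor_def']
    have hd : (0 : ℤ) < x.den := by exact_mod_cast x.den_pos
    have h1 : (x.num / (x.den : ℤ)).natAbs ≤ x.num.natAbs := by
      exact Int.natAbs_ediv_le_natAbs _ _
    exact h1
  · have := x.den_pos
    have := den_lt x
    omega

/-- A crude bound without logarithm. It is applied only to counts that are polynomially bounded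
themselves. -/
theorem ht_natCast_le {k : ℕ} {B : ℕ} (h : k ≤ B) : ht (k : ℚ) ≤ B + 1 := by
  refine ht_le_of_eq_div (p := k) (q := 1) one_ne_zero (by simp) ?_ ?_
  · rw [Int.natAbs_natCast]
    exact (h.trans_lt Nat.lt_two_pow_self).trans (Nat.pow_lt_pow_right (by norm_num) (by omega))
  · exact Nat.one_lt_two_pow (by omega)

namespace PT

variable {a b c s Γ : Ty}

/-- A program that consists of a single primitive operation on numbers. -/
def ofHt (f : Prog (.prod .rat .rat) .rat) (hc : ∀ x, f.cost x = f.charge x)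
    (h : ∀ x : ℚ × ℚ, ht (f.eval x) ≤ ht x.1 + ht x.2 + 1) : PT (.prod .rat .rat) .rat :=
  ⟨f, by
    have h1 : PolyBdd (Ty.prod .rat .rat).size fun x => Ty.rat.size (f.eval x) := by
      refine (((PolyBdd.const _ 2).mul ((PolyBdd.self _))).add (PolyBdd.const _ 3)).mono fun x => ?_
      have h0 := h x
      have h1 := size_le_ht (f.eval x)
      have h2 := ht_le_size x.1
      have h3 := ht_le_size x.2
      simp only [Ty.size_prod]
      omega
    exact (charge_poly h1).mono fun x => (hc x).le⟩

/-- Addition. -/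
def add (f g : PT a .rat) : PT a .rat :=
  comp (ofHt .add (fun _ => rfl) fun x => ht_add x.1 x.2) (pair f g)

/-- Subtraction. -/
def sub (f g : PT a .rat) : PT a .rat :=
  comp (ofHt .sub (fun _ => rfl) fun x => ht_sub x.1 x.2) (pair f g)

/-- Multiplication. -/
def mul (f g : PT a .rat) : PT a .rat :=
  comp (ofHt .mul (fun _ => rfl) fun x => (ht_mul x.1 x.2).trans (Nat.le_succ _)) (pair f g)

/-- Division. -/
def div (f g : PT a .rat) : PT a .rat :=
  comp (ofHt .div (fun _ => rfl) fun x => (ht_div x.1 x.2).trans (Nat.le_succ _)) (pair f g)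

/-- The integral part. -/
def floor (f : PT a .rat) : PT a .rat :=
  comp ⟨.floor, by
    have h1 : PolyBdd Ty.rat.size fun x => Ty.rat.size (Prog.floor.eval x) := by
      refine (((PolyBdd.const _ 2).mul ((PolyBdd.self _))).add (PolyBdd.const _ 1)).mono fun x => ?_
      have h0 : ht (Prog.floor.eval x) ≤ ht x := ht_floor x
      have h1 := size_le_ht (Prog.floor.eval x)
      have h2 := ht_le_size x
      omega
    exact (charge_poly h1).mono fun x => le_rfl⟩ f

variable (x : a.den) (f g : PT a .rat)

@[simp] theorem ev_add : (add f g).ev x = (f.ev x + g.ev x : ℚ) := rfl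
@[simp] theorem ev_sub : (sub f g).ev x = (f.ev x - g.ev x : ℚ) := rfl
@[simp] theorem ev_mul : (mul f g).ev x = (f.ev x * g.ev x : ℚ) := rfl
@[simp] theorem ev_div : (div f g).ev x = (f.ev x / g.ev x : ℚ) := rfl
@[simp] theorem ev_floor : (floor f).ev x = ((⌊(f.ev x : ℚ)⌋ : ℤ) : ℚ) := rfl

end PT

/-- A sufficient condition for the states of a fold to have polynomial size: each step increases
some measure of the state by a summand that does not depend on the state. -/
theorem polyBdd_foldl {Γ s b : Ty} (F : Γ.den → s.den → b.den → s.den) (φ : s.den → ℕ)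
    (h₁ : PolyBdd φ s.size) (h₂ : PolyBdd s.size φ) (ψ : Γ.den × b.den → ℕ)
    (hψ : PolyBdd (fun x : Γ.den × b.den => Γ.size x.1 + b.size x.2) ψ)
    (h : ∀ x s y, φ (F x s y) ≤ φ s + ψ (x, y)) :
    PolyBdd (fun x : Γ.den × s.den × List b.den => Γ.size x.1 + s.size x.2.1 +
        (Ty.list b).size x.2.2)
      fun x => s.size (x.2.2.foldl (F x.1) x.2.1) := by
  obtain ⟨d, hd⟩ := hψ
  obtain ⟨e, he⟩ := h₂
  have key : ∀ (x : Γ.den) (s₀ : s.den) (l : List b.den) (B : ℕ), (Ty.list b).size l ≤ B →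
      φ (l.foldl (F x) s₀) ≤ φ s₀ + l.length * (Γ.size x + B + 2) ^ d := by
    intro x s₀ l B
    induction l generalizing s₀ with
    | nil => simp
    | cons y l ih =>
      intro hB
      rw [Ty.size_cons] at hB
      have h1 := ih (F x s₀ y) (by omega)
      have h2 := h x s₀ y
      have h3 := hd (x, y)
      have h4 : (Γ.size x + b.size y + 2) ^ d ≤ (Γ.size x + B + 2) ^ d :=
        Nat.pow_le_pow_left (by omega) d
      simp only [List.foldl_cons, List.length_cons]
      have h5 : (l.length + 1) * (Γ.size x + B + 2) ^ d =
        l.length * (Γ.size x + B + 2) ^ d + (Γ.size x + B + 2) ^ d := by ring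
      simp only at h3
      omega
  refine PolyBdd.trans (h₁.comp fun x : Γ.den × s.den × List b.den => x.2.2.foldl (F x.1) x.2.1) ?_
  set μ := fun x : Γ.den × s.den × List b.den => Γ.size x.1 + s.size x.2.1 + (Ty.list b).size x.2.2
    with hμ
  have : PolyBdd μ fun x => (μ x + 2) ^ e + μ x * (μ x + 2) ^ d :=
    (((PolyBdd.self _).add (PolyBdd.const _ 2)).pow e).add
      ((PolyBdd.self _).mul (((PolyBdd.self _).add (PolyBdd.const _ 2)).pow d))
  refine this.mono fun x => ?_
  obtain ⟨x, s₀, l⟩ := x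
  refine (key x s₀ l _ le_rfl).trans (Nat.add_le_add ((he s₀).trans ?_) (Nat.mul_le_mul ?_ ?_))
  · exact Nat.pow_le_pow_left (by simp only [hμ]; omega) e
  · have := Ty.length_lt_size l
    simp only [hμ]; omega
  · exact Nat.pow_le_pow_left (by simp only [hμ]; omega) d

end BernoulliSched

namespace BernoulliSched

/-! ### Least and greatest elements -/

theorem leastOf_eq {S : Set ℚ} {x : ℚ} (h : IsLeast S x) : leastOf S = x := by
  have h' : ∃ x, IsLeast S x := ⟨x, h⟩
  rw [leastOf, dif_pos h']
  exact h'.choose_spec.unique h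

theorem greatestOf_eq {S : Set ℚ} {x : ℚ} (h : IsGreatest S x) : greatestOf S = x := by
  have h' : ∃ x, IsGreatest S x := ⟨x, h⟩
  rw [greatestOf, dif_pos h']
  exact h'.choose_spec.unique h

theorem isLeast_leastOf {S : Set ℚ} (h : ∃ x, IsLeast S x) : IsLeast S (leastOf S) := by
  obtain ⟨x, hx⟩ := h
  rwa [leastOf_eq hx]

/-- The elements of `S` are nonnegative multiples of `1 / D`. -/
def Fractions (D : ℕ) (S : Set ℚ) : Prop := ∀ x ∈ S, ∃ k : ℕ, x = (k : ℚ) / D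

theorem Fractions.mono {D : ℕ} {S T : Set ℚ} (h : Fractions D T) (hST : S ⊆ T) : Fractions D S :=
  fun x hx => h x (hST hx)

/-- Nonnegative multiples of a fixed unit are ordered like natural numbers. Hence the default value
in `leastOf` plays no role for nonempty sets of time points. -/
theorem Fractions.exists_isLeast {D : ℕ} {S : Set ℚ} (h : Fractions D S) (hne : S.Nonempty) :
    ∃ x, IsLeast S x := by
  classical
  have h1 : ∃ k : ℕ, (k : ℚ) / D ∈ S := by
    obtain ⟨x, hx⟩ := hne
    obtain ⟨k, rfl⟩ := h x hx
    exact ⟨k, hx⟩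
  refine ⟨_, Nat.find_spec h1, fun y hy => ?_⟩
  obtain ⟨k, rfl⟩ := h y hy
  have := Nat.find_min' h1 hy
  gcongr

theorem Fractions.finite_le {D : ℕ} (hD : 0 < D) {S : Set ℚ} (h : Fractions D S) (B : ℚ) :
    (S ∩ Set.Iic B).Finite := by
  refine (Set.Finite.image (fun k : ℕ => (k : ℚ) / D) (Set.finite_Iic ⌊B * D⌋₊)).subset ?_
  rintro x ⟨hx, hB⟩
  obtain ⟨k, rfl⟩ := h x hx
  refine ⟨k, Nat.le_floor ?_, rfl⟩
  have : (0 : ℚ) < D := by exact_mod_cast hD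
  rwa [Set.mem_Iic, div_le_iff₀ this] at hB

theorem Fractions.nonneg {D : ℕ} {S : Set ℚ} (h : Fractions D S) {x : ℚ} (hx : x ∈ S) : 0 ≤ x := by
  obtain ⟨k, rfl⟩ := h x hx
  positivity

namespace Instance

variable {n E : ℕ} (I : Instance n E)

/-! ### Groups -/

theorem eps_pos (hE : 3 ≤ E) : 0 < I.eps := by
  have : (0 : ℚ) < E := by exact_mod_cast (by omega : 0 < E)
  unfold eps; positivity

theorem E_mul_eps (hE : 3 ≤ E) : (E : ℚ) * I.eps = 1 := by
  have : (E : ℚ) ≠ 0 := by exact_mod_cast (by omega : E ≠ 0)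
  unfold eps; field_simp

theorem eps_le (hE : 3 ≤ E) : I.eps ≤ 1 / 3 := by
  have : (3 : ℚ) ≤ E := by exact_mod_cast hE
  unfold eps
  exact one_div_le_one_div_of_le (by norm_num) this

theorem grp_zero (h0 : 0 < n) : I.grp ⟨0, h0⟩ = 1 := by
  unfold grp
  rw [Finset.card_eq_zero.2]
  rw [Finset.filter_eq_empty_iff]
  rintro i - ⟨hi, i₀, h1, -⟩
  have : (i : ℕ) ≤ 0 := hi
  omega

/-- Turns the counting definition of the group number into a recursion along the types, on which the
inductions about groups run. -/
theorem grp_succ {j : ℕ} (hj : j + 1 < n) :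
    I.grp ⟨j + 1, hj⟩ = I.grp ⟨j, by omega⟩ +
      if I.p ⟨j + 1, hj⟩ ≤ I.eps ^ 2 * I.p ⟨j, by omega⟩ then 1 else 0 := by
  unfold grp
  rw [add_right_comm]
  congr 1
  split_ifs with h
  · rw [← Finset.card_insert_of_notMem (a := (⟨j + 1, hj⟩ : Fin n))]
    · congr 1
      ext i
      simp only [Finset.mem_filter, Finset.mem_univ, true_and, Finset.mem_insert]
      constructor
      · rintro ⟨h1, h2⟩
        rcases eq_or_lt_of_le h1 with h1 | h1
        · exact Or.inl h1
        · exact Or.inr ⟨by rw [Fin.le_def]; rw [Fin.lt_def] at h1; simp only at h1 ⊢; omega, h2⟩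
      · rintro (rfl | ⟨h1, h2⟩)
        · exact ⟨le_rfl, ⟨j, by omega⟩, rfl, h⟩
        · exact ⟨by rw [Fin.le_def] at h1 ⊢; simp only at h1 ⊢; omega, h2⟩
    · simp [Fin.le_def]
  · rw [add_zero]
    congr 1
    ext i
    simp only [Finset.mem_filter, Finset.mem_univ, true_and]
    refine and_congr_left ?_
    rintro ⟨i₀, h1, h2⟩
    rw [Fin.le_def, Fin.le_def]
    simp only
    constructor
    · intro h3
      by_contra h4
      have h5 : i = ⟨j + 1, hj⟩ := Fin.ext (by simp only; omega)
      have h6 : i₀ = ⟨j, by omega⟩ := Fin.ext (by simp only; rw [h5] at h1; simp only at h1; omega)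
      rw [h5, h6] at h2
      exact h h2
    · intro h3; omega

theorem grp_mono : Monotone I.grp := by
  intro i j hij
  unfold grp
  refine Nat.add_le_add_right (Finset.card_le_card fun k hk => ?_) 1
  simp only [Finset.mem_filter, Finset.mem_univ, true_and] at hk ⊢
  exact ⟨hk.1.trans hij, hk.2⟩

theorem one_le_grp (j : Fin n) : 1 ≤ I.grp j := by unfold grp; omega

theorem grp_le_γ (j : Fin n) : I.grp j ≤ I.γ := Finset.le_sup (f := I.grp) (Finset.mem_univ j)

theorem grp_le_succ (j : Fin n) : I.grp j ≤ j + 1 := by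
  obtain ⟨j, hj⟩ := j
  induction j with
  | zero => rw [grp_zero]
  | succ j ih =>
    rw [grp_succ]
    have := ih (by omega)
    simp only at this ⊢
    split_ifs <;> omega

theorem γ_le : I.γ ≤ n := Finset.sup_le fun j _ => (I.grp_le_succ j).trans (by omega)

/-- A discrete intermediate value theorem: group numbers start at `1` and grow by at most one from
type to type. -/
theorem exists_grp_eq_of_le {j : Fin n} {h : ℕ} (h1 : 1 ≤ h) (h2 : h ≤ I.grp j) :
    ∃ i ≤ j, I.grp i = h := by
  obtain ⟨j, hj⟩ := j
  induction j with
  | zero => exact ⟨_, le_rfl, by rw [grp_zero] at h2 ⊢; omega⟩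
  | succ j ih =>
    by_cases h3 : h ≤ I.grp ⟨j, by omega⟩
    · obtain ⟨i, hi, e⟩ := ih (by omega) h3
      exact ⟨i, hi.trans (by rw [Fin.le_def]; simp), e⟩
    · refine ⟨_, le_rfl, ?_⟩
      rw [grp_succ] at h2 ⊢
      split_ifs at h2 ⊢ <;> omega

theorem exists_grp_eq_γ (hn : 0 < n) : ∃ j, I.grp j = I.γ := by
  have : Nonempty (Fin n) := ⟨⟨0, hn⟩⟩
  obtain ⟨j, -, hj⟩ := Finset.exists_mem_eq_sup (Finset.univ : Finset (Fin n)) Finset.univ_nonempty I.grp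
  exact ⟨j, hj.symm⟩

theorem γ_pos (hn : 0 < n) : 1 ≤ I.γ := (I.one_le_grp ⟨0, hn⟩).trans (I.grp_le_γ _)

/-- Numbers of groups. -/
def IsGrp (h : ℕ) : Prop := 1 ≤ h ∧ h ≤ I.γ

variable {I}

theorem isGrp_grp (j : Fin n) : I.IsGrp (I.grp j) := ⟨I.one_le_grp j, I.grp_le_γ j⟩

theorem IsGrp.pos {h : ℕ} (hh : I.IsGrp h) : 0 < n := by
  have := I.γ_le
  have := hh.1
  have := hh.2
  omega

theorem IsGrp.exists_type {h : ℕ} (hh : I.IsGrp h) : ∃ j, I.grp j = h := by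
  obtain ⟨j, hj⟩ := I.exists_grp_eq_γ hh.pos
  obtain ⟨i, -, hi⟩ := I.exists_grp_eq_of_le hh.1 (hh.2.trans_eq hj.symm)
  exact ⟨i, hi⟩

/-- Each group has a last and a first type, which have the extreme sizes. -/
theorem IsGrp.exists_last {h : ℕ} (hh : I.IsGrp h) :
    ∃ j, I.grp j = h ∧ I.pG h = I.p j ∧ ∀ i, I.grp i = h → i ≤ j := by
  classical
  obtain ⟨j₀, hj₀⟩ := hh.exists_type
  obtain ⟨j, hj, hmax⟩ := Finset.exists_max_image (Finset.univ.filter fun j => I.grp j = h) id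
    ⟨j₀, by simp [hj₀]⟩
  simp only [Finset.mem_filter, Finset.mem_univ, true_and, id] at hj hmax
  refine ⟨j, hj, leastOf_eq ⟨⟨j, hj, rfl⟩, ?_⟩, hmax⟩
  rintro x ⟨i, hi, rfl⟩
  exact I.p_anti.antitone (hmax i hi)

theorem IsGrp.exists_first {h : ℕ} (hh : I.IsGrp h) :
    ∃ j, I.grp j = h ∧ I.pmax h = I.p j ∧ ∀ i, I.grp i = h → j ≤ i := by
  classical
  obtain ⟨j₀, hj₀⟩ := hh.exists_type
  obtain ⟨j, hj, hmin⟩ := Finset.exists_min_image (Finset.univ.filter fun j => I.grp j = h) id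
    ⟨j₀, by simp [hj₀]⟩
  simp only [Finset.mem_filter, Finset.mem_univ, true_and, id] at hj hmin
  refine ⟨j, hj, greatestOf_eq ⟨⟨j, hj, rfl⟩, ?_⟩, hmin⟩
  rintro x ⟨i, hi, rfl⟩
  exact I.p_anti.antitone (hmin i hi)

theorem IsGrp.pG_pos {h : ℕ} (hh : I.IsGrp h) : 0 < I.pG h := by
  obtain ⟨j, -, e, -⟩ := hh.exists_last
  rw [e]; exact I.p_pos j

theorem pG_le (j : Fin n) : I.pG (I.grp j) ≤ I.p j := by
  obtain ⟨i, -, e, hm⟩ := (isGrp_grp (I := I) j).exists_last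
  rw [e]; exact I.p_anti.antitone (hm j rfl)

theorem le_pmax (j : Fin n) : I.p j ≤ I.pmax (I.grp j) := by
  obtain ⟨i, -, e, hm⟩ := (isGrp_grp (I := I) j).exists_first
  rw [e]; exact I.p_anti.antitone (hm j rfl)

theorem IsGrp.pG_le_pmax {h : ℕ} (hh : I.IsGrp h) : I.pG h ≤ I.pmax h := by
  obtain ⟨j, rfl⟩ := hh.exists_type
  exact (pG_le j).trans (le_pmax j)

/-- The last type of a group and the first type of the following one are neighbours, and a new group
starts exactly where the size drops by the factor `ε ^ 2`. -/
theorem pmax_succ_le {h : ℕ} (hh : I.IsGrp h) (hh' : I.IsGrp (h + 1)) :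
    I.pmax (h + 1) ≤ I.eps ^ 2 * I.pG h := by
  obtain ⟨⟨j, hj⟩, hjg, e, hm⟩ := hh.exists_last
  obtain ⟨⟨i, hi⟩, hig, e', hm'⟩ := hh'.exists_first
  have hji : j < i := by
    by_contra h1
    have := I.grp_mono (show (⟨i, hi⟩ : Fin n) ≤ ⟨j, hj⟩ by rw [Fin.le_def]; simp only; omega)
    omega
  have hs := I.grp_succ (j := j) (by omega)
  -- If no group started at `j + 1`, this type would still belong to group `h`, although `j` is the
  -- last one there.
  have h1 : I.grp ⟨j + 1, by omega⟩ = h + 1 ∧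
      I.p ⟨j + 1, by omega⟩ ≤ I.eps ^ 2 * I.p ⟨j, by omega⟩ := by
    split_ifs at hs with h2
    · exact ⟨by omega, h2⟩
    · have := hm ⟨j + 1, by omega⟩ (by omega)
      rw [Fin.le_def] at this
      simp only at this; omega
  have h2 := hm' _ h1.1
  rw [e, e']
  have h3 : i = j + 1 := by rw [Fin.le_def] at h2; simp only at h2; omega
  subst h3
  exact h1.2

/-- Neighbours within a group differ by a factor below `E ^ 2`, and there are `gsize h - 1` pairs of
neighbours. -/
theorem pmax_le_pow_mul_pG {h : ℕ} (hE : 3 ≤ E) (hh : I.IsGrp h) :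
    I.pmax h ≤ (E : ℚ) ^ (2 * (I.gsize h - 1)) * I.pG h := by
  obtain ⟨⟨b, hb⟩, hbg, e, hm⟩ := hh.exists_last
  obtain ⟨⟨a, ha⟩, hag, e', hm'⟩ := hh.exists_first
  have hE1 : (1 : ℚ) ≤ E := by exact_mod_cast (by omega : 1 ≤ E)
  have hab : a ≤ b := by
    have := hm ⟨a, ha⟩ hag
    rwa [Fin.le_def] at this
  have hcard : b - a + 1 ≤ I.gsize h := by
    have : (Finset.Icc (⟨a, ha⟩ : Fin n) ⟨b, hb⟩).card ≤ I.gsize h := by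
      refine Finset.card_le_card fun i hi => ?_
      rw [Finset.mem_Icc] at hi
      simp only [Finset.mem_filter, Finset.mem_univ, true_and]
      have h1 := I.grp_mono hi.1
      have h2 := I.grp_mono hi.2
      omega
    rw [Fin.card_Icc] at this
    simp only at this
    omega
  have key : ∀ k, ∀ hk : a + k < n, a + k ≤ b →
      I.p ⟨a, ha⟩ ≤ (E : ℚ) ^ (2 * k) * I.p ⟨a + k, hk⟩ := by
    intro k
    induction k with
    | zero => intro _ _; simp
    | succ k ih =>
      intro hk hkb
      have h1 := ih (by omega) (by omega)
      have h2 := I.grp_succ (j := a + k) hk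
      have h3 : I.grp ⟨a + k + 1, hk⟩ ≤ h := by
        rw [← hbg]; exact I.grp_mono (by rw [Fin.le_def]; simp only; omega)
      have h4 : h ≤ I.grp ⟨a + k, by omega⟩ := by
        rw [← hag]; exact I.grp_mono (by rw [Fin.le_def]; simp only; omega)
      have h5 : ¬ I.p ⟨a + k + 1, hk⟩ ≤ I.eps ^ 2 * I.p ⟨a + k, by omega⟩ := by
        intro h6
        rw [if_pos h6] at h2
        omega
      have h6 : I.p ⟨a + k, by omega⟩ ≤ (E : ℚ) ^ 2 * I.p ⟨a + k + 1, hk⟩ := by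
        have h7 := (not_le.1 h5).le
        have h8 : (E : ℚ) ^ 2 * (I.eps ^ 2 * I.p ⟨a + k, by omega⟩) = I.p ⟨a + k, by omega⟩ := by
          rw [← mul_assoc, ← mul_pow, I.E_mul_eps hE]; simp
        rw [← h8]
        gcongr
      calc I.p ⟨a, ha⟩ ≤ (E : ℚ) ^ (2 * k) * I.p ⟨a + k, by omega⟩ := h1
        _ ≤ (E : ℚ) ^ (2 * k) * ((E : ℚ) ^ 2 * I.p ⟨a + k + 1, hk⟩) := by gcongr
        _ = (E : ℚ) ^ (2 * (k + 1)) * I.p ⟨a + (k + 1), hk⟩ := by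
          rw [← mul_assoc, ← pow_add]; rfl
  rw [e, e']
  have := key (b - a) (by omega) (by omega)
  have hb' : (⟨a + (b - a), by omega⟩ : Fin n) = ⟨b, hb⟩ := Fin.ext (by simp only; omega)
  rw [hb'] at this
  refine this.trans ?_
  exact mul_le_mul_of_nonneg_right (pow_le_pow_right₀ hE1 (by omega)) (I.p_pos _).le

theorem pG_anti {h h' : ℕ} (hh : I.IsGrp h) (hh' : I.IsGrp h') (hle : h ≤ h') :
    I.pG h' ≤ I.pG h := by
  obtain ⟨j, hj, e, hm⟩ := hh.exists_last
  obtain ⟨j', hj', e', hm'⟩ := hh'.exists_last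
  rw [e, e']
  refine I.p_anti.antitone ?_
  by_contra h1
  rw [not_le] at h1
  have := I.grp_mono h1.le
  have : h = h' := by omega
  subst this
  exact absurd (hm' j hj) (not_le.2 h1)

/-! ### Shifted sizes -/

/-- The summand `k = h` is split off; the rest of the sum is the one in `pstar (h + 1)`. -/
theorem pstar_eq {h : ℕ} (hh' : h < I.γ) :
    I.pstar h = I.pG h + (1 + I.eps) * I.eps *
      ((∑ i ∈ Finset.Ioc h I.γ, (I.gsize i : ℚ)) + 3) * I.pG h +
      (I.pstar (h + 1) - I.pG (h + 1)) := by
  unfold pstar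
  rw [Finset.sum_eq_sum_Ico_succ_bot hh']
  ring

theorem pstar_γ : I.pstar I.γ = I.pG I.γ := by
  unfold pstar; simp

theorem pG_le_pstar (hE : 3 ≤ E) {h : ℕ} (hh : I.IsGrp h) : I.pG h ≤ I.pstar h := by
  unfold pstar
  have h0 := I.eps_pos hE
  have : 0 ≤ ∑ k ∈ Finset.Ico h I.γ, ((∑ i ∈ Finset.Ioc k I.γ, (I.gsize i : ℚ)) + 3) * I.pG k := by
    refine Finset.sum_nonneg fun k hk => ?_
    rw [Finset.mem_Ico] at hk
    have := (show I.IsGrp k from ⟨hh.1.trans hk.1, hk.2.le⟩).pG_pos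
    positivity
  have h1 : 0 ≤ (1 + I.eps) * I.eps := by positivity
  nlinarith [mul_nonneg h1 this]

theorem pstar_pos (hE : 3 ≤ E) {h : ℕ} (hh : I.IsGrp h) : 0 < I.pstar h :=
  hh.pG_pos.trans_le (pG_le_pstar hE hh)

theorem pG_succ_le (hE : 3 ≤ E) {h : ℕ} (hh : I.IsGrp h) (hh' : I.IsGrp (h + 1)) :
    9 * I.pG (h + 1) ≤ I.pG h := by
  have h1 := hh'.pG_le_pmax.trans (pmax_succ_le hh hh')
  have h2 := I.eps_le hE
  have h3 := I.eps_pos hE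
  have h4 := hh.pG_pos
  have h5 : I.eps ^ 2 ≤ 1 / 9 := by nlinarith
  nlinarith

/-- Sizes of consecutive groups differ by a factor of at least `9`, which leaves ample room. The
point of the statement is that the grid of group `h + 1` has at least one element below its cut-off.
-/
theorem pstar_succ_lt (hE : 3 ≤ E) {h : ℕ} (hh : I.IsGrp h) (hh' : I.IsGrp (h + 1)) :
    I.pstar (h + 1) < I.pstar h - I.eps * I.pG (h + 1) := by
  have h1 := pstar_eq (I := I) (h := h) (by have := hh'.2; omega)
  have h2 := pG_succ_le hE hh hh'
  have h3 := I.eps_pos hE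
  have h4 := I.eps_le hE
  have h5 := hh'.pG_pos
  have h6 := hh.pG_pos
  have h7 : 0 ≤ (1 + I.eps) * I.eps *
      ((∑ i ∈ Finset.Ioc h I.γ, (I.gsize i : ℚ)) + 3) * I.pG h := by positivity
  have h8 : I.eps * I.pG (h + 1) ≤ 1 / 3 * I.pG (h + 1) := by gcongr
  linarith

theorem pstar_lt (hE : 3 ≤ E) {h h' : ℕ} (hh : I.IsGrp h) (hh' : I.IsGrp h') (hlt : h < h') :
    I.pstar h' < I.pstar h := by
  induction h', hlt using Nat.le_induction with
  | base =>
    have h1 := pstar_succ_lt hE hh hh'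
    have h2 := mul_pos (I.eps_pos hE) hh'.pG_pos
    simp only [Nat.succ_eq_add_one] at h1 h2 ⊢
    linarith
  | succ k hk ih =>
    have hk' : I.IsGrp k := ⟨hh.1.trans (by omega), by have := hh'.2; omega⟩
    have h1 := pstar_succ_lt hE hk' hh'
    have h2 := mul_pos (I.eps_pos hE) hh'.pG_pos
    have := ih hk'
    linarith

theorem pstar_le (hE : 3 ≤ E) {h h' : ℕ} (hh : I.IsGrp h) (hh' : I.IsGrp h') (hle : h ≤ h') :
    I.pstar h' ≤ I.pstar h := by
  rcases eq_or_lt_of_le hle with rfl | h1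
  · exact le_rfl
  · exact (pstar_lt hE hh hh' h1).le

end Instance

end BernoulliSched

/-! ### Common denominators, and the order of the left endpoints -/

namespace BernoulliSched

/-- `x` is a nonnegative multiple of `1 / D`. -/
def IsFrac (D : ℕ) (x : ℚ) : Prop := ∃ k : ℕ, x = (k : ℚ) / D

namespace IsFrac

variable {D : ℕ} {x y : ℚ}

theorem zero : IsFrac D 0 := ⟨0, by simp⟩

theorem add (hx : IsFrac D x) (hy : IsFrac D y) : IsFrac D (x + y) := by
  obtain ⟨a, rfl⟩ := hx
  obtain ⟨b, rfl⟩ := hy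
  exact ⟨a + b, by push_cast; ring⟩

theorem sum {ι : Type*} {s : Finset ι} {f : ι → ℚ} (h : ∀ i ∈ s, IsFrac D (f i)) :
    IsFrac D (∑ i ∈ s, f i) := by
  classical
  induction s using Finset.induction_on with
  | empty => simpa using zero
  | insert a s ha ih =>
    rw [Finset.sum_insert ha]
    exact (h a (by simp)).add (ih fun i hi => h i (by simp [hi]))

theorem div_mul (hx : IsFrac D x) (c k : ℕ) :
    IsFrac (c * D) ((k : ℚ) / c * x) := by
  obtain ⟨a, rfl⟩ := hx
  exact ⟨k * a, by push_cast; ring⟩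

theorem of_mul (hx : IsFrac D x) {c : ℕ} (hc : c ≠ 0) : IsFrac (c * D) x := by
  have := hx.div_mul c c
  have hc' : (c : ℚ) ≠ 0 := by exact_mod_cast hc
  rwa [div_self hc', one_mul] at this

theorem nat_mul (hx : IsFrac D x) (k : ℕ) : IsFrac D (k * x) := by
  obtain ⟨a, rfl⟩ := hx
  exact ⟨k * a, by push_cast; ring⟩

theorem of_den_dvd (hx : 0 ≤ x) (h : x.den ∣ D) (hD : D ≠ 0) :
    IsFrac D x := by
  obtain ⟨c, rfl⟩ := h
  obtain ⟨k, hk⟩ := Int.eq_ofNat_of_zero_le (Rat.num_nonneg.2 hx)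
  have h1 : (x.den : ℚ) ≠ 0 := by exact_mod_cast x.den_nz
  have h2 : (c : ℚ) ≠ 0 := by
    intro h
    exact hD (by rw [show c = 0 by exact_mod_cast h, mul_zero])
  refine ⟨k * c, ?_⟩
  conv_lhs => rw [← Rat.num_div_den x, hk]
  push_cast
  rw [mul_div_mul_right _ _ h2]

end IsFrac

namespace Instance

variable {n E : ℕ} (I : Instance n E)

/-- The step width in group `h`. -/
noncomputable def dl (h : ℕ) : ℚ := I.eps * I.pG h

/-- The stretching factor. -/
def κ : ℚ := 1 + 5 * I.eps

/-- Groups whose thresholds are left endpoints. -/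
def IsReg (g : ℕ) : Prop := 1 ≤ g ∧ g ≤ max (I.γ - 1) 1

/-- The number of steps within the part of the time axis that belongs to group `g`. -/
noncomputable def lastIdx (g : ℕ) : ℕ := ⌈(I.pstar (g - 1) - I.dl g - I.pstar g) / I.dl g⌉₊ - 1

/-- The midpoint at the end of the part of the time axis that belongs to group `g`. -/
noncomputable def mid (g : ℕ) : ℚ :=
  (I.pstar g + I.lastIdx g * I.dl g + I.pstar (g - 1)) / 2

/-- A common denominator of the sizes. -/
def pden : ℕ := ∏ j, (I.p j).den

variable {I}

theorem κ_pos (hE : 3 ≤ E) : 0 < I.κ := by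
  have := I.eps_pos hE
  unfold κ; positivity

theorem one_lt_κ (hE : 3 ≤ E) : 1 < I.κ := by
  have := I.eps_pos hE
  unfold κ; linarith

theorem IsReg.isGrp (hn : 0 < n) {g : ℕ} (hg : I.IsReg g) : I.IsGrp g := by
  have := I.γ_pos hn
  have := hg.2
  exact ⟨hg.1, by omega⟩

theorem IsGrp.isReg_of_lt {g : ℕ} (hg : I.IsGrp g) (h : g < I.γ) : I.IsReg g :=
  ⟨hg.1, by omega⟩

theorem IsReg.lt_γ {g : ℕ} (hg : I.IsReg g) (h : 2 ≤ g) : g < I.γ := by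
  have := hg.2
  omega

theorem IsReg.pred {g : ℕ} (hg : I.IsReg g) (h : 2 ≤ g) : I.IsReg (g - 1) :=
  ⟨by omega, by have := hg.2; omega⟩

theorem IsGrp.pred {g : ℕ} (hg : I.IsGrp g) (h : 2 ≤ g) : I.IsReg (g - 1) :=
  ⟨by omega, by have := hg.2; omega⟩

theorem isReg_one : I.IsReg 1 := ⟨le_rfl, by omega⟩

theorem IsReg.mono {g g' : ℕ} (hg : I.IsReg g) (h1 : 1 ≤ g') (h : g' ≤ g) : I.IsReg g' :=
  ⟨h1, h.trans hg.2⟩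

theorem isReg_top : I.IsReg (max (I.γ - 1) 1) := ⟨by omega, le_rfl⟩

theorem dl_pos (hE : 3 ≤ E) {h : ℕ} (hh : I.IsGrp h) : 0 < I.dl h :=
  mul_pos (I.eps_pos hE) hh.pG_pos

theorem dl_anti (hE : 3 ≤ E) {h h' : ℕ} (hh : I.IsGrp h) (hh' : I.IsGrp h') (hle : h ≤ h') :
    I.dl h' ≤ I.dl h :=
  mul_le_mul_of_nonneg_left (pG_anti hh hh' hle) (I.eps_pos hE).le

theorem pstar_lt_sub (hE : 3 ≤ E) (hn : 0 < n) {g : ℕ} (hg : I.IsReg g) (h2 : 2 ≤ g) :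
    I.pstar g < I.pstar (g - 1) - I.dl g := by
  have h := pstar_succ_lt hE ((hg.pred h2).isGrp hn)
    (show I.IsGrp (g - 1 + 1) by rw [Nat.sub_add_cancel (by omega)]; exact hg.isGrp hn)
  rwa [Nat.sub_add_cancel (by omega)] at h

/-- The cut-off is a strict inequality, and the largest integer strictly below a positive real is
its ceiling minus one. -/
theorem lastIdx_spec (hE : 3 ≤ E) (hn : 0 < n) {g : ℕ} (hg : I.IsReg g) (h2 : 2 ≤ g) (i : ℕ) :
    I.pstar g + i * I.dl g < I.pstar (g - 1) - I.dl g ↔ i ≤ I.lastIdx g := by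
  have h1 := pstar_lt_sub hE hn hg h2
  have h3 := dl_pos hE (hg.isGrp hn)
  have h4 : 0 < (I.pstar (g - 1) - I.dl g - I.pstar g) / I.dl g := div_pos (by linarith) h3
  have h5 : 0 < ⌈(I.pstar (g - 1) - I.dl g - I.pstar g) / I.dl g⌉₊ := Nat.ceil_pos.2 h4
  have h6 : i ≤ I.lastIdx g ↔ i < ⌈(I.pstar (g - 1) - I.dl g - I.pstar g) / I.dl g⌉₊ := by
    unfold lastIdx; omega
  rw [h6, Nat.lt_ceil, lt_div_iff₀ h3]
  constructor <;> intro h <;> linarith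

theorem lastIdx_lt (hE : 3 ≤ E) (hn : 0 < n) {g : ℕ} (hg : I.IsReg g) (h2 : 2 ≤ g) :
    I.pstar g + I.lastIdx g * I.dl g < I.pstar (g - 1) - I.dl g :=
  (lastIdx_spec hE hn hg h2 _).2 le_rfl

theorem le_lastIdx (hE : 3 ≤ E) (hn : 0 < n) {g : ℕ} (hg : I.IsReg g) (h2 : 2 ≤ g) :
    I.pstar (g - 1) ≤ I.pstar g + I.lastIdx g * I.dl g + 2 * I.dl g := by
  by_contra h
  have := (lastIdx_spec hE hn hg h2 (I.lastIdx g + 1)).1 (by push_cast; linarith)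
  omega

theorem greatestOf_innerEnds (hE : 3 ≤ E) (hn : 0 < n) {g : ℕ} (hg : I.IsReg g) (h2 : 2 ≤ g) :
    greatestOf (I.innerEnds g) = I.pstar g + I.lastIdx g * I.dl g := by
  refine greatestOf_eq ⟨⟨⟨_, rfl⟩, lastIdx_lt hE hn hg h2⟩, ?_⟩
  rintro x ⟨⟨i, rfl⟩, hi⟩
  have h3 := dl_pos hE (hg.isGrp hn)
  have h4 : (i : ℚ) ≤ I.lastIdx g := by exact_mod_cast (lastIdx_spec hE hn hg h2 i).1 hi
  have : (i : ℚ) * I.dl g ≤ I.lastIdx g * I.dl g := by gcongr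
  unfold dl at this ⊢
  linarith

/-- The stretch between the last grid point and the next threshold is longer than one step
(`lastIdx_lt`) and at most two steps long (`le_lastIdx`). Halving it keeps every interval between
half a step and one step. -/
theorem mid_bounds (hE : 3 ≤ E) (hn : 0 < n) {g : ℕ} (hg : I.IsReg g) (h2 : 2 ≤ g) :
    I.pstar g + I.lastIdx g * I.dl g + I.dl g / 2 < I.mid g ∧
    I.mid g ≤ I.pstar g + I.lastIdx g * I.dl g + I.dl g ∧
    I.mid g + I.dl g / 2 < I.pstar (g - 1) ∧ I.pstar (g - 1) ≤ I.mid g + I.dl g := by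
  have h3 := lastIdx_lt hE hn hg h2
  have h4 := le_lastIdx hE hn hg h2
  unfold mid
  refine ⟨?_, ?_, ?_, ?_⟩ <;> linarith

/-- The left endpoints in the part of the time axis that belongs to group `g`. -/
def InReg (I : Instance n E) (g : ℕ) (x : ℚ) : Prop :=
  (∃ i : ℕ, x = I.pstar g + i * I.dl g ∧ (2 ≤ g → i ≤ I.lastIdx g)) ∨ 2 ≤ g ∧ x = I.mid g

/-- Treats the finite grids of the groups from `2` on and the infinite grid of group `1` uniformly,
through `IsReg`. -/
theorem mem_leftEnds_iff (hE : 3 ≤ E) (hn : 0 < n) {x : ℚ} :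
    x ∈ I.leftEnds ↔ x = 0 ∨ ∃ g, I.IsReg g ∧ I.InReg g x := by
  constructor
  · rintro ((h | ⟨h, h2, hγ, h3⟩) | ⟨i, hi⟩)
    · exact Or.inl h
    · have hg : I.IsReg h := ⟨by omega, by omega⟩
      refine Or.inr ⟨h, hg, ?_⟩
      rcases h3 with ⟨⟨i, rfl⟩, hi⟩ | h3
      · exact Or.inl ⟨i, rfl, fun _ => (lastIdx_spec hE hn hg h2 i).1 hi⟩
      · refine Or.inr ⟨h2, ?_⟩
        rw [h3, greatestOf_innerEnds hE hn hg h2, mid]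
        ring
    · exact Or.inr ⟨1, isReg_one, Or.inl ⟨i, hi, fun h => by omega⟩⟩
  · rintro (h | ⟨g, hg, ⟨i, rfl, hi⟩ | ⟨h2, rfl⟩⟩)
    · exact Or.inl (Or.inl h)
    · by_cases h2 : 2 ≤ g
      · exact Or.inl (Or.inr ⟨g, h2, hg.lt_γ h2, Or.inl ⟨⟨i, rfl⟩,
          (lastIdx_spec hE hn hg h2 i).2 (hi h2)⟩⟩)
      · have : g = 1 := by have := hg.1; omega
        subst this
        exact Or.inr ⟨i, rfl⟩
    · refine Or.inl (Or.inr ⟨g, h2, hg.lt_γ h2, Or.inr ?_⟩)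
      rw [greatestOf_innerEnds hE hn hg h2, mid]
      ring

theorem InReg.bounds (hE : 3 ≤ E) (hn : 0 < n) {g : ℕ} (hg : I.IsReg g) {x : ℚ}
    (h : I.InReg g x) : I.pstar g ≤ x ∧ (2 ≤ g → x < I.pstar (g - 1)) := by
  have h3 := dl_pos hE (hg.isGrp hn)
  rcases h with ⟨i, rfl, hi⟩ | ⟨h2, rfl⟩
  · refine ⟨by have : 0 ≤ i * I.dl g := by positivity
               linarith, fun h2 => ?_⟩
    have := (lastIdx_spec hE hn hg h2 i).2 (hi h2)
    linarith
  · obtain ⟨h4, h5, h6, h7⟩ := mid_bounds hE hn hg h2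
    have : 0 ≤ I.lastIdx g * I.dl g := by positivity
    exact ⟨by linarith, fun _ => by linarith⟩

theorem zero_mem_leftEnds : (0 : ℚ) ∈ I.leftEnds := Or.inl (Or.inl rfl)

theorem pstar_mem_leftEnds (hE : 3 ≤ E) (hn : 0 < n) {g : ℕ} (hg : I.IsReg g) :
    I.pstar g ∈ I.leftEnds :=
  (mem_leftEnds_iff hE hn).2 (Or.inr ⟨g, hg, Or.inl ⟨0, by simp, by simp⟩⟩)

theorem isFrac_p (j : Fin n) : IsFrac I.pden (I.p j) :=
  IsFrac.of_den_dvd (I.p_pos j).le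
    (Finset.dvd_prod_of_mem (fun j => (I.p j).den) (Finset.mem_univ j))
    (Finset.prod_ne_zero_iff.2 fun j _ => (I.p j).den_nz)

theorem pden_pos : 0 < I.pden := Finset.prod_pos fun j _ => (I.p j).den_pos

/-- A common denominator of all the time points. -/
def tden (I : Instance n E) : ℕ := E * (2 * (E ^ 2 * I.pden))

theorem tden_pos (hE : 3 ≤ E) : 0 < I.tden := by
  have := I.pden_pos
  have : 0 < E := by omega
  unfold tden; positivity

theorem isFrac_pG {h : ℕ} (hh : I.IsGrp h) : IsFrac I.pden (I.pG h) := by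
  obtain ⟨j, -, e, -⟩ := hh.exists_last
  rw [e]; exact isFrac_p j

theorem isFrac_pstar (hE : 3 ≤ E) {h : ℕ} (hh : I.IsGrp h) :
    IsFrac (E ^ 2 * I.pden) (I.pstar h) := by
  have hE0 : E ^ 2 ≠ 0 := by positivity
  unfold pstar
  refine ((isFrac_pG hh).of_mul hE0).add ?_
  have h1 : (1 + I.eps) * I.eps = ((E + 1 : ℕ) : ℚ) / (E ^ 2 : ℕ) := by
    have : (E : ℚ) ≠ 0 := by exact_mod_cast (by omega : E ≠ 0)
    unfold eps; push_cast; field_simp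
  rw [h1]
  refine IsFrac.div_mul (IsFrac.sum fun k hk => ?_) _ _
  rw [Finset.mem_Ico] at hk
  have := (isFrac_pG (show I.IsGrp k from ⟨hh.1.trans hk.1, hk.2.le⟩)).nat_mul
    ((∑ i ∈ Finset.Ioc k I.γ, I.gsize i) + 3)
  push_cast at this
  exact this

theorem isFrac_dl (hE : 3 ≤ E) {h : ℕ} (hh : I.IsGrp h) : IsFrac (E ^ 2 * I.pden) (I.dl h) := by
  have := (isFrac_pG hh).div_mul (E ^ 2) E
  have h1 : I.eps = (E : ℚ) / (E ^ 2 : ℕ) := by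
    have : (E : ℚ) ≠ 0 := by exact_mod_cast (by omega : E ≠ 0)
    unfold eps; push_cast; field_simp
  rwa [← h1] at this

theorem isFrac_of_mem_leftEnds (hE : 3 ≤ E) (hn : 0 < n) {x : ℚ} (hx : x ∈ I.leftEnds) :
    IsFrac (2 * (E ^ 2 * I.pden)) x := by
  rcases (mem_leftEnds_iff hE hn).1 hx with rfl | ⟨g, hg, ⟨i, rfl, hi⟩ | ⟨h2, rfl⟩⟩
  · exact IsFrac.zero
  · exact ((isFrac_pstar hE (hg.isGrp hn)).add ((isFrac_dl hE (hg.isGrp hn)).nat_mul i)).of_mul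
      two_ne_zero
  · have := (((isFrac_pstar hE (hg.isGrp hn)).add ((isFrac_dl hE (hg.isGrp hn)).nat_mul
      (I.lastIdx g))).add (isFrac_pstar hE ((hg.pred h2).isGrp hn))).div_mul 2 1
    convert this using 1
    unfold mid; push_cast; ring

theorem fractions_leftEnds (hE : 3 ≤ E) (hn : 0 < n) :
    Fractions (2 * (E ^ 2 * I.pden)) I.leftEnds := fun _ hx => isFrac_of_mem_leftEnds hE hn hx

/-- The unbounded grid of group `1` provides the point. The upper bound is later needed to bound all
times, hence their bit lengths. -/
theorem exists_leftEnd_gt (hE : 3 ≤ E) (hn : 0 < n) (u : ℚ) :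
    ∃ x ∈ I.leftEnds, u < x ∧ x ≤ max u (I.pstar 1) + I.dl 1 := by
  have h1 := dl_pos hE (isReg_one.isGrp hn : I.IsGrp 1)
  set w := max u (I.pstar 1) with hw
  have hw' : 0 ≤ (w - I.pstar 1) / I.dl 1 :=
    div_nonneg (by have := le_max_right u (I.pstar 1); linarith) h1.le
  refine ⟨I.pstar 1 + (⌊(w - I.pstar 1) / I.dl 1⌋₊ + 1 : ℕ) * I.dl 1,
    (mem_leftEnds_iff hE hn).2 (Or.inr ⟨1, isReg_one, Or.inl ⟨_, rfl, fun h => by omega⟩⟩), ?_, ?_⟩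
  · have h2 := Nat.lt_floor_add_one ((w - I.pstar 1) / I.dl 1)
    rw [div_lt_iff₀ h1] at h2
    have := le_max_left u (I.pstar 1)
    push_cast
    linarith
  · have h2 := Nat.floor_le hw'
    rw [le_div_iff₀ h1] at h2
    push_cast
    linarith

theorem l_succ_isLeast (hE : 3 ≤ E) (hn : 0 < n) (k : ℕ) :
    IsLeast {x ∈ I.leftEnds | I.l k < x} (I.l (k + 1)) := by
  refine isLeast_leastOf (((fractions_leftEnds hE hn).mono (Set.sep_subset _ _)).exists_isLeast ?_)
  obtain ⟨x, hx, h1, -⟩ := exists_leftEnd_gt hE hn (I.l k)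
  exact ⟨x, hx, h1⟩

theorem l_mem (hE : 3 ≤ E) (hn : 0 < n) (k : ℕ) : I.l k ∈ I.leftEnds := by
  cases k with
  | zero => exact zero_mem_leftEnds
  | succ k => exact (l_succ_isLeast hE hn k).1.1

theorem l_strictMono (hE : 3 ≤ E) (hn : 0 < n) : StrictMono I.l :=
  strictMono_nat_of_lt_succ fun k => (l_succ_isLeast hE hn k).1.2

theorem exists_l_gt (hE : 3 ≤ E) (hn : 0 < n) (u : ℚ) : ∃ k, u < I.l k := by
  by_contra! h
  have h1 := (fractions_leftEnds (I := I) hE hn).finite_le (by have := I.pden_pos; positivity) u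
  refine Set.infinite_range_of_injective (l_strictMono (I := I) hE hn).injective (h1.subset ?_)
  rintro _ ⟨k, rfl⟩
  exact ⟨l_mem hE hn k, h k⟩

theorem exists_l_le_lt (hE : 3 ≤ E) (hn : 0 < n) {u : ℚ} (hu : 0 ≤ u) :
    ∃ k, I.l k ≤ u ∧ u < I.l (k + 1) := by
  classical
  have h := exists_l_gt (I := I) hE hn u
  have h0 : Nat.find h ≠ 0 := by
    intro h1
    have := Nat.find_spec h
    rw [h1] at this
    exact absurd this (not_lt.2 hu)
  obtain ⟨k, hk⟩ := Nat.exists_eq_succ_of_ne_zero h0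
  refine ⟨k, not_lt.1 (Nat.find_min h (by omega)), ?_⟩
  have := Nat.find_spec h
  rwa [hk] at this

theorem exists_l_eq (hE : 3 ≤ E) (hn : 0 < n) {x : ℚ} (hx : x ∈ I.leftEnds) : ∃ k, I.l k = x := by
  obtain ⟨k, h1, h2⟩ := exists_l_le_lt (I := I) hE hn ((fractions_leftEnds hE hn).nonneg hx)
  refine ⟨k, le_antisymm h1 ?_⟩
  by_contra h3
  exact absurd ((l_succ_isLeast hE hn k).2 ⟨hx, not_le.1 h3⟩) (not_le.2 h2)

/-- `b` and `e` are consecutive left endpoints. -/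
def Consec (I : Instance n E) (b e : ℚ) : Prop :=
  b ∈ I.leftEnds ∧ e ∈ I.leftEnds ∧ b < e ∧ ∀ x ∈ I.leftEnds, x ≤ b ∨ e ≤ x

/-- Links explicit pairs of neighbouring endpoints with the enumeration `l`. Neither the interval
lengths nor the algorithm ever determine an index. -/
theorem Consec.exists_index (hE : 3 ≤ E) (hn : 0 < n) {b e : ℚ} (h : I.Consec b e) :
    ∃ k, I.l k = b ∧ I.l (k + 1) = e := by
  obtain ⟨k, hk⟩ := exists_l_eq hE hn h.1
  refine ⟨k, hk, (l_succ_isLeast hE hn k).unique ⟨⟨h.2.1, by rw [hk]; exact h.2.2.1⟩, ?_⟩⟩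
  rintro x ⟨hx, hlt⟩
  rcases h.2.2.2 x hx with h1 | h1
  · rw [hk] at hlt; exact absurd h1 (not_le.2 hlt)
  · exact h1

/-- Left endpoints of different parts of the time axis are ordered like these parts. -/
theorem le_or_le_of_inReg (hE : 3 ≤ E) (hn : 0 < n) {g : ℕ} (hg : I.IsReg g) {x : ℚ}
    (hx : x ∈ I.leftEnds) : x < I.pstar g ∨ I.InReg g x ∨ 2 ≤ g ∧ I.pstar (g - 1) ≤ x := by
  rcases (mem_leftEnds_iff hE hn).1 hx with rfl | ⟨g', hg', h⟩
  · exact Or.inl (pstar_pos hE (hg.isGrp hn))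
  · obtain ⟨h1, h2⟩ := h.bounds hE hn hg'
    rcases lt_trichotomy g g' with h3 | rfl | h3
    · refine Or.inl ((h2 (by have := hg.1; omega)).trans_le ?_)
      exact pstar_le hE (hg.isGrp hn) ((hg'.pred (by have := hg.1; omega)).isGrp hn) (by omega)
    · exact Or.inr (Or.inl h)
    · refine Or.inr (Or.inr ⟨by have := hg'.1; omega, h1.trans' ?_⟩)
      exact pstar_le hE (hg'.isGrp hn) ((hg.pred (by have := hg'.1; omega)).isGrp hn) (by omega)

/-- The last group contributes no grid of its own unless it is the only one; the first interval
extends to the smallest regular threshold. -/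
theorem consec_zero (hE : 3 ≤ E) (hn : 0 < n) : I.Consec 0 (I.pstar (max (I.γ - 1) 1)) := by
  refine ⟨zero_mem_leftEnds, pstar_mem_leftEnds hE hn isReg_top,
    pstar_pos hE (isReg_top.isGrp hn), fun x hx => ?_⟩
  rcases (mem_leftEnds_iff hE hn).1 hx with rfl | ⟨g, hg, h⟩
  · exact Or.inl le_rfl
  · exact Or.inr ((pstar_le hE (hg.isGrp hn) (isReg_top.isGrp hn) hg.2).trans (h.bounds hE hn hg).1)

theorem consec_step (hE : 3 ≤ E) (hn : 0 < n) {g : ℕ} (hg : I.IsReg g) {i : ℕ}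
    (hi : 2 ≤ g → i + 1 ≤ I.lastIdx g) :
    I.Consec (I.pstar g + i * I.dl g) (I.pstar g + (i + 1 : ℕ) * I.dl g) := by
  have h3 := dl_pos hE (hg.isGrp hn)
  refine ⟨(mem_leftEnds_iff hE hn).2 (Or.inr ⟨g, hg, Or.inl ⟨i, rfl, fun h => by
    have := hi h; omega⟩⟩), (mem_leftEnds_iff hE hn).2 (Or.inr ⟨g, hg, Or.inl ⟨_, rfl, hi⟩⟩),
    by push_cast; linarith, fun x hx => ?_⟩
  have h0 : 0 ≤ i * I.dl g := by positivity
  rcases le_or_le_of_inReg hE hn hg hx with h | (⟨i', rfl, h⟩ | ⟨h2, rfl⟩) | ⟨h2, h⟩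
  · left; linarith
  · rcases Nat.lt_or_ge i i' with h4 | h4
    · right
      have : ((i + 1 : ℕ) : ℚ) ≤ i' := by exact_mod_cast h4
      gcongr
    · left
      gcongr
  · right
    have h4 := (mid_bounds hE hn hg h2).1
    have : ((i + 1 : ℕ) : ℚ) * I.dl g ≤ I.lastIdx g * I.dl g := by
      gcongr; exact hi h2
    linarith
  · right
    have h4 := lastIdx_lt hE hn hg h2
    have : ((i + 1 : ℕ) : ℚ) * I.dl g ≤ I.lastIdx g * I.dl g := by
      gcongr; exact hi h2
    linarith

theorem consec_last (hE : 3 ≤ E) (hn : 0 < n) {g : ℕ} (hg : I.IsReg g) (h2 : 2 ≤ g) :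
    I.Consec (I.pstar g + I.lastIdx g * I.dl g) (I.mid g) := by
  have h3 := dl_pos hE (hg.isGrp hn)
  obtain ⟨m1, m2, m3, m4⟩ := mid_bounds hE hn hg h2
  refine ⟨(mem_leftEnds_iff hE hn).2 (Or.inr ⟨g, hg, Or.inl ⟨_, rfl, fun _ => le_rfl⟩⟩),
    (mem_leftEnds_iff hE hn).2 (Or.inr ⟨g, hg, Or.inr ⟨h2, rfl⟩⟩), by linarith, fun x hx => ?_⟩
  have h0 : 0 ≤ I.lastIdx g * I.dl g := by positivity
  rcases le_or_le_of_inReg hE hn hg hx with h | (⟨i', rfl, h⟩ | ⟨-, rfl⟩) | ⟨-, h⟩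
  · left; linarith
  · left
    have := h h2
    gcongr
  · right; exact le_rfl
  · right; linarith

theorem consec_mid (hE : 3 ≤ E) (hn : 0 < n) {g : ℕ} (hg : I.IsReg g) (h2 : 2 ≤ g) :
    I.Consec (I.mid g) (I.pstar (g - 1)) := by
  have h3 := dl_pos hE (hg.isGrp hn)
  obtain ⟨m1, m2, m3, m4⟩ := mid_bounds hE hn hg h2
  refine ⟨(mem_leftEnds_iff hE hn).2 (Or.inr ⟨g, hg, Or.inr ⟨h2, rfl⟩⟩),
    pstar_mem_leftEnds hE hn (hg.pred h2), by linarith, fun x hx => ?_⟩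
  have h0 : 0 ≤ I.lastIdx g * I.dl g := by positivity
  rcases le_or_le_of_inReg hE hn hg hx with h | (⟨i', rfl, h⟩ | ⟨-, rfl⟩) | ⟨-, h⟩
  · left; linarith
  · left
    have : (i' : ℚ) * I.dl g ≤ I.lastIdx g * I.dl g := by gcongr; exact h h2
    linarith
  · left; exact le_rfl
  · right; exact h

end Instance

end BernoulliSched

namespace BernoulliSched

namespace Instance

variable {n E : ℕ} {I : Instance n E}

/-! ### Stretched intervals -/

theorem lStr_eq (k : ℕ) : I.lStr k = I.κ * I.l k := rfl

theorem lStr_strictMono (hE : 3 ≤ E) (hn : 0 < n) : StrictMono I.lStr := fun a b h => by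
  rw [lStr_eq, lStr_eq]
  exact mul_lt_mul_of_pos_left (l_strictMono hE hn h) (κ_pos hE)

theorem lStr_zero : I.lStr 0 = 0 := by rw [lStr_eq]; exact mul_zero _

theorem lStr_nonneg (hE : 3 ≤ E) (hn : 0 < n) (k : ℕ) : 0 ≤ I.lStr k := by
  rw [← lStr_zero (I := I)]; exact (lStr_strictMono hE hn).monotone (Nat.zero_le k)

theorem stretch_eq (hE : 3 ≤ E) (hn : 0 < n) {t : ℚ} {k : ℕ} (h1 : I.l k ≤ t)
    (h2 : t < I.l (k + 1)) : I.stretch t = I.lStr k + (t - I.l k) := by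
  have : {k | I.l k ≤ t} = Set.Iic k := by
    ext i
    constructor
    · intro hi
      by_contra h3
      have := (l_strictMono (I := I) hE hn).monotone (show k + 1 ≤ i by simp at h3; omega)
      simp only [Set.mem_ofPred_eq] at hi
      linarith
    · intro hi
      exact ((l_strictMono (I := I) hE hn).monotone hi).trans h1
  rw [stretch, this, csSup_Iic]

theorem exists_lStr_eq_pcirc (hE : 3 ≤ E) (hn : 0 < n) {g : ℕ} (hg : I.IsReg g) :
    ∃ k, I.lStr k = I.pcirc g ∧ I.l k = I.pstar g := by
  obtain ⟨k, hk⟩ := exists_l_eq hE hn (pstar_mem_leftEnds hE hn hg)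
  refine ⟨k, ?_, hk⟩
  rw [pcirc, stretch_eq hE hn hk.le (by rw [← hk]; exact l_strictMono hE hn (Nat.lt_succ_self k)), hk]
  simp

theorem pcirc_eq (hE : 3 ≤ E) (hn : 0 < n) {g : ℕ} (hg : I.IsReg g) :
    I.pcirc g = I.κ * I.pstar g := by
  obtain ⟨k, h1, h2⟩ := exists_lStr_eq_pcirc hE hn hg
  rw [← h1, ← h2, lStr_eq]

theorem l_one (hE : 3 ≤ E) (hn : 0 < n) : I.l 1 = I.pstar (max (I.γ - 1) 1) := by
  obtain ⟨k, h1, h2⟩ := (consec_zero (I := I) hE hn).exists_index hE hn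
  have : k = 0 := (l_strictMono hE hn).injective h1
  rwa [this] at h2

theorem lStr_one (hE : 3 ≤ E) (hn : 0 < n) : I.lStr 1 = I.pcirc (max (I.γ - 1) 1) := by
  rw [lStr_eq, l_one hE hn, pcirc_eq hE hn isReg_top]

/-- If there are several groups, the threshold of the last one is not a left endpoint. It lies
inside the first interval, where stretching moves nothing. -/
theorem pcirc_γ (hE : 3 ≤ E) (h2 : 2 ≤ I.γ) :
    I.pcirc I.γ = I.pG I.γ ∧ I.pG I.γ < I.pcirc (I.γ - 1) := by
  have hn : 0 < n := by have := I.γ_le; omega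
  have hg : I.IsGrp I.γ := ⟨by omega, le_rfl⟩
  have hr : I.IsReg (I.γ - 1) := hg.pred h2
  have h3 : I.pstar I.γ < I.pstar (I.γ - 1) := pstar_lt hE (hr.isGrp hn) hg (by omega)
  have h4 : max (I.γ - 1) 1 = I.γ - 1 := by omega
  constructor
  · rw [pcirc, stretch_eq (k := 0) hE hn (pstar_pos hE hg).le (by
      rw [zero_add, l_one hE hn, h4]; exact h3), lStr_zero, pstar_γ]
    simp [l]
  · rw [pcirc_eq hE hn hr, ← pstar_γ]
    have := one_lt_κ (I := I) hE
    have := pstar_pos hE (hr.isGrp hn)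
    nlinarith

theorem IsGrp.isReg_or {h : ℕ} (hh : I.IsGrp h) : I.IsReg h ∨ h = I.γ ∧ 2 ≤ I.γ := by
  have h1 := hh.1
  have h2 := hh.2
  by_cases h3 : 2 ≤ I.γ
  · by_cases h4 : h = I.γ
    · exact Or.inr ⟨h4, h3⟩
    · exact Or.inl ⟨h1, by omega⟩
  · exact Or.inl ⟨h1, by omega⟩

theorem pcirc_pos (hE : 3 ≤ E) {h : ℕ} (hh : I.IsGrp h) : 0 < I.pcirc h := by
  rcases hh.isReg_or with h1 | ⟨rfl, h2⟩
  · rw [pcirc_eq hE hh.pos h1]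
    exact mul_pos (κ_pos hE) (pstar_pos hE hh)
  · rw [(pcirc_γ hE h2).1]; exact hh.pG_pos

theorem pcirc_le (hE : 3 ≤ E) {h h' : ℕ} (hh : I.IsGrp h) (hh' : I.IsGrp h') (hle : h ≤ h') :
    I.pcirc h' ≤ I.pcirc h := by
  have hn := hh.pos
  rcases hh'.isReg_or with h1 | ⟨rfl, h2⟩
  · rw [pcirc_eq hE hn h1, pcirc_eq hE hn (h1.mono hh.1 hle)]
    exact mul_le_mul_of_nonneg_left (pstar_le hE hh hh' hle) (κ_pos hE).le
  · rcases eq_or_lt_of_le hle with rfl | h3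
    · exact le_rfl
    · obtain ⟨e, h4⟩ := pcirc_γ hE h2
      rw [e]
      refine h4.le.trans ?_
      have hr := hh'.pred h2
      rw [pcirc_eq hE hn hr, pcirc_eq hE hn (hh.isReg_of_lt h3)]
      exact mul_le_mul_of_nonneg_left (pstar_le hE hh (hr.isGrp hn) (by omega)) (κ_pos hE).le

theorem pcirc_lt (hE : 3 ≤ E) {h : ℕ} (hh : I.IsGrp h) (h2 : 2 ≤ h) :
    I.pcirc h < I.pcirc (h - 1) := by
  have hn := hh.pos
  rcases hh.isReg_or with h1 | ⟨rfl, h2⟩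
  · rw [pcirc_eq hE hn h1, pcirc_eq hE hn (h1.pred h2)]
    exact mul_lt_mul_of_pos_left (pstar_lt hE ((h1.pred h2).isGrp hn) hh (by omega)) (κ_pos hE)
  · obtain ⟨e, h4⟩ := pcirc_γ hE h2
    rw [e]; exact h4

theorem pcirc_γ_le (hE : 3 ≤ E) (hn : 0 < n) {h : ℕ} (hh : I.IsGrp h) (hk : h = I.γ) :
    I.pcirc h ≤ I.lStr 1 := by
  rw [lStr_one hE hn]
  exact pcirc_le hE (isReg_top.isGrp hn) hh (by subst hk; have := hh.1; omega)

/-- Lengths of the intervals. -/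
theorem l_gap (hE : 3 ≤ E) (hn : 0 < n) {k : ℕ} (hk : k ≠ 0) :
    ∃ g, I.IsReg g ∧ I.pstar g ≤ I.l k ∧ (2 ≤ g → I.l (k + 1) ≤ I.pstar (g - 1)) ∧
      I.dl g / 2 < I.l (k + 1) - I.l k ∧ I.l (k + 1) - I.l k ≤ I.dl g := by
  have huse : ∀ {b e}, I.Consec b e → I.l k = b → I.l (k + 1) = e := by
    intro b e h hb
    obtain ⟨k', h1, h2⟩ := h.exists_index hE hn
    have : k' = k := (l_strictMono hE hn).injective (h1.trans hb.symm)
    rwa [this] at h2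
  have hk0 : I.l k ≠ 0 := fun h => hk ((l_strictMono (I := I) hE hn).injective h)
  obtain ⟨g, hg, hr⟩ := ((mem_leftEnds_iff hE hn).1 (l_mem hE hn k)).resolve_left hk0
  have hd := dl_pos hE (hg.isGrp hn)
  refine ⟨g, hg, (hr.bounds hE hn hg).1, ?_⟩
  rcases hr with ⟨i, hi, hi2⟩ | ⟨h2, hm⟩
  · by_cases h3 : 2 ≤ g → i + 1 ≤ I.lastIdx g
    · have := huse (consec_step hE hn hg h3) hi
      rw [this, hi]
      push_cast
      refine ⟨fun h2 => ?_, by linarith, by linarith⟩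
      have := (lastIdx_spec hE hn hg h2 (i + 1)).2 (h3 h2)
      push_cast at this
      linarith
    · push Not at h3
      obtain ⟨h2, h3⟩ := h3
      have h4 : i = I.lastIdx g := by have := hi2 h2; omega
      subst h4
      have := huse (consec_last hE hn hg h2) hi
      obtain ⟨m1, m2, m3, m4⟩ := mid_bounds hE hn hg h2
      rw [this, hi]
      exact ⟨fun _ => by linarith, by linarith, by linarith⟩
  · have := huse (consec_mid hE hn hg h2) hm
    obtain ⟨m1, m2, m3, m4⟩ := mid_bounds hE hn hg h2
    rw [this, hm]
    exact ⟨fun _ => le_rfl, by linarith, by linarith⟩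

/-- Intervals behind the threshold of a group are long compared with the sizes of the next one. -/
theorem pmax_lt_gap (hE : 3 ≤ E) {h k : ℕ} (hh : I.IsGrp h) (h2 : 2 ≤ h)
    (hk : I.pcirc (h - 1) ≤ I.lStr k) : I.lStr k + 3 / 2 * I.pmax h < I.lStr (k + 1) := by
  have hn := hh.pos
  have hr := hh.pred h2
  have hκ := κ_pos (I := I) hE
  have hκ1 := one_lt_κ (I := I) hE
  rw [pcirc_eq hE hn hr, lStr_eq, mul_le_mul_iff_right₀ hκ] at hk
  have hk0 : k ≠ 0 := by
    rintro rfl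
    have := pstar_pos hE (hr.isGrp hn)
    simp only [l] at hk
    linarith
  obtain ⟨g, hg, h3, h4, h5, -⟩ := l_gap hE hn hk0
  -- The interval begins at or behind the threshold of group `h - 1`, so it cannot belong to the
  -- part of a later group.
  have hgh : g ≤ h - 1 := by
    by_contra h6
    have h7 := h4 (by omega)
    have h8 := pstar_le hE (hr.isGrp hn) ((hg.pred (by omega)).isGrp hn) (by omega : h - 1 ≤ g - 1)
    have := l_strictMono (I := I) hE hn (Nat.lt_succ_self k)
    simp only [Nat.succ_eq_add_one] at this
    linarith
  have h6 := dl_anti hE (hg.isGrp hn) (hr.isGrp hn) hgh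
  have h7 := pmax_succ_le (hr.isGrp hn) (show I.IsGrp (h - 1 + 1) by
    rw [Nat.sub_add_cancel (by omega)]; exact hh)
  rw [Nat.sub_add_cancel (by omega)] at h7
  -- Here `pmax h ≤ ε ^ 2 * pG (h - 1)` and `ε ≤ 1 / 3` are combined. Intervals are longer than half
  -- a step, which explains the factor `3 / 2` in the statement.
  have h8 : 3 * I.pmax h ≤ I.dl (h - 1) := by
    have e1 := I.eps_le hE
    have e2 := I.eps_pos hE
    have e3 := (hr.isGrp hn).pG_pos
    have e4 : I.eps ^ 2 * I.pG (h - 1) ≤ 1 / 3 * (I.eps * I.pG (h - 1)) := by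
      rw [pow_two, mul_assoc]
      gcongr
    unfold dl
    linarith
  have hp := hh.pG_pos.trans_le hh.pG_le_pmax
  rw [lStr_eq, lStr_eq]
  nlinarith

/-! ### Start points -/

/-- Resolves the recursion over the groups. Below its threshold a group inherits from the next finer
one, but the subdividing points of that one lie at or behind the threshold and are cut off; only
endpoints are inherited. The lower threshold therefore disappears from the description. -/
theorem mem_Q_iff (hE : 3 ≤ E) {h : ℕ} (hh : I.IsGrp h) {t : ℚ} :
    t ∈ I.Q h ↔ (∃ k, t = I.lStr k ∧ (2 ≤ h → t < I.pcirc (h - 1))) ∨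
      2 ≤ h ∧ ∃ k i : ℕ, t = I.lStr k + i * I.dl h ∧ I.pcirc (h - 1) ≤ I.lStr k ∧
        t < I.lStr (k + 1) - I.pmax h := by
  have hn := hh.pos
  have key : ∀ d, d < I.γ → ∀ t, t ∈ I.Qdown d ↔
      (∃ k, t = I.lStr k ∧ (2 ≤ I.γ - d → t < I.pcirc (I.γ - d - 1))) ∨
      2 ≤ I.γ - d ∧ ∃ k i : ℕ, t = I.lStr k + i * I.dl (I.γ - d) ∧
        I.pcirc (I.γ - d - 1) ≤ I.lStr k ∧ t < I.lStr (k + 1) - I.pmax (I.γ - d) := by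
    intro d
    induction d with
    | zero =>
      intro hd t
      simp only [Qdown, Nat.sub_zero]
      constructor
      · rintro ((⟨-, rfl⟩ | ⟨k, h1, -, h2⟩) | h1)
        · exact Or.inl ⟨0, lStr_zero.symm, fun h2 => pcirc_pos hE
            ((show I.IsGrp I.γ from ⟨by omega, le_rfl⟩).pred h2 |>.isGrp hn)⟩
        · exact Or.inl ⟨k, h1, h2⟩
        · exact Or.inr h1
      · rintro (⟨k, rfl, h2⟩ | h1)
        · rcases Nat.eq_zero_or_pos k with rfl | hk
          · exact Or.inl (Or.inl ⟨rfl, lStr_zero⟩)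
          · refine Or.inl (Or.inr ⟨k, rfl, ?_, h2⟩)
            exact (pcirc_γ_le hE hn ⟨by omega, le_rfl⟩ rfl).trans
              ((lStr_strictMono hE hn).monotone hk)
        · exact Or.inr h1
    | succ d ih =>
      intro hd t
      have hg : I.IsGrp (I.γ - (d + 1)) := ⟨by omega, by omega⟩
      have hs : I.γ - d - 1 = I.γ - (d + 1) := by omega
      have ih := ih (by omega) t
      rw [hs] at ih
      simp only [Qdown]
      constructor
      · rintro (((⟨h1, -⟩ | ⟨k, h1, -, h2⟩) | h1) | ⟨h1, h2, h3⟩)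
        · omega
        · exact Or.inl ⟨k, h1, h2⟩
        · exact Or.inr h1
        · rcases ih.1 h1 with ⟨k, h4, h5⟩ | ⟨h4, k, i, h5, h6, h7⟩
          · exact Or.inl ⟨k, h4, fun h6 => h3.trans (pcirc_lt hE hg h6)⟩
          · exfalso
            have := dl_pos hE (show I.IsGrp (I.γ - d) from ⟨by omega, by omega⟩)
            have : 0 ≤ (i : ℚ) * I.dl (I.γ - d) := by positivity
            linarith
      · rintro (⟨k, rfl, h2⟩ | h1)
        · rcases le_or_gt (I.pcirc (I.γ - (d + 1))) (I.lStr k) with h3 | h3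
          · exact Or.inl (Or.inl (Or.inr ⟨k, rfl, h3, h2⟩))
          · exact Or.inr ⟨ih.2 (Or.inl ⟨k, rfl, fun _ => h3⟩), lStr_nonneg hE hn k, h3⟩
        · exact Or.inl (Or.inr h1)
  have h1 := hh.1
  have h2 := hh.2
  have := key (I.γ - h) (by omega) t
  rw [Nat.sub_sub_self h2] at this
  exact this

/-- An endpoint behind the threshold of the preceding group is the subdividing point with `i = 0`;
it is admissible because its interval is longer than `pmax h`. -/
theorem lStr_mem_Q (hE : 3 ≤ E) {h : ℕ} (hh : I.IsGrp h) (k : ℕ) : I.lStr k ∈ I.Q h := by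
  rw [mem_Q_iff hE hh]
  by_cases h1 : 2 ≤ h → I.lStr k < I.pcirc (h - 1)
  · exact Or.inl ⟨k, rfl, h1⟩
  · push Not at h1
    have h3 := pmax_lt_gap hE hh h1.1 h1.2
    have hp := hh.pG_pos.trans_le hh.pG_le_pmax
    exact Or.inr ⟨h1.1, k, 0, by simp, h1.2, by linarith⟩

theorem zero_mem_Q (hE : 3 ≤ E) {h : ℕ} (hh : I.IsGrp h) : (0 : ℚ) ∈ I.Q h := by
  rw [← lStr_zero (I := I)]; exact lStr_mem_Q hE hh 0

theorem pcirc_mem_Q (hE : 3 ≤ E) {g h : ℕ} (hg : I.IsReg g) (hh : I.IsGrp h) :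
    I.pcirc g ∈ I.Q h := by
  obtain ⟨k, hk, -⟩ := exists_lStr_eq_pcirc hE hh.pos hg
  rw [← hk]; exact lStr_mem_Q hE hh k

/-- The factors of `tden`: `E ^ 2` clears the coefficient `(1 + ε) * ε` of the shifted sizes, `2`
the midpoints, and the outer `E` the stretching factor `(E + 5) / E`. -/
theorem isFrac_lStr (hE : 3 ≤ E) (hn : 0 < n) (k : ℕ) : IsFrac I.tden (I.lStr k) := by
  have h0 : (E : ℚ) ≠ 0 := by exact_mod_cast (by omega : E ≠ 0)
  have := (isFrac_of_mem_leftEnds hE hn (l_mem (I := I) hE hn k)).div_mul E (E + 5)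
  have e : I.lStr k = ((E + 5 : ℕ) : ℚ) / E * I.l k := by
    rw [lStr_eq, κ, eps]
    congr 1
    push_cast
    field_simp
  rw [e]
  exact this

theorem fractions_Q (hE : 3 ≤ E) {h : ℕ} (hh : I.IsGrp h) : Fractions I.tden (I.Q h) := by
  intro x hx
  change IsFrac _ _
  rcases (mem_Q_iff hE hh).1 hx with ⟨k, rfl, -⟩ | ⟨-, k, i, rfl, -, -⟩
  · exact isFrac_lStr hE hh.pos k
  · exact (isFrac_lStr hE hh.pos k).add
      ((((isFrac_dl hE hh).of_mul two_ne_zero).of_mul (by omega)).nat_mul i)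

theorem Q_nonneg (hE : 3 ≤ E) {h : ℕ} (hh : I.IsGrp h) {x : ℚ} (hx : x ∈ I.Q h) : 0 ≤ x :=
  (fractions_Q hE hh).nonneg hx

theorem exists_lStr_ge (hE : 3 ≤ E) (hn : 0 < n) (t : ℚ) :
    ∃ k, t ≤ I.lStr k ∧ I.lStr k ≤ max t (I.pcirc 1) + I.κ * I.dl 1 := by
  have hκ := κ_pos (I := I) hE
  obtain ⟨x, hx, h1, h2⟩ := exists_leftEnd_gt (I := I) hE hn (t / I.κ)
  obtain ⟨k, rfl⟩ := exists_l_eq hE hn hx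
  refine ⟨k, ?_, ?_⟩
  · rw [div_lt_iff₀' hκ] at h1
    exact h1.le
  · rw [lStr_eq, pcirc_eq hE hn isReg_one]
    calc I.κ * I.l k ≤ I.κ * (max (t / I.κ) (I.pstar 1) + I.dl 1) := by gcongr
      _ = _ := by
        rw [mul_add, mul_max_of_nonneg _ _ hκ.le, mul_div_cancel₀ _ hκ.ne']

theorem isLeast_nextPt (hE : 3 ≤ E) {h : ℕ} (hh : I.IsGrp h) (t : ℚ) :
    IsLeast {s ∈ I.Q h | t ≤ s} (nextPt (I.Q h) t) := by
  refine isLeast_leastOf (((fractions_Q hE hh).mono (Set.sep_subset _ _)).exists_isLeast ?_)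
  obtain ⟨k, hk, -⟩ := exists_lStr_ge (I := I) hE hh.pos t
  exact ⟨_, lStr_mem_Q hE hh k, hk⟩

theorem nextPt_mem (hE : 3 ≤ E) {h : ℕ} (hh : I.IsGrp h) (t : ℚ) : nextPt (I.Q h) t ∈ I.Q h :=
  (isLeast_nextPt hE hh t).1.1

theorem le_nextPt (hE : 3 ≤ E) {h : ℕ} (hh : I.IsGrp h) (t : ℚ) : t ≤ nextPt (I.Q h) t :=
  (isLeast_nextPt hE hh t).1.2

theorem nextPt_le (hE : 3 ≤ E) {h : ℕ} (hh : I.IsGrp h) {t s : ℚ} (hs : s ∈ I.Q h) (hts : t ≤ s) :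
    nextPt (I.Q h) t ≤ s := (isLeast_nextPt hE hh t).2 ⟨hs, hts⟩

theorem nextPt_mono (hE : 3 ≤ E) {h : ℕ} (hh : I.IsGrp h) : Monotone (nextPt (I.Q h)) :=
  fun _ t' htt' => nextPt_le hE hh (nextPt_mem hE hh t') (htt'.trans (le_nextPt hE hh t'))

theorem nextPt_of_mem (hE : 3 ≤ E) {h : ℕ} (hh : I.IsGrp h) {t : ℚ} (ht : t ∈ I.Q h) :
    nextPt (I.Q h) t = t := le_antisymm (nextPt_le hE hh ht le_rfl) (le_nextPt hE hh t)

theorem nextPt_le_max (hE : 3 ≤ E) {h : ℕ} (hh : I.IsGrp h) (t : ℚ) :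
    nextPt (I.Q h) t ≤ max t (I.pcirc 1) + I.κ * I.dl 1 := by
  obtain ⟨k, hk, hk'⟩ := exists_lStr_ge (I := I) hE hh.pos t
  exact (nextPt_le hE hh (lStr_mem_Q hE hh k) hk).trans hk'

/-- Points that stem from earlier intervals lie before `lStr k`, and points of later ones at or
behind `lStr (k + 1)`. So only the subdivision of the current interval and its two ends compete. The
algorithm evaluates this formula. -/
theorem nextPt_eq (hE : 3 ≤ E) {h : ℕ} (hh : I.IsGrp h) {t : ℚ} {k : ℕ} (h1 : I.lStr k ≤ t)
    (h2 : t < I.lStr (k + 1)) :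
    nextPt (I.Q h) t =
      if 2 ≤ h ∧ I.pcirc (h - 1) ≤ I.lStr k then
        if I.lStr k + ⌈(t - I.lStr k) / I.dl h⌉ * I.dl h < I.lStr (k + 1) - I.pmax h then
          I.lStr k + ⌈(t - I.lStr k) / I.dl h⌉ * I.dl h
        else I.lStr (k + 1)
      else if t ≤ I.lStr k then I.lStr k else I.lStr (k + 1) := by
  have hn := hh.pos
  have hd := dl_pos hE hh
  have hmono := lStr_strictMono (I := I) hE hn
  refine leastOf_eq ?_
  have hk2 : ∀ k', t ≤ I.lStr k' → k' = k ∧ t ≤ I.lStr k ∨ k + 1 ≤ k' := by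
    intro k' h3
    rcases Nat.lt_or_ge k k' with h4 | h4
    · exact Or.inr h4
    · have := hmono.monotone h4
      have h5 : k' = k := by
        by_contra h6
        have := hmono (show k' < k by omega)
        linarith
      subst h5
      exact Or.inl ⟨rfl, h3⟩
  split_ifs with h3 h4 h4
  · set i := ⌈(t - I.lStr k) / I.dl h⌉ with hi
    have hi0 : 0 ≤ i := Int.ceil_nonneg (div_nonneg (by linarith) hd.le)
    have hit : t ≤ I.lStr k + i * I.dl h := by
      have := Int.le_ceil ((t - I.lStr k) / I.dl h)
      rw [div_le_iff₀ hd] at this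
      linarith
    refine ⟨⟨(mem_Q_iff hE hh).2 (Or.inr ⟨h3.1, k, i.toNat, ?_, h3.2, h4⟩), hit⟩, ?_⟩
    · have : ((i.toNat : ℕ) : ℚ) = (i : ℚ) := by
        have := Int.toNat_of_nonneg hi0
        exact_mod_cast this
      rw [this]
    · rintro s ⟨hs, hts⟩
      have hp := hh.pG_pos.trans_le hh.pG_le_pmax
      rcases (mem_Q_iff hE hh).1 hs with ⟨k', rfl, h5⟩ | ⟨-, k', i', rfl, h6, h7⟩
      · rcases hk2 k' hts with ⟨rfl, -⟩ | h6
        · exact absurd (h5 h3.1) (not_lt.2 h3.2)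
        · have := hmono.monotone h6
          linarith
      · rcases lt_trichotomy k k' with h8 | rfl | h8
        · have := hmono.monotone (show k + 1 ≤ k' from h8)
          have : 0 ≤ (i' : ℚ) * I.dl h := by positivity
          linarith
        · have : i ≤ (i' : ℤ) := by
            rw [hi, Int.ceil_le, div_le_iff₀ hd]
            push_cast
            linarith
          have : (i : ℚ) ≤ i' := by exact_mod_cast this
          gcongr
        · have := hmono.monotone (show k' + 1 ≤ k from h8)
          linarith
  · refine ⟨⟨lStr_mem_Q hE hh _, h2.le⟩, ?_⟩
    rintro s ⟨hs, hts⟩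
    have hp := hh.pG_pos.trans_le hh.pG_le_pmax
    rcases (mem_Q_iff hE hh).1 hs with ⟨k', rfl, h5⟩ | ⟨-, k', i', rfl, h6, h7⟩
    · rcases hk2 k' hts with ⟨rfl, -⟩ | h6
      · exact absurd (h5 h3.1) (not_lt.2 h3.2)
      · exact hmono.monotone h6
    · rcases lt_trichotomy k k' with h8 | rfl | h8
      · have := hmono.monotone (show k + 1 ≤ k' from h8)
        have : 0 ≤ (i' : ℚ) * I.dl h := by positivity
        linarith
      · exfalso
        refine h4 (lt_of_le_of_lt ?_ h7)
        have : ⌈(t - I.lStr k) / I.dl h⌉ ≤ (i' : ℤ) := by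
          rw [Int.ceil_le, div_le_iff₀ hd]
          push_cast
          linarith
        have : (⌈(t - I.lStr k) / I.dl h⌉ : ℚ) ≤ i' := by exact_mod_cast this
        gcongr
      · have := hmono.monotone (show k' + 1 ≤ k from h8)
        linarith
  · exact ⟨⟨lStr_mem_Q hE hh _, h4⟩, fun s hs => h1.trans hs.2⟩
  · refine ⟨⟨lStr_mem_Q hE hh _, h2.le⟩, ?_⟩
    rintro s ⟨hs, hts⟩
    have hp := hh.pG_pos.trans_le hh.pG_le_pmax
    rcases (mem_Q_iff hE hh).1 hs with ⟨k', rfl, h5⟩ | ⟨h2', k', i', rfl, h6, h7⟩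
    · rcases hk2 k' hts with ⟨rfl, h6⟩ | h6
      · exact absurd h6 h4
      · exact hmono.monotone h6
    · have h8 : k < k' := by
        by_contra h9
        have := hmono.monotone (show k' ≤ k by omega)
        exact h3 ⟨h2', h6.trans this⟩
      have := hmono.monotone (show k + 1 ≤ k' from h8)
      have : 0 ≤ (i' : ℚ) * I.dl h := by positivity
      linarith

/-- Start points of different groups agree before the relevant thresholds. -/
theorem mem_Q_congr (hE : 3 ≤ E) {h g : ℕ} (hh : I.IsGrp h) (hg : I.IsGrp g) (hle : h ≤ g) {t : ℚ}
    (ht : 2 ≤ g → t < I.pcirc (g - 1)) : t ∈ I.Q h ↔ t ∈ I.Q g := by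
  have hn := hh.pos
  have hsub : ∀ {h' : ℕ}, I.IsGrp h' → h' ≤ g → t ∈ I.Q h' → ∃ k, t = I.lStr k := by
    intro h' hh' hle' h1
    rcases (mem_Q_iff hE hh').1 h1 with ⟨k, h2, -⟩ | ⟨h2, k, i, h3, h4, -⟩
    · exact ⟨k, h2⟩
    · exfalso
      have h5 := pcirc_le hE ((hh'.pred h2).isGrp hn) ((hg.pred (by omega)).isGrp hn)
        (by omega : h' - 1 ≤ g - 1)
      have h6 := ht (by omega)
      have := dl_pos hE hh'
      have : 0 ≤ (i : ℚ) * I.dl h' := by positivity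
      linarith
  constructor
  · intro h1
    obtain ⟨k, rfl⟩ := hsub hh hle h1
    exact lStr_mem_Q hE hg k
  · intro h1
    obtain ⟨k, rfl⟩ := hsub hg le_rfl h1
    exact lStr_mem_Q hE hh k

/-- Apart from one midpoint, start points of a group behind its threshold keep a distance. -/
theorem dl_le_sub (hE : 3 ≤ E) {h : ℕ} (hh : I.IsGrp h) {y z : ℚ} (hy : y ∈ I.Q h) (hz : z ∈ I.Q h)
    (hyz : y < z) (hpy : I.pcirc h ≤ y) (hym : 2 ≤ h → y ≠ I.κ * I.mid h)
    (hzm : 2 ≤ h → z ≠ I.κ * I.mid h) : I.dl h ≤ z - y := by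
  have hn := hh.pos
  have hd := dl_pos hE hh
  have hκ := κ_pos (I := I) hE
  have hκ1 := one_lt_κ (I := I) hE
  have hmono := lStr_strictMono (I := I) hE hn
  -- An endpoint in the part of group `h` that is not the midpoint is a stretched grid point. For an
  -- irregular last group there is none: the only endpoint before the next threshold is `0`.
  have hreg : ∀ x k, x = I.lStr k → I.pcirc h ≤ x → (2 ≤ h → x < I.pcirc (h - 1)) →
      (2 ≤ h → x ≠ I.κ * I.mid h) →
      I.IsReg h ∧ ∃ i : ℕ, x = I.κ * (I.pstar h + i * I.dl h) ∧ (2 ≤ h → i ≤ I.lastIdx h) := by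
    rintro x k rfl h1 h2 h3
    rcases hh.isReg_or with hr | ⟨rfl, hγ⟩
    · refine ⟨hr, ?_⟩
      rw [pcirc_eq hE hn hr, lStr_eq, mul_le_mul_iff_right₀ hκ] at h1
      rcases le_or_le_of_inReg hE hn hr (l_mem hE hn k) with h4 | (⟨i, h4, h5⟩ | ⟨h4, h5⟩) | ⟨h4, h5⟩
      · exact absurd h1 (not_le.2 h4)
      · exact ⟨i, by rw [lStr_eq, h4], h5⟩
      · exact absurd (by rw [lStr_eq, h5]) (h3 h4)
      · have := h2 h4
        rw [pcirc_eq hE hn (hr.pred h4), lStr_eq, mul_lt_mul_iff_right₀ hκ] at this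
        exact absurd this (not_lt.2 h5)
    · exfalso
      have h4 := h2 hγ
      have h5 : max (I.γ - 1) 1 = I.γ - 1 := by omega
      rw [← h5, ← lStr_one hE hn] at h4
      have h6 : k = 0 := by have := hmono.lt_iff_lt.1 h4; omega
      subst h6
      have := pcirc_pos hE hh
      rw [lStr_zero] at h1
      linarith
  have hp := hh.pG_le_pmax
  have hδp : I.dl h ≤ I.pG h := by
    have := I.eps_le hE
    have := hh.pG_pos
    unfold dl
    nlinarith
  rcases (mem_Q_iff hE hh).1 hy with ⟨k, h1, h2⟩ | ⟨h2, k, i, rfl, h3, h4⟩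
  · obtain ⟨hr, i, hi, hi2⟩ := hreg y k h1 hpy h2 hym
    rcases (mem_Q_iff hE hh).1 hz with ⟨k', h1', h2'⟩ | ⟨h2', k', i', h1', h3', h4'⟩
    · obtain ⟨-, i', hi', -⟩ := hreg z k' h1' (hpy.trans hyz.le) h2' hzm
      rw [hi, hi'] at hyz ⊢
      rw [mul_lt_mul_iff_right₀ hκ] at hyz
      have h5 : (i : ℚ) < i' := by
        have : (i : ℚ) * I.dl h < i' * I.dl h := by linarith
        exact lt_of_mul_lt_mul_right this hd.le
      have h6 : (i : ℚ) + 1 ≤ i' := by exact_mod_cast (by exact_mod_cast h5 : i < i')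
      have h7 : (i' : ℚ) * I.dl h - i * I.dl h ≥ I.dl h := by nlinarith
      nlinarith
    -- A grid point stays `dl h` before the next threshold by the cut-off, and stretching only
    -- increases the distance.
    · have h5 := (lastIdx_spec hE hn hr h2' i).2 (hi2 h2')
      rw [pcirc_eq hE hn (hr.pred h2')] at h3'
      have : 0 ≤ (i' : ℚ) * I.dl h := by positivity
      rw [hi, h1']
      nlinarith
  · have h0 : 0 ≤ (i : ℚ) * I.dl h := by positivity
    rcases (mem_Q_iff hE hh).1 hz with ⟨k', h1', h2'⟩ | ⟨h2', k', i', rfl, h3', h4'⟩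
    · have := h2' h2
      linarith
    · have h0' : 0 ≤ (i' : ℚ) * I.dl h := by positivity
      -- Points in different subdivided intervals are separated by the room of length `pmax h` that
      -- is left free at the end of an interval.
      rcases lt_trichotomy k k' with h8 | rfl | h8
      · have := hmono.monotone (show k + 1 ≤ k' from h8)
        linarith
      · have h5 : (i : ℚ) < i' := by
          have : (i : ℚ) * I.dl h < i' * I.dl h := by linarith
          exact lt_of_mul_lt_mul_right this hd.le
        have h6 : (i : ℚ) + 1 ≤ i' := by exact_mod_cast (by exact_mod_cast h5 : i < i')
        nlinarith
      · have := hmono.monotone (show k' + 1 ≤ k from h8)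
        have := hh.pG_pos
        linarith

/-- Rounding a coarse start point up to the finer grid moves it by less than `dl h'`. The room kept
free by the coarse group must cover this move and the room required by the fine group. -/
theorem pmax_add_dl_le (hE : 3 ≤ E) {h h' : ℕ} (hh : I.IsGrp h) (hh' : I.IsGrp h') (hlt : h < h') :
    I.pmax h' + I.dl h' ≤ I.pmax h := by
  have hr := hh'.pred (by have := hh.1; omega)
  have h7 := pmax_succ_le (hr.isGrp hh.pos) (show I.IsGrp (h' - 1 + 1) by
    rw [Nat.sub_add_cancel (by omega)]; exact hh')
  rw [Nat.sub_add_cancel (by omega)] at h7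
  have h8 := pG_anti hh (hr.isGrp hh.pos) (by omega : h ≤ h' - 1)
  have h9 := hh.pG_le_pmax
  have h10 := hh'.pG_le_pmax
  have e1 := I.eps_le hE
  have e2 := I.eps_pos hE
  have h11 := hh'.pG_pos
  have h12 := (hr.isGrp hh.pos).pG_pos
  have h13 : I.eps ^ 2 ≤ 1 / 9 := by nlinarith
  have h14 : I.pmax h' ≤ 1 / 9 * I.pG (h' - 1) := h7.trans (by gcongr)
  have h15 : I.dl h' ≤ I.pmax h' := by unfold dl; nlinarith
  linarith

/-- Start points of smaller groups are finer. -/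
theorem exists_mem_Q_between (hE : 3 ≤ E) {h h' : ℕ} (hh : I.IsGrp h) (hh' : I.IsGrp h')
    (hlt : h < h') {z z' : ℚ} (hz : z ∈ I.Q h) (hz' : z' ∈ I.Q h) (hzz' : z < z') :
    ∃ w ∈ I.Q h', z ≤ w ∧ w < z' := by
  have hn := hh.pos
  have hd := dl_pos hE hh'
  rcases (mem_Q_iff hE hh).1 hz with ⟨k, rfl, -⟩ | ⟨h2, k, i, hzi, h3, h4⟩
  · exact ⟨_, lStr_mem_Q hE hh' k, le_rfl, hzz'⟩
  · have hdh := dl_pos hE hh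
    have h0 : 0 ≤ (i : ℚ) * I.dl h := by positivity
    have hr := hh.pred h2
    -- The exceptional midpoint lies before the threshold of group `h - 1`, whereas both given
    -- points lie behind it.
    have hmid : ∀ x, I.pcirc (h - 1) ≤ x → h < I.γ → x ≠ I.κ * I.mid h := by
      intro x hx hγ he
      have hreg := hh.isReg_of_lt hγ
      rw [pcirc_eq hE hn hr, he, mul_le_mul_iff_right₀ (κ_pos hE)] at hx
      have := (mid_bounds hE hn hreg h2).2.2.1
      linarith
    have hγ : h < I.γ := hlt.trans_le hh'.2
    have h5 := dl_le_sub hE hh hz hz' hzz' (by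
      have := pcirc_lt hE hh h2
      linarith) (fun _ => hmid z (by linarith) hγ) (fun _ => hmid z' (by linarith) hγ)
    have h6 := dl_anti hE hh hh' hlt.le
    have h7 := pmax_add_dl_le hE hh hh' hlt
    -- The witness is `z` rounded up to the grid of group `h'`. It moves by less than `dl h'`, which
    -- is at most `dl h` and hence at most `z' - z`.
    set c := ⌈(z - I.lStr k) / I.dl h'⌉ with hc
    have hc0 : 0 ≤ c := Int.ceil_nonneg (div_nonneg (by linarith) hd.le)
    have hc1 : z ≤ I.lStr k + c * I.dl h' := by
      have := Int.le_ceil ((z - I.lStr k) / I.dl h')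
      rw [div_le_iff₀ hd] at this
      linarith
    have hc2 : I.lStr k + c * I.dl h' < z + I.dl h' := by
      have := Int.ceil_lt_add_one ((z - I.lStr k) / I.dl h')
      rw [← hc, ← sub_lt_iff_lt_add, lt_div_iff₀ hd] at this
      linarith
    refine ⟨I.lStr k + c * I.dl h', (mem_Q_iff hE hh').2 (Or.inr ⟨by omega, k, c.toNat, ?_, ?_, ?_⟩),
      hc1, by linarith⟩
    · have : ((c.toNat : ℕ) : ℚ) = (c : ℚ) := by
        have := Int.toNat_of_nonneg hc0
        exact_mod_cast this
      rw [this]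
    · exact (pcirc_le hE (hr.isGrp hn) ((hh'.pred (by omega)).isGrp hn) (by omega)).trans h3
    · linarith

theorem finite_Q_inter (hE : 3 ≤ E) {h : ℕ} (hh : I.IsGrp h) {S : Set ℚ} (hS : BddAbove S) :
    (I.Q h ∩ S).Finite := by
  obtain ⟨B, hB⟩ := hS
  exact ((fractions_Q hE hh).finite_le (tden_pos hE) B).subset
    (Set.inter_subset_inter_right _ fun x hx => hB hx)

/-- Rounding `(y - x) / δ` down separates points at distance `δ`, and it takes values up to `K`
only. -/
theorem ncard_le_of_spacing {S : Set ℚ} {x w δ : ℚ} {K : ℕ} (hδ : 0 < δ) (hS : S ⊆ Set.Icc x (x + w))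
    (h : ∀ y ∈ S, ∀ z ∈ S, y < z → δ ≤ z - y) (hw : w ≤ K * δ) : S.Finite ∧ S.ncard ≤ K + 1 := by
  have hmaps : Set.MapsTo (fun y => ⌊(y - x) / δ⌋₊) S (Finset.range (K + 1) : Set ℕ) := by
    intro y hy
    have h1 := hS hy
    simp only [Finset.coe_range, Set.mem_Iio]
    refine Nat.lt_succ_of_le (Nat.floor_le_of_le ?_)
    rw [div_le_iff₀ hδ]
    linarith [h1.2]
  have hinj : Set.InjOn (fun y => ⌊(y - x) / δ⌋₊) S := by
    have key : ∀ y ∈ S, ∀ z ∈ S, y < z → ⌊(y - x) / δ⌋₊ < ⌊(z - x) / δ⌋₊ := by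
      intro y hy z hz hyz
      have h1 := h y hy z hz hyz
      have h2 := hS hy
      rw [Nat.lt_iff_add_one_le]
      refine Nat.le_floor ?_
      have h3 := Nat.floor_le (div_nonneg (by linarith [h2.1] : 0 ≤ y - x) hδ.le)
      push_cast
      rw [le_div_iff₀ hδ] at h3 ⊢
      linarith
    intro y hy z hz he
    rcases lt_trichotomy y z with h1 | h1 | h1
    · exact absurd he (key y hy z hz h1).ne
    · exact h1
    · exact absurd he (key z hz y hy h1).ne'
  refine ⟨Set.Finite.of_finite_image ((Finset.finite_toSet _).subset hmaps.image_subset) hinj, ?_⟩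
  have := Set.ncard_le_ncard_of_injOn _ hmaps hinj (Finset.finite_toSet _)
  rwa [Set.ncard_coe_finset, Finset.card_range] at this

theorem one_le_gsize {h : ℕ} (hh : I.IsGrp h) : 1 ≤ I.gsize h := by
  obtain ⟨j, hj⟩ := hh.exists_type
  exact Finset.card_pos.2 ⟨j, by simp [hj]⟩

theorem gsize_le_z {h : ℕ} (hh : I.IsGrp h) : I.gsize h ≤ I.z := by
  obtain ⟨j, rfl⟩ := hh.exists_type
  exact Finset.le_sup (f := fun j => I.gsize (I.grp j)) (Finset.mem_univ j)

theorem z_le : I.z ≤ n := Finset.sup_le fun j _ => by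
  unfold gsize
  exact (Finset.card_le_univ _).trans (by simp)

/-- The number of start points of a group in a window behind its threshold. -/
theorem ncard_window_le (hE : 3 ≤ E) {h : ℕ} (hh : I.IsGrp h) {a : ℚ} (ha : I.pcirc h ≤ a) :
    (I.Q h ∩ Set.Icc a (a + I.pmax h)).ncard ≤ E ^ (2 * I.z - 1) + 2 := by
  have hd := dl_pos hE hh
  have hp := hh.pG_le_pmax
  set T := I.Q h ∩ Set.Icc a (a + I.pmax h) with hT
  have hfin : T.Finite := finite_Q_inter hE hh bddAbove_Icc
  -- The ratio of the sizes in a group accounts for `E ^ (2 * (gsize h - 1))`, and `dl h = ε * pG h`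
  -- for one further factor `E`.
  have h1 : I.pmax h ≤ ((E ^ (2 * I.z - 1) : ℕ) : ℚ) * I.dl h := by
    have h2 := one_le_gsize hh
    have h3 := gsize_le_z hh
    have hE1 : (1 : ℚ) ≤ E := by exact_mod_cast (by omega : 1 ≤ E)
    calc I.pmax h ≤ (E : ℚ) ^ (2 * (I.gsize h - 1)) * I.pG h := pmax_le_pow_mul_pG hE hh
      _ = (E : ℚ) ^ (2 * (I.gsize h - 1)) * ((E : ℚ) * I.eps * I.pG h) := by
        rw [I.E_mul_eps hE, one_mul]
      _ = (E : ℚ) ^ (2 * (I.gsize h - 1) + 1) * I.dl h := by rw [dl]; ring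
      _ ≤ (E : ℚ) ^ (2 * I.z - 1) * I.dl h :=
        mul_le_mul_of_nonneg_right (pow_le_pow_right₀ hE1 (by omega)) hd.le
      _ = _ := by push_cast; rfl
  -- Without the midpoint the spacing argument gives one more than the quotient; the midpoint itself
  -- makes it two more.
  have h2 := (ncard_le_of_spacing (S := T \ {I.κ * I.mid h}) hd
    (fun y hy => hy.1.2) (fun y hy z hz hyz => dl_le_sub hE hh hy.1.1 hz.1.1 hyz
      (ha.trans hy.1.2.1) (fun _ => hy.2) (fun _ => hz.2)) h1).2
  have h3 := Set.ncard_le_ncard_sdiff_add_ncard T {I.κ * I.mid h} (Set.finite_singleton _)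
  rw [Set.ncard_singleton] at h3
  omega

end Instance

end BernoulliSched

namespace BernoulliSched

namespace Instance

variable {n E : ℕ} {I : Instance n E}

/-! ### The value function -/

theorem sum_dec {ν : Fin n → ℕ} {j : Fin n} (hj : 0 < ν j) : (∑ i, dec ν j i) + 1 = ∑ i, ν i := by
  classical
  unfold dec
  rw [Finset.sum_update_of_mem (Finset.mem_univ j), ← Finset.add_sum_erase _ _ (Finset.mem_univ j),
    Finset.sdiff_singleton_eq_erase]
  omega

theorem startCost_congr {V W : List ℚ → (Fin n → ℕ) → ℚ} {ms : List ℚ} {ν : Fin n → ℕ} {j : Fin n}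
    (h : ∀ ms, V ms (dec ν j) = W ms (dec ν j)) : I.startCost V ms ν j = I.startCost W ms ν j := by
  unfold startCost; rw [h, h]

/-- Every successor has one leftover job fewer, so the recursion depth always matches. This turns
the definition by depth into the Bellman equation for `ecost` itself. -/
theorem ecost_isLeast (ms : List ℚ) {ν : Fin n → ℕ} (hν : ν ≠ 0) :
    IsLeast {c | ∃ j, 0 < ν j ∧ c = I.startCost I.ecost ms ν j} (I.ecost ms ν) := by
  obtain ⟨j₀, hj₀⟩ : ∃ j, 0 < ν j := by
    by_contra! h
    exact hν (funext fun j => Nat.le_zero.1 (h j))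
  obtain ⟨k, hk⟩ : ∃ k, ∑ j, ν j = k + 1 := ⟨_, (sum_dec hj₀).symm⟩
  have h1 : {c | ∃ j, 0 < ν j ∧ c = I.startCost I.ecost ms ν j} =
      {c | ∃ j, 0 < ν j ∧ c = I.startCost (I.ecostAux k) ms ν j} := by
    ext c
    refine exists_congr fun j => and_congr_right fun hj => ?_
    rw [startCost_congr (V := I.ecost) (W := I.ecostAux k)]
    intro ms
    have := sum_dec hj
    rw [ecost, show ∑ i, dec ν j i = k by omega]
  have h2 : {c | ∃ j, 0 < ν j ∧ c = I.startCost I.ecost ms ν j}.Finite :=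
    (Set.finite_range fun j => I.startCost I.ecost ms ν j).subset (by
      rintro _ ⟨j, -, rfl⟩
      exact ⟨j, rfl⟩)
  have h3 : ∃ x, IsLeast {c | ∃ j, 0 < ν j ∧ c = I.startCost I.ecost ms ν j} x := by
    obtain ⟨x, hx, hm⟩ := Set.exists_min_image _ id h2 ⟨_, j₀, hj₀, rfl⟩
    exact ⟨x, hx, hm⟩
  have h4 := isLeast_leastOf h3
  rw [ecost, hk, ecostAux, ← h1]
  exact h4

theorem ecost_zero (ms : List ℚ) : I.ecost ms 0 = 0 := by
  unfold ecost
  simp [ecostAux]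

theorem nextProb_mem (j : Fin n) (v : ℕ) : 0 ≤ I.nextProb j v ∧ I.nextProb j v ≤ 1 := by
  unfold nextProb
  by_cases h : I.Nj j - v < (I.probs j).length
  · rw [List.getD_eq_getElem _ _ h]
    have := I.probs_mem j _ (List.getElem_mem h)
    exact ⟨this.1.le, this.2⟩
  · rw [List.getD_eq_default _ _ (by omega)]
    norm_num

/-- If the insertion stops in one list but continues in the other one, the list where it stops is
regarded as the insertion of its own head into its tail; then the induction applies. -/
theorem orderedInsert_mono {l l' : List ℚ} (h : List.Forall₂ (· ≤ ·) l l')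
    (hl : l.Pairwise (· ≤ ·)) (hl' : l'.Pairwise (· ≤ ·)) {r r' : ℚ} (hr : r ≤ r') :
    List.Forall₂ (· ≤ ·) (l.orderedInsert (· ≤ ·) r) (l'.orderedInsert (· ≤ ·) r') := by
  have hoi : ∀ {a : ℚ} {t : List ℚ}, (a :: t).Pairwise (· ≤ ·) →
      t.orderedInsert (· ≤ ·) a = a :: t := by
    intro a t ht
    cases t with
    | nil => rfl
    | cons b t =>
      rw [List.orderedInsert_cons, if_pos ((List.pairwise_cons.1 ht).1 b (by simp))]
  induction h generalizing r r' with
  | nil => simpa using hr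
  | @cons a a' t t' haa' htt' ih =>
    have ht := (List.pairwise_cons.1 hl).2
    have ht' := (List.pairwise_cons.1 hl').2
    rw [List.orderedInsert_cons, List.orderedInsert_cons]
    split_ifs with h1 h2 h2
    · exact .cons hr (.cons haa' htt')
    · refine .cons (h1.trans haa') ?_
      rw [← hoi hl]
      exact ih ht ht' (haa'.trans (not_le.1 h2).le)
    · refine .cons ((not_le.1 h1).le.trans hr) ?_
      rw [← hoi hl']
      exact ih ht ht' (hr.trans h2)
    · exact .cons haa' (ih ht ht' hr)

theorem forall₂_tail {l l' : List ℚ} (h : List.Forall₂ (· ≤ ·) l l') :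
    List.Forall₂ (· ≤ ·) l.tail l'.tail := by
  cases h with
  | nil => exact .nil
  | cons _ h => exact h

theorem headD_mono {l l' : List ℚ} (h : List.Forall₂ (· ≤ ·) l l') : l.headD 0 ≤ l'.headD 0 := by
  cases h with
  | nil => exact le_rfl
  | cons h _ => exact h

theorem map_max_mono {l l' : List ℚ} (h : List.Forall₂ (· ≤ ·) l l') {s s' : ℚ} (hs : s ≤ s') :
    List.Forall₂ (· ≤ ·) (l.map (max s)) (l'.map (max s')) := by
  induction h with
  | nil => exact .nil
  | cons h _ ih => exact .cons (max_le_max hs h) ih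

theorem sorted_map_max {l : List ℚ} (h : l.Pairwise (· ≤ ·)) (s : ℚ) :
    (l.map (max s)).Pairwise (· ≤ ·) := by
  rw [List.pairwise_map]
  exact h.imp fun h => max_le_max le_rfl h

theorem release_mono (hE : 3 ≤ E) (j : Fin n) : Monotone (I.release j) := fun s s' h =>
  nextPt_mono hE (isGrp_grp j) (max_le_max le_rfl (by linarith))

/-- An optimal decision for the later profile can be copied in the earlier one: the start and the
release are no later, and induction applies to the resulting cells. Thereby it suffices to consider
earliest starts on machines of smallest load. -/
theorem ecost_mono (hE : 3 ≤ E) {ms ms' : List ℚ} (h : List.Forall₂ (· ≤ ·) ms ms')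
    (hs : ms.Pairwise (· ≤ ·)) (hs' : ms'.Pairwise (· ≤ ·)) (ν : Fin n → ℕ) :
    I.ecost ms ν ≤ I.ecost ms' ν := by
  induction hk : ∑ j, ν j generalizing ms ms' ν with
  | zero =>
    have : ν = 0 := funext fun j => by
      have := Finset.sum_eq_zero_iff.1 hk j (Finset.mem_univ j)
      simpa using this
    rw [this, ecost_zero, ecost_zero]
  | succ k ih =>
    have hν : ν ≠ 0 := by rintro rfl; simp at hk
    obtain ⟨j, hj, e⟩ := (ecost_isLeast (I := I) ms' hν).1
    refine ((ecost_isLeast (I := I) ms hν).2 ⟨j, hj, rfl⟩).trans ?_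
    rw [e]
    have hst : I.startTime j ms ≤ I.startTime j ms' := nextPt_mono hE (isGrp_grp j) (headD_mono h)
    have hd : ∑ i, dec ν j i = k := by have := sum_dec hj; omega
    obtain ⟨hq0, hq1⟩ := nextProb_mem (I := I) j (ν j)
    have hw := map_max_mono h hst
    have hl : I.ecost (I.longProfile j ms) (dec ν j) ≤ I.ecost (I.longProfile j ms') (dec ν j) := by
      refine ih (orderedInsert_mono (forall₂_tail hw) ?_ ?_ (release_mono hE j hst)) ?_ ?_ _ hd
      · exact (sorted_map_max hs _).tail
      · exact (sorted_map_max hs' _).tail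
      · exact (sorted_map_max hs _).tail.orderedInsert _ _
      · exact (sorted_map_max hs' _).tail.orderedInsert _ _
    have hsh : I.ecost (I.waitProfile j ms) (dec ν j) ≤ I.ecost (I.waitProfile j ms') (dec ν j) :=
      ih hw (sorted_map_max hs _) (sorted_map_max hs' _) _ hd
    unfold startCost
    have : 0 ≤ 1 - I.nextProb j (ν j) := by linarith
    gcongr

/-! ### Profiles of histories -/

theorem profile_sorted (es : List I.Event) : (I.profile es).Pairwise (· ≤ ·) :=
  List.pairwise_insertionSort _ _

theorem profile_perm (es : List I.Event) :
    (I.profile es).Perm ((List.finRange I.m).map (I.load es)) := List.perm_insertionSort _ _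

theorem profile_nil : I.profile [] = I.profileInit := by
  refine (List.Perm.eq_of_pairwise' (r := (· ≤ ·)) (profile_sorted _) ?_
    (profile_perm [])).trans ?_
  · simp [load]
  · simp [load, profileInit, List.map_const']

theorem perm_finRange_cons {m : ℕ} (i : Fin m) :
    (List.finRange m).Perm (i :: (List.finRange m).erase i) :=
  List.perm_cons_erase (List.mem_finRange i)

/-- The profile after a job has been started at time `s` on a machine that was available. -/
theorem profile_cons_short {es : List I.Event} {e : I.Event} (he : e.long = false) :
    I.profile (e :: es) = (I.profile es).map (max e.start) := by
  refine List.Perm.eq_of_pairwise' (r := (· ≤ ·)) (profile_sorted _)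
    (sorted_map_max (profile_sorted es) _) ?_
  refine (profile_perm _).trans ?_
  refine List.Perm.trans ?_ ((profile_perm es).map _).symm
  rw [List.map_map]
  refine List.Perm.of_eq (List.map_congr_left fun i _ => ?_)
  simp [load, he, max_comm]

theorem headD_profile_le (es : List I.Event) (i : Fin I.m) : (I.profile es).headD 0 ≤ I.load es i := by
  have h1 : I.load es i ∈ I.profile es :=
    (profile_perm es).mem_iff.2 (List.mem_map.2 ⟨i, List.mem_finRange i, rfl⟩)
  have h2 := profile_sorted es
  revert h1 h2
  generalize I.profile es = L
  intro h1 h2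
  cases L with
  | nil => simp at h1
  | cons a t =>
    rcases List.mem_cons.1 h1 with h | h
    · exact h.ge
    · exact (List.pairwise_cons.1 h2).1 _ h

/-- Both sides are sorted, so they need only be permutations of each other. After waiting, the
chosen machine has load exactly `e.start`, which is the minimum; removing the head thus amounts to
removing this machine, whatever ties there are. -/
theorem profile_cons_long {es : List I.Event} {e : I.Event} (he : e.long = true)
    (hle : I.load es e.mach ≤ e.start) (hr : e.start ≤ I.release e.job.1 e.start) :
    I.profile (e :: es) = ((I.profile es).map (max e.start)).tail.orderedInsert (· ≤ ·)
      (I.release e.job.1 e.start) := by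
  have hs := sorted_map_max (profile_sorted es) e.start
  refine List.Perm.eq_of_pairwise' (r := (· ≤ ·)) (profile_sorted _)
    (hs.tail.orderedInsert _ _) ?_
  refine (profile_perm _).trans ?_
  refine List.Perm.trans ?_ (List.perm_orderedInsert _ _ _).symm
  have h1 : ((I.profile es).map (max e.start)).Perm
      (e.start :: ((List.finRange I.m).erase e.mach).map fun i => max e.start (I.load es i)) := by
    refine ((profile_perm es).map _).trans ?_
    rw [List.map_map]
    refine ((perm_finRange_cons e.mach).map _).trans (List.Perm.of_eq ?_)
    rw [List.map_cons]
    congr 1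
    exact max_eq_left hle
  have h2 : (I.profile es).map (max e.start) =
      e.start :: ((I.profile es).map (max e.start)).tail := by
    have hmem : e.start ∈ (I.profile es).map (max e.start) := h1.mem_iff.2 (by simp)
    have hge : ∀ x ∈ (I.profile es).map (max e.start), e.start ≤ x := by
      intro x hx
      obtain ⟨y, -, rfl⟩ := List.mem_map.1 hx
      exact le_max_left _ _
    revert hmem hge hs
    generalize (I.profile es).map (max e.start) = L
    intro hs hmem hge
    cases L with
    | nil => simp at hmem
    | cons a t =>
      rw [List.tail_cons]
      congr 1
      refine le_antisymm ?_ (hge a (by simp))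
      rcases List.mem_cons.1 hmem with h | h
      · exact h.ge
      · exact (List.pairwise_cons.1 hs).1 _ h
  rw [h2] at h1
  have h3 := (List.perm_cons _).1 h1
  refine List.Perm.trans ?_ (h3.symm.cons _)
  refine ((perm_finRange_cons e.mach).map _).trans (List.Perm.of_eq ?_)
  rw [List.map_cons]
  congr 1
  · simp only [load, he, and_self, if_true]
    exact max_eq_right (hle.trans hr)
  · refine List.map_congr_left fun i hi => ?_
    have : e.mach ≠ i := by
      rintro rfl
      exact (List.nodup_finRange _).not_mem_erase hi
    simp [load, this, max_comm]

theorem start_le_release (hE : 3 ≤ E) (j : Fin n) (s : ℚ) : s + I.p j ≤ I.release j s :=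
  (le_max_right _ _).trans (le_nextPt hE (isGrp_grp j) _)

/-- The numbers of leftover jobs. -/
def left (I : Instance n E) (es : List I.Event) (j : Fin n) : ℕ := I.Nj j - I.started es j

theorem left_cons (e : I.Event) (es : List I.Event) :
    I.left (e :: es) = dec (I.left es) e.job.1 := by
  funext j
  unfold left dec started
  by_cases h : j = e.job.1
  · subst h
    simp only [List.countP_cons, Function.update_self, decide_true, if_true]
    omega
  · rw [Function.update_of_ne h, List.countP_cons, if_neg (by simpa using fun h' => h h'.symm)]
    rfl

theorem left_nil : I.left [] = I.Nj := by
  funext j; simp [left, started]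

/-! ### Averaging over realizations -/

/-- A run consults the realization only at jobs that it has started. -/
theorem run_update {pol : I.Policy} {ω : I.Realization} {k : ℕ} {J : I.Job} {b : Bool}
    (hJ : ∀ e ∈ I.run pol ω k, e.job ≠ J) :
    I.run pol (Function.update ω J b) k = I.run pol ω k := by
  induction k with
  | zero => rfl
  | succ k ih =>
    simp only [run] at hJ ⊢
    have hJ' : ∀ e ∈ I.run pol ω k, e.job ≠ J := by
      intro e he
      refine hJ e ?_
      split
      · exact he
      · exact List.mem_cons_of_mem _ he
    rw [ih hJ']
    split
    · rfl
    · rename_i J' i s heq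
      rw [heq] at hJ
      have : J' ≠ J := hJ ⟨J', i, s, ω J'⟩ (by simp)
      rw [Function.update_of_ne this]

/-- Flipping the outcome of the job that is about to start is an involution `σ` on the realizations,
since it leaves the history and hence the choice of the job unchanged. Within each pair `ω`, `σ ω`
the remaining factor `r` of the probability is the same, and the two terms add up alike on both
sides. -/
theorem sum_prob_step {pol : I.Policy} {k : ℕ} (nxt : List I.Event → I.Job)
    (hnxt : ∀ ω, ∀ e ∈ I.run pol ω k, e.job ≠ nxt (I.run pol ω k))
    (f : List I.Event → Bool → ℚ) :
    ∑ ω : I.Realization, I.prob ω * f (I.run pol ω k) (ω (nxt (I.run pol ω k))) =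
      ∑ ω : I.Realization, I.prob ω *
        (I.q (nxt (I.run pol ω k)) * f (I.run pol ω k) true +
          (1 - I.q (nxt (I.run pol ω k))) * f (I.run pol ω k) false) := by
  classical
  let σ : I.Realization → I.Realization := fun ω =>
    Function.update ω (nxt (I.run pol ω k)) (!ω (nxt (I.run pol ω k)))
  have hrun : ∀ ω, I.run pol (σ ω) k = I.run pol ω k := fun ω => run_update (hnxt ω)
  have hinv : Function.Involutive σ := by
    intro ω
    simp only [σ]
    rw [run_update (hnxt ω)]
    simp
  let r : I.Realization → ℚ := fun ω =>
    ∏ J ∈ Finset.univ.erase (nxt (I.run pol ω k)), if ω J then I.q J else 1 - I.q J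
  have hprob : ∀ ω, I.prob ω = (if ω (nxt (I.run pol ω k)) then I.q (nxt (I.run pol ω k))
      else 1 - I.q (nxt (I.run pol ω k))) * r ω := fun ω =>
    (Finset.mul_prod_erase _ _ (Finset.mem_univ _)).symm
  have hr : ∀ ω, r (σ ω) = r ω := by
    intro ω
    simp only [r, hrun]
    refine Finset.prod_congr rfl fun J hJ => ?_
    have := Finset.ne_of_mem_erase hJ
    have e : σ ω J = ω J := Function.update_of_ne this _ _
    simp only [e]
  have hval : ∀ ω, σ ω (nxt (I.run pol ω k)) = !ω (nxt (I.run pol ω k)) := fun ω => by simp [σ]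
  have hsum : ∀ F : I.Realization → ℚ, ∑ ω, F ω = ∑ ω, F (σ ω) := fun F =>
    (Equiv.sum_comp (Function.Involutive.toPerm σ hinv) F).symm
  have h2 : ∀ F G : I.Realization → ℚ, (∀ ω, F ω + F (σ ω) = G ω + G (σ ω)) →
      ∑ ω, F ω = ∑ ω, G ω := by
    intro F G h
    have h3 := hsum F
    have h4 := hsum G
    have h5 : ∑ ω, F ω + ∑ ω, F (σ ω) = ∑ ω, G ω + ∑ ω, G (σ ω) := by
      rw [← Finset.sum_add_distrib, ← Finset.sum_add_distrib]
      exact Finset.sum_congr rfl fun ω _ => h ω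
    linarith
  refine h2 _ _ fun ω => ?_
  have h3 := hprob ω
  have h4 := hprob (σ ω)
  rw [hrun, hval, hr] at h4
  rw [hrun, hval, h3, h4]
  cases ω (nxt (I.run pol ω k)) <;> simp <;> ring

theorem sum_prob : ∑ ω : I.Realization, I.prob ω = 1 := by
  classical
  unfold prob
  have := (Fintype.prod_sum (fun (J : I.Job) (b : Bool) => if b then I.q J else 1 - I.q J)).symm
  simp only [Fintype.sum_bool] at this
  rw [this]
  simp

theorem q_mem (J : I.Job) : 0 ≤ I.q J ∧ I.q J ≤ 1 := by
  have := I.probs_mem J.1 (I.q J) (List.get_mem _ _)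
  exact ⟨this.1.le, this.2⟩

theorem prob_nonneg (ω : I.Realization) : 0 ≤ I.prob ω := by
  refine Finset.prod_nonneg fun J _ => ?_
  have := q_mem J
  split_ifs <;> linarith

/-- The costs so far plus the value of the current cell. -/
noncomputable def potential (I : Instance n E) (es : List I.Event) : ℚ :=
  (es.map Event.compl).sum + I.ecost (I.profile es) (I.left es)

theorem card_job : Fintype.card I.Job = I.N := by
  simp [N, Nj, Fintype.card_sigma]

end Instance

end BernoulliSched

namespace BernoulliSched

namespace Instance

variable {n E : ℕ} {I : Instance n E}

/-! ### Every stratified policy is at least as expensive as the value of the initial cell -/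

theorem run_succ {pol : I.Policy} {ω : I.Realization} {k : ℕ} {J : I.Job} {i : Fin I.m} {s : ℚ}
    (h : pol (I.run pol ω k) = some (J, i, s)) :
    I.run pol ω (k + 1) = ⟨J, i, s, ω J⟩ :: I.run pol ω k := by
  simp only [run, h]

theorem run_suffix (pol : I.Policy) (ω : I.Realization) {k k' : ℕ} (h : k ≤ k') :
    I.run pol ω k <:+ I.run pol ω k' := by
  induction k', h using Nat.le_induction with
  | base => exact List.suffix_rfl
  | succ k' _ ih =>
    refine ih.trans ?_
    simp only [run]
    split
    · exact List.suffix_rfl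
    · exact List.suffix_cons _ _

theorem Feasible.length_run {pol : I.Policy} (h : I.Feasible pol) (ω : I.Realization) {k : ℕ}
    (hk : k ≤ I.N) : (I.run pol ω k).length = k := by
  induction k with
  | zero => rfl
  | succ k ih =>
    obtain ⟨J, i, s, h1, -⟩ := h ω k (by omega)
    rw [run_succ h1, List.length_cons, ih (by omega)]

theorem Feasible.nodup_run {pol : I.Policy} (h : I.Feasible pol) (ω : I.Realization) {k : ℕ}
    (hk : k ≤ I.N) : ((I.run pol ω k).map Event.job).Nodup := by
  induction k with
  | zero => exact List.nodup_nil
  | succ k ih =>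
    obtain ⟨J, i, s, h1, -, h2⟩ := h ω k (by omega)
    rw [run_succ h1, List.map_cons, List.nodup_cons]
    refine ⟨?_, ih (by omega)⟩
    intro h3
    obtain ⟨e, he, h4⟩ := List.mem_map.1 h3
    exact (h2 e he).1 h4

theorem Feasible.exists_mem_run {pol : I.Policy} (h : I.Feasible pol) (ω : I.Realization)
    (J : I.Job) : ∃ e ∈ I.run pol ω I.N, e.job = J := by
  classical
  have h1 : ((I.run pol ω I.N).map Event.job).toFinset = Finset.univ := by
    rw [← Finset.card_eq_iff_eq_univ, List.toFinset_card_of_nodup (h.nodup_run ω le_rfl),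
      List.length_map, h.length_run ω le_rfl, card_job]
  have h2 : J ∈ ((I.run pol ω I.N).map Event.job).toFinset := by rw [h1]; simp
  simpa using h2

theorem load_le {es : List I.Event} {i : Fin I.m} {s : ℚ} (h0 : 0 ≤ s) (h1 : ∀ e ∈ es, e.start ≤ s)
    (h2 : ∀ e ∈ es, e.mach = i → e.long = true → I.release e.job.1 e.start ≤ s) :
    I.load es i ≤ s := by
  induction es with
  | nil => exact h0
  | cons e es ih =>
    refine max_le (ih (fun e he => h1 e (by simp [he])) fun e he => h2 e (by simp [he])) ?_
    split_ifs with h3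
    · exact h2 e (by simp) h3.1 h3.2
    · exact h1 e (by simp)

theorem pairwise_of_suffix_cons {α : Type*} {R : α → α → Prop} {l es : List α} {e : α}
    (h : l.Pairwise R) (hs : e :: es <:+ l) :
    (∀ x ∈ es, R e x) ∧ ∀ x ∈ l, x ∉ es → x ≠ e → R x e := by
  obtain ⟨pre, rfl⟩ := hs
  rw [List.pairwise_append] at h
  refine ⟨fun x hx => (List.pairwise_cons.1 h.2.1).1 x hx, fun x hx h1 h2 => ?_⟩
  rcases List.mem_append.1 hx with h3 | h3
  · exact h.2.2 x h3 e (by simp)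
  · simp [h1, h2] at h3

/-- A stratified policy starts the jobs of each type in order, at start points, on machines that are
available. -/
theorem Stratified.next {pol : I.Policy} (h : I.Feasible pol) (h' : I.Stratified pol)
    (ω : I.Realization) {k : ℕ} (hk : k < I.N) {J : I.Job} {i : Fin I.m} {s : ℚ}
    (hp : pol (I.run pol ω k) = some (J, i, s)) :
    (J.2 : ℕ) = I.started (I.run pol ω k) J.1 ∧ s ∈ I.Q (I.grp J.1) ∧
      I.load (I.run pol ω k) i ≤ s := by
  classical
  obtain ⟨J', i', s', hp', h0, hf⟩ := h ω k hk
  rw [hp] at hp'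
  obtain ⟨rfl, rfl, rfl⟩ : J = J' ∧ i = i' ∧ s = s' := by simpa using hp'
  obtain ⟨hs1, hs2, hs3⟩ := h' ω
  have hsuf : (⟨J, i, s, ω J⟩ :: I.run pol ω k) <:+ I.run pol ω I.N := by
    rw [← run_succ hp]; exact run_suffix pol ω hk
  have hmem : (⟨J, i, s, ω J⟩ : I.Event) ∈ I.run pol ω I.N := hsuf.mem (by simp)
  obtain ⟨hpw1, hpw2⟩ := pairwise_of_suffix_cons hs3 hsuf
  refine ⟨?_, hs1 _ hmem, ?_⟩
  · set es := I.run pol ω k with hes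
    have hnd : (((es.filter fun e => decide (e.job.1 = J.1)).map fun e => (e.job.2 : ℕ))).Nodup := by
      have h1 := h.nodup_run ω hk.le
      rw [List.Nodup, List.pairwise_map] at h1 ⊢
      refine (List.Pairwise.imp_of_mem ?_ (h1.filter _))
      intro a b ha hb hab h3
      have ha' : a.job.1 = J.1 := by simpa using (List.mem_filter.1 ha).2
      have hb' : b.job.1 = J.1 := by simpa using (List.mem_filter.1 hb).2
      apply hab
      generalize a.job = x at *
      generalize b.job = y at *
      obtain ⟨x1, x2⟩ := x
      obtain ⟨y1, y2⟩ := y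
      simp only at ha' hb'
      subst ha'
      subst hb'
      exact congrArg _ (Fin.ext h3)
    -- Jobs started earlier have smaller indices. Conversely, a job of smaller index must have been
    -- started already, as otherwise it would follow later in the complete run, against the order of
    -- indices.
    have hset : (((es.filter fun e => decide (e.job.1 = J.1)).map fun e => (e.job.2 : ℕ))).toFinset =
        Finset.range J.2 := by
      ext c
      simp only [List.mem_toFinset, List.mem_map, List.mem_filter, decide_eq_true_eq,
        Finset.mem_range]
      constructor
      · rintro ⟨e, ⟨he, h1⟩, rfl⟩
        exact hpw1 e he h1.symm
      · intro hc
        obtain ⟨e, he, h1⟩ := h.exists_mem_run ω (⟨J.1, ⟨c, hc.trans J.2.2⟩⟩ : I.Job)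
        refine ⟨e, ⟨?_, by rw [h1]⟩, by rw [h1]⟩
        by_contra h2
        have h3 := hpw2 e he h2 (by
          rintro rfl
          simp only at h1
          rw [h1] at hc
          simp at hc) (by rw [h1])
        rw [h1] at h3
        simp only at h3
        omega
    have hcard := congrArg Finset.card hset
    rw [List.toFinset_card_of_nodup hnd, List.length_map, ← List.countP_eq_length_filter,
      Finset.card_range] at hcard
    exact hcard.symm
  -- Stratification restricts only starts that are not before the completion of the long job;
  -- feasibility guarantees that this holds on the same machine.
  · refine load_le h0 (fun e he => (hf e he).2.1) fun e he h1 h2 => ?_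
    exact hs2 e (hsuf.mem (by simp [he])) h2 _ hmem h1.symm ((hf e he).2.2 h1)

theorem nextProb_eq_q {es : List I.Event} {J : I.Job} (h : (J.2 : ℕ) = I.started es J.1) :
    I.nextProb J.1 (I.left es J.1) = I.q J := by
  have h1 : I.Nj J.1 - I.left es J.1 = J.2 := by
    unfold left
    have : (J.2 : ℕ) < I.Nj J.1 := J.2.2
    omega
  unfold nextProb q
  rw [h1, List.getD_eq_getElem _ _ J.2.2]
  rfl

theorem left_pos {es : List I.Event} {J : I.Job} (h : (J.2 : ℕ) = I.started es J.1) :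
    0 < I.left es J.1 := by
  have : (J.2 : ℕ) < I.Nj J.1 := J.2.2
  unfold left
  omega

theorem ne_zero_of_pos {ν : Fin n → ℕ} {j : Fin n} (h : 0 < ν j) : ν ≠ 0 := by
  rintro rfl; simp at h

/-- One start under a policy, averaged over the realization of the started job. -/
theorem potential_step (hE : 3 ≤ E) {es : List I.Event} {J : I.Job} {i : Fin I.m} {s : ℚ}
    (hJ : (J.2 : ℕ) = I.started es J.1) (hs : s ∈ I.Q (I.grp J.1)) (hl : I.load es i ≤ s) :
    I.potential es ≤ I.q J * I.potential (⟨J, i, s, true⟩ :: es) +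
        (1 - I.q J) * I.potential (⟨J, i, s, false⟩ :: es) ∧
      (s = I.startTime J.1 (I.profile es) →
        I.startCost I.ecost (I.profile es) (I.left es) J.1 = I.ecost (I.profile es) (I.left es) →
        I.potential es = I.q J * I.potential (⟨J, i, s, true⟩ :: es) +
          (1 - I.q J) * I.potential (⟨J, i, s, false⟩ :: es)) := by
  have hlp := left_pos hJ
  have hp := I.p_pos J.1
  have hr := start_le_release (I := I) hE J.1 s
  have hL : I.profile (⟨J, i, s, true⟩ :: es) = _ := profile_cons_long rfl hl (by simp only; linarith)
  have hS : I.profile (⟨J, i, s, false⟩ :: es) = _ := profile_cons_short rfl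
  have hmin := (ecost_isLeast (I := I) (I.profile es) (ne_zero_of_pos hlp)).2 ⟨J.1, hlp, rfl⟩
  unfold potential
  rw [left_cons, left_cons, hL, hS]
  simp only [List.map_cons, List.sum_cons, Event.compl, if_true, Bool.false_eq_true, if_false, add_zero]
  obtain ⟨hq0, hq1⟩ := q_mem J
  constructor
  · have hst : I.startTime J.1 (I.profile es) ≤ s :=
      nextPt_le hE (isGrp_grp _) hs ((headD_profile_le es i).trans hl)
    have hid : List.Forall₂ (· ≤ ·) (I.profile es) (I.profile es) :=
      List.forall₂_same.2 fun _ _ => le_rfl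
    have hw := map_max_mono hid hst
    have hso := sorted_map_max (profile_sorted es)
    have h1 : I.ecost (I.longProfile J.1 (I.profile es)) (dec (I.left es) J.1) ≤ _ :=
      ecost_mono hE (orderedInsert_mono (forall₂_tail hw) (hso _).tail (hso _).tail
        (release_mono hE J.1 hst)) ((hso _).tail.orderedInsert _ _)
        ((hso _).tail.orderedInsert _ _) (dec (I.left es) J.1)
    have h2 : I.ecost (I.waitProfile J.1 (I.profile es)) (dec (I.left es) J.1) ≤ _ :=
      ecost_mono hE hw (hso _) (hso _) (dec (I.left es) J.1)
    have hc : I.startCost I.ecost (I.profile es) (I.left es) J.1 ≤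
        I.q J * (I.ecost (((I.profile es).map (max s)).tail.orderedInsert (· ≤ ·)
          (I.release J.1 s)) (dec (I.left es) J.1) + (s + I.p J.1)) +
        (1 - I.q J) * (I.ecost ((I.profile es).map (max s)) (dec (I.left es) J.1) + s) := by
      unfold startCost
      rw [nextProb_eq_q hJ]
      have : 0 ≤ 1 - I.q J := by linarith
      gcongr
    linarith
  · intro h1 h2
    rw [← h2]
    unfold startCost longProfile waitProfile
    rw [nextProb_eq_q hJ, ← h1]
    ring

theorem left_eq_zero {es : List I.Event} (h1 : ∀ j, I.started es j ≤ I.Nj j)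
    (h2 : es.length = I.N) : I.left es = 0 := by
  have h3 : ∑ j, I.started es j = es.length := by
    clear h1 h2
    induction es with
    | nil => simp [started]
    | cons e es ih =>
      rw [List.length_cons, ← ih]
      simp only [started, List.countP_cons, Finset.sum_add_distrib]
      simp
  have h4 : ∀ j ∈ Finset.univ, I.started es j = I.Nj j :=
    (Finset.sum_eq_sum_iff_of_le fun j _ => h1 j).1 (by rw [h3, h2]; rfl)
  funext j
  simp [left, h4 j (Finset.mem_univ j)]

theorem Feasible.started_le {pol : I.Policy} (h : I.Feasible pol) (ω : I.Realization) {k : ℕ}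
    (hk : k ≤ I.N) (j : Fin n) : I.started (I.run pol ω k) j ≤ I.Nj j := by
  classical
  have h1 : I.started (I.run pol ω k) j =
      (((I.run pol ω k).map Event.job).filter fun J => decide (J.1 = j)).length := by
    rw [started, List.filter_map, List.length_map, List.countP_eq_length_filter]
    rfl
  rw [h1, ← List.toFinset_card_of_nodup ((h.nodup_run ω hk).filter _)]
  calc _ ≤ (Finset.univ.image fun c : Fin (I.probs j).length => (⟨j, c⟩ : I.Job)).card := by
        refine Finset.card_le_card fun J hJ => ?_
        simp only [List.mem_toFinset, List.mem_filter, decide_eq_true_eq] at hJ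
        obtain ⟨J1, J2⟩ := J
        obtain rfl := hJ.2
        simp
    _ ≤ _ := Finset.card_image_le.trans (by simp [Nj])

/-- After the last start no job is left over, so the value of the cell vanishes and the potential is
the realized cost. -/
theorem expCost_eq {pol : I.Policy} (h : I.Feasible pol) :
    I.expCost pol = ∑ ω : I.Realization, I.prob ω * I.potential (I.run pol ω I.N) := by
  refine Finset.sum_congr rfl fun ω _ => ?_
  rw [potential, left_eq_zero (h.started_le ω le_rfl) (h.length_run ω le_rfl), ecost_zero, add_zero]

theorem sum_potential_zero (pol : I.Policy) :
    ∑ ω : I.Realization, I.prob ω * I.potential (I.run pol ω 0) = I.ecost I.profileInit I.Nj := by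
  simp only [run, potential, profile_nil, left_nil, List.map_nil, List.sum_nil, zero_add]
  rw [← Finset.sum_mul, sum_prob, one_mul]

/-- The job and the machine and the time that are chosen. -/
theorem sum_potential_succ {pol : I.Policy} (h : I.Feasible pol) {k : ℕ} (hk : k < I.N) :
    ∃ nxt : List I.Event → I.Job × Fin I.m × ℚ,
      (∀ ω, pol (I.run pol ω k) = some (nxt (I.run pol ω k))) ∧
      ∑ ω : I.Realization, I.prob ω * I.potential (I.run pol ω (k + 1)) =
        ∑ ω : I.Realization, I.prob ω *
          (I.q (nxt (I.run pol ω k)).1 * I.potential (⟨(nxt (I.run pol ω k)).1,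
            (nxt (I.run pol ω k)).2.1, (nxt (I.run pol ω k)).2.2, true⟩ :: I.run pol ω k) +
          (1 - I.q (nxt (I.run pol ω k)).1) * I.potential (⟨(nxt (I.run pol ω k)).1,
            (nxt (I.run pol ω k)).2.1, (nxt (I.run pol ω k)).2.2, false⟩ :: I.run pol ω k)) := by
  classical
  -- A default that is never used on the runs considered; it only makes the choice function total.
  obtain ⟨J₀, i₀, s₀, -⟩ := h (fun _ => true) k hk
  let nxt : List I.Event → I.Job × Fin I.m × ℚ := fun es => (pol es).getD (J₀, i₀, s₀)
  have hnxt : ∀ ω, pol (I.run pol ω k) = some (nxt (I.run pol ω k)) := by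
    intro ω
    obtain ⟨J, i, s, h1, -⟩ := h ω k hk
    simp only [nxt]
    rw [h1]
    rfl
  refine ⟨nxt, hnxt, ?_⟩
  have h1 : ∀ ω, I.run pol ω (k + 1) = ⟨(nxt (I.run pol ω k)).1, (nxt (I.run pol ω k)).2.1,
      (nxt (I.run pol ω k)).2.2, ω (nxt (I.run pol ω k)).1⟩ :: I.run pol ω k :=
    fun ω => run_succ (hnxt ω)
  rw [Finset.sum_congr rfl fun ω _ => by rw [h1 ω]]
  exact sum_prob_step (fun es => (nxt es).1) (fun ω e he => by
    obtain ⟨J, i, s, h2, -, h3⟩ := h ω k hk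
    rw [hnxt ω] at h2
    have : (nxt (I.run pol ω k)).1 = J := by rw [Option.some.inj h2]
    rw [this]
    exact (h3 e he).1) fun es b => I.potential (⟨(nxt es).1, (nxt es).2.1, (nxt es).2.2, b⟩ :: es)

/-- The expected potential starts at the value of the initial cell, ends at the expected cost, and
never decreases in between. -/
theorem ecost_le_expCost (hE : 3 ≤ E) {pol : I.Policy} (h : I.Feasible pol) (h' : I.Stratified pol) :
    I.ecost I.profileInit I.Nj ≤ I.expCost pol := by
  rw [expCost_eq h]
  have key : ∀ k ≤ I.N, I.ecost I.profileInit I.Nj ≤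
      ∑ ω : I.Realization, I.prob ω * I.potential (I.run pol ω k) := by
    intro k
    induction k with
    | zero => intro _; exact (sum_potential_zero pol).ge
    | succ k ih =>
      intro hk
      obtain ⟨nxt, h1, h2⟩ := sum_potential_succ h (show k < I.N from hk)
      rw [h2]
      refine (ih (by omega)).trans (Finset.sum_le_sum fun ω _ => ?_)
      obtain ⟨a, b, c⟩ := Stratified.next h h' ω hk (h1 ω)
      exact mul_le_mul_of_nonneg_left (potential_step hE a b c).1 (prob_nonneg ω)
  exact key _ le_rfl

/-! ### The policy that is described by a table -/

/-- Histories that result from optimal decisions. -/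
inductive Hist (I : Instance n E) : List I.Event → Prop
  | nil : Hist I []
  | cons (es : List I.Event) (J : I.Job) (i : Fin I.m) (b : Bool) : Hist I es →
      (J.2 : ℕ) = I.started es J.1 → (∀ i', I.load es i ≤ I.load es i') →
      Hist I (⟨J, i, I.startTime J.1 (I.profile es), b⟩ :: es)

theorem headD_profile_eq {es : List I.Event} {i : Fin I.m} (h : ∀ i', I.load es i ≤ I.load es i') :
    (I.profile es).headD 0 = I.load es i := by
  refine le_antisymm (headD_profile_le es i) ?_
  have h1 := profile_perm es
  have h2 : I.profile es ≠ [] := by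
    intro h3
    rw [h3] at h1
    have h4 := h1.length_eq
    have := I.m_pos
    simp at h4
    omega
  obtain ⟨a, t, h3⟩ := List.exists_cons_of_ne_nil h2
  have h4 : a ∈ (List.finRange I.m).map (I.load es) := h1.mem_iff.1 (by simp [h3])
  obtain ⟨i', -, rfl⟩ := List.mem_map.1 h4
  rw [h3]
  exact h i'

theorem startTime_mem (hE : 3 ≤ E) (j : Fin n) (ms : List ℚ) :
    I.startTime j ms ∈ I.Q (I.grp j) := nextPt_mem hE (isGrp_grp j) _

theorem load_le_startTime (hE : 3 ≤ E) {es : List I.Event} {i : Fin I.m} (j : Fin n)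
    (h : ∀ i', I.load es i ≤ I.load es i') : I.load es i ≤ I.startTime j (I.profile es) := by
  rw [← headD_profile_eq h]
  exact le_nextPt hE (isGrp_grp j) _

theorem le_load {es : List I.Event} {e : I.Event} (he : e ∈ es) (i : Fin I.m) :
    (e.start ≤ I.load es i ∨ e.mach = i ∧ e.long = true) ∧
      (e.mach = i → e.long = true → I.release e.job.1 e.start ≤ I.load es i) := by
  induction es with
  | nil => simp at he
  | cons e' es ih =>
    rcases List.mem_cons.1 he with rfl | he
    · simp only [load]
      constructor
      · split_ifs with h
        · exact Or.inr h
        · exact Or.inl (le_max_right _ _)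
      · intro h1 h2
        rw [if_pos ⟨h1, h2⟩]
        exact le_max_right _ _
    · obtain ⟨h1, h2⟩ := ih he
      exact ⟨h1.imp_left fun h => h.trans (le_max_left _ _),
        fun h3 h4 => (h2 h3 h4).trans (le_max_left _ _)⟩

/-- Each start raises the loads of all machines, not only of its own. So a start that respects the
load of its machine also respects the order of the starts. -/
theorem start_le_load (hE : 3 ≤ E) {es : List I.Event} {e : I.Event} (he : e ∈ es) (i : Fin I.m) :
    e.start ≤ I.load es i := by
  obtain ⟨h1, h2⟩ := le_load he i
  rcases h1 with h1 | ⟨h1, h3⟩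
  · exact h1
  · have := start_le_release (I := I) hE e.job.1 e.start
    have := I.p_pos e.job.1
    have := h2 h1 h3
    linarith

theorem compl_le_load (hE : 3 ≤ E) {es : List I.Event} {e : I.Event} (he : e ∈ es) :
    e.compl ≤ I.load es e.mach := by
  unfold Event.compl
  split_ifs with h
  · exact (start_le_release hE _ _).trans ((le_load he e.mach).2 rfl h)
  · rw [add_zero]; exact start_le_load hE he _

theorem Hist.reach (hE : 3 ≤ E) {es : List I.Event} (h : I.Hist es) :
    I.Reach (I.profile es, I.left es) := by
  induction h with
  | nil => rw [profile_nil, left_nil]; exact .init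
  | cons es J i b _ hJ hi ih =>
    have hle := load_le_startTime hE J.1 hi
    rw [left_cons]
    cases b with
    | false =>
      rw [profile_cons_short rfl]
      exact .short _ _ J.1 ih (left_pos hJ)
    | true =>
      have := start_le_release (I := I) hE J.1 (I.startTime J.1 (I.profile es))
      have := I.p_pos J.1
      rw [profile_cons_long rfl hle (by simp only; linarith)]
      exact .long _ _ J.1 ih (left_pos hJ)

theorem Hist.job_lt {es : List I.Event} (h : I.Hist es) :
    (∀ e ∈ es, (e.job.2 : ℕ) < I.started es e.job.1) ∧
      es.Pairwise fun later earlier => later.job.1 = earlier.job.1 →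
        (earlier.job.2 : ℕ) < later.job.2 := by
  induction h with
  | nil => simp
  | cons es J i b _ hJ hi ih =>
    constructor
    · intro e he
      rw [started, List.countP_cons]
      rcases List.mem_cons.1 he with rfl | he
      · simp only [decide_true, if_true]
        change _ < I.started es J.1 + 1
        omega
      · exact (ih.1 e he).trans_le (Nat.le_add_right _ _)
    · rw [List.pairwise_cons]
      refine ⟨fun e he h1 => ?_, ih.2⟩
      simp only at h1 ⊢
      rw [hJ, h1]
      exact ih.1 e he

theorem Hist.stratified (hE : 3 ≤ E) {es : List I.Event} (h : I.Hist es) :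
    (∀ e ∈ es, e.start ∈ I.Q (I.grp e.job.1)) ∧
    ∀ e ∈ es, e.long = true → ∀ e' ∈ es, e'.mach = e.mach →
      e.compl ≤ e'.start → I.release e.job.1 e.start ≤ e'.start := by
  induction h with
  | nil => simp
  | cons es J i b _ hJ hi ih =>
    have hle := load_le_startTime hE J.1 hi
    constructor
    · intro e he
      rcases List.mem_cons.1 he with rfl | he
      · exact startTime_mem hE _ _
      · exact ih.1 e he
    · intro e he hl e' he' hm hc
      rcases List.mem_cons.1 he with rfl | he
      -- The latest job is long and completes after its start, but no start of the history is later
      -- than that.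
      · exfalso
        have h1 : e'.start ≤ I.startTime J.1 (I.profile es) := by
          rcases List.mem_cons.1 he' with rfl | he'
          · exact le_rfl
          · exact (start_le_load hE he' i).trans hle
        have := I.p_pos J.1
        simp only at hl
        simp only [Event.compl, hl, if_true] at hc
        linarith
      · rcases List.mem_cons.1 he' with rfl | he'
        · simp only at hm ⊢
          exact ((le_load he i).2 hm.symm hl).trans hle
        · exact ih.2 e he hl e' he' hm hc

theorem key_injective : Function.Injective (key (n := n)) := by
  intro ν ν' h
  have := List.ofFn_injective h
  funext j
  have := congrFun this j
  exact_mod_cast this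

/-- The current cell is reachable and has leftover jobs, so it has a row. Every row with this key
carries an optimal decision, so it does not matter which one the search returns. -/
theorem Hist.tablePolicy {T : List Row} (hT : I.IsTable T) (hE : 3 ≤ E) {es : List I.Event}
    (h : I.Hist es) (hlen : es.length < I.N) :
    ∃ (J : I.Job) (i : Fin I.m), I.tablePolicy T es = some (J, i, I.startTime J.1 (I.profile es)) ∧
      (J.2 : ℕ) = I.started es J.1 ∧ (∀ i', I.load es i ≤ I.load es i') ∧
      I.startCost I.ecost (I.profile es) (I.left es) J.1 = I.ecost (I.profile es) (I.left es) := by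
  have hν : I.left es ≠ 0 := by
    intro h0
    have h3 : ∑ j, I.started es j = es.length := by
      clear h0 hlen h
      induction es with
      | nil => simp [started]
      | cons e es ih =>
        rw [List.length_cons, ← ih]
        simp only [started, List.countP_cons, Finset.sum_add_distrib]
        simp
    have h4 : I.N ≤ ∑ j, I.started es j := Finset.sum_le_sum fun j _ => by
      have := congrFun h0 j
      simp only [left, Pi.zero_apply] at this
      omega
    omega
  obtain ⟨r₀, hr₀, e₀⟩ := hT.2 _ _ (h.reach hE) hν
  have hfind : ∃ r ∈ T, r.1 = (I.profile es, key (I.left es)) ∧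
      (T.find? fun r => decide (r.1 = (I.profile es, key fun j : Fin n => I.Nj j - I.started es j))) =
        some r := by
    cases h1 : T.find? fun r =>
      decide (r.1 = (I.profile es, key fun j : Fin n => I.Nj j - I.started es j)) with
    | none =>
      rw [List.find?_eq_none] at h1
      exact absurd (decide_eq_true e₀) (h1 r₀ hr₀)
    | some r =>
      refine ⟨r, List.mem_of_find?_eq_some h1, ?_, rfl⟩
      have h2 := List.find?_some h1
      exact of_decide_eq_true h2
  obtain ⟨r, hr, e1, hfr⟩ := hfind
  obtain ⟨ms, ν, j, hreach, hj, hopt, e2⟩ := hT.1 r hr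
  rw [e2] at e1
  simp only [Prod.mk.injEq] at e1
  obtain ⟨rfl, e1⟩ := e1
  have e1 := key_injective e1
  subst e1
  have hfj : ((List.finRange n).find? fun j' : Fin n => decide (((j' : ℕ) : ℚ) = r.2.1)) = some j := by
    rw [e2]
    cases h1 : (List.finRange n).find? fun j' : Fin n => decide (((j' : ℕ) : ℚ) = ((j : ℕ) : ℚ)) with
    | none =>
      rw [List.find?_eq_none] at h1
      exact absurd (by simp) (h1 j (List.mem_finRange j))
    | some j' =>
      have h2 := List.find?_some h1
      simp only [decide_eq_true_eq, Nat.cast_inj] at h2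
      rw [Fin.ext h2]
  have hst : I.started es j < (I.probs j).length := by
    unfold left Nj at hj; omega
  obtain ⟨i, hi⟩ : ∃ i, (List.finRange I.m).argmin (I.load es) = some i := by
    rw [← Option.ne_none_iff_exists']
    rw [Ne, List.argmin_eq_none]
    intro h1
    have := congrArg List.length h1
    have := I.m_pos
    simp at *
    omega
  refine ⟨⟨j, ⟨I.started es j, hst⟩⟩, i, ?_, rfl, fun i' => ?_, hopt⟩
  · have e3 : r.2.2.1 = I.startTime j (I.profile es) := by rw [e2]
    simp only [Instance.tablePolicy]
    rw [hfr]
    simp only [Option.bind_eq_bind, Option.bind_some]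
    rw [hfj]
    simp only [Option.bind_some]
    rw [hi]
    simp only [Option.bind_some]
    rw [dif_pos hst, e3]
  · exact List.le_of_mem_argmin (List.mem_finRange i') hi

theorem hist_run {T : List Row} (hT : I.IsTable T) (hE : 3 ≤ E) (ω : I.Realization) {k : ℕ}
    (hk : k ≤ I.N) : I.Hist (I.run (I.tablePolicy T) ω k) ∧ (I.run (I.tablePolicy T) ω k).length = k := by
  induction k with
  | zero => exact ⟨.nil, rfl⟩
  | succ k ih =>
    obtain ⟨h1, h2⟩ := ih (by omega)
    obtain ⟨J, i, h3, h4, h5, -⟩ := h1.tablePolicy hT hE (by omega)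
    rw [run_succ h3]
    exact ⟨.cons _ J i _ h1 h4 h5, by simp [h2]⟩

theorem feasible_tablePolicy {T : List Row} (hT : I.IsTable T) (hE : 3 ≤ E) :
    I.Feasible (I.tablePolicy T) := by
  intro ω k hk
  obtain ⟨h1, h2⟩ := hist_run hT hE ω hk.le
  obtain ⟨J, i, h3, h4, h5, -⟩ := h1.tablePolicy hT hE (by omega)
  have hle := load_le_startTime hE J.1 h5
  refine ⟨J, i, _, h3, Q_nonneg hE (isGrp_grp _) (startTime_mem hE _ _), fun e he => ⟨?_, ?_, ?_⟩⟩
  · rintro rfl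
    have := h1.job_lt.1 e he
    omega
  · exact (start_le_load hE he i).trans hle
  · rintro rfl
    exact (compl_le_load hE he).trans hle

/-- Along the runs of the table policy each start is an earliest one of an optimal type, so
`potential_step` holds with equality and the lower bound is attained. -/
theorem optimal_tablePolicy {T : List Row} (hT : I.IsTable T) (hE : 3 ≤ E) :
    I.IsOptimalStratified (I.tablePolicy T) ∧
      I.expCost (I.tablePolicy T) = I.ecost I.profileInit I.Nj := by
  have hF := feasible_tablePolicy hT hE
  have hS : I.Stratified (I.tablePolicy T) := fun ω => by
    obtain ⟨h1, -⟩ := hist_run hT hE ω le_rfl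
    exact ⟨(h1.stratified hE).1, (h1.stratified hE).2, h1.job_lt.2⟩
  have hc : I.expCost (I.tablePolicy T) = I.ecost I.profileInit I.Nj := by
    rw [expCost_eq hF]
    have key : ∀ k ≤ I.N, ∑ ω : I.Realization, I.prob ω * I.potential (I.run (I.tablePolicy T) ω k) =
        I.ecost I.profileInit I.Nj := by
      intro k
      induction k with
      | zero => intro _; exact sum_potential_zero _
      | succ k ih =>
        intro hk
        obtain ⟨nxt, h1, h2⟩ := sum_potential_succ hF (show k < I.N from hk)
        rw [h2, ← ih (by omega)]
        refine Finset.sum_congr rfl fun ω _ => ?_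
        obtain ⟨h3, h4⟩ := hist_run hT hE ω (show k ≤ I.N by omega)
        obtain ⟨J, i, h5, h6, h7, h8⟩ := h3.tablePolicy hT hE (by omega)
        have h9 := h1 ω
        rw [h5] at h9
        rw [← Option.some.inj h9]
        congr 1
        exact ((potential_step hE h6 (startTime_mem hE _ _) (load_le_startTime hE J.1 h7)).2
          rfl h8).symm
    exact key _ le_rfl
  exact ⟨⟨hF, hS, fun pol h h' => hc.trans_le (ecost_le_expCost hE h h')⟩, hc⟩

end Instance

end BernoulliSched

namespace BernoulliSched

namespace Instance

variable {n E : ℕ} {I : Instance n E}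

/-! ### Counting start points -/

/-- The number of start points of group `h` in the interval `(y, x]`. -/
noncomputable def cnt (I : Instance n E) (h : ℕ) (y x : ℚ) : ℕ := (I.Q h ∩ Set.Ioc y x).ncard

theorem cnt_add (hE : 3 ≤ E) {h : ℕ} (hh : I.IsGrp h) {y z x : ℚ} (h1 : y ≤ z) (h2 : z ≤ x) :
    I.cnt h y x = I.cnt h y z + I.cnt h z x := by
  unfold cnt
  rw [← Set.ncard_union_eq (Set.disjoint_left.2 fun a ha hb => absurd ha.2.2 (not_le.2 hb.2.1))
    (finite_Q_inter hE hh bddAbove_Ioc) (finite_Q_inter hE hh bddAbove_Ioc),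
    ← Set.inter_union_distrib_left, Set.Ioc_union_Ioc_eq_Ioc h1 h2]

theorem cnt_self (h : ℕ) (y : ℚ) : I.cnt h y y = 0 := by simp [cnt]

theorem cnt_nextPt (hE : 3 ≤ E) {h : ℕ} (hh : I.IsGrp h) (t : ℚ) :
    I.cnt h t (nextPt (I.Q h) t) ≤ 1 := by
  have : I.Q h ∩ Set.Ioc t (nextPt (I.Q h) t) ⊆ {nextPt (I.Q h) t} := by
    rintro x ⟨hx, h1, h2⟩
    exact le_antisymm h2 (nextPt_le hE hh hx h1.le)
  exact (Set.ncard_le_ncard this).trans_eq (Set.ncard_singleton _)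

/-- Between two coarse start points there is a fine one, so rounding up to the fine set is injective
on the coarse one; it does not leave the interval, because `x` is itself a fine point. -/
theorem cnt_le_cnt (hE : 3 ≤ E) {h h' : ℕ} (hh : I.IsGrp h) (hh' : I.IsGrp h') (hlt : h < h')
    {y x : ℚ} (hx : x = y ∨ x ∈ I.Q h') : I.cnt h y x ≤ I.cnt h' y x := by
  rcases hx with rfl | hx
  · rw [cnt_self, cnt_self]
  have hm : StrictMonoOn (nextPt (I.Q h')) (I.Q h ∩ Set.Ioc y x) := by
    intro z hz z' hz' hzz'
    obtain ⟨w, hw, h1, h2⟩ := exists_mem_Q_between hE hh hh' hlt hz.1 hz'.1 hzz'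
    exact ((nextPt_le hE hh' hw h1).trans_lt h2).trans_le (le_nextPt hE hh' _)
  refine Set.ncard_le_ncard_of_injOn (nextPt (I.Q h')) ?_ hm.injOn
    (finite_Q_inter hE hh' bddAbove_Ioc)
  intro z hz
  exact ⟨nextPt_mem hE hh' z, hz.2.1.trans_le (le_nextPt hE hh' z), nextPt_le hE hh' hx hz.2.2⟩

/-- `x` is reached from `y` by at most `k` steps through start points of group `h`. -/
def Step (I : Instance n E) (h : ℕ) (y : ℚ) (k : ℕ) (x : ℚ) : Prop :=
  (x = y ∨ y < x ∧ x ∈ I.Q h) ∧ I.cnt h y x ≤ k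

theorem Step.refl (h : ℕ) (y : ℚ) (k : ℕ) : I.Step h y k y :=
  ⟨Or.inl rfl, by rw [cnt_self]; exact Nat.zero_le _⟩

theorem Step.le {h : ℕ} {y x : ℚ} {k : ℕ} (hs : I.Step h y k x) : y ≤ x := by
  rcases hs.1 with h1 | h1
  · exact h1.ge
  · exact h1.1.le

theorem Step.trans (hE : 3 ≤ E) {h : ℕ} (hh : I.IsGrp h) {y z x : ℚ} {k k' : ℕ}
    (hs : I.Step h y k z) (hx : x ∈ I.Q h) (hzx : z ≤ x) (hc : I.cnt h z x ≤ k') :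
    I.Step h y (k + k') x := by
  refine ⟨?_, ?_⟩
  · rcases eq_or_lt_of_le (hs.le.trans hzx) with h1 | h1
    · exact Or.inl h1.symm
    · exact Or.inr ⟨h1, hx⟩
  · rw [cnt_add hE hh hs.le hzx]
    exact Nat.add_le_add hs.2 hc

/-- A point reached from `y` is determined by the number of start points passed on the way. -/
theorem ncard_step_le (hE : 3 ≤ E) {h : ℕ} (hh : I.IsGrp h) (y : ℚ) (k : ℕ) :
    {x | I.Step h y k x}.Finite ∧ {x | I.Step h y k x}.ncard ≤ k + 1 := by
  have hmaps : Set.MapsTo (I.cnt h y) {x | I.Step h y k x} (Finset.range (k + 1) : Set ℕ) := by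
    intro x hx
    simp only [Finset.coe_range, Set.mem_Iio]
    exact Nat.lt_succ_of_le hx.2
  have hinj : Set.InjOn (I.cnt h y) {x | I.Step h y k x} := by
    refine StrictMonoOn.injOn fun x hx x' hx' hxx' => ?_
    have h1 : y ≤ x := Step.le hx
    have h2 : x' ∈ I.Q h := (hx'.1.resolve_left (h1.trans_lt hxx').ne').2
    rw [cnt_add hE hh h1 hxx'.le]
    have : 0 < I.cnt h x x' :=
      (Set.ncard_pos (finite_Q_inter hE hh bddAbove_Ioc)).2 ⟨x', h2, hxx', le_rfl⟩
    omega
  refine ⟨Set.Finite.of_finite_image ((Finset.finite_toSet _).subset hmaps.image_subset) hinj, ?_⟩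
  have := Set.ncard_le_ncard_of_injOn _ hmaps hinj (Finset.finite_toSet _)
  rwa [Set.ncard_coe_finset, Finset.card_range] at this

/-- `x` is reached from the threshold of group `g` by at most `c` steps, first through start points of
group `g`, then of group `g + 1`, and so on up to group `g + d`. -/
def Rep (I : Instance n E) (g : ℕ) : ℕ → ℕ → ℚ → Prop
  | 0, c, x => I.Step g (I.pcirc g) c x
  | d + 1, c, x => ∃ y c₁ c₂, Rep I g d c₁ y ∧ I.Step (g + d + 1) y c₂ x ∧ c₁ + c₂ ≤ c

theorem Rep.mono {g d c c' : ℕ} {x : ℚ} (h : I.Rep g d c x) (hc : c ≤ c') : I.Rep g d c' x := by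
  cases d with
  | zero => exact ⟨h.1, h.2.trans hc⟩
  | succ d =>
    obtain ⟨y, c₁, c₂, h1, h2, h3⟩ := h
    exact ⟨y, c₁, c₂, h1, h2, h3.trans hc⟩

theorem Rep.lift {g d d' c : ℕ} {x : ℚ} (h : I.Rep g d c x) (hd : d ≤ d') : I.Rep g d' c x := by
  induction d', hd using Nat.le_induction with
  | base => exact h
  | succ d' _ ih => exact ⟨x, c, 0, ih, Step.refl _ _ _, le_rfl⟩

theorem Rep.pcirc_le {g d c : ℕ} {x : ℚ} (h : I.Rep g d c x) : I.pcirc g ≤ x := by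
  induction d generalizing c x with
  | zero => exact h.le
  | succ d ih =>
    obtain ⟨y, c₁, c₂, h1, h2, h3⟩ := h
    exact (ih h1).trans h2.le

theorem Rep.extend (hE : 3 ≤ E) {g d c k : ℕ} {y x : ℚ} (hg : I.IsGrp (g + d)) (h : I.Rep g d c y)
    (hx : x ∈ I.Q (g + d)) (hyx : y ≤ x) (hk : I.cnt (g + d) y x ≤ k) : I.Rep g d (c + k) x := by
  cases d with
  | zero => exact Step.trans hE hg h hx hyx hk
  | succ d =>
    obtain ⟨z, c₁, c₂, h1, h2, h3⟩ := h
    exact ⟨z, c₁, c₂ + k, h1, h2.trans hE hg hx hyx hk, by omega⟩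

/-- The segments through groups finer than `g + d` are given up and recounted in start points of
group `g + d`. By `cnt_le_cnt` this does not increase the number of steps. -/
theorem Rep.truncate (hE : 3 ≤ E) {g d d' c : ℕ} {t : ℚ} (h1 : 1 ≤ g) (hg : g + d' ≤ I.γ)
    (h : I.Rep g d' c t) (hd : d ≤ d') :
    ∃ y c₁, I.Rep g d c₁ y ∧ y ≤ t ∧ c₁ + I.cnt (g + d) y t ≤ c := by
  induction d', hd using Nat.le_induction generalizing c t with
  | base => exact ⟨t, c, h, le_rfl, by rw [cnt_self, add_zero]⟩
  | succ d' hd ih =>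
    obtain ⟨z, c₁, c₂, h2, h3, h4⟩ := h
    obtain ⟨y, c₃, h5, h6, h7⟩ := ih (by omega) h2
    refine ⟨y, c₃, h5, h6.trans h3.le, ?_⟩
    have hgd : I.IsGrp (g + d) := ⟨by omega, by omega⟩
    rw [cnt_add hE hgd h6 h3.le]
    have h8 : I.cnt (g + d) z t ≤ I.cnt (g + d' + 1) z t :=
      cnt_le_cnt hE hgd ⟨by omega, by omega⟩ (by omega) (h3.1.imp_right And.right)
    have := h3.2
    omega

/-- Consequently a wait for any group in the range costs a single step, however fine the preceding
steps were. -/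
theorem Rep.next (hE : 3 ≤ E) {g d d' c : ℕ} {t : ℚ} (h1 : 1 ≤ g) (hg : g + d' ≤ I.γ)
    (h : I.Rep g d' c t) (hd : d ≤ d') : I.Rep g d (c + 1) (nextPt (I.Q (g + d)) t) := by
  obtain ⟨y, c₁, h2, h3, h4⟩ := h.truncate hE h1 hg hd
  have hgd : I.IsGrp (g + d) := ⟨by omega, by omega⟩
  have h5 := cnt_nextPt hE hgd t
  have h6 := le_nextPt hE hgd t
  refine (h2.extend hE hgd (nextPt_mem hE hgd t) (h3.trans h6) le_rfl).mono ?_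
  rw [cnt_add hE hgd h3 h6]
  omega

theorem ncard_biUnion_le {α β : Type*} {S : Set α} (hS : S.Finite) {F : α → Set β} {k : ℕ}
    (hF : ∀ a ∈ S, (F a).Finite ∧ (F a).ncard ≤ k) :
    (⋃ a ∈ S, F a).Finite ∧ (⋃ a ∈ S, F a).ncard ≤ S.ncard * k := by
  classical
  refine ⟨hS.biUnion fun a ha => (hF a ha).1, ?_⟩
  induction S, hS using Set.Finite.induction_on with
  | empty => simp
  | @insert a S ha hS ih =>
    rw [Set.biUnion_insert, Set.ncard_insert_of_notMem ha hS]
    refine (Set.ncard_union_le _ _).trans ?_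
    have h1 := (hF a (by simp)).2
    have h2 := ih fun b hb => hF b (by simp [hb])
    nlinarith

/-- One factor `c + 1` for the step count within each of the `d + 1` groups. -/
theorem ncard_rep_le (hE : 3 ≤ E) {g d : ℕ} (h1 : 1 ≤ g) (hg : g + d ≤ I.γ) (c : ℕ) :
    {x | I.Rep g d c x}.Finite ∧ {x | I.Rep g d c x}.ncard ≤ (c + 1) ^ (d + 1) := by
  induction d with
  | zero => rw [zero_add, pow_one]; exact ncard_step_le hE (⟨h1, hg⟩ : I.IsGrp g) (I.pcirc g) c
  | succ d ih =>
    obtain ⟨h2, h3⟩ := ih (by omega)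
    have h4 := ncard_biUnion_le h2 (F := fun y => {x | I.Step (g + d + 1) y c x})
      fun y _ => ncard_step_le hE ⟨by omega, by omega⟩ y c
    have hsub : {x | I.Rep g (d + 1) c x} ⊆
        ⋃ y ∈ {y | I.Rep g d c y}, {x | I.Step (g + d + 1) y c x} := by
      rintro x ⟨y, c₁, c₂, h5, h6, h7⟩
      simp only [Set.mem_iUnion]
      exact ⟨y, h5.mono (by omega), h6.1, h6.2.trans (by omega)⟩
    refine ⟨h4.1.subset hsub, (Set.ncard_le_ncard hsub h4.1).trans (h4.2.trans ?_)⟩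
    rw [pow_succ]
    exact Nat.mul_le_mul_right _ h3

/-- Points that are reached by few steps from the threshold that precedes them. -/
def Good (I : Instance n E) (c : ℕ) (x : ℚ) : Prop :=
  x = 0 ∨ ∃ g, I.IsReg g ∧ I.Rep g (I.γ - g) c x ∧ (2 ≤ g → x < I.pcirc (g - 1))

theorem Good.mono {c c' : ℕ} {x : ℚ} (h : I.Good c x) (hc : c ≤ c') : I.Good c' x :=
  h.imp_right fun ⟨g, h1, h2, h3⟩ => ⟨g, h1, h2.mono hc, h3⟩

theorem ncard_good_le (hE : 3 ≤ E) (hn : 0 < n) (c : ℕ) :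
    {x | I.Good c x}.Finite ∧ {x | I.Good c x}.ncard ≤ 1 + n * (c + 1) ^ n := by
  have h1 := ncard_biUnion_le (Finset.finite_toSet (Finset.Icc 1 I.γ))
    (F := fun g => {x | I.Rep g (I.γ - g) c x}) (k := (c + 1) ^ n) fun g hg => by
      rw [Finset.mem_coe, Finset.mem_Icc] at hg
      have h2 := ncard_rep_le (I := I) hE (g := g) (d := I.γ - g) hg.1 (by omega) c
      refine ⟨h2.1, h2.2.trans (Nat.pow_le_pow_right (by omega) ?_)⟩
      have := I.γ_le
      omega
  rw [Set.ncard_coe_finset, Nat.card_Icc] at h1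
  have hsub : {x | I.Good c x} ⊆ {0} ∪
      ⋃ g ∈ ((Finset.Icc 1 I.γ : Finset ℕ) : Set ℕ), {x | I.Rep g (I.γ - g) c x} := by
    rintro x (rfl | ⟨g, hg, h2, -⟩)
    · exact Or.inl rfl
    · right
      simp only [Set.mem_iUnion]
      exact ⟨g, by rw [Finset.mem_coe, Finset.mem_Icc]; exact ⟨hg.1, (hg.isGrp hn).2⟩, h2⟩
  have hfin := (Set.finite_singleton (0 : ℚ)).union h1.1
  refine ⟨hfin.subset hsub, (Set.ncard_le_ncard hsub hfin).trans ?_⟩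
  refine (Set.ncard_union_le _ _).trans ?_
  rw [Set.ncard_singleton]
  have := I.γ_le
  refine Nat.add_le_add_left (h1.2.trans (Nat.mul_le_mul_right _ (by omega))) 1

theorem lStr_one_le (hE : 3 ≤ E) {h : ℕ} (hh : I.IsGrp h) {x : ℚ} (hx : x ∈ I.Q h) (h0 : 0 < x) :
    I.lStr 1 ≤ x := by
  have hmono := lStr_strictMono (I := I) hE hh.pos
  have hpos : ∀ k, 0 < I.lStr k → I.lStr 1 ≤ I.lStr k := by
    intro k hk
    refine hmono.monotone ?_
    by_contra h1
    have : k = 0 := by omega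
    rw [this, lStr_zero] at hk
    exact lt_irrefl _ hk
  rcases (mem_Q_iff hE hh).1 hx with ⟨k, rfl, -⟩ | ⟨h2, k, i, rfl, h3, -⟩
  · exact hpos k h0
  · have h4 := dl_pos hE hh
    have : 0 ≤ (i : ℚ) * I.dl h := by positivity
    have h5 := hpos k ((pcirc_pos hE ((hh.pred h2).isGrp hh.pos)).trans_le h3)
    linarith

theorem exists_reg (hE : 3 ≤ E) (hn : 0 < n) {x : ℚ} (hx : I.lStr 1 ≤ x) :
    ∃ g, I.IsReg g ∧ I.pcirc g ≤ x ∧ (2 ≤ g → x < I.pcirc (g - 1)) := by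
  classical
  have h : ∃ g, I.IsReg g ∧ I.pcirc g ≤ x := ⟨_, isReg_top, by rwa [← lStr_one hE hn]⟩
  refine ⟨Nat.find h, (Nat.find_spec h).1, (Nat.find_spec h).2, fun h2 => ?_⟩
  have h3 := Nat.find_min h (show Nat.find h - 1 < Nat.find h by omega)
  by_contra h4
  exact h3 ⟨(Nat.find_spec h).1.pred h2, not_lt.1 h4⟩

theorem IsReg.le_γ (hn : 0 < n) {g : ℕ} (hg : I.IsReg g) : g ≤ I.γ := (hg.isGrp hn).2

/-- Regular thresholds are start points of all groups, so waiting cannot jump over one. If it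
reaches the next threshold, it stops there and the count is reset. Otherwise `Rep.next` applies; a
group coarser than `g` has the same start points there as group `g`. -/
theorem Good.next (hE : 3 ≤ E) {h : ℕ} (hh : I.IsGrp h) {c : ℕ} {t : ℚ} (ht : I.Good c t) :
    I.Good (c + 1) (nextPt (I.Q h) t) := by
  have hn := hh.pos
  rcases ht with rfl | ⟨g, hg, hr, hlt⟩
  · exact Or.inl (nextPt_of_mem hE hh (zero_mem_Q hE hh))
  right
  have hgγ := hg.le_γ hn
  by_cases h1 : 2 ≤ g ∧ I.pcirc (g - 1) ≤ nextPt (I.Q h) t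
  · have h2 : nextPt (I.Q h) t = I.pcirc (g - 1) :=
      le_antisymm (nextPt_le hE hh (pcirc_mem_Q hE (hg.pred h1.1) hh) (hlt h1.1).le) h1.2
    rw [h2]
    refine ⟨g - 1, hg.pred h1.1, Rep.lift (d := 0) (Step.refl _ _ _) (Nat.zero_le _), fun h3 => ?_⟩
    exact pcirc_lt hE ((hg.pred h1.1).isGrp hn) h3
  · have h2 : 2 ≤ g → nextPt (I.Q h) t < I.pcirc (g - 1) := fun h3 => by
      by_contra h4
      exact h1 ⟨h3, not_lt.1 h4⟩
    refine ⟨g, hg, ?_, h2⟩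
    rcases Nat.lt_or_ge h g with h3 | h3
    · have h4 : nextPt (I.Q h) t = nextPt (I.Q g) t := by
        have hG := hg.isGrp hn
        have h5 : nextPt (I.Q h) t ∈ I.Q g := (mem_Q_congr hE hh hG h3.le h2).1 (nextPt_mem hE hh t)
        have h6 := nextPt_le hE hG h5 (le_nextPt hE hh t)
        refine le_antisymm (nextPt_le hE hh ?_ (le_nextPt hE hG t)) h6
        exact (mem_Q_congr hE hh hG h3.le fun h7 => h6.trans_lt (h2 h7)).2 (nextPt_mem hE hG t)
      rw [h4]
      exact (hr.next hE hg.1 (by omega) (Nat.zero_le _) : I.Rep g 0 (c + 1) _).lift (Nat.zero_le _)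
    · have h4 := hr.next hE (d := h - g) hg.1 (by omega) (by have := hh.2; omega)
      rw [Nat.add_sub_cancel' h3] at h4
      exact h4.lift (by have := hh.2; omega)

/-- A bound on the number of steps that a long job takes. -/
def stepBound (n E : ℕ) : ℕ := E ^ (2 * n) + 3

theorem cnt_release_le (hE : 3 ≤ E) {h : ℕ} (hh : I.IsGrp h) {a x : ℚ} (ha : I.pcirc h ≤ a)
    (hx : x ≤ a + I.pmax h) : I.cnt h a (nextPt (I.Q h) x) ≤ stepBound n E := by
  have hsub : I.Q h ∩ Set.Ioc a (nextPt (I.Q h) x) ⊆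
      (I.Q h ∩ Set.Icc a (a + I.pmax h)) ∪ {nextPt (I.Q h) x} := by
    rintro y ⟨hy, h1, h2⟩
    rcases le_or_gt y (a + I.pmax h) with h3 | h3
    · exact Or.inl ⟨hy, h1.le, h3⟩
    · exact Or.inr (le_antisymm h2 (nextPt_le hE hh hy (hx.trans h3.le)))
  have hfin : (I.Q h ∩ Set.Icc a (a + I.pmax h)).Finite := finite_Q_inter hE hh bddAbove_Icc
  refine (Set.ncard_le_ncard hsub (hfin.union (Set.finite_singleton _))).trans
    ((Set.ncard_union_le _ _).trans ?_)
  rw [Set.ncard_singleton]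
  have h1 := ncard_window_le hE hh ha
  have h2 : E ^ (2 * I.z - 1) ≤ E ^ (2 * n) :=
    Nat.pow_le_pow_right (by omega) (by have := I.z_le; omega)
  unfold stepBound
  omega

/-- Let `g` be the part in which the release lies. If its threshold is not before `max (pcirc h) s`,
the steps are counted afresh from this threshold, and a long job takes at most `stepBound` of them.
Otherwise `s` lies in the same part, and its representation is extended; the additional step
switches it to group `h`. -/
theorem Good.release (hE : 3 ≤ E) {h : ℕ} (hh : I.IsGrp h) {c : ℕ} {s p : ℚ} (hs : I.Good c s)
    (hsQ : s ∈ I.Q h) (hp0 : 0 < p) (hp : p ≤ I.pmax h) :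
    I.Good (c + 1 + stepBound n E) (nextPt (I.Q h) (max (I.pcirc h) (s + p))) := by
  have hn := hh.pos
  set R := nextPt (I.Q h) (max (I.pcirc h) (s + p)) with hR
  have hRQ : R ∈ I.Q h := nextPt_mem hE hh _
  have hR1 : max (I.pcirc h) (s + p) ≤ R := le_nextPt hE hh _
  have hRp : I.pcirc h ≤ R := (le_max_left _ _).trans hR1
  have hRs : s ≤ R := by have := (le_max_right _ _).trans hR1; linarith
  obtain ⟨g, hg, hg1, hg2⟩ := exists_reg hE hn
    (lStr_one_le hE hh hRQ ((pcirc_pos hE hh).trans_le hRp))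
  have hgG := hg.isGrp hn
  have hgγ := hgG.2
  have hc : I.cnt h (max (I.pcirc h) s) R ≤ stepBound n E := by
    refine cnt_release_le hE hh (le_max_left _ _) (max_le ?_ ?_)
    · have := hh.pG_pos.trans_le hh.pG_le_pmax
      have := le_max_left (I.pcirc h) s
      linarith
    · have := le_max_right (I.pcirc h) s
      linarith
  refine Or.inr ⟨g, hg, ?_, hg2⟩
  rcases le_or_gt (max (I.pcirc h) s) (I.pcirc g) with h1 | h1
  · have hc' : I.cnt h (I.pcirc g) R ≤ stepBound n E := by
      rw [cnt_add hE hh h1 hg1] at hc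
      omega
    rcases Nat.lt_or_ge h g with h3 | h3
    · have h4 : I.cnt g (I.pcirc g) R = I.cnt h (I.pcirc g) R := by
        unfold cnt
        congr 1
        ext x
        exact and_congr_left fun hx =>
          (mem_Q_congr hE hh hgG h3.le fun h5 => hx.2.trans_lt (hg2 h5)).symm
      have h5 : I.Rep g 0 (stepBound n E) R := by
        refine ⟨?_, h4.trans_le hc'⟩
        rcases eq_or_lt_of_le hg1 with h6 | h6
        · exact Or.inl h6.symm
        · exact Or.inr ⟨h6, (mem_Q_congr hE hh hgG h3.le hg2).1 hRQ⟩
      exact (h5.lift (Nat.zero_le _)).mono (by omega)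
    · have h4 : I.Rep g (h - g) 0 (I.pcirc g) :=
        Rep.lift (d := 0) (Step.refl _ _ _) (Nat.zero_le _)
      have e : g + (h - g) = h := Nat.add_sub_cancel' h3
      have h5 := h4.extend hE (x := R) (k := stepBound n E) (by rwa [e]) (by rwa [e]) hg1 (by rwa [e])
      exact (h5.lift (by have := hh.2; omega)).mono (by omega)
  · have hgh : g ≤ h := by
      by_contra h2
      have h3 := hg2 (by have := hh.1; omega)
      have h4 := pcirc_le hE hh ((hg.pred (by have := hh.1; omega)).isGrp hn) (by omega : h ≤ g - 1)
      linarith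
    have h2 := pcirc_le hE hgG hh hgh
    have h3 : I.pcirc g < s := by
      rcases lt_max_iff.1 h1 with h4 | h4
      · linarith
      · exact h4
    have h4 : max (I.pcirc h) s = s := max_eq_right (h2.trans h3.le)
    rw [h4] at hc
    rcases hs with rfl | ⟨g', hg', hr, hlt⟩
    · have := pcirc_pos hE hgG
      linarith
    · have hG' := hg'.isGrp hn
      have hpc := hr.pcirc_le
      have e : g' = g := by
        rcases lt_trichotomy g' g with h5 | h5 | h5
        · have h6 := hg2 (by have := hg'.1; omega)
          have h7 := pcirc_le hE hG' ((hg.pred (by have := hg'.1; omega)).isGrp hn)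
            (by omega : g' ≤ g - 1)
          linarith
        · exact h5
        · have h6 := hlt (by have := hg.1; omega)
          have h7 := pcirc_le hE hgG ((hg'.pred (by have := hg.1; omega)).isGrp hn)
            (by omega : g ≤ g' - 1)
          linarith
      subst e
      have h5 := hr.next hE (d := h - g') hg'.1 (by omega) (by have := hh.2; omega)
      have e : g' + (h - g') = h := Nat.add_sub_cancel' hgh
      rw [e, nextPt_of_mem hE hh hsQ] at h5
      exact (h5.extend hE (by rwa [e]) (by rwa [e]) hRs (by rwa [e])).lift (by have := hh.2; omega)

end Instance

end BernoulliSched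

namespace BernoulliSched

namespace Instance

variable {n E : ℕ} {I : Instance n E}

/-! ### Counting profiles and cells -/

/-- Profiles that occur after at most a given number of steps. -/
structure Prof (I : Instance n E) (c : ℕ) (ms : List ℚ) : Prop where
  length : ms.length = I.m
  sorted : ms.Pairwise (· ≤ ·)
  good : ∀ x ∈ ms, I.Good c x
  form : ∃ u, ∀ x ∈ ms, u ≤ x ∧ (x = u ∨ ∃ j s, s ≤ u ∧ x = I.release j s)

theorem Prof.ne_nil {c : ℕ} {ms : List ℚ} (h : I.Prof c ms) : ms ≠ [] := by
  rintro rfl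
  have := h.length
  have := I.m_pos
  simp at *
  omega

theorem Prof.headD_mem {c : ℕ} {ms : List ℚ} (h : I.Prof c ms) : ms.headD 0 ∈ ms := by
  have := h.ne_nil
  cases ms with
  | nil => simp at this
  | cons a t => simp

theorem Prof.headD_le {c : ℕ} {ms : List ℚ} (h : I.Prof c ms) {x : ℚ} (hx : x ∈ ms) :
    ms.headD 0 ≤ x := by
  have h1 := h.sorted
  cases ms with
  | nil => simp at hx
  | cons a t =>
    rcases List.mem_cons.1 hx with rfl | hx
    · exact le_rfl
    · exact (List.pairwise_cons.1 h1).1 x hx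

theorem Prof.mono {c c' : ℕ} {ms : List ℚ} (h : I.Prof c ms) (hc : c ≤ c') : I.Prof c' ms :=
  ⟨h.length, h.sorted, fun x hx => (h.good x hx).mono hc, h.form⟩

theorem prof_init : I.Prof 0 I.profileInit := by
  refine ⟨by simp [profileInit], by simp [profileInit, List.pairwise_replicate], fun x hx => ?_, 0,
    fun x hx => ?_⟩
  · exact Or.inl (List.eq_of_mem_replicate hx)
  · rw [List.eq_of_mem_replicate hx]
    exact ⟨le_rfl, Or.inl rfl⟩

theorem Prof.good_startTime (hE : 3 ≤ E) {c : ℕ} {ms : List ℚ} (h : I.Prof c ms) (j : Fin n) :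
    I.Good (c + 1) (I.startTime j ms) := (h.good _ h.headD_mem).next hE (isGrp_grp j)

theorem Prof.wait_form (hE : 3 ≤ E) {c : ℕ} {ms : List ℚ} (h : I.Prof c ms) (j : Fin n) :
    ∀ x ∈ I.waitProfile j ms, I.startTime j ms ≤ x ∧
      (x = I.startTime j ms ∨ ∃ j' s, s ≤ I.startTime j ms ∧ x = I.release j' s) := by
  intro x hx
  obtain ⟨y, hy, rfl⟩ := List.mem_map.1 hx
  refine ⟨le_max_left _ _, ?_⟩
  obtain ⟨u, hu⟩ := h.form
  have h1 : ms.headD 0 ≤ I.startTime j ms := le_nextPt hE (isGrp_grp j) _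
  have h2 := (hu _ h.headD_mem).1
  rcases le_or_gt y (I.startTime j ms) with h3 | h3
  · exact Or.inl (max_eq_left h3)
  · rw [max_eq_right h3.le]
    rcases (hu y hy).2 with rfl | ⟨j', s, h4, h5⟩
    · linarith
    · exact Or.inr ⟨j', s, by linarith, h5⟩

theorem Prof.wait (hE : 3 ≤ E) {c : ℕ} {ms : List ℚ} (h : I.Prof c ms) (j : Fin n) :
    I.Prof (c + 1) (I.waitProfile j ms) := by
  refine ⟨by simp [waitProfile, h.length], sorted_map_max h.sorted _, fun x hx => ?_,
    _, h.wait_form hE j⟩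
  obtain ⟨y, hy, rfl⟩ := List.mem_map.1 hx
  rcases max_choice (I.startTime j ms) y with h1 | h1 <;> rw [h1]
  · exact h.good_startTime hE j
  · exact (h.good y hy).mono (by omega)

theorem Prof.long (hE : 3 ≤ E) {c : ℕ} {ms : List ℚ} (h : I.Prof c ms) (j : Fin n) :
    I.Prof (c + 2 + stepBound n E) (I.longProfile j ms) := by
  have hw := h.wait hE j
  have hmem : ∀ x ∈ I.longProfile j ms, x = I.release j (I.startTime j ms) ∨
      x ∈ I.waitProfile j ms := by
    intro x hx
    rcases (List.mem_orderedInsert _).1 hx with h1 | h1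
    · exact Or.inl h1
    · exact Or.inr (List.mem_of_mem_tail h1)
  refine ⟨?_, ?_, fun x hx => ?_, I.startTime j ms, fun x hx => ?_⟩
  · have := I.m_pos
    simp only [longProfile, List.orderedInsert_length, List.length_tail, hw.length]
    omega
  · exact hw.sorted.tail.orderedInsert _ _
  · rcases hmem x hx with rfl | h1
    · exact ((h.good_startTime hE j).release hE (isGrp_grp j) (startTime_mem hE _ _) (I.p_pos j)
        (le_pmax j)).mono (by omega)
    · exact (hw.good x h1).mono (by omega)
  · rcases hmem x hx with rfl | h1
    · refine ⟨?_, Or.inr ⟨j, _, le_rfl, rfl⟩⟩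
      have := start_le_release (I := I) hE j (I.startTime j ms)
      have := I.p_pos j
      linarith
    · exact h.wait_form hE j x h1

theorem dec_le {ν : Fin n → ℕ} (j i : Fin n) : dec ν j i ≤ ν i := by
  unfold dec
  by_cases h : i = j
  · subst h; simp
  · rw [Function.update_of_ne h]

/-- Each started job contributes at most one step for waiting and `stepBound + 1` steps for the
release, and the number of started jobs is the total number minus the leftover ones. -/
theorem Reach.inv (hE : 3 ≤ E) {x : Cell n} (h : I.Reach x) :
    (∀ j, x.2 j ≤ I.Nj j) ∧
      I.Prof ((stepBound n E + 2) * (I.N - ∑ j, x.2 j)) x.1 := by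
  induction h with
  | init => exact ⟨fun _ => le_rfl, prof_init.mono (Nat.zero_le _)⟩
  | long ms ν j _ hj ih =>
    refine ⟨fun i => (dec_le j i).trans (ih.1 i), (ih.2.long hE j).mono ?_⟩
    have h1 := sum_dec hj
    have h2 : ∑ i, ν i ≤ I.N := Finset.sum_le_sum fun i _ => ih.1 i
    have h3 : I.N - ∑ i, dec ν j i = (I.N - ∑ i, ν i) + 1 := by omega
    simp only [h3]
    rw [mul_add, mul_one]
    omega
  | short ms ν j _ hj ih =>
    refine ⟨fun i => (dec_le j i).trans (ih.1 i), (ih.2.wait hE j).mono ?_⟩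
    have h1 := sum_dec hj
    have h2 : ∑ i, ν i ≤ I.N := Finset.sum_le_sum fun i _ => ih.1 i
    have h3 : I.N - ∑ i, dec ν j i = (I.N - ∑ i, ν i) + 1 := by omega
    simp only [h3]
    rw [mul_add, mul_one]
    omega

/-- The possible values of loads if the smallest load is `t`. -/
def window (I : Instance n E) (t : ℚ) : Set ℚ :=
  ⋃ h ∈ ((Finset.Icc 1 I.γ : Finset ℕ) : Set ℕ),
    (I.Q h ∩ Set.Icc (max t (I.pcirc h)) (max t (I.pcirc h) + I.pmax h)) ∪
      {nextPt (I.Q h) (max t (I.pcirc h) + I.pmax h)}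

/-- A group contributes the points of its window and the first one behind it, at most `E ^ (2 * z -
1) + 3` values; this is at most `E ^ (2 * z)` because `E ≥ 3`. -/
theorem ncard_window (hE : 3 ≤ E) (t : ℚ) :
    (I.window t).Finite ∧ (I.window t).ncard ≤ n * E ^ (2 * I.z) := by
  have h1 := ncard_biUnion_le (Finset.finite_toSet (Finset.Icc 1 I.γ))
    (F := fun h => (I.Q h ∩ Set.Icc (max t (I.pcirc h)) (max t (I.pcirc h) + I.pmax h)) ∪
      {nextPt (I.Q h) (max t (I.pcirc h) + I.pmax h)}) (k := E ^ (2 * I.z)) fun h hh => by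
      rw [Finset.mem_coe, Finset.mem_Icc] at hh
      have hg : I.IsGrp h := hh
      have hfin : (I.Q h ∩ Set.Icc (max t (I.pcirc h)) (max t (I.pcirc h) + I.pmax h)).Finite :=
        finite_Q_inter hE hg bddAbove_Icc
      refine ⟨hfin.union (Set.finite_singleton _), (Set.ncard_union_le _ _).trans ?_⟩
      rw [Set.ncard_singleton]
      have h2 := ncard_window_le hE hg (le_max_right t (I.pcirc h))
      have h3 : 1 ≤ I.z := (one_le_gsize hg).trans (gsize_le_z hg)
      have h4 : E ^ (2 * I.z) = E ^ (2 * I.z - 1) * E := by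
        rw [← pow_succ]; congr 1; omega
      have h5 : E ^ 1 ≤ E ^ (2 * I.z - 1) := Nat.pow_le_pow_right (by omega) (by omega)
      rw [pow_one] at h5
      rw [h4]
      nlinarith
  refine ⟨h1.1, h1.2.trans (Nat.mul_le_mul_right _ ?_)⟩
  rw [Set.ncard_coe_finset, Nat.card_Icc]
  have := I.γ_le
  omega

/-- A load that is not minimal is the release time of a job started at some `s ≤ u ≤ t`. Before
rounding it lies at most `pmax` behind `max t pcirc`, and rounding is monotone. -/
theorem Prof.mem_window (hE : 3 ≤ E) {c : ℕ} {ms : List ℚ} (h : I.Prof c ms) {x : ℚ} (hx : x ∈ ms) :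
    x = ms.headD 0 ∨ x ∈ I.window (ms.headD 0) := by
  obtain ⟨u, hu⟩ := h.form
  have h1 := h.headD_le hx
  have h2 := (hu _ h.headD_mem).1
  set t := ms.headD 0
  rcases (hu x hx).2 with rfl | ⟨j, s, h3, rfl⟩
  · exact Or.inl (le_antisymm h2 h1)
  · right
    have hg := isGrp_grp (I := I) j
    simp only [window, Set.mem_iUnion]
    refine ⟨I.grp j, by rw [Finset.mem_coe, Finset.mem_Icc]; exact hg, ?_⟩
    have h4 : max (I.pcirc (I.grp j)) (s + I.p j) ≤
        max t (I.pcirc (I.grp j)) + I.pmax (I.grp j) := by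
      have h5 := hg.pG_pos.trans_le hg.pG_le_pmax
      refine max_le ?_ ?_
      · have := le_max_right t (I.pcirc (I.grp j)); linarith
      · have := le_max_left t (I.pcirc (I.grp j))
        have := le_pmax (I := I) j
        linarith
    have h6 : I.pcirc (I.grp j) ≤ I.release j s := (le_max_left _ _).trans (le_nextPt hE hg _)
    rcases le_or_gt (I.release j s) (max t (I.pcirc (I.grp j)) + I.pmax (I.grp j)) with h5 | h5
    · exact Or.inl ⟨nextPt_mem hE hg _, max_le h1 h6, h5⟩
    · exact Or.inr (le_antisymm (nextPt_mono hE hg h4)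
        (nextPt_le hE hg (nextPt_mem hE hg _) h5.le))

/-- Sorted lists of given length with given first entry whose entries come from a small set. -/
theorem ncard_sorted_le {m : ℕ} (hm : 0 < m) (t : ℚ) {V : Set ℚ} (hV : V.Finite) {K : ℕ}
    (hK : V.ncard ≤ K) :
    {ms : List ℚ | ms.length = m ∧ ms.Pairwise (· ≤ ·) ∧ t ∈ ms ∧ ∀ x ∈ ms, x = t ∨ x ∈ V}.Finite ∧
    {ms : List ℚ | ms.length = m ∧ ms.Pairwise (· ≤ ·) ∧ t ∈ ms ∧
      ∀ x ∈ ms, x = t ∨ x ∈ V}.ncard ≤ m ^ K := by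
  classical
  set S := {ms : List ℚ | ms.length = m ∧ ms.Pairwise (· ≤ ·) ∧ t ∈ ms ∧ ∀ x ∈ ms, x = t ∨ x ∈ V}
  set W : Finset ℚ := hV.toFinset.erase t with hW
  have htW : t ∉ W := Finset.notMem_erase _ _
  have hWc : W.card ≤ K := by
    refine (Finset.card_erase_le).trans ?_
    rwa [← Set.ncard_eq_toFinset_card V hV]
  let F : List ℚ → (W → ℕ) := fun ms v => ms.count (v : ℚ)
  let T : Finset (W → ℕ) := Fintype.piFinset fun _ => Finset.range m
  have hTc : T.card ≤ m ^ K := by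
    simp only [T, Fintype.card_piFinset, Finset.card_range, Finset.prod_const, Finset.card_univ,
      Fintype.card_coe]
    exact Nat.pow_le_pow_right hm hWc
  have hsub : ∀ ms ∈ S, ∀ x ∈ ms, x ∈ insert t W := by
    intro ms hms x hx
    by_cases hxt : x = t
    · simp [hxt]
    · rcases hms.2.2.2 x hx with h1 | h1
      · exact absurd h1 hxt
      · simp [hW, hxt, h1]
  have hsum : ∀ ms ∈ S, ms.count t + ∑ v ∈ W, ms.count v = m := by
    intro ms hms
    have := Multiset.sum_count_eq_card (s := insert t W) (m := (ms : Multiset ℚ)) (hsub ms hms)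
    rw [Finset.sum_insert htW] at this
    simp only [Multiset.coe_count, Multiset.coe_card] at this
    rw [this, hms.1]
  -- Since `t` occurs in the list, every other multiplicity is below `m`; the multiplicity of `t`
  -- follows from the length.
  have hmaps : Set.MapsTo F S (T : Set (W → ℕ)) := by
    intro ms hms
    rw [Finset.mem_coe, Fintype.mem_piFinset]
    intro v
    rw [Finset.mem_range]
    have h1 := hsum ms hms
    have h2 : 0 < ms.count t := List.count_pos_iff.2 hms.2.2.1
    have h3 := Finset.single_le_sum (f := fun v => ms.count v) (fun _ _ => Nat.zero_le _) v.2
    simp only [F]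
    omega
  have hinj : Set.InjOn F S := by
    intro ms hms ms' hms' he
    refine List.Perm.eq_of_pairwise' (r := (· ≤ ·)) hms.2.1 hms'.2.1 ?_
    have hcW : ∀ v ∈ W, ms.count v = ms'.count v := fun v hv => congrFun he ⟨v, hv⟩
    rw [List.perm_iff_count]
    intro a
    by_cases h1 : a ∈ W
    · exact hcW a h1
    · by_cases h2 : a = t
      · subst h2
        have h3 := hsum ms hms
        have h4 := hsum ms' hms'
        rw [Finset.sum_congr rfl hcW] at h3
        omega
      · rw [List.count_eq_zero_of_not_mem, List.count_eq_zero_of_not_mem]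
        · intro h3; have := hsub ms' hms' a h3; simp [h1, h2] at this
        · intro h3; have := hsub ms hms a h3; simp [h1, h2] at this
  refine ⟨Set.Finite.of_finite_image ((Finset.finite_toSet _).subset hmaps.image_subset) hinj, ?_⟩
  have := Set.ncard_le_ncard_of_injOn _ hmaps hinj (Finset.finite_toSet _)
  rw [Set.ncard_coe_finset] at this
  exact this.trans hTc

theorem ncard_prof_le (hE : 3 ≤ E) (hn : 0 < n) (c : ℕ) :
    {ms | I.Prof c ms}.Finite ∧
      {ms | I.Prof c ms}.ncard ≤ (1 + n * (c + 1) ^ n) * I.m ^ (n * E ^ (2 * I.z)) := by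
  obtain ⟨h1, h2⟩ := ncard_good_le (I := I) hE hn c
  have h3 := ncard_biUnion_le h1 (F := fun t => {ms : List ℚ | ms.length = I.m ∧
    ms.Pairwise (· ≤ ·) ∧ t ∈ ms ∧ ∀ x ∈ ms, x = t ∨ x ∈ I.window t}) fun t _ =>
    ncard_sorted_le I.m_pos t (ncard_window hE t).1 (ncard_window hE t).2
  have hsub : {ms | I.Prof c ms} ⊆ ⋃ t ∈ {x | I.Good c x}, {ms : List ℚ | ms.length = I.m ∧
      ms.Pairwise (· ≤ ·) ∧ t ∈ ms ∧ ∀ x ∈ ms, x = t ∨ x ∈ I.window t} := by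
    intro ms h
    simp only [Set.mem_iUnion]
    have h : I.Prof c ms := h
    exact ⟨ms.headD 0, h.good _ h.headD_mem, h.length, h.sorted, h.headD_mem,
      fun x hx => h.mem_window hE hx⟩
  exact ⟨h3.1.subset hsub, (Set.ncard_le_ncard hsub h3.1).trans
    (h3.2.trans (Nat.mul_le_mul_right _ h2))⟩

theorem one_le_Nj (j : Fin n) : 1 ≤ I.Nj j := List.length_pos_iff.2 (I.probs_ne j)

theorem Nj_le_N (j : Fin n) : I.Nj j ≤ I.N :=
  Finset.single_le_sum (f := I.Nj) (fun _ _ => Nat.zero_le _) (Finset.mem_univ j)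

theorem one_le_N (hn : 0 < n) : 1 ≤ I.N := (one_le_Nj ⟨0, hn⟩).trans (Nj_le_N _)

theorem ncard_le_Nj (hn : 0 < n) :
    {ν : Fin n → ℕ | ∀ j, ν j ≤ I.Nj j}.Finite ∧
      {ν : Fin n → ℕ | ∀ j, ν j ≤ I.Nj j}.ncard ≤ (2 * I.N) ^ n := by
  classical
  have h1 : {ν : Fin n → ℕ | ∀ j, ν j ≤ I.Nj j} =
      (Fintype.piFinset fun j => Finset.range (I.Nj j + 1) : Finset (Fin n → ℕ)) := by
    ext ν
    simp
  rw [h1]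
  refine ⟨Finset.finite_toSet _, ?_⟩
  rw [Set.ncard_coe_finset, Fintype.card_piFinset]
  calc ∏ j, (Finset.range (I.Nj j + 1)).card ≤ ∏ _j : Fin n, 2 * I.N := by
        refine Finset.prod_le_prod' fun j _ => ?_
        rw [Finset.card_range]
        have := Nj_le_N (I := I) j
        have := one_le_N (I := I) hn
        omega
    _ = (2 * I.N) ^ n := by simp

/-- The constant in the bound on the number of relevant cells. -/
def cellConst (n E : ℕ) : ℕ := (1 + n * (2 * (stepBound n E + 2)) ^ n) * 2 ^ n

theorem relevantCells_bound (hE : 3 ≤ E) :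
    I.relevantCells.Finite ∧ I.relevantCells.ncard ≤
      cellConst n E * (I.N ^ (2 * n) * E ^ (2 * n) * I.m ^ (n * E ^ (2 * I.z))) := by
  rcases Nat.eq_zero_or_pos n with rfl | hn
  · have hsub : I.relevantCells ⊆ {(I.profileInit, I.Nj)} := by
      rintro x (hx | ⟨ms, ν, j, -⟩)
      · induction (hx : I.Reach x) with
        | init => rfl
        | long _ _ j => exact j.elim0
        | short _ _ j => exact j.elim0
      · exact j.elim0
    refine ⟨(Set.finite_singleton _).subset hsub, (Set.ncard_le_ncard hsub).trans ?_⟩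
    simp [cellConst]
  · set c := (stepBound n E + 2) * I.N with hc
    have h1 := ncard_prof_le (I := I) hE hn c
    have h2 := ncard_le_Nj (I := I) hn
    have hN := one_le_N (I := I) hn
    have hsub : I.relevantCells ⊆ {ms | I.Prof c ms} ×ˢ {ν : Fin n → ℕ | ∀ j, ν j ≤ I.Nj j} := by
      rintro x (hx | ⟨ms, ν, j, hx, hj, rfl⟩)
      · obtain ⟨h3, h4⟩ := Reach.inv hE hx
        exact ⟨h4.mono (Nat.mul_le_mul_left _ (Nat.sub_le _ _)), h3⟩
      · obtain ⟨h3, h4⟩ := Reach.inv hE hx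
        -- In a waiting cell at most `N - 1` jobs have been started, so the extra step for waiting
        -- is covered by `c`.
        refine ⟨(h4.wait hE j).mono ?_, h3⟩
        have h5 := sum_dec hj
        simp only
        calc (stepBound n E + 2) * (I.N - ∑ j, ν j) + 1
            ≤ (stepBound n E + 2) * (I.N - 1) + 1 := by gcongr; omega
          _ ≤ (stepBound n E + 2) * (I.N - 1) + (stepBound n E + 2) := by omega
          _ = c := by
            rw [hc, ← Nat.mul_succ]
            congr 1
            omega
    have hfin := h1.1.prod h2.1
    refine ⟨hfin.subset hsub, (Set.ncard_le_ncard hsub hfin).trans ?_⟩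
    rw [Set.ncard_prod]
    have h3 : c + 1 ≤ 2 * (stepBound n E + 2) * I.N := by
      rw [hc]
      nlinarith [Nat.zero_le (stepBound n E)]
    have h4 : 1 + n * (c + 1) ^ n ≤ (1 + n * (2 * (stepBound n E + 2)) ^ n) * I.N ^ n := by
      have h5 : (c + 1) ^ n ≤ (2 * (stepBound n E + 2)) ^ n * I.N ^ n := by
        rw [← mul_pow]; exact Nat.pow_le_pow_left h3 n
      have h6 : 1 ≤ I.N ^ n := Nat.one_le_pow _ _ hN
      calc 1 + n * (c + 1) ^ n ≤ I.N ^ n + n * ((2 * (stepBound n E + 2)) ^ n * I.N ^ n) := by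
            gcongr
        _ = _ := by ring
    -- The constant may depend on `E` anyway, so the factor `E ^ (2 * n)` of the bound is mere
    -- slack.
    have hE1 : 1 ≤ E ^ (2 * n) := Nat.one_le_pow _ _ (by omega)
    calc _ ≤ ((1 + n * (c + 1) ^ n) * I.m ^ (n * E ^ (2 * I.z))) * (2 * I.N) ^ n :=
          Nat.mul_le_mul h1.2 h2.2
      _ ≤ (((1 + n * (2 * (stepBound n E + 2)) ^ n) * I.N ^ n) * I.m ^ (n * E ^ (2 * I.z))) *
          (2 * I.N) ^ n := by gcongr
      _ = cellConst n E * (I.N ^ (2 * n) * 1 * I.m ^ (n * E ^ (2 * I.z))) := by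
        rw [cellConst, mul_pow, two_mul n, pow_add]; ring
      _ ≤ _ := by gcongr

end Instance

end BernoulliSched

namespace BernoulliSched

variable {a b c s Γ : Ty}

/-! ### Functions of polynomial cost -/

/-- Functions that are computed by programs of polynomial cost. -/
def PF (a b : Ty) (f : a.den → b.den) : Prop := ∃ P : PT a b, ∀ x, P.ev x = f x

/-- Predicates that are decided by programs of polynomial cost. -/
def PD (a : Ty) (p : a.den → Prop) : Prop := ∃ P : PT a .rat, ∀ x, (0 : ℚ) < P.ev x ↔ p x

namespace PF

theorem of_eq {f g : a.den → b.den} (h : PF a b f) (e : ∀ x, f x = g x) : PF a b g :=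
  h.imp fun _ hP x => (hP x).trans (e x)

theorem size {f : a.den → b.den} (h : PF a b f) : PolyBdd a.size fun x => b.size (f x) := by
  obtain ⟨P, hP⟩ := h
  exact P.size_ev.mono fun x => by rw [hP]

theorem size_pair {f : Γ.den → a.den → c.den} (h : PF (.prod Γ a) c fun x => f x.1 x.2) :
    PolyBdd (fun x : Γ.den × a.den => Γ.size x.1 + a.size x.2) fun x => c.size (f x.1 x.2) :=
  h.size.trans (((PolyBdd.self _).add (PolyBdd.const _ 1)).mono fun x => by rw [Ty.size_prod])

theorem id : PF a a fun x => x := ⟨PT.ident a, fun _ => rfl⟩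

theorem comp {g : b.den → c.den} {f : a.den → b.den} (hg : PF b c g) (hf : PF a b f) :
    PF a c fun x => g (f x) := by
  obtain ⟨P, hP⟩ := hg
  obtain ⟨R, hR⟩ := hf
  exact ⟨P.comp R, fun x => by rw [PT.ev_comp, hR, hP]⟩

theorem pair {f : a.den → b.den} {g : a.den → c.den} (hf : PF a b f) (hg : PF a c g) :
    PF a (.prod b c) fun x => (f x, g x) := by
  obtain ⟨P, hP⟩ := hf
  obtain ⟨R, hR⟩ := hg
  exact ⟨P.pair R, fun x => by rw [PT.ev_pair, hR, hP]⟩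

theorem fst {f : a.den → b.den × c.den} (hf : PF a (.prod b c) f) : PF a b fun x => (f x).1 := by
  obtain ⟨P, hP⟩ := hf
  exact ⟨P.fst, fun x => by rw [PT.ev_fst, hP]⟩

theorem snd {f : a.den → b.den × c.den} (hf : PF a (.prod b c) f) : PF a c fun x => (f x).2 := by
  obtain ⟨P, hP⟩ := hf
  exact ⟨P.snd, fun x => by rw [PT.ev_snd, hP]⟩

theorem const (r : ℚ) : PF a .rat fun _ => r := ⟨PT.const a r, fun _ => rfl⟩

theorem add {f g : a.den → ℚ} (hf : PF a .rat f) (hg : PF a .rat g) :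
    PF a .rat fun x => f x + g x := by
  obtain ⟨P, hP⟩ := hf
  obtain ⟨R, hR⟩ := hg
  exact ⟨P.add R, fun x => by rw [PT.ev_add, hR, hP]⟩

theorem sub {f g : a.den → ℚ} (hf : PF a .rat f) (hg : PF a .rat g) :
    PF a .rat fun x => f x - g x := by
  obtain ⟨P, hP⟩ := hf
  obtain ⟨R, hR⟩ := hg
  exact ⟨P.sub R, fun x => by rw [PT.ev_sub, hR, hP]⟩

theorem mul {f g : a.den → ℚ} (hf : PF a .rat f) (hg : PF a .rat g) :
    PF a .rat fun x => f x * g x := by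
  obtain ⟨P, hP⟩ := hf
  obtain ⟨R, hR⟩ := hg
  exact ⟨P.mul R, fun x => by rw [PT.ev_mul, hR, hP]⟩

theorem div {f g : a.den → ℚ} (hf : PF a .rat f) (hg : PF a .rat g) :
    PF a .rat fun x => f x / g x := by
  obtain ⟨P, hP⟩ := hf
  obtain ⟨R, hR⟩ := hg
  exact ⟨P.div R, fun x => by rw [PT.ev_div, hR, hP]⟩

theorem floor {f : a.den → ℚ} (hf : PF a .rat f) : PF a .rat fun x => ((⌊f x⌋ : ℤ) : ℚ) := by
  obtain ⟨P, hP⟩ := hf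
  exact ⟨P.floor, fun x => by rw [PT.ev_floor, hP]⟩

theorem ceil {f : a.den → ℚ} (hf : PF a .rat f) : PF a .rat fun x => ((⌈f x⌉ : ℤ) : ℚ) :=
  ((const 0).sub ((const 0).sub hf).floor).of_eq fun x => by
    rw [zero_sub, zero_sub, Int.floor_neg]
    push_cast
    ring

theorem ite {p : a.den → Prop} [∀ x, Decidable (p x)] {f g : a.den → b.den} (hp : PD a p)
    (hf : PF a b f) (hg : PF a b g) : PF a b fun x => if p x then f x else g x := by
  obtain ⟨C, hC⟩ := hp
  obtain ⟨P, hP⟩ := hf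
  obtain ⟨R, hR⟩ := hg
  refine ⟨PT.ite C P R, fun x => ?_⟩
  rw [PT.ev_ite, hR, hP]
  beta_reduce
  by_cases h : p x
  · rw [if_pos h, if_pos ((hC x).2 h)]
  · rw [if_neg h, if_neg (mt (hC x).1 h)]

theorem nil : PF a (.list b) fun _ => [] := ⟨PT.nil a b, fun _ => rfl⟩

theorem cons {f : a.den → b.den} {g : a.den → List b.den} (hf : PF a b f) (hg : PF a (.list b) g) :
    PF a (.list b) fun x => f x :: g x := by
  obtain ⟨P, hP⟩ := hf
  obtain ⟨R, hR⟩ := hg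
  exact ⟨P.cons R, fun x => by rw [PT.ev_cons, hR, hP]⟩

theorem headD {l : a.den → List b.den} {d : a.den → b.den} (hl : PF a (.list b) l) (hd : PF a b d) :
    PF a b fun x => (l x).headD (d x) := by
  obtain ⟨P, hP⟩ := hl
  obtain ⟨R, hR⟩ := hd
  refine ⟨PT.caseList P R (PT.ident _).snd.fst, fun x => ?_⟩
  rw [PT.ev_caseList, hP, hR]
  beta_reduce
  cases l x <;> rfl

theorem tail {l : a.den → List b.den} (hl : PF a (.list b) l) :
    PF a (.list b) fun x => (l x).tail := by
  obtain ⟨P, hP⟩ := hl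
  refine ⟨PT.caseList P (PT.nil _ _) (PT.ident _).snd.snd, fun x => ?_⟩
  rw [PT.ev_caseList, hP]
  beta_reduce
  cases l x <;> rfl

/-- Folds with states of polynomial size. -/
theorem foldl_of_bdd {l : Γ.den → List b.den} {s₀ : Γ.den → s.den}
    {F : Γ.den → s.den → b.den → s.den} (hl : PF Γ (.list b) l) (hs : PF Γ s s₀)
    (hF : PF (.prod Γ (.prod s b)) s fun x => F x.1 x.2.1 x.2.2)
    (h : PolyBdd (fun x : Γ.den × s.den × List b.den => Γ.size x.1 + s.size x.2.1 +
        (Ty.list b).size x.2.2)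
      fun x => s.size (x.2.2.foldl (F x.1) x.2.1)) :
    PF Γ s fun x => (l x).foldl (F x) (s₀ x) := by
  obtain ⟨P, hP⟩ := hl
  obtain ⟨R, hR⟩ := hs
  obtain ⟨S, hS⟩ := hF
  have e : ∀ x : Γ.den, (fun s y => S.ev (x, s, y)) = F x := by
    intro x
    funext t y
    exact hS (x, t, y)
  refine ⟨PT.fold P R S ?_, fun x => ?_⟩
  · refine h.mono fun x => ?_
    rw [e]
  · rw [PT.ev_fold, hP, hR, e]

/-- Folds in which each step increases some measure of the state by a summand that does not depend
on the state. -/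
theorem foldl {l : Γ.den → List b.den} {s₀ : Γ.den → s.den} {F : Γ.den → s.den → b.den → s.den}
    (hl : PF Γ (.list b) l) (hs : PF Γ s s₀)
    (hF : PF (.prod Γ (.prod s b)) s fun x => F x.1 x.2.1 x.2.2) (φ : s.den → ℕ)
    (h₁ : PolyBdd φ s.size) (h₂ : PolyBdd s.size φ) (ψ : Γ.den → b.den → ℕ)
    (hψ : PolyBdd (fun x : Γ.den × b.den => Γ.size x.1 + b.size x.2) fun x => ψ x.1 x.2)
    (h : ∀ x t y, φ (F x t y) ≤ φ t + ψ x y) :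
    PF Γ s fun x => (l x).foldl (F x) (s₀ x) :=
  hl.foldl_of_bdd hs hF (polyBdd_foldl F φ h₁ h₂ (fun x => ψ x.1 x.2) hψ h)

theorem foldl_size {l : Γ.den → List b.den} {s₀ : Γ.den → s.den}
    {F : Γ.den → s.den → b.den → s.den}
    (hl : PF Γ (.list b) l) (hs : PF Γ s s₀)
    (hF : PF (.prod Γ (.prod s b)) s fun x => F x.1 x.2.1 x.2.2) (ψ : Γ.den → b.den → ℕ)
    (hψ : PolyBdd (fun x : Γ.den × b.den => Γ.size x.1 + b.size x.2) fun x => ψ x.1 x.2)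
    (h : ∀ x t y, s.size (F x t y) ≤ s.size t + ψ x y) :
    PF Γ s fun x => (l x).foldl (F x) (s₀ x) :=
  hl.foldl hs hF s.size (PolyBdd.self _) (PolyBdd.self _) ψ hψ h

end PF

namespace PD

theorem of_iff {p q : a.den → Prop} (h : PD a p) (e : ∀ x, p x ↔ q x) : PD a q :=
  h.imp fun _ hP x => (hP x).trans (e x)

theorem comp {p : b.den → Prop} {f : a.den → b.den} (hp : PD b p) (hf : PF a b f) :
    PD a fun x => p (f x) := by
  obtain ⟨P, hP⟩ := hp
  obtain ⟨R, hR⟩ := hf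
  exact ⟨P.comp R, fun x => by rw [PT.ev_comp, hR, hP]⟩

theorem pos {f : a.den → ℚ} (hf : PF a .rat f) : PD a fun x => 0 < f x :=
  hf.imp fun P hP x => by rw [hP]

theorem lt {f g : a.den → ℚ} (hf : PF a .rat f) (hg : PF a .rat g) : PD a fun x => f x < g x :=
  (pos (hg.sub hf)).of_iff fun _ => sub_pos

theorem not {p : a.den → Prop} (hp : PD a p) : PD a fun x => ¬ p x := by
  classical
  exact (pos (PF.ite hp (PF.const 0) (PF.const 1))).of_iff fun x => by split_ifs with h <;> simp [h]

theorem le {f g : a.den → ℚ} (hf : PF a .rat f) (hg : PF a .rat g) : PD a fun x => f x ≤ g x :=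
  (lt hg hf).not.of_iff fun _ => not_lt

theorem and {p q : a.den → Prop} (hp : PD a p) (hq : PD a q) : PD a fun x => p x ∧ q x := by
  classical
  exact (pos (PF.ite hp (PF.ite hq (PF.const 1) (PF.const 0)) (PF.const 0))).of_iff fun x => by
    by_cases h : p x <;> by_cases h' : q x <;> simp [h, h']

theorem or {p q : a.den → Prop} (hp : PD a p) (hq : PD a q) : PD a fun x => p x ∨ q x :=
  (hp.not.and hq.not).not.of_iff fun x => by tauto

theorem eq {f g : a.den → ℚ} (hf : PF a .rat f) (hg : PF a .rat g) : PD a fun x => f x = g x :=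
  ((le hf hg).and (le hg hf)).of_iff fun _ => le_antisymm_iff.symm

end PD

/-! ### List functions -/

/-- The elements of a list with their indices. -/
def enumQ {α : Type} (l : List α) : List (ℚ × α) := l.zipIdx.map fun y => ((y.2 : ℚ), y.1)

/-- The entry of a list at a given index. -/
def nthQ (l : List ℚ) (i : ℚ) : ℚ := ((enumQ l).map fun y => if y.1 = i then y.2 else 0).sum

/-- A list of numbers with one entry decreased by one. -/
def decQ (l : List ℚ) (i : ℚ) : List ℚ := (enumQ l).map fun y => if y.1 = i then y.2 - 1 else y.2

/-- Insertion of a number into a sorted list. -/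
def insertQ (r : ℚ) (l : List ℚ) : List ℚ :=
  (l.filter fun y => decide (y < r)) ++ r :: l.filter fun y => decide (r ≤ y)

theorem getElem_enumQ {α : Type} (l : List α) (k : ℕ) (h : k < (enumQ l).length) :
    (enumQ l)[k] = ((k : ℚ), l[k]'(by simpa [enumQ] using h)) := by
  simp [enumQ]

@[simp] theorem length_enumQ {α : Type} (l : List α) : (enumQ l).length = l.length := by
  simp [enumQ]

theorem enumQ_ofFn {α : Type} {n : ℕ} (f : Fin n → α) :
    enumQ (List.ofFn f) = List.ofFn fun j => (((j : ℕ) : ℚ), f j) := by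
  refine List.ext_getElem (by simp) fun k h1 h2 => ?_
  rw [getElem_enumQ]
  simp

theorem sum_ofFn_ite {n : ℕ} (f : Fin n → ℚ) (j : Fin n) :
    (List.ofFn fun i : Fin n => if (((i : ℕ) : ℚ) = (j : ℕ)) then f i else 0).sum = f j := by
  rw [List.sum_ofFn]
  simp only [Nat.cast_inj, Fin.val_inj]
  simp

theorem nthQ_ofFn {n : ℕ} (f : Fin n → ℚ) (j : Fin n) : nthQ (List.ofFn f) (j : ℕ) = f j := by
  rw [nthQ, enumQ_ofFn, List.map_ofFn]
  exact sum_ofFn_ite f j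

theorem nthQ_getElem (l : List ℚ) (k : ℕ) (h : k < l.length) : nthQ l k = l[k] := by
  have := nthQ_ofFn (fun i : Fin l.length => l[i]) ⟨k, h⟩
  simpa using this

theorem decQ_key {n : ℕ} (ν : Fin n → ℕ) (j : Fin n) (hj : 0 < ν j) :
    decQ (Instance.key ν) (j : ℕ) = Instance.key (Instance.dec ν j) := by
  rw [decQ, Instance.key, enumQ_ofFn, List.map_ofFn, Instance.key]
  congr 1
  funext i
  simp only [Function.comp, Nat.cast_inj, Fin.val_inj, Instance.dec]
  by_cases h : i = j
  · subst h
    rw [if_pos rfl, Function.update_self, Nat.cast_sub hj]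
    simp
  · rw [if_neg h, Function.update_of_ne h]

theorem insertQ_eq (r : ℚ) (l : List ℚ) (hs : l.Pairwise (· ≤ ·)) :
    insertQ r l = l.orderedInsert (· ≤ ·) r := by
  induction l with
  | nil => simp [insertQ]
  | cons y t ih =>
    have ht := List.pairwise_cons.1 hs
    rw [List.orderedInsert_cons]
    by_cases h : r ≤ y
    · rw [if_pos h]
      have h3 : ∀ z ∈ y :: t, r ≤ z := by
        intro z hz
        rcases List.mem_cons.1 hz with rfl | hz
        · exact h
        · exact h.trans (ht.1 z hz)
      rw [insertQ, List.filter_eq_nil_iff.2 fun z hz => by simpa using h3 z hz,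
        List.filter_eq_self.2 fun z hz => by simpa using h3 z hz]
      rfl
    · rw [if_neg h, ← ih ht.2]
      have h3 : y < r := not_le.1 h
      simp [insertQ, h3]

/-- The language has no test for equality of lists, so it is reduced to numbers. The lengths must be
compared as well, since `nthQ` yields `0` out of range. -/
theorem eq_iff_nthQ (l l' : List ℚ) :
    l = l' ↔ (l.length : ℚ) = l'.length ∧ ∀ y ∈ enumQ l, nthQ l' y.1 = y.2 := by
  constructor
  · rintro rfl
    refine ⟨rfl, fun y hy => ?_⟩
    obtain ⟨k, hk, rfl⟩ := List.getElem_of_mem hy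
    rw [getElem_enumQ, nthQ_getElem]
  · rintro ⟨h1, h2⟩
    have h1 : l.length = l'.length := by exact_mod_cast h1
    refine List.ext_getElem h1 fun k hk hk' => ?_
    have h3 := h2 _ (List.getElem_mem (l := enumQ l) (n := k) (by simpa using hk))
    rw [getElem_enumQ] at h3
    exact h3.symm.trans (nthQ_getElem _ _ hk')

namespace PF

theorem sum {l : Γ.den → List b.den} {g : Γ.den → b.den → ℚ} (hl : PF Γ (.list b) l)
    (hg : PF (.prod Γ b) .rat fun x => g x.1 x.2) : PF Γ .rat fun x => ((l x).map (g x)).sum := by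
  -- States are measured by `ht`, which grows additively. Going back and forth between `size` and
  -- `ht` would lose a factor of two in each step.
  have h := hl.foldl (F := fun x (t : Ty.rat.den) y => (t + g x y : ℚ)) (const 0)
    (id.snd.fst.add (hg.comp (id.fst.pair id.snd.snd))) ht
    ((((PolyBdd.const _ 2).mul (PolyBdd.self _)).add (PolyBdd.const _ 1)).mono size_le_ht)
    (PolyBdd.of_le ht_le_size) (fun x y => Ty.rat.size (g x y) + 1)
    (hg.size_pair.add (PolyBdd.const _ 1)) (fun x t y => by
      have h1 := ht_add t (g x y)
      have h2 := ht_le_size (g x y)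
      omega)
  exact h.of_eq fun x => by rw [List.sum_eq_foldl, List.foldl_map]

/-- The state of a fold is replaced if a condition holds. -/
theorem foldSel {l : Γ.den → List b.den} {s₀ : Γ.den → s.den} {p : Γ.den → s.den → b.den → Prop}
    [∀ x t y, Decidable (p x t y)] {g : Γ.den → b.den → s.den} (hl : PF Γ (.list b) l)
    (hs : PF Γ s s₀) (hp : PD (.prod Γ (.prod s b)) fun x => p x.1 x.2.1 x.2.2)
    (hg : PF (.prod Γ b) s fun x => g x.1 x.2) :
    PF Γ s fun x => (l x).foldl (fun t y => if p x t y then g x y else t) (s₀ x) := by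
  refine hl.foldl_size (F := fun x t y => if p x t y then g x y else t) hs
    (ite hp (hg.comp (id.fst.pair id.snd.snd)) id.snd.fst) (fun x y => s.size (g x y))
    hg.size_pair ?_
  intro x t y
  split_ifs <;> omega

theorem reverse {l : Γ.den → List b.den} (hl : PF Γ (.list b) l) :
    PF Γ (.list b) fun x => (l x).reverse := by
  have h := hl.foldl_size (F := fun _ (t : (Ty.list b).den) y => (y :: t : List b.den)) nil
    (id.snd.snd.cons id.snd.fst) (fun x y => b.size y + 1)
    ((PolyBdd.of_le fun x => by omega).add (PolyBdd.const _ 1)) (fun x t y => by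
      rw [Ty.size_cons]; omega)
  refine h.of_eq fun x => ?_
  rw [List.foldl_flip_cons_eq_append', List.append_nil]

theorem append {l l' : Γ.den → List b.den} (hl : PF Γ (.list b) l) (hl' : PF Γ (.list b) l') :
    PF Γ (.list b) fun x => l x ++ l' x := by
  have h := hl.reverse.foldl_size (F := fun _ (t : (Ty.list b).den) y => (y :: t : List b.den)) hl'
    (id.snd.snd.cons id.snd.fst) (fun x y => b.size y + 1)
    ((PolyBdd.of_le fun x => by omega).add (PolyBdd.const _ 1)) (fun x t y => by
      rw [Ty.size_cons]; omega)
  refine h.of_eq fun x => ?_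
  rw [List.foldl_flip_cons_eq_append', List.reverse_reverse]

theorem filter {l : Γ.den → List b.den} {p : Γ.den → b.den → Prop} [∀ x y, Decidable (p x y)]
    (hl : PF Γ (.list b) l) (hp : PD (.prod Γ b) fun x => p x.1 x.2) :
    PF Γ (.list b) fun x => (l x).filter fun y => decide (p x y) := by
  have h := hl.foldl_size
    (F := fun x (t : (Ty.list b).den) y => (if p x y then y :: t else t : List b.den)) nil
    (ite (hp.comp (id.fst.pair id.snd.snd)) (id.snd.snd.cons id.snd.fst) id.snd.fst)
    (fun x y => b.size y + 1)
    ((PolyBdd.of_le fun x => by omega).add (PolyBdd.const _ 1)) (fun x t y => by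
      split_ifs
      · rw [Ty.size_cons]; omega
      · omega)
  refine h.reverse.of_eq fun x => ?_
  have key : ∀ (l t : List b.den),
      (l.foldl (fun t y => if p x y then y :: t else t) t).reverse =
        t.reverse ++ l.filter fun y => decide (p x y) := by
    intro l
    induction l with
    | nil => simp
    | cons y l ih =>
      intro t
      rw [List.foldl_cons, ih, List.filter_cons]
      by_cases h : p x y <;> simp [h]
  exact (key _ _).trans (by simp)

theorem map {l : Γ.den → List b.den} {g : Γ.den → b.den → c.den} (hl : PF Γ (.list b) l)
    (hg : PF (.prod Γ b) c fun x => g x.1 x.2) : PF Γ (.list c) fun x => (l x).map (g x) := by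
  have h := hl.reverse.foldl_size
    (F := fun x (t : (Ty.list c).den) y => (g x y :: t : List c.den)) nil
    ((hg.comp (id.fst.pair id.snd.snd)).cons id.snd.fst) (fun x y => c.size (g x y) + 1)
    (hg.size_pair.add (PolyBdd.const _ 1)) (fun x t y => by rw [Ty.size_cons]; omega)
  refine h.of_eq fun x => ?_
  rw [List.foldl_reverse]
  induction l x with
  | nil => rfl
  | cons y t ih => rw [List.foldr_cons, ih, List.map_cons]

theorem length {l : Γ.den → List b.den} (hl : PF Γ (.list b) l) :
    PF Γ .rat fun x => ((l x).length : ℚ) :=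
  (hl.sum (g := fun _ _ => 1) (const 1)).of_eq fun x => by simp

theorem max {f g : a.den → ℚ} (hf : PF a .rat f) (hg : PF a .rat g) :
    PF a .rat fun x => Max.max (f x) (g x) :=
  (ite (PD.le hf hg) hg hf).of_eq fun x => (max_def (f x) (g x)).symm

theorem enum {l : Γ.den → List b.den} (hl : PF Γ (.list b) l) :
    PF Γ (.list (.prod .rat b)) fun x => enumQ (l x) := by
  -- The index attached to an element depends on the length of the state, so the growth per step is
  -- not independent of the state; the total size is bounded directly by a quadratic expression.
  have h := hl.foldl_of_bdd (F := fun _ (t : (Ty.list (.prod .rat b)).den) y =>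
      ((((t.length : ℕ) : ℚ), y) :: t : List (ℚ × b.den))) nil
    ((id.snd.fst.length.pair id.snd.snd).cons id.snd.fst) (by
    set μ := fun x : Γ.den × List (ℚ × b.den) × List b.den => Γ.size x.1 +
      (Ty.list (.prod .rat b)).size x.2.1 + (Ty.list b).size x.2.2 with hμ
    have key : ∀ (l : List b.den) (t : List (ℚ × b.den)),
        (Ty.list (.prod .rat b)).size
            (l.foldl (fun (t : List (ℚ × b.den)) y => (((t.length : ℕ) : ℚ), y) :: t) t) ≤
          (Ty.list (.prod .rat b)).size t + (Ty.list b).size l +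
            l.length * (2 * (t.length + l.length) + 4) := by
      intro l
      induction l with
      | nil =>
        intro t
        simp only [List.foldl_nil]
        omega
      | cons y l ih =>
        intro t
        rw [List.foldl_cons]
        refine (ih _).trans ?_
        have h2 := ht_natCast_le (le_refl t.length)
        have h3 := size_le_ht (t.length : ℚ)
        have h7 := Ty.size_cons (a := .prod .rat b) (((t.length : ℕ) : ℚ), y) t
        have h8 := Ty.size_prod (a := .rat) (b := b) (((t.length : ℕ) : ℚ), y)
        have h9 := Ty.size_cons y l
        simp only [List.length_cons] at h8 ⊢
        have h6 : (l.length + 1) * (2 * (t.length + (l.length + 1)) + 4) =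
          l.length * (2 * (t.length + 1 + l.length) + 4) +
            (2 * (t.length + (l.length + 1)) + 4) := by ring
        omega
    have hp : PolyBdd μ fun x => μ x + μ x * (2 * μ x + 4) :=
      (PolyBdd.self μ).add ((PolyBdd.self μ).mul
        (((PolyBdd.const μ 2).mul (PolyBdd.self μ)).add (PolyBdd.const μ 4)))
    refine hp.mono fun x => ?_
    obtain ⟨x, t, l⟩ := x
    refine (key l t).trans ?_
    have e1 := Ty.length_lt_size l
    have e2 := Ty.length_lt_size (a := .prod .rat b) t
    refine Nat.add_le_add ?_ (Nat.mul_le_mul ?_ ?_) <;> simp only [hμ] <;> omega)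
  refine h.reverse.of_eq fun x => ?_
  have key : ∀ (l : List b.den) (t : List (ℚ × b.den)),
      (l.foldl (fun (t : List (ℚ × b.den)) y => (((t.length : ℕ) : ℚ), y) :: t) t).reverse =
        t.reverse ++ (l.zipIdx t.length).map fun y => ((y.2 : ℚ), y.1) := by
    intro l
    induction l with
    | nil => simp
    | cons y l ih =>
      intro t
      rw [List.foldl_cons, ih]
      simp
  exact (key (l x) []).trans (by simp [enumQ])

theorem nth {l : Γ.den → List ℚ} {i : Γ.den → ℚ} (hl : PF Γ (.list .rat) l) (hi : PF Γ .rat i) :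
    PF Γ .rat fun x => nthQ (l x) (i x) :=
  sum (b := .prod .rat .rat) (l := fun x => enumQ (l x)) hl.enum (g := fun x (y : ℚ × ℚ) => (if y.1 = i x then y.2 else 0 : ℚ))
    (ite (PD.eq id.snd.fst (hi.comp id.fst)) id.snd.snd (const 0))

theorem dec {l : Γ.den → List ℚ} {i : Γ.den → ℚ} (hl : PF Γ (.list .rat) l) (hi : PF Γ .rat i) :
    PF Γ (.list .rat) fun x => decQ (l x) (i x) :=
  map (b := .prod .rat .rat) (c := .rat) (l := fun x => enumQ (l x)) hl.enum
    (g := fun x (y : ℚ × ℚ) => (if y.1 = i x then y.2 - 1 else y.2 : ℚ))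
    (ite (PD.eq id.snd.fst (hi.comp id.fst)) (id.snd.snd.sub (const 1)) id.snd.snd)

theorem insert {r : Γ.den → ℚ} {l : Γ.den → List ℚ} (hr : PF Γ .rat r) (hl : PF Γ (.list .rat) l) :
    PF Γ (.list .rat) fun x => insertQ (r x) (l x) :=
  (hl.filter (PD.lt id.snd (hr.comp id.fst))).append
    (hr.cons (hl.filter (PD.le (hr.comp id.fst) id.snd)))

end PF

namespace PD

theorem all {l : Γ.den → List b.den} {p : Γ.den → b.den → Prop} (hl : PF Γ (.list b) l)
    (hp : PD (.prod Γ b) fun x => p x.1 x.2) : PD Γ fun x => ∀ y ∈ l x, p x y := by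
  classical
  exact (le (hl.filter (p := fun x y => ¬ p x y) hp.not).length (PF.const 0)).of_iff fun x => by
    have : ∀ k : ℕ, (k : ℚ) ≤ 0 ↔ k = 0 := fun k => by
      rw [← Nat.cast_zero, Nat.cast_le, Nat.le_zero]
    rw [this, List.length_eq_zero_iff, List.filter_eq_nil_iff]
    simp

theorem exists_mem {l : Γ.den → List b.den} {p : Γ.den → b.den → Prop} (hl : PF Γ (.list b) l)
    (hp : PD (.prod Γ b) fun x => p x.1 x.2) : PD Γ fun x => ∃ y ∈ l x, p x y :=
  (all (p := fun x y => ¬ p x y) hl hp.not).not.of_iff fun _ => by push Not; rfl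

theorem eqList {l l' : Γ.den → List ℚ} (hl : PF Γ (.list .rat) l) (hl' : PF Γ (.list .rat) l') :
    PD Γ fun x => l x = l' x :=
  ((eq hl.length hl'.length).and (all (p := fun x (y : ℚ × ℚ) => nthQ (l' x) y.1 = y.2) hl.enum
    (eq ((hl'.comp PF.id.fst).nth PF.id.snd.fst) PF.id.snd.snd))).of_iff fun _ =>
      (eq_iff_nthQ _ _).symm

end PD

end BernoulliSched

namespace BernoulliSched

/-- The type of the input data that the dynamic program works with: `1 / ε`, and the list of the
types with their indices, sizes and probabilities. -/
abbrev ctxTy : Ty := .prod .rat (.list (.prod .rat (.prod .rat (.list .rat))))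

/-! ### Computation of the time points from the input data -/

namespace Raw

/-- The size of a type. -/
def sz (D : ctxTy.den) (i : ℚ) : ℚ := (D.2.map fun y => if y.1 = i then y.2.1 else 0).sum

/-- The group of a type. -/
def grp (D : ctxTy.den) (j : ℚ) : ℚ :=
  1 + (D.2.map fun y => if y.1 ≤ j ∧ D.1 * D.1 * y.2.1 ≤ sz D (y.1 - 1) then (1 : ℚ) else 0).sum

/-- The number of groups. -/
def γ (D : ctxTy.den) : ℚ := grp D (D.2.length : ℚ)

/-- The types of a group. -/
def types (D : ctxTy.den) (h : ℚ) : List (ℚ × ℚ × List ℚ) :=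
  D.2.filter fun y => decide (grp D y.1 = h)

/-- The smallest size in a group. -/
def pG (D : ctxTy.den) (h : ℚ) : ℚ := ((types D h).reverse.map fun y => y.2.1).headD 0

/-- The largest size in a group. -/
def pmax (D : ctxTy.den) (h : ℚ) : ℚ := ((types D h).map fun y => y.2.1).headD 0

/-- The number of types in later groups. -/
def above (D : ctxTy.den) (k : ℚ) : ℚ :=
  (D.2.map fun y => if k < grp D y.1 then (1 : ℚ) else 0).sum

/-- The shifted sizes. -/
def pstar (D : ctxTy.den) (h : ℚ) : ℚ :=
  pG D h + (1 + 1 / D.1) * (1 / D.1) * (D.2.map fun y =>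
    if h ≤ y.1 + 1 ∧ y.1 + 1 < γ D then (above D (y.1 + 1) + 3) * pG D (y.1 + 1) else 0).sum

/-- The distance of consecutive time points. -/
def dl (D : ctxTy.den) (h : ℚ) : ℚ := 1 / D.1 * pG D h

/-- The stretching factor. -/
def κ (D : ctxTy.den) : ℚ := 1 + 5 * (1 / D.1)

/-- The thresholds. -/
def pcirc (D : ctxTy.den) (h : ℚ) : ℚ :=
  if h < γ D ∨ h ≤ 1 then κ D * pstar D h else pstar D h

/-- The number of steps within the part of the time axis that belongs to a group. -/
def lastIdx (D : ctxTy.den) (g : ℚ) : ℚ :=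
  (⌈(pstar D (g - 1) - dl D g - pstar D g) / dl D g⌉ : ℤ) - 1

/-- The midpoint at the end of the part of the time axis that belongs to a group. -/
def mid (D : ctxTy.den) (g : ℚ) : ℚ :=
  (pstar D g + lastIdx D g * dl D g + pstar D (g - 1)) / 2

/-- The interval with a given point, within the part of the time axis that belongs to a group. -/
def interval (D : ctxTy.den) (g u : ℚ) : ℚ × ℚ :=
  if g ≤ 1 ∨ (⌊(u - pstar D g) / dl D g⌋ : ℤ) < lastIdx D g then
    (pstar D g + (⌊(u - pstar D g) / dl D g⌋ : ℤ) * dl D g,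
      pstar D g + ((⌊(u - pstar D g) / dl D g⌋ : ℤ) + 1) * dl D g)
  else if u < mid D g then (pstar D g + lastIdx D g * dl D g, mid D g)
  else (mid D g, pstar D (g - 1))

/-- The interval with a given point. -/
def bracket (D : ctxTy.den) (u : ℚ) : ℚ × ℚ :=
  ((D.2.filter fun y => decide ((y.1 + 1 < γ D ∨ y.1 + 1 ≤ 1) ∧ pstar D (y.1 + 1) ≤ u)).map
    fun y => interval D (y.1 + 1) u).headD (0, pstar D (max (γ D - 1) 1))

/-- The first start time in a given stretched interval. -/
def nextIn (D : ctxTy.den) (h t b e : ℚ) : ℚ :=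
  if 2 ≤ h ∧ pcirc D (h - 1) ≤ b then
    if b + (⌈(t - b) / dl D h⌉ : ℤ) * dl D h < e - pmax D h then
      b + (⌈(t - b) / dl D h⌉ : ℤ) * dl D h
    else e
  else if t ≤ b then b else e

/-- The first start time for the types of a group. -/
def next (D : ctxTy.den) (h t : ℚ) : ℚ :=
  nextIn D h t (κ D * (bracket D (t / κ D)).1) (κ D * (bracket D (t / κ D)).2)

end Raw

/-! ### Polynomial cost of the computation of the time points -/

namespace PF

variable {Γ : Ty} {D : Γ.den → ctxTy.den} {h t u b e : Γ.den → ℚ}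

theorem sz (hD : PF Γ ctxTy D) (hh : PF Γ .rat h) : PF Γ .rat fun x => Raw.sz (D x) (h x) :=
  hD.snd.sum (ite (PD.eq id.snd.fst (hh.comp id.fst)) id.snd.snd.fst (const 0))

theorem grp (hD : PF Γ ctxTy D) (hh : PF Γ .rat h) : PF Γ .rat fun x => Raw.grp (D x) (h x) := by
  have hD' := hD.comp (id (a := .prod Γ (.prod .rat (.prod .rat (.list .rat))))).fst
  exact (const 1).add (hD.snd.sum (ite ((PD.le id.snd.fst (hh.comp id.fst)).and
    (PD.le ((hD'.fst.mul hD'.fst).mul id.snd.snd.fst) (sz hD' (id.snd.fst.sub (const 1)))))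
    (const 1) (const 0)))

theorem γ (hD : PF Γ ctxTy D) : PF Γ .rat fun x => Raw.γ (D x) := grp hD hD.snd.length

theorem types (hD : PF Γ ctxTy D) (hh : PF Γ .rat h) :
    PF Γ (.list (.prod .rat (.prod .rat (.list .rat)))) fun x => Raw.types (D x) (h x) :=
  hD.snd.filter (PD.eq (grp (hD.comp id.fst) id.snd.fst) (hh.comp id.fst))

theorem pG (hD : PF Γ ctxTy D) (hh : PF Γ .rat h) : PF Γ .rat fun x => Raw.pG (D x) (h x) :=
  headD (map (types hD hh).reverse id.snd.snd.fst) (const 0)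

theorem pmax (hD : PF Γ ctxTy D) (hh : PF Γ .rat h) : PF Γ .rat fun x => Raw.pmax (D x) (h x) :=
  headD (map (types hD hh) id.snd.snd.fst) (const 0)

theorem above (hD : PF Γ ctxTy D) (hh : PF Γ .rat h) : PF Γ .rat fun x => Raw.above (D x) (h x) :=
  hD.snd.sum (ite (PD.lt (hh.comp id.fst) (grp (hD.comp id.fst) id.snd.fst)) (const 1) (const 0))

theorem pstar (hD : PF Γ ctxTy D) (hh : PF Γ .rat h) :
    PF Γ .rat fun x => Raw.pstar (D x) (h x) := by
  have hD' := hD.comp (id (a := .prod Γ (.prod .rat (.prod .rat (.list .rat))))).fst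
  have hk := (id (a := .prod Γ (.prod .rat (.prod .rat (.list .rat))))).snd.fst.add (const 1)
  exact (pG hD hh).add ((((const 1).add ((const 1).div hD.fst)).mul ((const 1).div hD.fst)).mul
    (hD.snd.sum (ite ((PD.le (hh.comp id.fst) hk).and (PD.lt hk (γ hD')))
      (((above hD' hk).add (const 3)).mul (pG hD' hk)) (const 0))))

theorem dl (hD : PF Γ ctxTy D) (hh : PF Γ .rat h) : PF Γ .rat fun x => Raw.dl (D x) (h x) :=
  ((const 1).div hD.fst).mul (pG hD hh)

theorem κ (hD : PF Γ ctxTy D) : PF Γ .rat fun x => Raw.κ (D x) :=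
  (const 1).add ((const 5).mul ((const 1).div hD.fst))

theorem pcirc (hD : PF Γ ctxTy D) (hh : PF Γ .rat h) : PF Γ .rat fun x => Raw.pcirc (D x) (h x) :=
  ite ((PD.lt hh (γ hD)).or (PD.le hh (const 1))) ((κ hD).mul (pstar hD hh)) (pstar hD hh)

theorem lastIdx (hD : PF Γ ctxTy D) (hh : PF Γ .rat h) :
    PF Γ .rat fun x => Raw.lastIdx (D x) (h x) :=
  ((((pstar hD (hh.sub (const 1))).sub (dl hD hh)).sub (pstar hD hh)).div (dl hD hh)).ceil.sub
    (const 1)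

theorem mid (hD : PF Γ ctxTy D) (hh : PF Γ .rat h) : PF Γ .rat fun x => Raw.mid (D x) (h x) :=
  (((pstar hD hh).add ((lastIdx hD hh).mul (dl hD hh))).add (pstar hD (hh.sub (const 1)))).div
    (const 2)

theorem interval (hD : PF Γ ctxTy D) (hh : PF Γ .rat h) (hu : PF Γ .rat u) :
    PF Γ (.prod .rat .rat) fun x => Raw.interval (D x) (h x) (u x) := by
  have hi := ((hu.sub (pstar hD hh)).div (dl hD hh)).floor
  exact ite ((PD.le hh (const 1)).or (PD.lt hi (lastIdx hD hh)))
    (((pstar hD hh).add (hi.mul (dl hD hh))).pair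
      ((pstar hD hh).add ((hi.add (const 1)).mul (dl hD hh))))
    (ite (PD.lt hu (mid hD hh))
      (((pstar hD hh).add ((lastIdx hD hh).mul (dl hD hh))).pair (mid hD hh))
      ((mid hD hh).pair (pstar hD (hh.sub (const 1)))))

theorem bracket (hD : PF Γ ctxTy D) (hu : PF Γ .rat u) :
    PF Γ (.prod .rat .rat) fun x => Raw.bracket (D x) (u x) := by
  have hD' := hD.comp (id (a := .prod Γ (.prod .rat (.prod .rat (.list .rat))))).fst
  have hu' := hu.comp (id (a := .prod Γ (.prod .rat (.prod .rat (.list .rat))))).fst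
  have hk := (id (a := .prod Γ (.prod .rat (.prod .rat (.list .rat))))).snd.fst.add (const 1)
  exact headD (map (hD.snd.filter (((PD.lt hk (γ hD')).or (PD.le hk (const 1))).and
    (PD.le (pstar hD' hk) hu'))) (interval hD' hk hu'))
    ((const 0).pair (pstar hD (((γ hD).sub (const 1)).max (const 1))))

theorem nextIn (hD : PF Γ ctxTy D) (hh : PF Γ .rat h) (ht : PF Γ .rat t) (hb : PF Γ .rat b)
    (he : PF Γ .rat e) : PF Γ .rat fun x => Raw.nextIn (D x) (h x) (t x) (b x) (e x) := by
  have hx := hb.add (((ht.sub hb).div (dl hD hh)).ceil.mul (dl hD hh))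
  exact ite ((PD.le (const 2) hh).and (PD.le (pcirc hD (hh.sub (const 1))) hb))
    (ite (PD.lt hx (he.sub (pmax hD hh))) hx he) (ite (PD.le ht hb) hb he)

theorem next (hD : PF Γ ctxTy D) (hh : PF Γ .rat h) (ht : PF Γ .rat t) :
    PF Γ .rat fun x => Raw.next (D x) (h x) (t x) := by
  have hB := bracket hD (ht.div (κ hD))
  exact nextIn hD hh ht ((κ hD).mul hB.fst) ((κ hD).mul hB.snd)

end PF

end BernoulliSched

/-! ### Agreement of the computed time points with their definitions -/

namespace BernoulliSched

namespace Instance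

variable {n E : ℕ} {I : Instance n E}

/-- The input data for the dynamic program. -/
def ctx (I : Instance n E) : ctxTy.den :=
  ((E : ℚ), List.ofFn fun j => (((j : ℕ) : ℚ), I.p j, I.probs j))

theorem sum_map_ctx (f : ℚ × ℚ × List ℚ → ℚ) :
    (I.ctx.2.map f).sum = ∑ j : Fin n, f (((j : ℕ) : ℚ), I.p j, I.probs j) := by
  rw [ctx, List.map_ofFn, List.sum_ofFn]
  rfl

theorem raw_sz {k : ℕ} (hk : k < n) : Raw.sz I.ctx k = I.p ⟨k, hk⟩ := by
  rw [Raw.sz, sum_map_ctx]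
  have : ∀ j : Fin n, (j : ℕ) = k ↔ j = ⟨k, hk⟩ := fun j => by rw [Fin.ext_iff]
  simp [this]

/-- The first type has no predecessor. The lookup then returns `0`, which lies below every positive
multiple of a size, so no new group is counted there. -/
theorem raw_sz_neg : Raw.sz I.ctx (0 - 1) = 0 := by
  rw [Raw.sz, sum_map_ctx]
  refine Finset.sum_eq_zero fun j _ => if_neg ?_
  have : (0 : ℚ) ≤ (j : ℕ) := Nat.cast_nonneg _
  intro h
  simp only at h
  linarith

theorem new_group_iff (hE : 3 ≤ E) (i : Fin n) :
    ((E : ℚ) * E * I.p i ≤ Raw.sz I.ctx (((i : ℕ) : ℚ) - 1)) ↔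
      ∃ i₀ : Fin n, (i₀ : ℕ) + 1 = i ∧ I.p i ≤ I.eps ^ 2 * I.p i₀ := by
  have hE0 : (0 : ℚ) < E := by exact_mod_cast (by omega : 0 < E)
  obtain ⟨i, hi⟩ := i
  cases i with
  | zero =>
    simp only [Nat.cast_zero]
    rw [raw_sz_neg]
    have h1 := I.p_pos ⟨0, hi⟩
    have : 0 < (E : ℚ) * E * I.p ⟨0, hi⟩ := by positivity
    constructor
    · intro h; linarith
    · rintro ⟨i₀, h, -⟩; omega
  | succ i =>
    simp only [Nat.cast_succ, add_sub_cancel_right]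
    rw [raw_sz (show i < n by omega)]
    have e : ∀ x y : ℚ, (E : ℚ) * E * x ≤ y ↔ x ≤ I.eps ^ 2 * y := by
      intro x y
      rw [eps, div_pow, one_pow, one_div, ← div_eq_inv_mul, le_div_iff₀ (by positivity)]
      rw [show (E : ℚ) * E * x = x * E ^ 2 by ring]
    rw [e]
    constructor
    · intro h; exact ⟨⟨i, by omega⟩, rfl, h⟩
    · rintro ⟨i₀, h, h'⟩
      have : i₀ = ⟨i, by omega⟩ := Fin.ext (by simp only at h ⊢; omega)
      rwa [← this]

theorem raw_grp (hE : 3 ≤ E) (j : Fin n) : Raw.grp I.ctx (j : ℕ) = I.grp j := by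
  rw [Raw.grp, sum_map_ctx, grp]
  simp only [Nat.cast_le, Fin.val_fin_le, Nat.cast_add, Nat.cast_one, add_comm, Finset.card_filter,
    Nat.cast_sum, Nat.cast_ite, Nat.cast_zero]
  congr 1
  refine Finset.sum_congr rfl fun i _ => ?_
  have := new_group_iff (I := I) hE i
  simp only [ctx] at this ⊢
  simp only [this]

/-- The raw group number is taken at index `n`, one past the last type. It agrees with that of the
last type, because the sum runs over existing types only. -/
theorem raw_γ (hE : 3 ≤ E) (hn : 0 < n) : Raw.γ I.ctx = I.γ := by
  have hl : (I.ctx.2.length : ℚ) = n := by simp [ctx]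
  have h1 : I.γ = I.grp ⟨n - 1, by omega⟩ := by
    refine le_antisymm (Finset.sup_le fun j _ => I.grp_mono ?_) (I.grp_le_γ _)
    rw [Fin.le_def]
    have := j.2
    simp only
    omega
  rw [Raw.γ, hl, h1, ← raw_grp hE, Raw.grp, Raw.grp, sum_map_ctx, sum_map_ctx]
  congr 1
  refine Finset.sum_congr rfl fun i _ => ?_
  have h2 : ((i : ℕ) : ℚ) ≤ n := by exact_mod_cast i.2.le
  have h3 : ((i : ℕ) : ℚ) ≤ (n - 1 : ℕ) := by have := i.2; exact_mod_cast (by omega : (i : ℕ) ≤ n - 1)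
  simp only [h2, h3, true_and]

theorem types_ctx (hE : 3 ≤ E) (h : ℕ) : Raw.types I.ctx h =
    ((List.finRange n).filter fun j => decide (I.grp j = h)).map
      fun j : Fin n => (((j : ℕ) : ℚ), I.p j, I.probs j) := by
  rw [Raw.types, show I.ctx.2 = (List.finRange n).map
    (fun j : Fin n => (((j : ℕ) : ℚ), I.p j, I.probs j)) from by rw [ctx, List.ofFn_eq_map],
    List.filter_map]
  congr 1
  refine List.filter_congr fun j _ => ?_
  simp only [Function.comp, raw_grp hE, Nat.cast_inj]

theorem head_filter_finRange {p : Fin n → Bool} {j : Fin n} (hj : p j = true)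
    (h : ∀ i, p i = true → j ≤ i) : ∃ l, (List.finRange n).filter p = j :: l := by
  have hs : ((List.finRange n).filter p).Pairwise (· < ·) :=
    List.Pairwise.filter _ (List.pairwise_lt_finRange n)
  have hm : j ∈ (List.finRange n).filter p := by simp [hj]
  cases hl : (List.finRange n).filter p with
  | nil => rw [hl] at hm; simp at hm
  | cons a l =>
    rw [hl] at hm hs
    have ha : a ∈ (List.finRange n).filter p := by rw [hl]; simp
    have h1 := h a (List.mem_filter.1 ha).2
    rcases List.mem_cons.1 hm with rfl | h2
    · exact ⟨l, rfl⟩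
    · exact absurd ((List.pairwise_cons.1 hs).1 j h2) (not_lt.2 h1)

theorem head_reverse_filter_finRange {p : Fin n → Bool} {j : Fin n} (hj : p j = true)
    (h : ∀ i, p i = true → i ≤ j) : ∃ l, ((List.finRange n).filter p).reverse = j :: l := by
  have hs : ((List.finRange n).filter p).reverse.Pairwise (· > ·) :=
    List.pairwise_reverse.2 (List.Pairwise.filter _ (List.pairwise_lt_finRange n))
  have hm : j ∈ ((List.finRange n).filter p).reverse := by simp [hj]
  cases hl : ((List.finRange n).filter p).reverse with
  | nil => rw [hl] at hm; simp at hm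
  | cons a l =>
    rw [hl] at hm hs
    have ha : a ∈ ((List.finRange n).filter p).reverse := by rw [hl]; simp
    have h1 := h a (List.mem_filter.1 (List.mem_reverse.1 ha)).2
    rcases List.mem_cons.1 hm with rfl | h2
    · exact ⟨l, rfl⟩
    · exact absurd ((List.pairwise_cons.1 hs).1 j h2) (not_lt.2 h1)

/-- Types are listed by decreasing size, so the smallest size of a group is found at its last entry.
-/
theorem raw_pG (hE : 3 ≤ E) {h : ℕ} (hh : I.IsGrp h) : Raw.pG I.ctx h = I.pG h := by
  obtain ⟨j, hj, e, hm⟩ := hh.exists_last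
  obtain ⟨l, hl⟩ := head_reverse_filter_finRange (p := fun j => decide (I.grp j = h)) (j := j)
    (by simpa using hj) (fun i hi => hm i (by simpa using hi))
  rw [Raw.pG, types_ctx hE, ← List.map_reverse, hl, e]
  rfl

theorem raw_pmax (hE : 3 ≤ E) {h : ℕ} (hh : I.IsGrp h) : Raw.pmax I.ctx h = I.pmax h := by
  obtain ⟨j, hj, e, hm⟩ := hh.exists_first
  obtain ⟨l, hl⟩ := head_filter_finRange (p := fun j => decide (I.grp j = h)) (j := j)
    (by simpa using hj) (fun i hi => hm i (by simpa using hi))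
  rw [Raw.pmax, types_ctx hE, hl, e]
  rfl

theorem raw_above (hE : 3 ≤ E) (k : ℕ) :
    Raw.above I.ctx k = ∑ i ∈ Finset.Ioc k I.γ, (I.gsize i : ℚ) := by
  rw [Raw.above, sum_map_ctx]
  simp only [raw_grp hE, Nat.cast_lt, gsize, Finset.card_filter, Nat.cast_sum, Nat.cast_ite,
    Nat.cast_one, Nat.cast_zero]
  rw [Finset.sum_comm]
  refine Finset.sum_congr rfl fun j _ => ?_
  rw [Finset.sum_ite_eq]
  simp [I.grp_le_γ j]

/-- The program has no list of the groups. It sums over the types with `k = j + 1` instead; as `γ ≤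
n`, every group occurs, and superfluous terms are `0`. -/
theorem raw_pstar (hE : 3 ≤ E) {h : ℕ} (hh : I.IsGrp h) : Raw.pstar I.ctx h = I.pstar h := by
  rw [Raw.pstar, sum_map_ctx, pstar, raw_pG hE hh, raw_γ hE hh.pos]
  have h1 : ∀ j : Fin n, (((j : ℕ) : ℚ) + 1) = ((j + 1 : ℕ) : ℚ) := fun j => by push_cast; rfl
  simp only [h1, raw_above hE, Nat.cast_le, Nat.cast_lt]
  have h2 : ∑ j : Fin n, (if h ≤ (j : ℕ) + 1 ∧ (j : ℕ) + 1 < I.γ then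
      ((∑ i ∈ Finset.Ioc ((j : ℕ) + 1) I.γ, (I.gsize i : ℚ)) + 3) * Raw.pG I.ctx ((j + 1 : ℕ) : ℚ)
        else 0) =
      ∑ k ∈ Finset.Ico h I.γ, ((∑ i ∈ Finset.Ioc k I.γ, (I.gsize i : ℚ)) + 3) * I.pG k := by
    rw [Fin.sum_univ_eq_sum_range (fun j => if h ≤ j + 1 ∧ j + 1 < I.γ then
      ((∑ i ∈ Finset.Ioc (j + 1) I.γ, (I.gsize i : ℚ)) + 3) * Raw.pG I.ctx ((j + 1 : ℕ) : ℚ)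
        else 0), ← Finset.sum_filter]
    refine Finset.sum_bij (fun j _ => j + 1) ?_ ?_ ?_ ?_
    · intro j hj
      simp only [Finset.mem_filter] at hj
      exact Finset.mem_Ico.2 hj.2
    · intro a _ b _ hab; omega
    · intro k hk
      rw [Finset.mem_Ico] at hk
      have := hh.1
      have := I.γ_le
      exact ⟨k - 1, by simp only [Finset.mem_filter, Finset.mem_range]; omega, by omega⟩
    · intro j hj
      simp only [Finset.mem_filter] at hj
      rw [raw_pG hE ⟨by omega, hj.2.2.le⟩]
  rw [h2]
  rfl

theorem raw_dl (hE : 3 ≤ E) {h : ℕ} (hh : I.IsGrp h) : Raw.dl I.ctx h = I.dl h := by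
  rw [Raw.dl, raw_pG hE hh]
  rfl

theorem raw_κ : Raw.κ I.ctx = I.κ := rfl

theorem isReg_iff {g : ℕ} (hg : 1 ≤ g) : I.IsReg g ↔ g < I.γ ∨ g ≤ 1 := by
  unfold IsReg
  omega

theorem raw_pcirc (hE : 3 ≤ E) {h : ℕ} (hh : I.IsGrp h) : Raw.pcirc I.ctx h = I.pcirc h := by
  classical
  rw [Raw.pcirc, raw_pstar hE hh, raw_γ hE hh.pos, raw_κ]
  have e : ((h : ℚ) < I.γ ∨ (h : ℚ) ≤ 1) ↔ I.IsReg h := by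
    rw [isReg_iff hh.1, Nat.cast_lt, Nat.cast_le_one]
  rw [if_congr e rfl rfl]
  split_ifs with h1
  · exact (pcirc_eq hE hh.pos h1).symm
  · obtain h2 | ⟨rfl, h2⟩ := hh.isReg_or
    · exact absurd h2 h1
    · rw [(pcirc_γ hE h2).1, pstar_γ]

theorem cast_pred {g : ℕ} (h : 1 ≤ g) : (g : ℚ) - 1 = ((g - 1 : ℕ) : ℚ) := by
  rw [Nat.cast_sub h, Nat.cast_one]

theorem raw_lastIdx (hE : 3 ≤ E) (hn : 0 < n) {g : ℕ} (hg : I.IsReg g) (h2 : 2 ≤ g) :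
    Raw.lastIdx I.ctx g = I.lastIdx g := by
  have h1 := pstar_lt_sub hE hn hg h2
  have h3 := dl_pos hE (hg.isGrp hn)
  have h4 : 0 < (I.pstar (g - 1) - I.dl g - I.pstar g) / I.dl g := div_pos (by linarith) h3
  have h5 : 0 < ⌈(I.pstar (g - 1) - I.dl g - I.pstar g) / I.dl g⌉₊ := Nat.ceil_pos.2 h4
  rw [Raw.lastIdx, cast_pred hg.1, raw_pstar hE ((hg.pred h2).isGrp hn), raw_dl hE (hg.isGrp hn),
    raw_pstar hE (hg.isGrp hn), lastIdx, Nat.cast_sub h5, natCast_ceil_eq_intCast_ceil h4.le,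
    Nat.cast_one]

theorem raw_mid (hE : 3 ≤ E) (hn : 0 < n) {g : ℕ} (hg : I.IsReg g) (h2 : 2 ≤ g) :
    Raw.mid I.ctx g = I.mid g := by
  rw [Raw.mid, raw_lastIdx hE hn hg h2, cast_pred hg.1, raw_pstar hE ((hg.pred h2).isGrp hn),
    raw_dl hE (hg.isGrp hn), raw_pstar hE (hg.isGrp hn), mid]

theorem raw_interval (hE : 3 ≤ E) (hn : 0 < n) {g : ℕ} (hg : I.IsReg g) {u : ℚ}
    (hu : I.pstar g ≤ u) (hu' : 2 ≤ g → u < I.pstar (g - 1)) :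
    I.Consec (Raw.interval I.ctx g u).1 (Raw.interval I.ctx g u).2 ∧
      (Raw.interval I.ctx g u).1 ≤ u ∧ u < (Raw.interval I.ctx g u).2 := by
  have h3 := dl_pos hE (hg.isGrp hn)
  have hq : 0 ≤ (u - I.pstar g) / I.dl g := div_nonneg (by linarith) h3.le
  obtain ⟨i, hi⟩ := Int.eq_ofNat_of_zero_le (Int.floor_nonneg.2 hq)
  have hi' : (⌊(u - I.pstar g) / I.dl g⌋ : ℤ) = (i : ℤ) := hi
  have b1 : I.pstar g + i * I.dl g ≤ u := by
    have := Int.floor_le ((u - I.pstar g) / I.dl g)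
    rw [hi', Int.cast_natCast, le_div_iff₀ h3] at this
    linarith
  have b2 : u < I.pstar g + (i + 1) * I.dl g := by
    have := Int.lt_floor_add_one ((u - I.pstar g) / I.dl g)
    rw [hi', Int.cast_natCast, div_lt_iff₀ h3] at this
    linarith
  rw [Raw.interval, raw_pstar hE (hg.isGrp hn), raw_dl hE (hg.isGrp hn), hi', Int.cast_natCast]
  by_cases h2 : 2 ≤ g
  · rw [raw_lastIdx hE hn hg h2, raw_mid hE hn hg h2, cast_pred hg.1,
      raw_pstar hE ((hg.pred h2).isGrp hn)]
    split_ifs with c1 c2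
    · have c3 : i < I.lastIdx g := by
        rcases c1 with c1 | c1
        · exact absurd (Nat.cast_le_one.1 c1) (by omega)
        · exact_mod_cast c1
      have := consec_step hE hn hg (i := i) fun _ => c3
      push_cast at this
      exact ⟨this, b1, b2⟩
    · push Not at c1
      refine ⟨consec_last hE hn hg h2, ?_, c2⟩
      have := mul_le_mul_of_nonneg_right c1.2 h3.le
      simp only
      linarith
    · exact ⟨consec_mid hE hn hg h2, not_lt.1 c2, hu' h2⟩
  · have hg1 : (g : ℚ) ≤ 1 := by exact_mod_cast (by omega : g ≤ 1)
    rw [if_pos (Or.inl hg1)]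
    have := consec_step hE hn hg (i := i) fun h => absurd h h2
    push_cast at this
    exact ⟨this, b1, b2⟩

/-- Thresholds decrease with the number of the group, so the first regular group whose threshold is
at most `u` owns the part of the axis with `u`. If there is no such group, `u` lies in the first
interval, which is the default of `headD`. -/
theorem raw_bracket (hE : 3 ≤ E) (hn : 0 < n) {u : ℚ} (hu : 0 ≤ u) :
    I.Consec (Raw.bracket I.ctx u).1 (Raw.bracket I.ctx u).2 ∧
      (Raw.bracket I.ctx u).1 ≤ u ∧ u < (Raw.bracket I.ctx u).2 := by
  classical
  have hγ := I.γ_pos hn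
  have hc : ∀ j : Fin n, (((j : ℕ) : ℚ) + 1) = ((j + 1 : ℕ) : ℚ) := fun j => by push_cast; rfl
  have e : (I.ctx.2.filter fun y => decide ((y.1 + 1 < Raw.γ I.ctx ∨ y.1 + 1 ≤ 1) ∧
        Raw.pstar I.ctx (y.1 + 1) ≤ u)) =
      ((List.finRange n).filter fun j : Fin n => decide (I.IsReg (j + 1) ∧ I.pstar (j + 1) ≤ u)).map
        fun j : Fin n => (((j : ℕ) : ℚ), I.p j, I.probs j) := by
    conv_lhs => rw [show I.ctx.2 = (List.finRange n).map
      (fun j : Fin n => (((j : ℕ) : ℚ), I.p j, I.probs j)) from by rw [ctx, List.ofFn_eq_map],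
      List.filter_map]
    congr 1
    refine List.filter_congr fun j _ => ?_
    simp only [Function.comp, hc, raw_γ hE hn, Nat.cast_lt, Nat.cast_le_one, decide_eq_decide]
    rw [← isReg_iff (by omega)]
    refine and_congr_right fun h => ?_
    rw [raw_pstar hE (h.isGrp hn)]
  rw [Raw.bracket, e]
  by_cases hex : ∃ j : Fin n, I.IsReg (j + 1) ∧ I.pstar (j + 1) ≤ u
  · obtain ⟨j, hj, hmin⟩ : ∃ j : Fin n, (I.IsReg (j + 1) ∧ I.pstar (j + 1) ≤ u) ∧
        ∀ i : Fin n, (I.IsReg (i + 1) ∧ I.pstar (i + 1) ≤ u) → j ≤ i := by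
      obtain ⟨j₀, hj₀⟩ := hex
      obtain ⟨j, hj, hmin⟩ := Finset.exists_min_image
        (Finset.univ.filter fun j : Fin n => I.IsReg (j + 1) ∧ I.pstar (j + 1) ≤ u) _root_.id
        ⟨j₀, by simpa using hj₀⟩
      simp only [Finset.mem_filter, Finset.mem_univ, true_and, _root_.id] at hj hmin
      exact ⟨j, hj, hmin⟩
    obtain ⟨l, hl⟩ := head_filter_finRange
      (p := fun j : Fin n => decide (I.IsReg (j + 1) ∧ I.pstar (j + 1) ≤ u)) (j := j)
      (by simpa using hj) (fun i hi => hmin i (by simpa using hi))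
    rw [hl]
    simp only [List.map_cons, List.headD_cons, hc]
    refine raw_interval hE hn hj.1 hj.2 fun h2 => ?_
    by_contra h
    have h3 := hmin ⟨j - 1, by omega⟩
    simp only at h3
    rw [show (j : ℕ) - 1 + 1 = j + 1 - 1 by omega] at h3
    have h4 := h3 ⟨hj.1.pred h2, not_lt.1 h⟩
    rw [Fin.le_def] at h4
    simp only at h4
    omega
  · have h0 : ((List.finRange n).filter
        fun j : Fin n => decide (I.IsReg (j + 1) ∧ I.pstar (j + 1) ≤ u)) = [] :=
      List.filter_eq_nil_iff.2 fun j _ hj => hex ⟨j, by simpa using hj⟩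
    have h1 : max ((I.γ : ℚ) - 1) 1 = ((max (I.γ - 1) 1 : ℕ) : ℚ) := by
      rw [cast_pred hγ, Nat.cast_max, Nat.cast_one]
    rw [h0]
    simp only [List.map_nil, List.headD_nil, raw_γ hE hn, h1,
      raw_pstar hE (isReg_top.isGrp hn)]
    refine ⟨consec_zero hE hn, hu, ?_⟩
    by_contra h
    have h2 := (isReg_top (I := I)).isGrp hn
    have h3 := I.γ_le
    refine hex ⟨⟨max (I.γ - 1) 1 - 1, by omega⟩, ?_⟩
    simp only
    rw [show max (I.γ - 1) 1 - 1 + 1 = max (I.γ - 1) 1 by omega]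
    exact ⟨isReg_top, not_lt.1 h⟩

/-- Division by `κ` leads back to the unstretched axis, where the interval is located; its ends are
stretched again and `nextPt_eq` applies. -/
theorem raw_next (hE : 3 ≤ E) {h : ℕ} (hh : I.IsGrp h) {t : ℚ} (ht : 0 ≤ t) :
    Raw.next I.ctx h t = nextPt (I.Q h) t := by
  have hn := hh.pos
  have hκ := κ_pos (I := I) hE
  obtain ⟨h1, h2, h3⟩ := raw_bracket (I := I) hE hn (div_nonneg ht hκ.le)
  obtain ⟨k, hb, he⟩ := h1.exists_index hE hn
  rw [← hb, le_div_iff₀' hκ, ← lStr_eq] at h2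
  rw [← he, div_lt_iff₀' hκ, ← lStr_eq] at h3
  rw [Raw.next, Raw.nextIn, raw_κ, ← hb, ← he, ← lStr_eq, ← lStr_eq, raw_dl hE hh, raw_pmax hE hh,
    nextPt_eq hE hh h2 h3]
  by_cases hh2 : 2 ≤ h
  · rw [cast_pred hh.1, raw_pcirc hE ((hh.pred hh2).isGrp hn)]
    have e : (2 : ℚ) ≤ h ↔ 2 ≤ h := by norm_cast
    simp only [e]
  · have e : ¬ (2 : ℚ) ≤ h := by norm_cast
    simp only [e, hh2, false_and, if_false]

end Instance

end BernoulliSched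

namespace BernoulliSched

/-- The type of cells. -/
abbrev cellTy : Ty := .prod (.list .rat) (.list .rat)

/-- The type of the entries of the list of types. -/
abbrev entryTy : Ty := .prod .rat (.prod .rat (.list .rat))

/-! ### Computation of the dynamic program from the input data -/

namespace Raw

/-- The earliest start time of a job of a type. -/
def start (D : ctxTy.den) (y : entryTy.den) (ms : List ℚ) : ℚ := next D (grp D y.1) (ms.headD 0)

/-- The time from which a machine may be used again after a long job. -/
def release (D : ctxTy.den) (y : entryTy.den) (s : ℚ) : ℚ :=
  next D (grp D y.1) (max (pcirc D (grp D y.1)) (s + y.2.1))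

/-- The profile after waiting. -/
def wait (D : ctxTy.den) (y : entryTy.den) (ms : List ℚ) : List ℚ :=
  ms.map fun t => max (start D y ms) t

/-- The cell after a short job. -/
def shortCell (D : ctxTy.den) (y : entryTy.den) (c : cellTy.den) : cellTy.den :=
  (wait D y c.1, decQ c.2 y.1)

/-- The cell after a long job. -/
def longCell (D : ctxTy.den) (y : entryTy.den) (c : cellTy.den) : cellTy.den :=
  (insertQ (release D y (start D y c.1)) (wait D y c.1).tail, decQ c.2 y.1)

/-- The types with leftover jobs. -/
def avail (D : ctxTy.den) (c : cellTy.den) : List entryTy.den :=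
  D.2.filter fun y => decide (0 < nthQ c.2 y.1)

/-- The cells that may follow a cell. -/
def succs (D : ctxTy.den) (c : cellTy.den) : List cellTy.den :=
  ((avail D c).map fun y => longCell D y c) ++ (avail D c).map fun y => shortCell D y c

/-- Insertion of a cell into a list of cells. -/
def insertCell (S : List cellTy.den) (c : cellTy.den) : List cellTy.den :=
  if ∃ c' ∈ S, c'.1 = c.1 ∧ c'.2 = c.2 then S else c :: S

/-- Insertion of all the cells that may follow the cells of a list. -/
def explore (D : ctxTy.den) (S : List cellTy.den) : List cellTy.den :=
  (S.flatMap (succs D)).foldl insertCell S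

/-- The value of a cell according to a table. -/
def lookup (T : tableTy.den) (c : cellTy.den) : ℚ :=
  ((T.filter fun r => decide (r.1.1 = c.1 ∧ r.1.2 = c.2)).map fun r => r.2.2.2).headD 0

/-- The probability of the next job of a type. -/
def prob (y : entryTy.den) (ν : List ℚ) : ℚ := nthQ y.2.2 ((y.2.2.length : ℚ) - nthQ ν y.1)

/-- The expected cost if a job of a type is started next. -/
def startCost (D : ctxTy.den) (T : tableTy.den) (c : cellTy.den) (y : entryTy.den) : ℚ :=
  prob y c.2 * (lookup T (longCell D y c) + (start D y c.1 + y.2.1)) +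
    (1 - prob y c.2) * (lookup T (shortCell D y c) + start D y c.1)

/-- A best decision in a cell, preceded by a number that tells whether there is one. -/
def best (D : ctxTy.den) (T : tableTy.den) (c : cellTy.den) : ℚ × ℚ × ℚ × ℚ :=
  (avail D c).foldl (fun t y => if t.1 ≤ 0 ∨ startCost D T c y < t.2.2.2 then
    (1, y.1, start D y c.1, startCost D T c y) else t) (0, 0, 0, 0)

/-- Addition of the row of a cell to a table. -/
def addRow (D : ctxTy.den) (T : tableTy.den) (c : cellTy.den) : tableTy.den :=
  if 0 < (best D T c).1 then (c, (best D T c).2) :: T else T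

end Raw

/-! ### Polynomial cost of single steps of the dynamic program -/

namespace PF

variable {Γ a b : Ty} {D : Γ.den → ctxTy.den} {y : Γ.den → entryTy.den} {c : Γ.den → cellTy.den}
  {T : Γ.den → tableTy.den} {S : Γ.den → List cellTy.den} {ms : Γ.den → List ℚ} {t : Γ.den → ℚ}

theorem flatMap {l : Γ.den → List a.den} {g : Γ.den → a.den → List b.den} (hl : PF Γ (.list a) l)
    (hg : PF (.prod Γ a) (.list b) fun x => g x.1 x.2) :
    PF Γ (.list b) fun x => (l x).flatMap (g x) := by
  have h := hl.foldl_size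
    (F := fun x (t : (Ty.list b).den) y => (t ++ g x y : List b.den)) nil
    (id.snd.fst.append (hg.comp (id.fst.pair id.snd.snd)))
    (fun x y => (Ty.list b).size (g x y)) hg.size_pair (fun x t y => by
      have := Ty.size_append t (g x y)
      omega)
  exact h.of_eq fun x => by rw [← List.flatMap_eq_foldl]

theorem start (hD : PF Γ ctxTy D) (hy : PF Γ entryTy y) (hm : PF Γ (.list .rat) ms) :
    PF Γ .rat fun x => Raw.start (D x) (y x) (ms x) :=
  next hD (grp hD hy.fst) (headD hm (const 0))

theorem release (hD : PF Γ ctxTy D) (hy : PF Γ entryTy y) (ht : PF Γ .rat t) :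
    PF Γ .rat fun x => Raw.release (D x) (y x) (t x) :=
  next hD (grp hD hy.fst) (max (pcirc hD (grp hD hy.fst)) (ht.add hy.snd.fst))

theorem wait (hD : PF Γ ctxTy D) (hy : PF Γ entryTy y) (hm : PF Γ (.list .rat) ms) :
    PF Γ (.list .rat) fun x => Raw.wait (D x) (y x) (ms x) :=
  map hm (max ((start hD hy hm).comp id.fst) id.snd)

theorem shortCell (hD : PF Γ ctxTy D) (hy : PF Γ entryTy y) (hc : PF Γ cellTy c) :
    PF Γ cellTy fun x => Raw.shortCell (D x) (y x) (c x) :=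
  (wait hD hy hc.fst).pair (dec hc.snd hy.fst)

theorem longCell (hD : PF Γ ctxTy D) (hy : PF Γ entryTy y) (hc : PF Γ cellTy c) :
    PF Γ cellTy fun x => Raw.longCell (D x) (y x) (c x) :=
  (insert (release hD hy (start hD hy hc.fst)) (wait hD hy hc.fst).tail).pair (dec hc.snd hy.fst)

theorem avail (hD : PF Γ ctxTy D) (hc : PF Γ cellTy c) :
    PF Γ (.list entryTy) fun x => Raw.avail (D x) (c x) :=
  hD.snd.filter (PD.lt (const 0) (nth (hc.snd.comp id.fst) id.snd.fst))

theorem succs (hD : PF Γ ctxTy D) (hc : PF Γ cellTy c) :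
    PF Γ (.list cellTy) fun x => Raw.succs (D x) (c x) :=
  append (map (avail hD hc) (longCell (hD.comp id.fst) id.snd (hc.comp id.fst)))
    (map (avail hD hc) (shortCell (hD.comp id.fst) id.snd (hc.comp id.fst)))

theorem insertCell (hS : PF Γ (.list cellTy) S) (hc : PF Γ cellTy c) :
    PF Γ (.list cellTy) fun x => Raw.insertCell (S x) (c x) := by
  have h1 := hc.comp (id (a := .prod Γ cellTy)).fst
  exact ite (PD.exists_mem hS ((PD.eqList id.snd.fst h1.fst).and (PD.eqList id.snd.snd h1.snd)))
    hS (hc.cons hS)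

/-- The list of successors is computed in advance and each insertion adds at most one cell, so one
round is polynomial in the list it starts from. This says nothing about many rounds; for these the
number of cells is needed. -/
theorem explore (hD : PF Γ ctxTy D) (hS : PF Γ (.list cellTy) S) :
    PF Γ (.list cellTy) fun x => Raw.explore (D x) (S x) := by
  refine foldl_size (F := fun _ (S : (Ty.list cellTy).den) c => Raw.insertCell S c)
    (flatMap hS (succs (hD.comp id.fst) id.snd)) hS (insertCell id.snd.fst id.snd.snd)
    (fun _ c => cellTy.size c + 1) ((PolyBdd.of_le fun x => by omega).add (PolyBdd.const _ 1)) ?_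
  intro x S c
  unfold Raw.insertCell
  split_ifs
  · omega
  · rw [Ty.size_cons]; omega

theorem lookup (hT : PF Γ tableTy T) (hc : PF Γ cellTy c) :
    PF Γ .rat fun x => Raw.lookup (T x) (c x) := by
  have h1 := hc.comp (id (a := .prod Γ (.prod cellTy (.prod .rat (.prod .rat .rat))))).fst
  exact headD (map (hT.filter ((PD.eqList id.snd.fst.fst h1.fst).and
    (PD.eqList id.snd.fst.snd h1.snd))) id.snd.snd.snd.snd) (const 0)

theorem prob (hy : PF Γ entryTy y) (hm : PF Γ (.list .rat) ms) :
    PF Γ .rat fun x => Raw.prob (y x) (ms x) :=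
  nth hy.snd.snd (hy.snd.snd.length.sub (nth hm hy.fst))

theorem startCost (hD : PF Γ ctxTy D) (hT : PF Γ tableTy T) (hc : PF Γ cellTy c)
    (hy : PF Γ entryTy y) : PF Γ .rat fun x => Raw.startCost (D x) (T x) (c x) (y x) :=
  ((prob hy hc.snd).mul ((lookup hT (longCell hD hy hc)).add
    ((start hD hy hc.fst).add hy.snd.fst))).add
  (((const 1).sub (prob hy hc.snd)).mul ((lookup hT (shortCell hD hy hc)).add
    (start hD hy hc.fst)))

theorem best (hD : PF Γ ctxTy D) (hT : PF Γ tableTy T) (hc : PF Γ cellTy c) :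
    PF Γ (.prod .rat (.prod .rat (.prod .rat .rat))) fun x => Raw.best (D x) (T x) (c x) := by
  have f1 := (id (a := .prod Γ (.prod (.prod .rat (.prod .rat (.prod .rat .rat))) entryTy))).fst
  have f2 := (id (a := .prod Γ entryTy)).fst
  exact foldSel (avail hD hc) ((const 0).pair ((const 0).pair ((const 0).pair (const 0))))
    ((PD.le id.snd.fst.fst (const 0)).or (PD.lt
      (startCost (hD.comp f1) (hT.comp f1) (hc.comp f1) id.snd.snd) id.snd.fst.snd.snd.snd))
    ((const 1).pair (id.snd.fst.pair ((start (hD.comp f2) id.snd (hc.comp f2).fst).pair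
      (startCost (hD.comp f2) (hT.comp f2) (hc.comp f2) id.snd))))

theorem addRow (hD : PF Γ ctxTy D) (hT : PF Γ tableTy T) (hc : PF Γ cellTy c) :
    PF Γ tableTy fun x => Raw.addRow (D x) (T x) (c x) :=
  ite (PD.lt (const 0) (best hD hT hc).fst) ((hc.pair (best hD hT hc).snd).cons hT) hT

end PF

end BernoulliSched

/-! ### Exploration of the reachable cells -/

namespace BernoulliSched

namespace Instance

variable {n E : ℕ} {I : Instance n E}

/-- The entry of a type in the input data. -/
def entry (I : Instance n E) (j : Fin n) : entryTy.den := (((j : ℕ) : ℚ), I.p j, I.probs j)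

/-- Cells as data. -/
def enc (x : Cell n) : cellTy.den := (x.1, key x.2)

theorem enc_injective : Function.Injective (enc (n := n)) := fun _ _ h =>
  Prod.ext (congrArg (fun c : cellTy.den => c.1) h)
    (key_injective (congrArg (fun c : cellTy.den => c.2) h))

theorem ctx_snd : I.ctx.2 = (List.finRange n).map I.entry := by
  rw [ctx, List.ofFn_eq_map]
  rfl

theorem nthQ_key (ν : Fin n → ℕ) (j : Fin n) : nthQ (key ν) (j : ℕ) = ν j := nthQ_ofFn _ j

/-- The computation of the next start point is correct for nonnegative times only. -/
theorem Reach.headD_nonneg (hE : 3 ≤ E) {x : Cell n} (h : I.Reach x) : ∀ t ∈ x.1, 0 ≤ t := by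
  have hst : ∀ (j : Fin n) (ms : List ℚ), 0 ≤ I.startTime j ms := fun j ms =>
    Q_nonneg hE (isGrp_grp j) (startTime_mem hE j ms)
  induction h with
  | init => intro t ht; exact (List.eq_of_mem_replicate ht).ge
  | long ms ν j _ _ _ =>
    intro t ht
    rcases (List.mem_orderedInsert _).1 ht with rfl | h1
    · exact Q_nonneg hE (isGrp_grp j) (nextPt_mem hE (isGrp_grp j) _)
    · obtain ⟨y, -, rfl⟩ := List.mem_map.1 (List.mem_of_mem_tail h1)
      exact (hst j ms).trans (le_max_left _ _)
  | short ms ν j _ _ _ =>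
    intro t ht
    obtain ⟨y, -, rfl⟩ := List.mem_map.1 ht
    exact (hst j ms).trans (le_max_left _ _)

theorem raw_start (hE : 3 ≤ E) (j : Fin n) {ms : List ℚ} (h0 : ∀ t ∈ ms, 0 ≤ t) :
    Raw.start I.ctx (I.entry j) ms = I.startTime j ms := by
  have h : 0 ≤ ms.headD 0 := by
    cases ms with
    | nil => exact le_rfl
    | cons a l => exact h0 a (by simp)
  rw [Raw.start, entry, raw_grp hE, raw_next hE (isGrp_grp j) h, startTime]

theorem raw_release (hE : 3 ≤ E) (j : Fin n) (s : ℚ) :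
    Raw.release I.ctx (I.entry j) s = I.release j s := by
  rw [Raw.release, entry, raw_grp hE, raw_pcirc hE (isGrp_grp j), raw_next hE (isGrp_grp j)
    ((pcirc_pos hE (isGrp_grp j)).le.trans (le_max_left _ _)), release]

theorem raw_wait (hE : 3 ≤ E) (j : Fin n) {ms : List ℚ} (h0 : ∀ t ∈ ms, 0 ≤ t) :
    Raw.wait I.ctx (I.entry j) ms = I.waitProfile j ms := by
  rw [Raw.wait, raw_start hE j h0]
  rfl

theorem raw_shortCell (hE : 3 ≤ E) {x : Cell n} (h : I.Reach x) {j : Fin n} (hj : 0 < x.2 j) :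
    Raw.shortCell I.ctx (I.entry j) (enc x) = enc (I.waitProfile j x.1, dec x.2 j) := by
  rw [Raw.shortCell, enc, raw_wait hE j (h.headD_nonneg hE)]
  exact Prod.ext rfl (decQ_key x.2 j hj)

theorem raw_longCell (hE : 3 ≤ E) {x : Cell n} (h : I.Reach x) {j : Fin n} (hj : 0 < x.2 j) :
    Raw.longCell I.ctx (I.entry j) (enc x) = enc (I.longProfile j x.1, dec x.2 j) := by
  rw [Raw.longCell, enc, raw_wait hE j (h.headD_nonneg hE), raw_start hE j (h.headD_nonneg hE),
    raw_release hE, insertQ_eq]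
  · exact Prod.ext rfl (decQ_key x.2 j hj)
  · exact (((h.inv hE).2.wait hE j).sorted).sublist (List.tail_sublist _)

theorem mem_avail {x : Cell n} {y : entryTy.den} :
    y ∈ Raw.avail I.ctx (enc x) ↔ ∃ j, 0 < x.2 j ∧ y = I.entry j := by
  rw [Raw.avail, ctx_snd]
  simp only [List.mem_filter, List.mem_map, List.mem_finRange, true_and, decide_eq_true_eq]
  constructor
  · rintro ⟨⟨j, rfl⟩, h⟩
    refine ⟨j, ?_, rfl⟩
    have := nthQ_key x.2 j
    simp only [entry, enc] at h
    rw [this] at h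
    exact_mod_cast h
  · rintro ⟨j, hj, rfl⟩
    refine ⟨⟨j, rfl⟩, ?_⟩
    have := nthQ_key x.2 j
    simp only [entry, enc]
    rw [this]
    exact_mod_cast hj

/-- The cells that may follow a cell. -/
def Next (I : Instance n E) (x y : Cell n) : Prop :=
  ∃ j, 0 < x.2 j ∧ (y = (I.longProfile j x.1, dec x.2 j) ∨ y = (I.waitProfile j x.1, dec x.2 j))

theorem Next.reach {x y : Cell n} (h : I.Next x y) (hx : I.Reach x) : I.Reach y := by
  obtain ⟨j, hj, rfl | rfl⟩ := h
  · exact Reach.long _ _ _ hx hj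
  · exact Reach.short _ _ _ hx hj

theorem Next.sum {x y : Cell n} (h : I.Next x y) : (∑ j, y.2 j) + 1 = ∑ j, x.2 j := by
  obtain ⟨j, hj, rfl | rfl⟩ := h <;> exact sum_dec hj

theorem Reach.eq_init_or {y : Cell n} (h : I.Reach y) :
    y = (I.profileInit, I.Nj) ∨ ∃ x, I.Reach x ∧ I.Next x y := by
  cases h with
  | init => exact Or.inl rfl
  | long ms ν j h hj => exact Or.inr ⟨(ms, ν), h, j, hj, Or.inl rfl⟩
  | short ms ν j h hj => exact Or.inr ⟨(ms, ν), h, j, hj, Or.inr rfl⟩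

theorem mem_succs (hE : 3 ≤ E) {x : Cell n} (h : I.Reach x) {c : cellTy.den} :
    c ∈ Raw.succs I.ctx (enc x) ↔ ∃ y, I.Next x y ∧ c = enc y := by
  rw [Raw.succs, List.mem_append, List.mem_map, List.mem_map]
  constructor
  · rintro (⟨_, h1, rfl⟩ | ⟨_, h1, rfl⟩)
    · obtain ⟨j, hj, rfl⟩ := mem_avail.1 h1
      exact ⟨_, ⟨j, hj, Or.inl rfl⟩, raw_longCell hE h hj⟩
    · obtain ⟨j, hj, rfl⟩ := mem_avail.1 h1
      exact ⟨_, ⟨j, hj, Or.inr rfl⟩, raw_shortCell hE h hj⟩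
  · rintro ⟨_, ⟨j, hj, rfl | rfl⟩, rfl⟩
    · exact Or.inl ⟨_, mem_avail.2 ⟨j, hj, rfl⟩, raw_longCell hE h hj⟩
    · exact Or.inr ⟨_, mem_avail.2 ⟨j, hj, rfl⟩, raw_shortCell hE h hj⟩

theorem insertCell_eq (S : List cellTy.den) (c : cellTy.den) [Decidable (c ∈ S)] :
    Raw.insertCell S c = if c ∈ S then S else c :: S := by
  rw [Raw.insertCell]
  refine if_congr ⟨?_, fun h => ⟨c, h, rfl, rfl⟩⟩ rfl rfl
  rintro ⟨c', h, h1, h2⟩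
  rwa [← Prod.ext h1 h2]

/-- Lists of reachable cells that hold all cells with at least `k` leftover jobs and no others, in
nondecreasing order of the number of leftover jobs. -/
structure Explored (I : Instance n E) (k : ℕ) (L : List (Cell n)) : Prop where
  nodup : L.Nodup
  reach : ∀ x ∈ L, I.Reach x
  le : ∀ x ∈ L, k ≤ ∑ j, x.2 j
  mem : ∀ x, I.Reach x → k ≤ ∑ j, x.2 j → x ∈ L
  sorted : L.Pairwise fun x y => ∑ j, x.2 j ≤ ∑ j, y.2 j

theorem Reach.sum_le {x : Cell n} (hE : 3 ≤ E) (h : I.Reach x) : ∑ j, x.2 j ≤ I.N :=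
  Finset.sum_le_sum fun j _ => (h.inv hE).1 j

theorem explored_init (hE : 3 ≤ E) : I.Explored I.N [(I.profileInit, I.Nj)] := by
  refine ⟨by simp, ?_, ?_, ?_, by simp⟩
  · intro x hx
    rw [List.mem_singleton.1 hx]
    exact Reach.init
  · intro x hx
    rw [List.mem_singleton.1 hx]
    exact le_rfl
  · intro x hx h
    rcases hx.eq_init_or with rfl | ⟨y, hy, hn⟩
    · simp
    · have := hn.sum
      have := hy.sum_le hE
      omega

/-- A successor that is not yet listed has exactly `k` leftover jobs, as cells with more are listed
already; so putting it in front keeps the order. Conversely a reachable cell with `k < N` leftover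
jobs is not initial and has a predecessor in `L`. -/
theorem Explored.step (hE : 3 ≤ E) {k : ℕ} {L : List (Cell n)} (h : I.Explored (k + 1) L)
    (hk : k < I.N) :
    ∃ L', I.Explored k L' ∧ Raw.explore I.ctx (L.map enc) = L'.map enc := by
  classical
  have key : ∀ (C : List cellTy.den) (A : List (Cell n)),
      (∀ c ∈ C, ∃ x ∈ L, ∃ y, I.Next x y ∧ c = enc y) → L ⊆ A → A.Nodup →
      (∀ x ∈ A, I.Reach x ∧ k ≤ ∑ j, x.2 j) → (A.Pairwise fun x y => ∑ j, x.2 j ≤ ∑ j, y.2 j) →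
      ∃ A' : List (Cell n), C.foldl Raw.insertCell (A.map enc) = A'.map enc ∧ A ⊆ A' ∧ A'.Nodup ∧
        (∀ x ∈ A', I.Reach x ∧ k ≤ ∑ j, x.2 j) ∧
        (A'.Pairwise fun x y => ∑ j, x.2 j ≤ ∑ j, y.2 j) ∧ ∀ c ∈ C, c ∈ A'.map enc := by
    intro C
    induction C with
    | nil => intro A _ _ h2 h3 h4; exact ⟨A, rfl, fun _ h => h, h2, h3, h4, by simp⟩
    | cons c C ih =>
      intro A hC h1 h2 h3 h4
      obtain ⟨x, hx, y, hxy, rfl⟩ := hC c (by simp)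
      rw [List.foldl_cons, insertCell_eq]
      by_cases hm : enc y ∈ A.map enc
      · rw [if_pos hm]
        obtain ⟨A', e, g1, g2, g3, g4, g5⟩ := ih A (fun c hc => hC c (by simp [hc])) h1 h2 h3 h4
        refine ⟨A', e, g1, g2, g3, g4, fun c hc => ?_⟩
        rcases List.mem_cons.1 hc with rfl | hc
        · exact (List.map_subset enc g1) hm
        · exact g5 c hc
      · rw [if_neg hm]
        have hy : y ∉ A := fun hy => hm (List.mem_map_of_mem hy)
        have hyr := hxy.reach (h.reach x hx)
        have hys := hxy.sum
        have hxs := h.le x hx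
        have hys' : ∑ j, y.2 j = k := by
          by_contra hne
          exact hy (h1 (h.mem y hyr (by omega)))
        obtain ⟨A', e, g1, g2, g3, g4, g5⟩ := ih (y :: A) (fun c hc => hC c (by simp [hc]))
          (fun z hz => List.mem_cons_of_mem _ (h1 hz)) (List.nodup_cons.2 ⟨hy, h2⟩)
          (by
            intro z hz
            rcases List.mem_cons.1 hz with rfl | hz
            · exact ⟨hyr, hys'.ge⟩
            · exact h3 z hz)
          (List.pairwise_cons.2 ⟨fun z hz => hys'.le.trans (h3 z hz).2, h4⟩)
        refine ⟨A', e, fun z hz => g1 (List.mem_cons_of_mem _ hz), g2, g3, g4, fun c hc => ?_⟩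
        rcases List.mem_cons.1 hc with rfl | hc
        · exact List.mem_map_of_mem (g1 (by simp))
        · exact g5 c hc
  have hsucc : ∀ c, c ∈ (L.map enc).flatMap (Raw.succs I.ctx) ↔
      ∃ x ∈ L, ∃ y, I.Next x y ∧ c = enc y := by
    intro c
    rw [List.mem_flatMap]
    constructor
    · rintro ⟨_, h1, h2⟩
      obtain ⟨x, hx, rfl⟩ := List.mem_map.1 h1
      exact ⟨x, hx, (mem_succs hE (h.reach x hx)).1 h2⟩
    · rintro ⟨x, hx, h2⟩
      exact ⟨_, List.mem_map_of_mem hx, (mem_succs hE (h.reach x hx)).2 h2⟩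
  obtain ⟨A', e, g1, g2, g3, g4, g5⟩ := key _ L (fun c hc => (hsucc c).1 hc) (fun _ h => h) h.nodup
    (fun x hx => ⟨h.reach x hx, by have := h.le x hx; omega⟩) h.sorted
  refine ⟨A', ⟨g2, fun x hx => (g3 x hx).1, fun x hx => (g3 x hx).2, fun y hy hk' => ?_, g4⟩, e⟩
  rcases Nat.lt_or_ge k (∑ j, y.2 j) with hlt | hge
  · exact g1 (h.mem y hy hlt)
  · rcases hy.eq_init_or with rfl | ⟨x, hx, hxy⟩
    · exact absurd hk (not_lt.2 hge)
    · have h1 := hxy.sum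
      have h2 := g5 (enc y) ((hsucc _).2 ⟨x, h.mem x hx (by omega), y, hxy, rfl⟩)
      obtain ⟨y', hy', e'⟩ := List.mem_map.1 h2
      rwa [← enc_injective e']

theorem explored_iterate (hE : 3 ≤ E) {i : ℕ} (hi : i ≤ I.N) :
    ∃ L, I.Explored (I.N - i) L ∧
      (Raw.explore I.ctx)^[i] [enc (I.profileInit, I.Nj)] = L.map enc := by
  induction i with
  | zero => exact ⟨_, explored_init hE, rfl⟩
  | succ i ih =>
    obtain ⟨L, h, e⟩ := ih (by omega)
    obtain ⟨L', h', e'⟩ := Explored.step (k := I.N - (i + 1)) hE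
      (by rwa [show I.N - (i + 1) + 1 = I.N - i by omega]) (by omega)
    exact ⟨L', h', by rw [Function.iterate_succ_apply', e, e']⟩

/-! ### Correctness of the table -/

/-- Correct rows. -/
def IsRow (I : Instance n E) (r : Row) : Prop :=
  ∃ ms ν j, I.Reach (ms, ν) ∧ 0 < ν j ∧ I.startCost I.ecost ms ν j = I.ecost ms ν ∧
    r = ((ms, key ν), (((j : ℕ) : ℚ), I.startTime j ms, I.ecost ms ν))

/-- Cells without leftover jobs need no row: the default `0` of the search is their value. -/
theorem lookup_eq {T : List Row} (hT : ∀ r ∈ T, I.IsRow r) {x : Cell n}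
    (hx : x.2 ≠ 0 → ∃ r ∈ T, r.1 = enc x) : Raw.lookup T (enc x) = I.ecost x.1 x.2 := by
  rw [Raw.lookup]
  cases hl : T.filter fun r => decide (r.1.1 = (enc x).1 ∧ r.1.2 = (enc x).2) with
  | nil =>
    have h0 : x.2 = 0 := by
      by_contra h
      obtain ⟨r, hr, e⟩ := hx h
      have := List.filter_eq_nil_iff.1 hl r hr
      simp [e] at this
    rw [h0, ecost_zero]
    rfl
  | cons r l =>
    have hr : r ∈ T.filter fun r => decide (r.1.1 = (enc x).1 ∧ r.1.2 = (enc x).2) := by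
      rw [hl]; simp
    obtain ⟨h1, h2⟩ := List.mem_filter.1 hr
    obtain ⟨ms, ν, j, -, -, -, rfl⟩ := hT r h1
    have h3 : ms = x.1 ∧ key ν = key x.2 := of_decide_eq_true h2
    rw [← h3.1, ← key_injective h3.2]
    rfl

theorem raw_prob {x : Cell n} (hx : ∀ j, x.2 j ≤ I.Nj j) {j : Fin n} (hj : 0 < x.2 j) :
    Raw.prob (I.entry j) (enc x).2 = I.nextProb j (x.2 j) := by
  have h1 := hx j
  have h2 : nthQ (key x.2) ((j : ℕ) : ℚ) = x.2 j := nthQ_key x.2 j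
  have h3 : I.Nj j - x.2 j < (I.probs j).length := by
    have : I.Nj j = (I.probs j).length := rfl
    omega
  simp only [Raw.prob, entry, enc]
  rw [h2, nextProb, List.getD_eq_getElem _ _ h3, ← nthQ_getElem _ _ h3, Nat.cast_sub h1]
  rfl

theorem raw_startCost (hE : 3 ≤ E) {T : List Row} (hT : ∀ r ∈ T, I.IsRow r) {x : Cell n}
    (h : I.Reach x) (hx : ∀ y, I.Next x y → y.2 ≠ 0 → ∃ r ∈ T, r.1 = enc y) {j : Fin n}
    (hj : 0 < x.2 j) :
    Raw.startCost I.ctx T (enc x) (I.entry j) = I.startCost I.ecost x.1 x.2 j := by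
  rw [Raw.startCost, raw_prob (h.inv hE).1 hj, raw_longCell hE h hj, raw_shortCell hE h hj,
    lookup_eq hT (hx _ ⟨j, hj, Or.inl rfl⟩), lookup_eq hT (hx _ ⟨j, hj, Or.inr rfl⟩),
    show (enc x).1 = x.1 from rfl, raw_start hE j (h.headD_nonneg hE)]
  rfl

/-- The invariant of the fold: either nothing has been inspected, which the first component `0`
records, or the state describes a cheapest type among those inspected. -/
theorem raw_best (hE : 3 ≤ E) {T : List Row} (hT : ∀ r ∈ T, I.IsRow r) {x : Cell n}
    (h : I.Reach x) (hx : ∀ y, I.Next x y → y.2 ≠ 0 → ∃ r ∈ T, r.1 = enc y) :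
    (x.2 = 0 → Raw.best I.ctx T (enc x) = (0, 0, 0, 0)) ∧
    (x.2 ≠ 0 → ∃ j, 0 < x.2 j ∧ I.startCost I.ecost x.1 x.2 j = I.ecost x.1 x.2 ∧
      Raw.best I.ctx T (enc x) = (1, ((j : ℕ) : ℚ), I.startTime j x.1, I.ecost x.1 x.2)) := by
  have key : ∀ L : List entryTy.den, L ⊆ Raw.avail I.ctx (enc x) →
      (L = [] ∧ L.foldl (fun t y => if t.1 ≤ 0 ∨ Raw.startCost I.ctx T (enc x) y < t.2.2.2 then
          (1, y.1, Raw.start I.ctx y (enc x).1, Raw.startCost I.ctx T (enc x) y) else t)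
          ((0 : ℚ), (0 : ℚ), (0 : ℚ), (0 : ℚ)) = (0, 0, 0, 0)) ∨
      ∃ j, 0 < x.2 j ∧ (∀ y ∈ L, I.startCost I.ecost x.1 x.2 j ≤ Raw.startCost I.ctx T (enc x) y) ∧
        L.foldl (fun t y => if t.1 ≤ 0 ∨ Raw.startCost I.ctx T (enc x) y < t.2.2.2 then
          (1, y.1, Raw.start I.ctx y (enc x).1, Raw.startCost I.ctx T (enc x) y) else t)
          ((0 : ℚ), (0 : ℚ), (0 : ℚ), (0 : ℚ)) =
          (1, ((j : ℕ) : ℚ), I.startTime j x.1, I.startCost I.ecost x.1 x.2 j) := by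
    intro L
    induction L using List.reverseRecOn with
    | nil => intro _; exact Or.inl ⟨rfl, rfl⟩
    | append_singleton L y ih =>
      intro hL
      right
      obtain ⟨i, hi, rfl⟩ := mem_avail.1 (hL (by simp : y ∈ L ++ [y]))
      rw [List.foldl_append, List.foldl_cons, List.foldl_nil, raw_startCost hE hT h hx hi,
        show (enc x).1 = x.1 from rfl, raw_start hE i (h.headD_nonneg hE)]
      rcases ih (fun z hz => hL (by simp [hz])) with ⟨rfl, e⟩ | ⟨j, hj, hmin, e⟩
      · refine ⟨i, hi, ?_, ?_⟩
        · intro y hy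
          rw [List.nil_append, List.mem_singleton] at hy
          rw [hy, raw_startCost hE hT h hx hi]
        · rfl
      · rw [show (enc x).1 = x.1 from rfl] at e
        rw [e]
        by_cases hlt : I.startCost I.ecost x.1 x.2 i < I.startCost I.ecost x.1 x.2 j
        · refine ⟨i, hi, ?_, if_pos (Or.inr hlt)⟩
          intro y hy
          rcases List.mem_append.1 hy with hy | hy
          · exact hlt.le.trans (hmin y hy)
          · rw [List.mem_singleton.1 hy, raw_startCost hE hT h hx hi]
        · refine ⟨j, hj, ?_, if_neg (by
            rintro (h1 | h1)
            · norm_num at h1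
            · exact hlt h1)⟩
          intro y hy
          rcases List.mem_append.1 hy with hy | hy
          · exact hmin y hy
          · rw [List.mem_singleton.1 hy, raw_startCost hE hT h hx hi]
            exact not_lt.1 hlt
  have hb := key (Raw.avail I.ctx (enc x)) fun _ h => h
  constructor
  · intro h0
    rcases hb with ⟨-, e⟩ | ⟨j, hj, -⟩
    · exact e
    · rw [h0] at hj; simp at hj
  · intro h0
    rcases hb with ⟨e, -⟩ | ⟨j, hj, hmin, e⟩
    · exfalso
      apply h0
      funext j
      by_contra hj
      have : I.entry j ∈ Raw.avail I.ctx (enc x) := mem_avail.2 ⟨j, Nat.pos_of_ne_zero hj, rfl⟩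
      rw [e] at this
      simp at this
    · obtain ⟨⟨i, hi, e1⟩, h2⟩ := ecost_isLeast (I := I) x.1 h0
      have h3 : I.startCost I.ecost x.1 x.2 j = I.ecost x.1 x.2 := by
        refine le_antisymm ?_ (h2 ⟨j, hj, rfl⟩)
        rw [e1, ← raw_startCost hE hT h hx hi]
        exact hmin _ (mem_avail.2 ⟨i, hi, rfl⟩)
      rw [h3] at e
      exact ⟨j, hj, h3, e⟩

/-- Correct partial tables. -/
structure PartialTable (I : Instance n E) (L : List (Cell n)) (T : List Row) : Prop where
  row : ∀ r ∈ T, I.IsRow r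
  mem : ∀ x ∈ L, x.2 ≠ 0 → ∃ r ∈ T, r.1 = enc x
  length_le : T.length ≤ L.length

/-- Cells are processed in nondecreasing order of leftover jobs. Successors have one fewer, so their
rows are present when the cell is processed. -/
theorem partialTable_foldl (hE : 3 ≤ E) {L : List (Cell n)} (hL : I.Explored 0 L)
    {L₁ L₂ : List (Cell n)} (h : L = L₁ ++ L₂) :
    I.PartialTable L₁ ((L₁.map enc).foldl (Raw.addRow I.ctx) []) := by
  induction L₁ using List.reverseRecOn generalizing L₂ with
  | nil => exact ⟨by simp, by simp, by simp⟩
  | append_singleton L₁ x ih =>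
    have h' : L = L₁ ++ x :: L₂ := by rw [h, List.append_assoc]; rfl
    have ih := ih h'
    rw [List.map_append, List.foldl_append, List.map_cons, List.map_nil, List.foldl_cons,
      List.foldl_nil]
    set T := (L₁.map enc).foldl (Raw.addRow I.ctx) []
    have hxL : x ∈ L := by rw [h']; simp
    have hx := hL.reach x hxL
    have hnext : ∀ y, I.Next x y → y.2 ≠ 0 → ∃ r ∈ T, r.1 = enc y := by
      intro y hy hy0
      refine ih.mem y ?_ hy0
      have hs := hy.sum
      have hyL := hL.mem y (hy.reach hx) (Nat.zero_le _)
      have hso := hL.sorted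
      rw [h'] at hyL hso
      rcases List.mem_append.1 hyL with h1 | h1
      · exact h1
      · rcases List.mem_cons.1 h1 with rfl | h1
        · omega
        · have := (List.pairwise_cons.1 (List.pairwise_append.1 hso).2.1).1 y h1
          omega
    obtain ⟨hb0, hb1⟩ := raw_best hE ih.row hx hnext
    by_cases h0 : x.2 = 0
    · have e : Raw.addRow I.ctx T (enc x) = T := by
        rw [Raw.addRow, hb0 h0]
        exact if_neg (by norm_num)
      rw [e]
      refine ⟨ih.row, fun y hy hy0 => ?_, ih.length_le.trans (by simp)⟩
      rcases List.mem_append.1 hy with hy | hy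
      · exact ih.mem y hy hy0
      · rw [List.mem_singleton.1 hy] at hy0
        exact absurd h0 hy0
    · obtain ⟨j, hj, h1, h2⟩ := hb1 h0
      have e : Raw.addRow I.ctx T (enc x) =
          (enc x, ((j : ℕ) : ℚ), I.startTime j x.1, I.ecost x.1 x.2) :: T := by
        rw [Raw.addRow, h2]
        exact if_pos (by norm_num)
      rw [e]
      refine ⟨fun r hr => ?_, fun y hy hy0 => ?_, ?_⟩
      · rcases List.mem_cons.1 hr with rfl | hr
        · exact ⟨x.1, x.2, j, hx, hj, h1, rfl⟩
        · exact ih.row r hr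
      · rcases List.mem_append.1 hy with hy | hy
        · obtain ⟨r, hr, hr'⟩ := ih.mem y hy hy0
          exact ⟨r, List.mem_cons_of_mem _ hr, hr'⟩
        · rw [List.mem_singleton.1 hy]
          exact ⟨_, List.mem_cons_self, rfl⟩
      · have := ih.length_le
        simp only [List.length_cons, List.length_append, List.length_nil]
        omega

theorem PartialTable.isTable {L : List (Cell n)} (hL : I.Explored 0 L) {T : List Row}
    (h : I.PartialTable L T) : I.IsTable T :=
  ⟨h.row, fun ms ν hr h0 => h.mem (ms, ν) (hL.mem _ hr (Nat.zero_le _)) h0⟩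

end Instance

end BernoulliSched

namespace BernoulliSched

theorem IsFrac.mul {A B : ℕ} {x y : ℚ} (hx : IsFrac A x) (hy : IsFrac B y) :
    IsFrac (A * B) (x * y) := by
  obtain ⟨a, rfl⟩ := hx
  obtain ⟨b, rfl⟩ := hy
  exact ⟨a * b, by push_cast; rw [div_mul_div_comm]⟩

theorem IsFrac.one_sub {D : ℕ} (hD : D ≠ 0) {x : ℚ} (h : IsFrac D x) (hx : x ≤ 1) :
    IsFrac D (1 - x) := by
  obtain ⟨k, rfl⟩ := h
  have h1 : (0 : ℚ) < D := by exact_mod_cast Nat.pos_of_ne_zero hD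
  rw [div_le_one h1] at hx
  have hk : k ≤ D := by exact_mod_cast hx
  exact ⟨D - k, by rw [Nat.cast_sub hk, sub_div, div_self h1.ne']⟩

/-- A common denominator and a bound on the value control the bit length. Thus the growth of
numerators need not be followed through the recursion. -/
theorem IsFrac.ht_le {D b h : ℕ} {x : ℚ} (hx : IsFrac D x) (hD : D ≠ 0) (hb : D ≤ 2 ^ b)
    (hh : x ≤ 2 ^ h) : ht x ≤ h + b + 1 := by
  obtain ⟨k, rfl⟩ := hx
  have h1 : (0 : ℚ) < D := by exact_mod_cast Nat.pos_of_ne_zero hD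
  rw [div_le_iff₀ h1] at hh
  have hk : k ≤ 2 ^ h * D := by exact_mod_cast hh
  have hk' : k ≤ 2 ^ (h + b) := hk.trans (by rw [pow_add]; exact Nat.mul_le_mul_left _ hb)
  have h2 : 2 ^ (h + b) < 2 ^ (h + b + 1) := Nat.pow_lt_pow_right (by norm_num) (by omega)
  refine ht_le_of_eq_div (p := k) (q := D) hD (by simp) ?_ ?_
  · rw [Int.natAbs_natCast]; omega
  · exact (hb.trans (Nat.pow_le_pow_right (by norm_num) (by omega))).trans_lt h2

theorem le_two_pow_of_ht_le {x : ℚ} {s : ℕ} (h : ht x ≤ s) : x ≤ 2 ^ s := by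
  have h1 : x ≤ x.num.natAbs := by
    rcases le_or_gt x 0 with h0 | h0
    · exact h0.trans (Nat.cast_nonneg _)
    · have hd : (1 : ℚ) ≤ x.den := by exact_mod_cast x.den_pos
      have hn : (x.num : ℚ) = x.num.natAbs := by
        rw [← Int.cast_natCast, Int.natCast_natAbs, abs_of_pos (Rat.num_pos.2 h0)]
      have : x * x.den = x.num := Rat.mul_den_eq_num x
      rw [← hn, ← this]
      nlinarith
  refine h1.trans ?_
  have h2 : x.num.natAbs ≤ 2 ^ s :=
    (natAbs_num_lt x).le.trans (Nat.pow_le_pow_right (by norm_num) h)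
  exact_mod_cast h2

namespace Instance

variable {n E : ℕ} {I : Instance n E}

/-! ### Bit lengths -/

/-- The bit length of the input. -/
def bits (I : Instance n E) : ℕ := inputTy.size I.encode

theorem size_entry_lt (j : Fin n) :
    Ty.rat.size (I.p j) + (Ty.list .rat).size (I.probs j) + 1 < I.bits := by
  have h1 : (I.p j, I.probs j) ∈ (List.ofFn fun j => (I.p j, I.probs j)) := by
    rw [List.mem_ofFn]; exact ⟨j, rfl⟩
  have h2 := Ty.size_mem (a := .prod .rat (.list .rat)) h1
  rw [Ty.size_prod] at h2
  rw [bits, Ty.size_prod]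
  refine h2.trans_le ?_
  change _ ≤ _ + (Ty.list (.prod .rat (.list .rat))).size (List.ofFn fun j => (I.p j, I.probs j)) + 1
  omega

theorem ht_p_le (j : Fin n) : ht (I.p j) ≤ I.bits := by
  have h1 := size_entry_lt (I := I) j
  have h2 := ht_le_size (I.p j)
  omega

theorem ht_prob_le {j : Fin n} {q : ℚ} (hq : q ∈ I.probs j) : ht q ≤ I.bits := by
  have h1 := size_entry_lt (I := I) j
  have h2 := ht_le_size q
  have h3 := Ty.size_mem (a := .rat) hq
  omega

theorem p_le_two_pow (j : Fin n) : I.p j ≤ 2 ^ I.bits := le_two_pow_of_ht_le (ht_p_le j)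

theorem tden_le : I.tden ≤ 2 ^ (E * (2 * E ^ 2) + I.bits * n) := by
  have h1 : I.pden ≤ 2 ^ (I.bits * n) := by
    rw [pow_mul]
    refine (Finset.prod_le_pow_card _ _ (2 ^ I.bits) fun j _ => ?_).trans (by simp)
    exact (den_lt (I.p j)).le.trans (Nat.pow_le_pow_right (by norm_num) (ht_p_le j))
  rw [pow_add, tden, show E * (2 * (E ^ 2 * I.pden)) = E * (2 * E ^ 2) * I.pden by ring]
  exact Nat.mul_le_mul Nat.lt_two_pow_self.le h1

/-- A common denominator of the probabilities. -/
def qden (I : Instance n E) : ℕ := ∏ j, ((I.probs j).map fun q => q.den).prod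

theorem qden_ne_zero : I.qden ≠ 0 := by
  refine Finset.prod_ne_zero_iff.2 fun j _ => ?_
  rw [Ne, List.prod_eq_zero_iff]
  intro h
  obtain ⟨q, -, hq⟩ := List.mem_map.1 h
  exact q.den_nz hq

theorem qden_le : I.qden ≤ 2 ^ (I.bits * I.N) := by
  have h : ∀ j, ((I.probs j).map fun q => q.den).prod ≤ (2 ^ I.bits) ^ I.Nj j := by
    intro j
    have := List.prod_le_pow_card ((I.probs j).map fun q => q.den) (2 ^ I.bits) (by
      intro d hd
      obtain ⟨q, hq, rfl⟩ := List.mem_map.1 hd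
      exact (den_lt q).le.trans (Nat.pow_le_pow_right (by norm_num) (ht_prob_le hq)))
    simpa [Nj] using this
  calc I.qden ≤ ∏ j, (2 ^ I.bits) ^ I.Nj j := Finset.prod_le_prod' fun j _ => h j
    _ = 2 ^ (I.bits * I.N) := by rw [Finset.prod_pow_eq_pow_sum, N, pow_mul]

theorem isFrac_nextProb (j : Fin n) (v : ℕ) : IsFrac I.qden (I.nextProb j v) := by
  unfold nextProb
  by_cases h : I.Nj j - v < (I.probs j).length
  · rw [List.getD_eq_getElem _ _ h]
    have hm := List.getElem_mem h
    refine IsFrac.of_den_dvd (I.probs_mem j _ hm).1.le ?_ qden_ne_zero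
    exact (List.dvd_prod (List.mem_map_of_mem (f := fun q : ℚ => q.den) hm)).trans
      (Finset.dvd_prod_of_mem (fun j => ((I.probs j).map fun q => q.den).prod) (Finset.mem_univ j))
  · rw [List.getD_eq_default _ _ (by omega)]
    exact IsFrac.zero

/-- A bound on the increase of the loads of the machines, in multiples of the largest size. -/
def stepConst (n : ℕ) : ℕ := 3 * (1 + n * (n + 3)) + 4

/-- With all sizes at most `P`, the shifted size is at most `(1 + n * (n + 3)) * P`, and `κ ≤ 3`.
The `4` in `stepConst` pays for `κ * dl 1` and for the extra summand `P`. -/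
theorem pcirc_one_le (hE : 3 ≤ E) (hn : 0 < n) :
    I.pcirc 1 + I.κ * I.dl 1 + 2 ^ I.bits ≤ stepConst n * 2 ^ I.bits := by
  have e0 := I.eps_pos hE
  have e1 := I.eps_le hE
  have g1 : I.IsGrp 1 := ⟨le_rfl, I.γ_pos hn⟩
  set P : ℚ := 2 ^ I.bits with hP
  have hP0 : 0 < P := by positivity
  have hpG : ∀ k, I.IsGrp k → I.pG k ≤ P := by
    intro k hk
    obtain ⟨j, -, e, -⟩ := hk.exists_last
    rw [e]; exact p_le_two_pow j
  have hg : ∀ k : ℕ, ∑ i ∈ Finset.Ioc k I.γ, (I.gsize i : ℚ) ≤ n := by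
    intro k
    rw [← raw_above hE, Raw.above, sum_map_ctx]
    refine (Finset.sum_le_card_nsmul _ _ 1 fun j _ => ?_).trans (by simp)
    split_ifs <;> norm_num
  have hs : ∑ k ∈ Finset.Ico 1 I.γ, ((∑ i ∈ Finset.Ioc k I.γ, (I.gsize i : ℚ)) + 3) * I.pG k ≤
      n * ((n + 3) * P) := by
    have h1 := Finset.sum_le_card_nsmul (Finset.Ico 1 I.γ)
      (fun k => ((∑ i ∈ Finset.Ioc k I.γ, (I.gsize i : ℚ)) + 3) * I.pG k) ((n + 3) * P) (by
        intro k hk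
        rw [Finset.mem_Ico] at hk
        have hk' : I.IsGrp k := ⟨hk.1, hk.2.le⟩
        have := hk'.pG_pos
        have := hg k
        exact mul_le_mul (by linarith) (hpG k hk') hk'.pG_pos.le (by positivity))
    rw [nsmul_eq_mul, Nat.card_Ico] at h1
    refine h1.trans (mul_le_mul_of_nonneg_right ?_ (by positivity))
    have := I.γ_le
    exact_mod_cast (by omega : I.γ - 1 ≤ n)
  have hps : I.pstar 1 ≤ (1 + n * (n + 3)) * P := by
    unfold pstar
    have h1 := hpG 1 g1
    have h2 : (1 + I.eps) * I.eps ≤ 1 := by nlinarith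
    have h3 : 0 ≤ (1 + I.eps) * I.eps := by positivity
    have h4 : (0 : ℚ) ≤ n * ((n + 3) * P) := by positivity
    have h5 := mul_le_mul_of_nonneg_left hs h3
    have h6 := mul_le_mul_of_nonneg_right h2 h4
    linarith
  have hκ : I.κ ≤ 3 := by unfold κ; linarith
  have hκ0 := κ_pos (I := I) hE
  have hdl : I.dl 1 ≤ P := by
    have h1 := hpG 1 g1
    have h2 := g1.pG_pos
    unfold dl
    nlinarith
  have hdl0 := dl_pos hE g1
  rw [pcirc_eq hE hn isReg_one]
  have h0 := pstar_pos hE g1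
  have h7 : I.κ * I.pstar 1 ≤ 3 * ((1 + n * (n + 3)) * P) := mul_le_mul hκ hps h0.le (by norm_num)
  have h8 : I.κ * I.dl 1 ≤ 3 * P := mul_le_mul hκ hdl hdl0.le (by norm_num)
  unfold stepConst
  push_cast
  linarith

theorem nextPt_le_add (hE : 3 ≤ E) (j : Fin n) {t : ℚ} (ht : 0 ≤ t) :
    nextPt (I.Q (I.grp j)) t + 2 ^ I.bits ≤ t + stepConst n * 2 ^ I.bits := by
  have hn : 0 < n := j.pos
  have h1 := nextPt_le_max hE (isGrp_grp (I := I) j) t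
  have h2 := pcirc_one_le (I := I) hE hn
  have h3 : max t (I.pcirc 1) ≤ t + I.pcirc 1 :=
    max_le (by have := pcirc_pos hE (I := I) (h := 1) ⟨le_rfl, I.γ_pos hn⟩; linarith) (by linarith)
  linarith

theorem startTime_le (hE : 3 ≤ E) (j : Fin n) {ms : List ℚ} (h : 0 ≤ ms.headD 0) :
    I.startTime j ms + 2 ^ I.bits ≤ ms.headD 0 + stepConst n * 2 ^ I.bits := nextPt_le_add hE j h

theorem release_le (hE : 3 ≤ E) (j : Fin n) {s : ℚ} (hs : 0 ≤ s) :
    I.release j s ≤ s + stepConst n * 2 ^ I.bits := by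
  have hn : 0 < n := j.pos
  have g1 : I.IsGrp 1 := ⟨le_rfl, I.γ_pos hn⟩
  have h1 := nextPt_le_max hE (isGrp_grp (I := I) j) (max (I.pcirc (I.grp j)) (s + I.p j))
  have h2 := pcirc_one_le (I := I) hE hn
  have h3 := p_le_two_pow (I := I) j
  have h4 := I.p_pos j
  have h5 := pcirc_le hE g1 (isGrp_grp (I := I) j) (I.one_le_grp j)
  have h6 := pcirc_pos hE g1
  have h7 : max (max (I.pcirc (I.grp j)) (s + I.p j)) (I.pcirc 1) ≤ s + I.p j + I.pcirc 1 :=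
    max_le (max_le (by linarith) (by linarith)) (by linarith)
  unfold release
  linarith

/-- The times in reachable profiles are multiples of a common unit, and they are bounded. -/
theorem Reach.time (hE : 3 ≤ E) {x : Cell n} (h : I.Reach x) : ∀ t ∈ x.1, IsFrac I.tden t ∧
    t + 2 * stepConst n * 2 ^ I.bits * (∑ j, x.2 j : ℕ) ≤ 2 * stepConst n * 2 ^ I.bits * I.N := by
  have hP : (0 : ℚ) < 2 ^ I.bits := by positivity
  have hc : (0 : ℚ) ≤ stepConst n := Nat.cast_nonneg _
  -- The budget per started job is twice `stepConst n * 2 ^ bits`. Waiting uses one half; the other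
  -- half remains for the release of a long job.
  have hwait : ∀ (ms : List ℚ) (ν : Fin n → ℕ) (j : Fin n), I.Reach (ms, ν) → 0 < ν j →
      (∀ t ∈ ms, IsFrac I.tden t ∧ t + 2 * stepConst n * 2 ^ I.bits * (∑ j, ν j : ℕ) ≤
        2 * stepConst n * 2 ^ I.bits * I.N) →
      IsFrac I.tden (I.startTime j ms) ∧ 0 ≤ I.startTime j ms ∧
        I.startTime j ms + 2 * stepConst n * 2 ^ I.bits * (∑ i, dec ν j i : ℕ) +
          stepConst n * 2 ^ I.bits ≤ 2 * stepConst n * 2 ^ I.bits * I.N := by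
    intro ms ν j hr hj ih
    have hm := (hr.inv hE).2.headD_mem
    have h0 := hr.headD_nonneg hE _ hm
    have h1 := startTime_le (I := I) hE j h0
    have h2 := (ih _ hm).2
    have h3 : ((∑ i, ν i : ℕ) : ℚ) = (∑ i, dec ν j i : ℕ) + 1 := by
      rw [← sum_dec hj]; push_cast; rfl
    rw [h3] at h2
    exact ⟨fractions_Q hE (isGrp_grp j) _ (startTime_mem hE j ms),
      Q_nonneg hE (isGrp_grp j) (startTime_mem hE j ms), by simp only at h2 ⊢; nlinarith⟩
  have hw2 : ∀ (ms : List ℚ) (ν : Fin n → ℕ) (j : Fin n), I.Reach (ms, ν) → 0 < ν j →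
      (∀ t ∈ ms, IsFrac I.tden t ∧ t + 2 * stepConst n * 2 ^ I.bits * (∑ j, ν j : ℕ) ≤
        2 * stepConst n * 2 ^ I.bits * I.N) →
      ∀ t ∈ I.waitProfile j ms, IsFrac I.tden t ∧
        t + 2 * stepConst n * 2 ^ I.bits * (∑ i, dec ν j i : ℕ) ≤
          2 * stepConst n * 2 ^ I.bits * I.N := by
    intro ms ν j hr hj ih t ht
    obtain ⟨y, hy, rfl⟩ := List.mem_map.1 ht
    obtain ⟨h1, h2, h3⟩ := hwait ms ν j hr hj ih
    rcases max_choice (I.startTime j ms) y with h4 | h4 <;> rw [h4]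
    · exact ⟨h1, by nlinarith⟩
    · refine ⟨(ih y hy).1, ?_⟩
      have h5 := (ih y hy).2
      have h6 : ((∑ i, ν i : ℕ) : ℚ) = (∑ i, dec ν j i : ℕ) + 1 := by
        rw [← sum_dec hj]; push_cast; rfl
      rw [h6] at h5
      nlinarith
  induction h with
  | init =>
    intro t ht
    rw [List.eq_of_mem_replicate ht]
    exact ⟨IsFrac.zero, by rw [zero_add]; rfl⟩
  | long ms ν j hr hj ih =>
    intro t ht
    rcases (List.mem_orderedInsert _).1 ht with rfl | h1
    · obtain ⟨h1, h2, h3⟩ := hwait ms ν j hr hj ih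
      have h4 := release_le (I := I) hE j h2
      exact ⟨fractions_Q hE (isGrp_grp j) _ (nextPt_mem hE (isGrp_grp j) _), by
        simp only at h3 ⊢; linarith⟩
    · exact hw2 ms ν j hr hj ih t (List.mem_of_mem_tail h1)
  | short ms ν j hr hj ih => exact hw2 ms ν j hr hj ih

theorem Reach.startTime_le (hE : 3 ≤ E) {x : Cell n} (h : I.Reach x) {j : Fin n} (hj : 0 < x.2 j) :
    I.startTime j x.1 ≤ 2 * stepConst n * 2 ^ I.bits * I.N := by
  have hm := (h.inv hE).2.headD_mem
  have h1 := ((Reach.short x.1 x.2 j h hj).time hE _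
    (List.mem_map_of_mem (f := max (I.startTime j x.1)) hm)).2
  have h2 := le_max_left (I.startTime j x.1) (x.1.headD 0)
  have h3 : (0 : ℚ) ≤ 2 * stepConst n * 2 ^ I.bits * (∑ i, dec x.2 j i : ℕ) := by positivity
  simp only at h1
  linarith

theorem isFrac_p_tden (hE : 3 ≤ E) (j : Fin n) : IsFrac I.tden (I.p j) :=
  (((isFrac_p j).of_mul (by positivity : E ^ 2 ≠ 0)).of_mul two_ne_zero).of_mul (by omega)

/-- Values of reachable cells have a common denominator, and they are bounded. -/
theorem Reach.ecost_isFrac (hE : 3 ≤ E) {x : Cell n} (h : I.Reach x) :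
    IsFrac (I.qden ^ (∑ j, x.2 j) * I.tden) (I.ecost x.1 x.2) ∧
      I.ecost x.1 x.2 ≤ (∑ j, x.2 j : ℕ) * ((2 * stepConst n * I.N + 1) * 2 ^ I.bits) := by
  induction hk : ∑ j, x.2 j generalizing x with
  | zero =>
    have h0 : x.2 = 0 := funext fun j => by
      have := Finset.sum_eq_zero_iff.1 hk j (Finset.mem_univ j)
      simpa using this
    rw [h0, ecost_zero]
    exact ⟨IsFrac.zero, by simp⟩
  | succ k ih =>
    have h0 : x.2 ≠ 0 := by
      intro h0
      rw [h0] at hk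
      simp at hk
    obtain ⟨⟨j, hj, e⟩, -⟩ := ecost_isLeast (I := I) x.1 h0
    have hs := sum_dec hj
    obtain ⟨l1, l2⟩ := ih (Reach.long x.1 x.2 j h hj) (by simp only; omega)
    obtain ⟨s1, s2⟩ := ih (Reach.short x.1 x.2 j h hj) (by simp only; omega)
    obtain ⟨q0, q1⟩ := nextProb_mem (I := I) j (x.2 j)
    have hst := h.startTime_le hE hj
    have hsf : IsFrac (I.qden ^ k * I.tden) (I.startTime j x.1) :=
      IsFrac.of_mul (fractions_Q hE (isGrp_grp j) _ (startTime_mem hE j x.1))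
        (pow_ne_zero _ qden_ne_zero)
    have hpf : IsFrac (I.qden ^ k * I.tden) (I.p j) :=
      (isFrac_p_tden hE j).of_mul (pow_ne_zero _ qden_ne_zero)
    have hq := isFrac_nextProb (I := I) j (x.2 j)
    have hp := p_le_two_pow (I := I) j
    rw [e, startCost]
    constructor
    -- Each level of the recursion multiplies by one probability, so it contributes one factor
    -- `qden`.
    · rw [pow_succ', mul_assoc]
      exact (hq.mul (l1.add (hsf.add hpf))).add ((hq.one_sub qden_ne_zero q1).mul (s1.add hsf))
    · simp only at l2 s2
      have hP : (0 : ℚ) < 2 ^ I.bits := by positivity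
      set V := I.ecost (I.longProfile j x.1) (dec x.2 j)
      set W := I.ecost (I.waitProfile j x.1) (dec x.2 j)
      set M : ℚ := (2 * stepConst n * I.N + 1) * 2 ^ I.bits with hM
      have a1 : V + (I.startTime j x.1 + I.p j) ≤ (k + 1) * M := by rw [hM] at *; linarith
      have a2 : W + I.startTime j x.1 ≤ (k + 1) * M := by rw [hM] at *; linarith
      have b1 := mul_le_mul_of_nonneg_left a1 q0
      have b2 := mul_le_mul_of_nonneg_left a2 (sub_nonneg.2 q1)
      push_cast
      linarith

/-- A bound on the bit lengths of the times. -/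
def timeBits (I : Instance n E) : ℕ :=
  (2 * stepConst n + I.bits + I.N) + (E * (2 * E ^ 2) + I.bits * n) + 1

theorem cast_le_two_pow (k : ℕ) : (k : ℚ) ≤ 2 ^ k := by
  exact_mod_cast (Nat.lt_two_pow_self (n := k)).le

theorem horizon_le :
    2 * (stepConst n : ℚ) * 2 ^ I.bits * I.N ≤ 2 ^ (2 * stepConst n + I.bits + I.N) := by
  have h1 := cast_le_two_pow (2 * stepConst n)
  have h2 := cast_le_two_pow I.N
  push_cast at h1
  rw [pow_add, pow_add]
  gcongr

theorem Reach.ht_time_le (hE : 3 ≤ E) {x : Cell n} (h : I.Reach x) {t : ℚ} (ht' : t ∈ x.1) :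
    ht t ≤ I.timeBits := by
  obtain ⟨h1, h2⟩ := h.time hE t ht'
  refine h1.ht_le (tden_pos hE).ne' tden_le (le_trans ?_ horizon_le)
  have h3 : (0 : ℚ) ≤ 2 * stepConst n * 2 ^ I.bits * (∑ i, x.2 i : ℕ) := by positivity
  linarith

theorem Reach.ht_startTime_le (hE : 3 ≤ E) {x : Cell n} (h : I.Reach x) {j : Fin n}
    (hj : 0 < x.2 j) : ht (I.startTime j x.1) ≤ I.timeBits :=
  IsFrac.ht_le (fractions_Q hE (isGrp_grp j) _ (startTime_mem hE j x.1)) (tden_pos hE).ne' tden_le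
    ((h.startTime_le hE hj).trans horizon_le)

/-- A bound on the bit lengths of the values. -/
def valueBits (I : Instance n E) : ℕ :=
  (I.N + (2 * stepConst n * I.N + 1 + I.bits)) +
    (I.bits * I.N * I.N + (E * (2 * E ^ 2) + I.bits * n)) + 1

theorem Reach.ht_ecost_le (hE : 3 ≤ E) {x : Cell n} (h : I.Reach x) :
    ht (I.ecost x.1 x.2) ≤ I.valueBits := by
  obtain ⟨h1, h2⟩ := h.ecost_isFrac hE
  have hs := h.sum_le hE
  refine h1.ht_le (mul_ne_zero (pow_ne_zero _ qden_ne_zero) (tden_pos hE).ne') ?_ (h2.trans ?_)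
  · rw [pow_add, pow_mul]
    refine Nat.mul_le_mul ?_ tden_le
    exact (Nat.pow_le_pow_right (Nat.pos_of_ne_zero qden_ne_zero) hs).trans
      (Nat.pow_le_pow_left qden_le _)
  · rw [pow_add, pow_add]
    have a1 := cast_le_two_pow (2 * stepConst n * I.N + 1)
    push_cast at a1
    have a2 : ((∑ j, x.2 j : ℕ) : ℚ) ≤ 2 ^ I.N :=
      (Nat.cast_le.2 hs).trans (cast_le_two_pow I.N)
    gcongr

theorem size_key_le {ν : Fin n → ℕ} {B : ℕ} (h : ∀ j, ν j ≤ B) :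
    (Ty.list .rat).size (key ν) ≤ n * (2 * (B + 1) + 2) + 1 := by
  have := Ty.size_list_le (a := .rat) (key ν) (2 * (B + 1) + 1) (by
    intro x hx
    obtain ⟨j, rfl⟩ := (List.mem_ofFn' _ _).1 hx
    have h1 := ht_natCast_le (h j)
    have h2 := size_le_ht ((ν j : ℕ) : ℚ)
    change Ty.rat.size ((ν j : ℕ) : ℚ) ≤ _
    omega)
  have hl : (key ν).length = n := by simp [key]
  rw [hl] at this
  exact this

/-- A bound on the bit lengths of the cells. -/
def cellBits (I : Instance n E) : ℕ :=
  I.m * (2 * I.timeBits + 2) + 1 + (n * (2 * (I.N + 1) + 2) + 1) + 1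

theorem Reach.size_le (hE : 3 ≤ E) {x : Cell n} (h : I.Reach x) :
    cellTy.size (enc x) ≤ I.cellBits := by
  have h1 := Ty.size_list_le (a := .rat) x.1 (2 * I.timeBits + 1) (by
    intro t ht'
    have h1 := h.ht_time_le hE ht'
    have h2 := size_le_ht t
    omega)
  rw [(h.inv hE).2.length, show 2 * I.timeBits + 1 + 1 = 2 * I.timeBits + 2 from rfl] at h1
  have h2 := size_key_le fun j => ((h.inv hE).1 j).trans (Nj_le_N j)
  rw [Ty.size_prod]
  change (Ty.list .rat).size x.1 + (Ty.list .rat).size (key x.2) + 1 ≤ _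
  unfold cellBits
  omega

/-- A bound on the bit lengths of the rows. -/
def rowBits (I : Instance n E) : ℕ :=
  I.cellBits + (2 * (n + 1) + 1 + (2 * I.timeBits + 1 + (2 * I.valueBits + 1) + 1) + 1) + 1

theorem IsRow.size_le (hE : 3 ≤ E) {r : Row} (h : I.IsRow r) :
    (Ty.prod cellTy (.prod .rat (.prod .rat .rat))).size r ≤ I.rowBits := by
  obtain ⟨ms, ν, j, hr, hj, -, rfl⟩ := h
  have h1 := hr.size_le hE
  have h2 := hr.ht_startTime_le hE hj
  have h3 := hr.ht_ecost_le hE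
  have h4 := ht_natCast_le j.2.le
  have g2 := size_le_ht (I.startTime j ms)
  have g3 := size_le_ht (I.ecost ms ν)
  have g4 := size_le_ht ((j : ℕ) : ℚ)
  have e1 := Ty.size_prod (a := cellTy) (b := .prod .rat (.prod .rat .rat))
    (enc (ms, ν), (((j : ℕ) : ℚ), I.startTime j ms, I.ecost ms ν))
  have e2 := Ty.size_prod (a := .rat) (b := .prod .rat .rat)
    (((j : ℕ) : ℚ), I.startTime j ms, I.ecost ms ν)
  have e3 := Ty.size_prod (a := .rat) (b := .rat) (I.startTime j ms, I.ecost ms ν)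
  simp only at e1 e2 e3 h2 h3
  refine (le_of_eq e1).trans ?_
  unfold rowBits
  omega

/-- A bound on the number of cells. -/
def cellCount (I : Instance n E) : ℕ :=
  cellConst n E * (I.N ^ (2 * n) * E ^ (2 * n) * I.m ^ (n * E ^ (2 * n)))

theorem length_le_cellCount (hE : 3 ≤ E) {L : List (Cell n)} (h : L.Nodup)
    (hr : ∀ x ∈ L, I.Reach x) : L.length ≤ I.cellCount := by
  classical
  obtain ⟨h1, h2⟩ := relevantCells_bound (I := I) hE
  have h3 : (L.toFinset : Set (Cell n)) ⊆ I.relevantCells := by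
    intro x hx
    exact Or.inl (hr x (List.mem_toFinset.1 hx))
  have h4 := Set.ncard_le_ncard h3 h1
  rw [Set.ncard_coe_finset, List.toFinset_card_of_nodup h] at h4
  refine h4.trans (h2.trans ?_)
  unfold cellCount
  -- The exponent must not depend on the instance, so `z` is replaced by `n`.
  have h5 : n * E ^ (2 * I.z) ≤ n * E ^ (2 * n) :=
    Nat.mul_le_mul_left _ (Nat.pow_le_pow_right (by omega) (Nat.mul_le_mul_left _ z_le))
  exact Nat.mul_le_mul_left _ (Nat.mul_le_mul_left _ (Nat.pow_le_pow_right I.m_pos h5))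

end Instance

end BernoulliSched

namespace BernoulliSched

/-! ### Costs of composed programs, along a family of inputs -/

section cost

variable {ι : Type*} {μ : ι → ℕ} {a b c s : Ty}

theorem Prog.size_le_cost (f : Prog a b) (x : a.den) : a.size x ≤ f.cost x := by
  refine le_trans ?_ (f.charge_le_cost x)
  unfold Prog.charge
  omega

/-- From here on costs are measured in a parameter `μ` of a family of inputs. The complete program
need not have polynomial cost on arbitrary inputs, so `PT` is not available for it. -/
theorem polyBdd_comp {g : Prog b c} {f : Prog a b} {x : ι → a.den}
    (hf : PolyBdd μ fun i => f.cost (x i)) (hg : PolyBdd μ fun i => g.cost (f.eval (x i))) :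
    PolyBdd μ fun i => (Prog.comp g f).cost (x i) := by
  refine (((hf.add hg).add (PolyBdd.const μ 1)).add (hf.add hg)).mono fun i => ?_
  have h1 := f.size_le_cost (x i)
  have h2 := g.size_eval_le (f.eval (x i))
  simp only [Prog.cost, Prog.charge, Prog.eval]
  omega

theorem polyBdd_pair {f : Prog a b} {g : Prog a c} {x : ι → a.den}
    (hf : PolyBdd μ fun i => f.cost (x i)) (hg : PolyBdd μ fun i => g.cost (x i)) :
    PolyBdd μ fun i => (Prog.pair f g).cost (x i) := by
  refine ((((hf.add hf).add hg).add (PolyBdd.const μ 2)).add (hf.add hg)).mono fun i => ?_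
  have h1 := f.size_le_cost (x i)
  have h2 := f.size_eval_le (x i)
  have h3 := g.size_eval_le (x i)
  simp only [Prog.cost, Prog.charge, Prog.eval, Ty.size_prod]
  omega

theorem PT.polyBdd (f : PT a b) {x : ι → a.den} (hx : PolyBdd μ fun i => a.size (x i)) :
    PolyBdd μ fun i => f.prog.cost (x i) := (f.poly.comp x).trans hx

/-- Iterating a polynomial step can let a state explode. The bound `β` on the states that are
actually visited excludes this. -/
theorem polyBdd_loop (f : PT s s) {x : ι → s.den × ℚ} {β : ι → ℕ}
    (hx : PolyBdd μ fun i => (Ty.prod s .rat).size (x i)) (hk : PolyBdd μ fun i => ⌊(x i).2⌋₊)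
    (hβ : PolyBdd μ β) (h : ∀ i, ∀ k ≤ ⌊(x i).2⌋₊, s.size ((fun s => f.ev s)^[k] (x i).1) ≤ β i) :
    PolyBdd μ fun i => (Prog.loop f.prog).cost (x i) := by
  obtain ⟨d, hd⟩ := f.poly
  refine (((hx.add hβ).add (PolyBdd.const μ 1)).add
    (hk.mul ((hβ.add (PolyBdd.const μ 2)).pow d))).mono fun i => ?_
  simp only [Prog.cost, Prog.charge, Prog.eval]
  refine Nat.add_le_add (Nat.add_le_add_right (Nat.add_le_add_left (h i _ le_rfl) _) _) ?_
  refine loop_cost_le _ _ _ _ fun k hk => (hd _).trans (Nat.pow_le_pow_left ?_ d)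
  have := h i k hk.le
  exact Nat.add_le_add_right this 2

theorem polyBdd_fold (f : PT (.prod s b) s) {x : ι → s.den × List b.den} {β : ι → ℕ}
    (hx : PolyBdd μ fun i => (Ty.prod s (.list b)).size (x i))
    (hβ : PolyBdd μ β) (h : ∀ i, ∀ l₁ l₂, (x i).2 = l₁ ++ l₂ →
      s.size (l₁.foldl (fun s y => f.ev (s, y)) (x i).1) ≤ β i) :
    PolyBdd μ fun i => (Prog.fold f.prog).cost (x i) := by
  obtain ⟨d, hd⟩ := f.poly
  refine (((hx.add hβ).add (PolyBdd.const μ 1)).add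
    (hx.mul (((hβ.add hx).add (PolyBdd.const μ 3)).pow d))).mono fun i => ?_
  have hl := Ty.size_prod (a := s) (b := .list b) (x i)
  simp only [Prog.cost, Prog.charge, Prog.eval]
  refine Nat.add_le_add (Nat.add_le_add_right (Nat.add_le_add_left
    (h i _ [] (List.append_nil _).symm) _) _) ?_
  refine (foldl_cost_le _ _ _ _ fun l₁ y l₂ e => (hd _).trans (Nat.pow_le_pow_left ?_ d)).trans
    (Nat.mul_le_mul_right _ ?_)
  · have h1 := h i l₁ (y :: l₂) e
    have h2 := Ty.size_mem (a := b) (x := y) (l := (x i).2) (by rw [e]; simp)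
    have h3 := Ty.size_prod (a := s) (b := b) (l₁.foldl (fun s y => f.ev (s, y)) (x i).1, y)
    simp only at h3
    refine Nat.le_trans (Nat.add_le_add_right (le_of_eq h3) 2) ?_
    omega
  · have := Ty.length_lt_size (x i).2
    omega

end cost

/-! ### Polynomial bounds in the numbers of jobs and machines and the input length -/

namespace Instance

variable {n E : ℕ} {I : Instance n E}

/-- The parameter in which the cost of the algorithm is measured. -/
def measure (I : Instance n E) : ℕ := I.N + I.m + I.bits

section bounds

variable (n E)

theorem polyBdd_N : PolyBdd (measure (n := n) (E := E)) N := PolyBdd.of_le fun I => by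
  unfold measure; omega

theorem polyBdd_m : PolyBdd (measure (n := n) (E := E)) m := PolyBdd.of_le fun I => by
  unfold measure; omega

theorem polyBdd_bits : PolyBdd (measure (n := n) (E := E)) bits := PolyBdd.of_le fun I => by
  unfold measure; omega

theorem polyBdd_timeBits : PolyBdd (measure (n := n) (E := E)) timeBits :=
  ((((PolyBdd.const _ _).add (polyBdd_bits n E)).add (polyBdd_N n E)).add
    ((PolyBdd.const _ _).add ((polyBdd_bits n E).mul (PolyBdd.const _ _)))).add (PolyBdd.const _ _)

theorem polyBdd_valueBits : PolyBdd (measure (n := n) (E := E)) valueBits :=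
  (((polyBdd_N n E).add ((((PolyBdd.const _ _).mul (polyBdd_N n E)).add (PolyBdd.const _ _)).add
    (polyBdd_bits n E))).add ((((polyBdd_bits n E).mul (polyBdd_N n E)).mul (polyBdd_N n E)).add
    ((PolyBdd.const _ _).add ((polyBdd_bits n E).mul (PolyBdd.const _ _))))).add (PolyBdd.const _ _)

theorem polyBdd_cellBits : PolyBdd (measure (n := n) (E := E)) cellBits :=
  ((((polyBdd_m n E).mul (((PolyBdd.const _ _).mul (polyBdd_timeBits n E)).add
    (PolyBdd.const _ _))).add (PolyBdd.const _ _)).add (((PolyBdd.const _ _).mul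
    (((PolyBdd.const _ _).mul ((polyBdd_N n E).add (PolyBdd.const _ _))).add
      (PolyBdd.const _ _))).add (PolyBdd.const _ _))).add (PolyBdd.const _ _)

theorem polyBdd_rowBits : PolyBdd (measure (n := n) (E := E)) rowBits :=
  ((polyBdd_cellBits n E).add (((PolyBdd.const _ _).add (((((PolyBdd.const _ _).mul
    (polyBdd_timeBits n E)).add (PolyBdd.const _ _)).add (((PolyBdd.const _ _).mul
    (polyBdd_valueBits n E)).add (PolyBdd.const _ _))).add (PolyBdd.const _ _))).add
    (PolyBdd.const _ _))).add (PolyBdd.const _ _)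

theorem polyBdd_cellCount : PolyBdd (measure (n := n) (E := E)) cellCount :=
  (PolyBdd.const _ _).mul ((((polyBdd_N n E).pow _).mul (PolyBdd.const _ _)).mul
    ((polyBdd_m n E).pow _))

end bounds

theorem size_states_le (hE : 3 ≤ E) {i : ℕ} (hi : i ≤ I.N) :
    (Ty.list cellTy).size ((Raw.explore I.ctx)^[i] [enc (I.profileInit, I.Nj)]) ≤
      I.cellCount * (I.cellBits + 1) + 1 := by
  obtain ⟨L, hL, e⟩ := explored_iterate (I := I) hE hi
  rw [e]
  have h1 := Ty.size_list_le (a := cellTy) (L.map enc) I.cellBits (by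
    intro c hc
    obtain ⟨x, hx, rfl⟩ := List.mem_map.1 hc
    exact (hL.reach x hx).size_le hE)
  rw [List.length_map] at h1
  refine h1.trans (Nat.add_le_add_right (Nat.mul_le_mul_right _ ?_) 1)
  exact length_le_cellCount hE hL.nodup hL.reach

/-- Stated for every prefix, since the cost of the fold depends on all intermediate tables. -/
theorem size_table_le (hE : 3 ≤ E) {L : List (Cell n)} (hL : I.Explored 0 L)
    {L₁ L₂ : List cellTy.den} (h : L.map enc = L₁ ++ L₂) :
    tableTy.size (L₁.foldl (Raw.addRow I.ctx) []) ≤ I.cellCount * (I.rowBits + 1) + 1 := by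
  obtain ⟨M₁, M₂, rfl, rfl, rfl⟩ := List.map_eq_append_iff.1 h
  have hT := partialTable_foldl hE hL (L₁ := M₁) rfl
  have h1 := Ty.size_list_le (a := .prod cellTy (.prod .rat (.prod .rat .rat)))
    ((M₁.map enc).foldl (Raw.addRow I.ctx) []) I.rowBits fun r hr => (hT.row r hr).size_le hE
  refine h1.trans (Nat.add_le_add_right (Nat.mul_le_mul_right _ ?_) 1)
  have h2 := length_le_cellCount hE hL.nodup hL.reach
  have h3 := hT.length_le
  rw [List.length_append] at h2
  omega

end Instance

end BernoulliSched

/-! ### Assembly of the algorithm -/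

namespace BernoulliSched

theorem pf_ctx : PF inputTy ctxTy fun x => (x.1.1, enumQ x.2) :=
  PF.id.fst.fst.pair PF.id.snd.enum

theorem pf_counts : PF inputTy (.list .rat) fun x => x.2.map fun y => (y.2.length : ℚ) :=
  PF.map PF.id.snd PF.id.snd.snd.length

theorem pf_total : PF inputTy .rat fun x => (x.2.map fun y => (y.2.length : ℚ)).sum :=
  PF.sum PF.id.snd PF.id.snd.snd.length

/-- The input of the exploration: the data, the initial cell, and the number of rounds. -/
theorem pf_init : PF (.prod inputTy (.list .rat)) (.prod (.prod ctxTy (.list cellTy)) .rat)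
    fun x => (((x.1.1.1, enumQ x.1.2), [(x.2, x.1.2.map fun y => (y.2.length : ℚ))]),
      (x.1.2.map fun y => (y.2.length : ℚ)).sum) :=
  ((pf_ctx.comp PF.id.fst).pair ((PF.id.snd.pair (pf_counts.comp PF.id.fst)).cons PF.nil)).pair
    (pf_total.comp PF.id.fst)

theorem pf_explore : PF (.prod ctxTy (.list cellTy)) (.prod ctxTy (.list cellTy))
    fun x => (x.1, Raw.explore x.1 x.2) :=
  PF.id.fst.pair (PF.explore PF.id.fst PF.id.snd)

theorem pf_addRow : PF (.prod (.prod ctxTy tableTy) cellTy) (.prod ctxTy tableTy)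
    fun x => (x.1.1, Raw.addRow x.1.1 x.1.2 x.2) :=
  PF.id.fst.fst.pair (PF.addRow PF.id.fst.fst PF.id.fst.snd PF.id.snd)

namespace Instance

variable {n E : ℕ} {I : Instance n E}

theorem iterate_cons_zero (k : ℕ) (l : List ℚ) :
    (fun l : List ℚ => 0 :: l)^[k] l = List.replicate k 0 ++ l := by
  induction k generalizing l with
  | zero => rfl
  | succ k ih =>
    rw [Function.iterate_succ_apply, ih, List.replicate_succ']
    simp

theorem iterate_explore (D : ctxTy.den) (S : List cellTy.den) (k : ℕ) :
    (fun x : (Ty.prod ctxTy (.list cellTy)).den => (x.1, Raw.explore x.1 x.2))^[k] (D, S) =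
      (D, (Raw.explore D)^[k] S) := by
  induction k generalizing S with
  | zero => rfl
  | succ k ih => exact ih _

theorem foldl_addRow (D : ctxTy.den) (T : tableTy.den) (L : List cellTy.den) :
    L.foldl (fun (x : (Ty.prod ctxTy tableTy).den) c => (x.1, Raw.addRow x.1 x.2 c)) (D, T) =
      (D, L.foldl (Raw.addRow D) T) := by
  induction L generalizing T with
  | nil => rfl
  | cons c L ih => exact ih _

/-- The algorithm: list the reachable cells, and then compute their rows. -/
theorem exists_program : ∃ P : Prog inputTy tableTy, ∀ n E : ℕ, 3 ≤ E →
    (∀ I : Instance n E, I.IsTable (P.eval I.encode)) ∧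
    PolyBdd (measure (n := n) (E := E)) fun I => P.cost I.encode := by
  -- `Z` and `A` produce the initial profile by a loop with `m` rounds. This is polynomial in `m`,
  -- not in its bit length, which is one reason why `measure` contains `m`.
  obtain ⟨Z, hZ⟩ : PF (.list .rat) (.list .rat) fun l => (0 : ℚ) :: l := (PF.const 0).cons PF.id
  obtain ⟨A, hA⟩ : PF inputTy (.prod (.list .rat) .rat) fun x => (([] : List ℚ), x.1.2) :=
    PF.nil.pair PF.id.fst.snd
  obtain ⟨B, hB⟩ := pf_init
  obtain ⟨X, hX⟩ := pf_explore
  obtain ⟨F, hF⟩ : PF (.prod ctxTy (.list cellTy)) (.prod (.prod ctxTy tableTy) (.list cellTy))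
      fun x => ((x.1, ([] : List Row)), x.2) := (PF.id.fst.pair PF.nil).pair PF.id.snd
  obtain ⟨R, hR⟩ := pf_addRow
  have eZ : (fun l => Z.ev l) = fun l : List ℚ => 0 :: l := funext hZ
  have eX : (fun x => X.ev x) = fun x : (Ty.prod ctxTy (.list cellTy)).den =>
    (x.1, Raw.explore x.1 x.2) := funext hX
  have eR : (fun (s : (Ty.prod ctxTy tableTy).den) (c : cellTy.den) => R.ev (s, c)) =
      fun x c => (x.1, Raw.addRow x.1 x.2 c) := by
    funext s c
    exact hR (s, c)
  let P₁ : Prog inputTy (.prod inputTy (.list .rat)) :=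
    .pair (.ident _) (.comp (.loop Z.prog) A.prog)
  let P₂ : Prog inputTy (.prod ctxTy (.list cellTy)) := .comp (.loop X.prog) (.comp B.prog P₁)
  let P₃ : Prog inputTy (.prod ctxTy tableTy) := .comp (.fold R.prog) (.comp F.prog P₂)
  refine ⟨.comp (.snd _ _) P₃, fun n E hE => ?_⟩
  have floor_m : ∀ I : Instance n E, ⌊((I.m : ℕ) : ℚ)⌋₊ = I.m := fun I => Nat.floor_natCast _
  have e₁ : ∀ I : Instance n E, P₁.eval I.encode = (I.encode, I.profileInit) := by
    intro I
    have h1 : A.prog.eval I.encode = (([] : List ℚ), (I.m : ℚ)) := hA I.encode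
    change (I.encode, (fun s => Z.ev s)^[⌊(A.prog.eval I.encode).2⌋₊] (A.prog.eval I.encode).1) = _
    rw [h1, eZ]
    simp only [floor_m, iterate_cons_zero, List.append_nil]
    rfl
  have e_init : ∀ I : Instance n E, B.prog.eval (P₁.eval I.encode) =
      ((I.ctx, [enc (I.profileInit, I.Nj)]), (I.N : ℚ)) := by
    intro I
    rw [e₁]
    refine (hB _).trans ?_
    have h1 : enumQ (List.ofFn fun j => (I.p j, I.probs j)) = I.ctx.2 := enumQ_ofFn _
    have h2 : (List.ofFn fun j => (I.p j, I.probs j)).map (fun y => (y.2.length : ℚ)) =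
        key I.Nj := by rw [List.map_ofFn]; rfl
    have h3 : (key I.Nj).sum = I.N := by rw [key, List.sum_ofFn, N]; push_cast; rfl
    simp only [encode, h1, h2, h3]
    rfl
  have e₂ : ∀ I : Instance n E, P₂.eval I.encode =
      (I.ctx, (Raw.explore I.ctx)^[I.N] [enc (I.profileInit, I.Nj)]) := by
    intro I
    change (fun s => X.ev s)^[⌊(B.prog.eval (P₁.eval I.encode)).2⌋₊]
      (B.prog.eval (P₁.eval I.encode)).1 = _
    rw [e_init, eX]
    simp only [Nat.floor_natCast]
    exact iterate_explore _ _ _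
  have e_fold : ∀ I : Instance n E, F.prog.eval (P₂.eval I.encode) =
      ((I.ctx, ([] : List Row)), (Raw.explore I.ctx)^[I.N] [enc (I.profileInit, I.Nj)]) := by
    intro I
    rw [e₂]
    exact hF _
  have e₃ : ∀ I : Instance n E, P₃.eval I.encode = (I.ctx,
      ((Raw.explore I.ctx)^[I.N] [enc (I.profileInit, I.Nj)]).foldl (Raw.addRow I.ctx) []) := by
    intro I
    change (F.prog.eval (P₂.eval I.encode)).2.foldl (fun s c => R.ev (s, c))
      (F.prog.eval (P₂.eval I.encode)).1 = _
    rw [e_fold, eR]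
    exact foldl_addRow _ _ _
  constructor
  · intro I
    obtain ⟨L, hL, e⟩ := explored_iterate (I := I) hE le_rfl
    rw [Nat.sub_self] at hL
    have h1 : (Prog.comp (.snd _ _) P₃).eval I.encode =
        (L.map enc).foldl (Raw.addRow I.ctx) [] := by
      change (P₃.eval I.encode).2 = _
      rw [e₃, e]
    rw [h1]
    exact (partialTable_foldl hE hL (List.append_nil _).symm).isTable hL
  · have b₀ : PolyBdd (measure (n := n) (E := E)) fun I => inputTy.size I.encode := polyBdd_bits n E
    have bA := A.polyBdd b₀
    have b₁ : PolyBdd (measure (n := n) (E := E)) fun I => P₁.cost I.encode := by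
      refine polyBdd_pair ((PT.ident _).polyBdd b₀) (polyBdd_comp bA ?_)
      refine polyBdd_loop Z (x := fun I => A.prog.eval (encode I))
        (bA.mono fun I => Prog.size_eval_le _ _) ?_ ((polyBdd_m n E).mul (PolyBdd.const _ 3) |>.add
          (PolyBdd.const _ 1)) ?_
      · refine (polyBdd_m n E).mono fun I => ?_
        have h1 : A.prog.eval I.encode = (([] : List ℚ), (I.m : ℚ)) := hA I.encode
        rw [h1]
        exact (floor_m I).le
      · intro I k hk
        have h1 : A.prog.eval I.encode = (([] : List ℚ), (I.m : ℚ)) := hA I.encode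
        rw [h1] at hk ⊢
        have hk' : k ≤ I.m := hk.trans (floor_m I).le
        rw [eZ, iterate_cons_zero, List.append_nil]
        have h2 := Ty.size_list_le (a := .rat) (List.replicate k (0 : ℚ)) 2 (by
          intro x hx
          rw [List.eq_of_mem_replicate hx]
          decide)
        rw [List.length_replicate] at h2
        exact h2.trans (Nat.add_le_add_right (Nat.mul_le_mul_right _ hk') 1)
    have bC : PolyBdd (measure (n := n) (E := E)) fun I => (Prog.comp B.prog P₁).cost I.encode :=
      polyBdd_comp b₁ (B.polyBdd (b₁.mono fun I => Prog.size_eval_le _ _))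
    have b_init : PolyBdd (measure (n := n) (E := E)) fun I =>
        (Ty.prod (.prod ctxTy (.list cellTy)) .rat).size (B.prog.eval (P₁.eval I.encode)) :=
      bC.mono fun I => (Prog.comp B.prog P₁).size_eval_le _
    have b_ctx : PolyBdd (measure (n := n) (E := E)) fun I => ctxTy.size I.ctx := by
      refine b_init.mono fun I => ?_
      have h1 := Ty.size_prod (a := .prod ctxTy (.list cellTy)) (b := .rat)
        ((I.ctx, [enc (I.profileInit, I.Nj)]), (I.N : ℚ))
      have h2 := Ty.size_prod (a := ctxTy) (b := .list cellTy)
        (I.ctx, [enc (I.profileInit, I.Nj)])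
      simp only at h1 h2
      rw [e_init, h1, h2]
      omega
    have b₂ : PolyBdd (measure (n := n) (E := E)) fun I => P₂.cost I.encode := by
      refine polyBdd_comp bC (polyBdd_loop X (x := fun I => B.prog.eval (P₁.eval (encode I))) b_init
        ?_ ((b_ctx.add (((polyBdd_cellCount n E).mul ((polyBdd_cellBits n E).add
          (PolyBdd.const _ 1))).add (PolyBdd.const _ 1))).add (PolyBdd.const _ 1)) ?_)
      · refine (polyBdd_N n E).mono fun I => ?_
        rw [e_init]
        exact (Nat.floor_natCast _).le
      · intro I k hk
        rw [e_init] at hk ⊢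
        have hk' : k ≤ I.N := hk.trans (Nat.floor_natCast _).le
        rw [eX, iterate_explore, Ty.size_prod]
        exact Nat.add_le_add_right (Nat.add_le_add_left (size_states_le hE hk') _) _
    have bF : PolyBdd (measure (n := n) (E := E)) fun I => (Prog.comp F.prog P₂).cost I.encode :=
      polyBdd_comp b₂ (F.polyBdd (b₂.mono fun I => Prog.size_eval_le _ _))
    have b₃ : PolyBdd (measure (n := n) (E := E)) fun I => P₃.cost I.encode := by
      refine polyBdd_comp bF (polyBdd_fold R (x := fun I => F.prog.eval (P₂.eval (encode I)))
        (bF.mono fun I => (Prog.comp F.prog P₂).size_eval_le _)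
        ((b_ctx.add (((polyBdd_cellCount n E).mul ((polyBdd_rowBits n E).add
          (PolyBdd.const _ 1))).add (PolyBdd.const _ 1))).add (PolyBdd.const _ 1)) ?_)
      intro I l₁ l₂ h
      rw [e_fold] at h ⊢
      obtain ⟨L, hL, e⟩ := explored_iterate (I := I) hE le_rfl
      rw [Nat.sub_self] at hL
      rw [eR]
      rw [foldl_addRow, Ty.size_prod]
      exact Nat.add_le_add_right (Nat.add_le_add_left (size_table_le hE hL (e.symm.trans h)) _) _
    have b_out : PolyBdd (measure (n := n) (E := E)) fun I =>
        (Ty.prod ctxTy tableTy).size (P₃.eval I.encode) :=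
      b₃.mono fun I => P₃.size_eval_le _
    refine polyBdd_comp b₃ (((b_out.add b_out).add (PolyBdd.const _ 1)).mono fun I => ?_)
    have h1 := Ty.size_prod (a := ctxTy) (b := tableTy) (P₃.eval I.encode)
    simp only [Prog.cost, Prog.charge, Prog.eval]
    omega

end Instance

end BernoulliSched

theorem mainTheorem5 :
    ∃ P : BernoulliSched.Prog BernoulliSched.inputTy BernoulliSched.tableTy,
      ∀ n E : ℕ, 3 ≤ E →
        (∀ I : BernoulliSched.Instance n E,
          I.IsTable (P.eval I.encode) ∧
          I.IsOptimalStratified (I.tablePolicy (P.eval I.encode)) ∧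
          I.expCost (I.tablePolicy (P.eval I.encode)) = I.ecost I.profileInit I.Nj) ∧
        (∃ C d : ℕ, ∀ I : BernoulliSched.Instance n E,
          P.cost I.encode ≤
            C * (I.N + I.m + BernoulliSched.inputTy.size I.encode) ^ d) ∧
        (∃ C : ℕ, ∀ I : BernoulliSched.Instance n E,
          I.relevantCells.Finite ∧
          I.relevantCells.ncard ≤
            C * (I.N ^ (2 * n) * E ^ (2 * n) * I.m ^ (n * E ^ (2 * I.z)))) := by
  obtain ⟨P, hP⟩ := BernoulliSched.Instance.exists_program
  refine ⟨P, fun n E hE => ?_⟩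
  obtain ⟨hT, d, hd⟩ := hP n E hE
  -- As `m ≥ 1`, the measure is at least `1`, so adding `2` at most triples it.
  refine ⟨fun I => ?_, ⟨3 ^ d, d, fun I => ?_⟩, BernoulliSched.Instance.cellConst n E, fun I =>
    BernoulliSched.Instance.relevantCells_bound hE⟩
  · obtain ⟨h1, h2⟩ := BernoulliSched.Instance.optimal_tablePolicy (hT I) hE
    exact ⟨hT I, h1, h2⟩
  · refine (hd I).trans ?_
    rw [← mul_pow]
    refine Nat.pow_le_pow_left ?_ d
    have := I.m_pos
    unfold BernoulliSched.Instance.measure BernoulliSched.Instance.bits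
    omega
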